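/- Let $k$ be a field of characteristic $0$ and let $\mathcal O$ be a cyclic operad in $k$-vector spaces. For a finite set $H$ with $n+1$ elements let $\mathcal O((H))=\bigl(\bigoplus_L \mathcal O(n)\bigr)_{S_{n+1}}$, where $L$ runs over the labellings of $H$ by $0,\dots,n$. An $\mathcal O$-labelled oriented graph is a finite graph (loops and multiple edges allowed) with all vertices of valence $\ge 3$, together with an element of $\mathcal O((H(v)))$ for each vertex $v$, where $H(v)$ is the set of half-edges at $v$, and an orientation, that is, an ordering of the vertices and a direction of each edge, modulo an even number of transpositions of vertices and reversals of edges. Let $\mathcal G^{\mathcal O}$ be the vector space spanned by isomorphism classes of $\mathcal O$-labelled oriented graphs, modulo multilinearity in the labels and $(G,or)=-(G,-or)$. Let $P\mathcal G^{\mathcal O}\subset\mathcal G^{\mathcal O}$ be the span of the (nonempty) connected graphs, graded by the number of vertices. Let $S(P\mathcal G^{\mathcal O})=\bigoplus_i S^i(P\mathcal G^{\mathcal O})$ be its graded symmetric algebra, let $S\colon\mathcal G^{\mathcal O}\cong S(P\mathcal G^{\mathcal O})$ be the isomorphism which sends a graph to the product of its connected components (with the sign given by the vertex ordering), and let $\pi_i$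 be the projection to $S^i(P\mathcal G^{\mathcal O})$. For an oriented graph $G$ and an edge $e$ let $G_e$ be $0$ if $e$ is a loop; otherwise $G_e$ is obtained by contracting $e$ and composing the labels of its endpoints along $e$. Its orientation is such that, if $e$ is directed from the first to the second vertex, then the merged vertex becomes the first vertex and the other vertices keep their order. For $i\ge1$ and directed edges $e_1,\dots,e_i$ lying on $i$ different edges of $G$, with $e_a$ going from the half-edge $t_a$ to the half-edge $h_a$, attaching a $2i$-gon replaces $e_1,\dots,e_i$ by the new edges $f_1,\dots,f_i$, where $f_a$ is directed from $t_{a+1}$ to $h_a$ (indices mod $i$). If the orientation of $G$ is represented so that the $e_a$ have their given directions, the new graph has the same vertex ordering and the directions of the other edges are unchanged. Let $\partial_i(G)$ be the sum, over all such ordered $i$-tuples $(e_1,\dots,e_i)$, of the graphs obtained by attaching the $2i$-gon and then contracting $f_1$. Let $\theta_i=\tfrac12\,\pi_i\circ S\circ\partial_i\colon P\mathcal G^{\mathcal O}\to S^i(P\mathcal G^{\mathcal O})$, and extend $\theta_i$ to $S(P\mathcal G^{\mathcal O})$ as a graded derivation of odd degree: $\theta_i(x\odot y)=\theta_i(x)\odot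 y+(-1)^{|x|}x\odot\theta_i(y)$. Then these operators $\theta_i$ ($i\ge1$) exist and are uniquely determined by this description, and a) $\theta_i\theta_j+\theta_j\theta_i=0$ for all $i\ne j$; b) $\theta_i^2=0$ for all $i$. -/

import Mathlib

universe u w

namespace GraphComplex

/-- The label in `a ∘ᵢ b` of the leaf (or root) `s` of `a`. -/
def outerLabel {m n p : ℕ} (h : p + 1 = m + n) (i : Fin m) (s : Fin (m + 1)) : Fin (p + 1) :=
  ⟨if (s : ℕ) ≤ i then s else s + n - 1, by have := s.2; have := i.2; split_ifs <;> omega⟩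

/-- The label in `a ∘ᵢ b` of the leaf `t` of `b`. -/
def innerLabel {m n p : ℕ} (h : p + 1 = m + n) (i : Fin m) (t : Fin (n + 1)) : Fin (p + 1) :=
  ⟨i + t, by have := t.2; have := i.2; omega⟩

/-- A cyclic operad in `k`-vector spaces: an operad `O(n) = obj n` with partial compositions
`a ∘ᵢ b = comp _ i a b ∈ O(m + n - 1)` (for `a ∈ O(m)`, `b ∈ O(n)`; the index `i : Fin m` stands for
the leaf with label `i.succ`, and the root has label `0`), a unit, and an action of `S_{n+1}` on
`O(n)` which permutes the labels of all the leaves and of the root.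
`act_comp` and `act_comp_swap` say that the composition, seen as the grafting of the root of `b` to
the leaf `i` of `a`, is compatible with relabelling: in `act_comp` the glued leaf of `a` stays a
non-root leaf (for permutations fixing `0` this is the usual equivariance of an operad, in general
it contains `τ(a ∘ᵢ b) = τ(a) ∘ᵢ₊₁ b`), in `act_comp_swap` the glued leaf of `a` becomes the root
and the root of `b` becomes a leaf, so the two factors are exchanged (this contains
`τ(a ∘ₘ b) = τ(b) ∘₁ τ(a)`). -/
structure CyclicOperad (k : Type u) [Field k] where
  obj : ℕ → Type w
  [addCommGroup : ∀ n, AddCommGroup (obj n)]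
  [module : ∀ n, Module k (obj n)]
  act : ∀ n, Equiv.Perm (Fin (n + 1)) →* Module.End k (obj n)
  comp : ∀ {m n p : ℕ}, p + 1 = m + n → Fin m → (obj m →ₗ[k] obj n →ₗ[k] obj p)
  one : obj 1
  comp_one : ∀ {m : ℕ} (i : Fin m) (a : obj m), comp rfl i a one = a
  one_comp : ∀ {n : ℕ} (b : obj n), comp (Nat.add_comm n 1) 0 one b = b
  act_one : ∀ σ, act 1 σ one = one
  comp_assoc_seq : ∀ {l m n p q r : ℕ} (hp : p + 1 = l + m) (hq : q + 1 = p + n)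
    (hr : r + 1 = m + n) (hq' : q + 1 = l + r) (i : Fin l) (j : Fin m) (x : Fin p),
    (x : ℕ) = i + j → ∀ (a : obj l) (b : obj m) (c : obj n),
      comp hq x (comp hp i a b) c = comp hq' i a (comp hr j b c)
  comp_assoc_par : ∀ {l m n p q r : ℕ} (hp : p + 1 = l + m) (hq : q + 1 = p + n)
    (hr : r + 1 = l + n) (hq' : q + 1 = r + m) (i j : Fin l) (x : Fin p) (y : Fin r),
    i < j → (x : ℕ) + 1 = j + m → (y : ℕ) = i → ∀ (a : obj l) (b : obj m) (c : obj n),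
      comp hq x (comp hp i a b) c = comp hq' y (comp hr j a c) b
  act_comp : ∀ {m n p : ℕ} (h : p + 1 = m + n) (i j : Fin m) (σ : Equiv.Perm (Fin (m + 1)))
    (τ : Equiv.Perm (Fin (n + 1))) (ρ : Equiv.Perm (Fin (p + 1))),
    σ i.succ = j.succ → τ 0 = 0 →
    (∀ s, s ≠ i.succ → ρ (outerLabel h i s) = outerLabel h j (σ s)) →
    (∀ t, t ≠ 0 → ρ (innerLabel h i t) = innerLabel h j (τ t)) →
    ∀ (a : obj m) (b : obj n), act p ρ (comp h i a b) = comp h j (act m σ a) (act n τ b)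
  act_comp_swap : ∀ {m n p : ℕ} (h : p + 1 = m + n) (h' : p + 1 = n + m) (i : Fin m) (j : Fin n)
    (σ : Equiv.Perm (Fin (m + 1))) (τ : Equiv.Perm (Fin (n + 1))) (ρ : Equiv.Perm (Fin (p + 1))),
    σ i.succ = 0 → τ 0 = j.succ →
    (∀ s, s ≠ i.succ → ρ (outerLabel h i s) = innerLabel h' j (σ s)) →
    (∀ t, t ≠ 0 → ρ (innerLabel h i t) = outerLabel h' j (τ t)) →
    ∀ (a : obj m) (b : obj n), act p ρ (comp h i a b) = comp h' j (act n τ b) (act m σ a)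

attribute [instance] CyclicOperad.addCommGroup CyclicOperad.module

variable {k : Type u} [Field k] (O : CyclicOperad.{u, w} k)

section Labels

/-- A labelling of the elements of the finite set `H` by `0, …, n`, where `n + 1 = |H|`. -/
abbrev Labelling (H : Type) : Type := Σ n : ℕ, H ≃ Fin (n + 1)

open Classical in
/-- The span of the elements `(σ · o)_{σ · L} - o_L` in `⨁_L O(n)`. -/
noncomputable def labelRel (H : Type) :
    Submodule k (DirectSum (Labelling H) fun L => O.obj L.1) :=
  Submodule.span k {z | ∃ (n : ℕ) (L : H ≃ Fin (n + 1)) (σ : Equiv.Perm (Fin (n + 1)))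
    (o : O.obj n), z =
      DirectSum.lof k (Labelling H) (fun L => O.obj L.1) ⟨n, L.trans σ⟩ (O.act n σ o)
        - DirectSum.lof k (Labelling H) (fun L => O.obj L.1) ⟨n, L⟩ o}

/-- `O((H)) = (⨁_L O(n))_{S_{n+1}}`, the coinvariants; `L` runs over the labellings of `H` by
`0, …, n`. -/
abbrev Labels (H : Type) : Type w :=
  (DirectSum (Labelling H) fun L => O.obj L.1) ⧸ labelRel O H

namespace Labels

open Classical in
/-- The class in `O((H))` of `o_L`. -/
noncomputable def mk {H : Type} {n : ℕ} (L : H ≃ Fin (n + 1)) : O.obj n →ₗ[k] Labels O H :=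
  (labelRel O H).mkQ ∘ₗ DirectSum.lof k (Labelling H) (fun L => O.obj L.1) ⟨n, L⟩

theorem mk_act {H : Type} {n : ℕ} (L : H ≃ Fin (n + 1)) (σ : Equiv.Perm (Fin (n + 1)))
    (o : O.obj n) : mk O (L.trans σ) (O.act n σ o) = mk O L o := by
  classical
  refine (Submodule.Quotient.eq _).2 (Submodule.subset_span ⟨n, L, σ, o, rfl⟩)

open Classical in
/-- Linear maps out of `O((H))`. -/
noncomputable def lift {H : Type} {M : Type*} [AddCommGroup M] [Module k M]
    (f : ∀ L : Labelling H, O.obj L.1 →ₗ[k] M)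
    (hf : ∀ (n : ℕ) (L : H ≃ Fin (n + 1)) (σ : Equiv.Perm (Fin (n + 1))) (o : O.obj n),
      f ⟨n, L.trans σ⟩ (O.act n σ o) = f ⟨n, L⟩ o) : Labels O H →ₗ[k] M :=
  (labelRel O H).liftQ (DirectSum.toModule k (Labelling H) M f) <| by
    rw [labelRel, Submodule.span_le]
    rintro z ⟨n, L, σ, o, rfl⟩
    simp [DirectSum.toModule_lof, hf]

theorem lift_mk {H : Type} {M : Type*} [AddCommGroup M] [Module k M]
    (f : ∀ L : Labelling H, O.obj L.1 →ₗ[k] M) (hf) {n : ℕ} (L : H ≃ Fin (n + 1)) (o : O.obj n) :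
    lift O f hf (mk O L o) = f ⟨n, L⟩ o := by
  classical
  simp [lift, mk, DirectSum.toModule_lof]

/-- Transport of labels along a bijection of sets of half-edges. -/
noncomputable def map {H H' : Type} (e : H ≃ H') : Labels O H →ₗ[k] Labels O H' :=
  lift O (fun L => mk O (e.symm.trans L.2)) fun n L σ o => by
    simpa [Equiv.trans_assoc] using mk_act O (e.symm.trans L) σ o

/-- The labelling of the half-edges that remain after the leaf `x` (with nonzero label `i + 1`) has
been glued to the root `y`. -/
def glue {H H' : Type} {x : H} {y : H'} {m n p : ℕ} (h : p + 1 = m + n) (i : Fin m)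
    (L : H ≃ Fin (m + 1)) (L' : H' ≃ Fin (n + 1)) (hx : L x = i.succ) (hy : L' y = 0) :
    {s // s ≠ x} ⊕ {t // t ≠ y} ≃ Fin (p + 1) where
  toFun := Sum.elim (fun s => outerLabel h i (L s.1)) (fun t => innerLabel h i (L' t.1))
  invFun q :=
    if h₁ : (q : ℕ) ≤ i then
      Sum.inl ⟨L.symm ⟨q, by have := i.2; omega⟩, by
        rw [ne_eq, Equiv.symm_apply_eq, hx, Fin.ext_iff]; simp; omega⟩
    else if h₂ : (q : ℕ) ≤ i + n then
      Sum.inr ⟨L'.symm ⟨q - i, by omega⟩, by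
        rw [ne_eq, Equiv.symm_apply_eq, hy, Fin.ext_iff]; simp; omega⟩
    else Sum.inl ⟨L.symm ⟨q + 1 - n, by have := q.2; omega⟩, by
        rw [ne_eq, Equiv.symm_apply_eq, hx, Fin.ext_iff]; simp; omega⟩
  left_inv := by
    rintro (⟨s, hs⟩ | ⟨t, ht⟩)
    · have hs' : ((L s : Fin (m + 1)) : ℕ) ≠ i + 1 := fun e => hs (L.injective (by
        rw [hx, Fin.ext_iff]; simpa using e))
      simp only [Sum.elim_inl, outerLabel]
      split_ifs <;> first | omega | skip
      all_goals
        simp only [Sum.inl.injEq, Subtype.mk.injEq, Equiv.symm_apply_eq, Fin.ext_iff]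
        try omega
    · have ht' : ((L' t : Fin (n + 1)) : ℕ) ≠ 0 := fun e => ht (L'.injective (by
        rw [hy, Fin.ext_iff]; simpa using e))
      have := (L' t).2
      refine (dif_neg ?_).trans ((dif_pos ?_).trans ?_)
      · change ¬ ((i : ℕ) + (L' t : ℕ) ≤ i); omega
      · change (i : ℕ) + (L' t : ℕ) ≤ i + n; omega
      · refine congrArg Sum.inr (Subtype.ext ?_)
        rw [Equiv.symm_apply_eq, Fin.ext_iff]
        change (i : ℕ) + (L' t : ℕ) - i = (L' t : ℕ)
        omega
  right_inv q := by
    have := q.2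
    dsimp only
    split_ifs with h₁ h₂ <;> simp [outerLabel, innerLabel, Fin.ext_iff] <;>  
      first | omega | (split_ifs <;> omega)


theorem mk_glue {H H' : Type} {x : H} {y : H'} {m n p : ℕ} (h : p + 1 = m + n) (i j : Fin m)
    (L : H ≃ Fin (m + 1)) (L' : H' ≃ Fin (n + 1)) (hx : L x = i.succ) (hy : L' y = 0)
    (σ : Equiv.Perm (Fin (m + 1))) (τ : Equiv.Perm (Fin (n + 1)))
    (hσ : (L.trans σ) x = j.succ) (hτ : (L'.trans τ) y = 0) (a : O.obj m) (b : O.obj n) :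
    mk O (glue h j (L.trans σ) (L'.trans τ) hσ hτ) (O.comp h j (O.act m σ a) (O.act n τ b)) =
      mk O (glue h i L L' hx hy) (O.comp h i a b) := by
  set G := glue h i L L' hx hy with hG
  set G' := glue h j (L.trans σ) (L'.trans τ) hσ hτ with hG'
  have hGG : G' = G.trans (G.symm.trans G') := by ext; simp
  rw [← O.act_comp h i j σ τ (G.symm.trans G') (by simpa [hx] using hσ) (by simpa [hy] using hτ),
    ← mk_act O G (G.symm.trans G'), ← hGG]
  · intro s hs
    have : outerLabel h i s = G (Sum.inl ⟨L.symm s, by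
        rw [ne_eq, Equiv.symm_apply_eq, hx]; exact hs⟩) := by simp [hG, glue]
    rw [this]; simp [hG', glue]
  · intro t ht
    have : innerLabel h i t = G (Sum.inr ⟨L'.symm t, by
        rw [ne_eq, Equiv.symm_apply_eq, hy]; exact ht⟩) := by simp [hG, glue]
    rw [this]; simp [hG', glue]

/-- The composite of `a_L` and `b_{L'}` along `x` and `y`: relabel so that `x` gets the last label
and `y` the label `0`, then compose. (If `x` is the only half-edge on its side the value is `0`;
this never occurs at a vertex of valence at least three.) -/
noncomputable def compAux {H H' : Type} (x : H) (y : H') : ∀ (A : Labelling H) (B : Labelling H'),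
    O.obj A.1 →ₗ[k] O.obj B.1 →ₗ[k] Labels O ({s // s ≠ x} ⊕ {t // t ≠ y})
  | ⟨0, _⟩, _ => 0
  | ⟨m + 1, L⟩, ⟨n, L'⟩ =>
    ((O.comp (Nat.add_right_comm m n 1) (Fin.last m)).compr₂
      (mk O (glue (Nat.add_right_comm m n 1) (Fin.last m)
        (L.trans (Equiv.swap (L x) (Fin.last m).succ)) (L'.trans (Equiv.swap (L' y) 0))
        (by simp) (by simp)))).compl₁₂
      (O.act (m + 1) (Equiv.swap (L x) (Fin.last m).succ)) (O.act n (Equiv.swap (L' y) 0))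

theorem compAux_act {H H' : Type} (x : H) (y : H') {m n : ℕ} (L : H ≃ Fin (m + 1))
    (L' : H' ≃ Fin (n + 1)) (σ : Equiv.Perm (Fin (m + 1))) (τ : Equiv.Perm (Fin (n + 1)))
    (a : O.obj m) (b : O.obj n) :
    compAux O x y ⟨m, L.trans σ⟩ ⟨n, L'.trans τ⟩ (O.act m σ a) (O.act n τ b) =
      compAux O x y ⟨m, L⟩ ⟨n, L'⟩ a b := by
  cases m with
  | zero => rfl
  | succ m =>
    simp only [compAux, LinearMap.compl₁₂_apply, LinearMap.compr₂_apply]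
    set μ := Equiv.swap (L x) (Fin.last m).succ
    set μ' := Equiv.swap ((L.trans σ) x) (Fin.last m).succ
    set ν := Equiv.swap (L' y) 0
    set ν' := Equiv.swap ((L'.trans τ) y) 0
    have e₁ : (L.trans σ).trans μ' = (L.trans μ).trans (μ' * σ * μ⁻¹) := by ext; simp
    have e₂ : (L'.trans τ).trans ν' = (L'.trans ν).trans (ν' * τ * ν⁻¹) := by ext; simp
    have h₁ : O.act (m + 1) μ' (O.act (m + 1) σ a) =
        O.act (m + 1) (μ' * σ * μ⁻¹) (O.act (m + 1) μ a) := by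
      rw [← Module.End.mul_apply, ← Module.End.mul_apply, ← map_mul, ← map_mul]; simp
    have h₂ : O.act n ν' (O.act n τ b) = O.act n (ν' * τ * ν⁻¹) (O.act n ν b) := by
      rw [← Module.End.mul_apply, ← Module.End.mul_apply, ← map_mul, ← map_mul]; simp
    rw [h₁, h₂]
    generalize_proofs p₁ p₂ p₃ p₄ p₅ p₆
    revert p₃ p₄
    rw [e₁, e₂]
    intro p₃ p₄
    exact mk_glue O _ _ _ _ _ _ _ _ _ _ _ _ _

theorem hom_ext {H : Type} {M : Type*} [AddCommGroup M] [Module k M] {f g : Labels O H →ₗ[k] M}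
    (hfg : ∀ (n : ℕ) (L : H ≃ Fin (n + 1)) (o : O.obj n), f (mk O L o) = g (mk O L o)) :
    f = g := by
  classical
  apply Submodule.linearMap_qext
  apply DirectSum.linearMap_ext
  rintro ⟨n, L⟩
  ext o
  exact hfg n L o

/-- `compAux`, descended to `O((H'))` in its second argument. -/
noncomputable def compRight {H H' : Type} (x : H) (y : H') (A : Labelling H) :
    O.obj A.1 →ₗ[k] Labels O H' →ₗ[k] Labels O ({s // s ≠ x} ⊕ {t // t ≠ y}) :=
  (lift O (fun B => (compAux O x y A B).flip) fun n L' τ b => by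
    ext a
    obtain ⟨m, L⟩ := A
    have := compAux_act O x y L L' 1 τ a b
    rw [map_one] at this
    exact this).flip

/-- Composition of operad elements along the edge with half-edges `x` and `y`. -/
noncomputable def comp {H H' : Type} (x : H) (y : H') :
    Labels O H →ₗ[k] Labels O H' →ₗ[k] Labels O ({s // s ≠ x} ⊕ {t // t ≠ y}) :=
  lift O (compRight O x y) fun m L σ a => hom_ext O fun n L' b => by
    have := compAux_act O x y L L' σ 1 a b
    rw [map_one] at this
    simp only [compRight, LinearMap.flip_apply, lift_mk]
    exact this

/-- Composition along an edge on representatives: for any labellings such that `y` is the root and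
`x` is a leaf `i`, it is the operad composition `∘ᵢ`. -/
theorem comp_mk {H H' : Type} {x : H} {y : H'} {m n p : ℕ} (h : p + 1 = m + n) (i : Fin m)
    (L : H ≃ Fin (m + 1)) (L' : H' ≃ Fin (n + 1)) (hx : L x = i.succ) (hy : L' y = 0)
    (a : O.obj m) (b : O.obj n) :
    comp O x y (mk O L a) (mk O L' b) = mk O (glue h i L L' hx hy) (O.comp h i a b) := by
  cases m with
  | zero => exact i.elim0
  | succ m =>
    obtain rfl : p = m + n := by omega
    rw [comp, lift_mk, compRight, LinearMap.flip_apply, lift_mk, LinearMap.flip_apply]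
    simp only [compAux, LinearMap.compl₁₂_apply, LinearMap.compr₂_apply]
    exact mk_glue O h i (Fin.last m) L L' hx hy _ _ _ _ a b

end Labels
end Labels

/-- An `O`-labelled oriented finite graph (loops and multiple edges allowed) all of whose vertices
have valence at least three. `H` is the set of half-edges, `inv` exchanges the two halves of an edge,
`vert` is the vertex of a half-edge. The label of `v` is an element of `O((H(v)))`. The orientation is
represented by an ordering of the vertices and a direction of each edge, given by the set of half-edges
which are tails. A half-edge `h` also stands for the directed edge that starts with `h` and ends with
`inv h`. -/
structure OGraph where
  V : Type
  H : Type
  [finV : Finite V]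
  [finH : Finite H]
  vert : H → V
  inv : H → H
  inv_inv : ∀ h, inv (inv h) = h
  inv_ne : ∀ h, inv h ≠ h
  valence : ∀ v, 3 ≤ Nat.card {h // vert h = v}
  deco : ∀ v, Labels O {h // vert h = v}
  lt : V → V → Prop
  [order : IsStrictTotalOrder V lt]
  tail : H → Prop
  tail_inv : ∀ h, tail (inv h) ↔ ¬ tail h

attribute [instance] OGraph.finV OGraph.finH OGraph.order

namespace OGraph
variable {O}

open Classical in
/-- Replace the label of the vertex `v`. -/
noncomputable def setDeco (Γ : OGraph O) (v : Γ.V) (z : Labels O {h // Γ.vert h = v}) :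
    OGraph O :=
  { Γ with deco := Function.update Γ.deco v z }

/-- Replace the ordering of the vertices and the directions of the edges. -/
def reorient (Γ : OGraph O) (lt' : Γ.V → Γ.V → Prop) [IsStrictTotalOrder Γ.V lt']
    (tail' : Γ.H → Prop) (h : ∀ h, tail' (Γ.inv h) ↔ ¬ tail' h) : OGraph O :=
  { Γ with lt := lt', order := ‹_›, tail := tail', tail_inv := h }

/-- The number of inversions between the two vertex orderings plus the number of edges whose
direction is changed; the two orientations agree if and only if this is even. -/
noncomputable def changes (Γ : OGraph O) (lt' : Γ.V → Γ.V → Prop) (tail' : Γ.H → Prop) : ℕ :=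
  Nat.card {p : Γ.V × Γ.V // Γ.lt p.1 p.2 ∧ lt' p.2 p.1} +
    Nat.card {h : Γ.H // Γ.tail h ∧ ¬ tail' h}

/-- Isomorphisms of labelled graphs with vertex ordering and edge directions. -/
structure Iso (Γ Δ : OGraph O) where
  onV : Γ.V ≃ Δ.V
  onH : Γ.H ≃ Δ.H
  vert_eq : ∀ h, Δ.vert (onH h) = onV (Γ.vert h)
  inv_eq : ∀ h, Δ.inv (onH h) = onH (Γ.inv h)
  deco_eq : ∀ v, Δ.deco (onV v) = Labels.map O (onH.subtypeEquiv fun h => by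
    rw [vert_eq, onV.apply_eq_iff_eq]) (Γ.deco v)
  lt_iff : ∀ v w, Δ.lt (onV v) (onV w) ↔ Γ.lt v w
  tail_iff : ∀ h, Δ.tail (onH h) ↔ Γ.tail h

/-- The vertices `v` and `w` are joined by an edge. -/
def Joined (Γ : OGraph O) (v w : Γ.V) : Prop := ∃ h, Γ.vert h = v ∧ Γ.vert (Γ.inv h) = w

/-- The set of connected components. -/
abbrev Comp (Γ : OGraph O) : Type := Quot Γ.Joined

def IsConnected (Γ : OGraph O) : Prop := Nat.card Γ.Comp = 1

/-- A connected component, with the induced labels, ordering and directions. -/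
noncomputable def component (Γ : OGraph O) (c : Γ.Comp) : OGraph O where
  V := {v : Γ.V // Quot.mk _ v = c}
  H := {h : Γ.H // Quot.mk _ (Γ.vert h) = c}
  vert h := ⟨Γ.vert h.1, h.2⟩
  inv h := ⟨Γ.inv h.1, (Quot.sound ⟨h.1, rfl, rfl⟩).symm.trans h.2⟩
  inv_inv h := Subtype.ext (Γ.inv_inv h.1)
  inv_ne h e := Γ.inv_ne h.1 (congrArg Subtype.val e)
  valence v := (Γ.valence v.1).trans_eq (Nat.card_congr
    { toFun h := ⟨⟨h.1, (congrArg _ h.2).trans v.2⟩, Subtype.ext h.2⟩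
      invFun h := ⟨h.1.1, congrArg Subtype.val h.2⟩
      left_inv _ := rfl
      right_inv _ := rfl })
  deco v := Labels.map O
    { toFun h := ⟨⟨h.1, (congrArg _ h.2).trans v.2⟩, Subtype.ext h.2⟩
      invFun h := ⟨h.1.1, congrArg Subtype.val h.2⟩
      left_inv _ := rfl
      right_inv _ := rfl } (Γ.deco v.1)
  lt v w := Γ.lt v.1 w.1
  order := (RelEmbedding.preimage (Function.Embedding.subtype _) Γ.lt).isStrictTotalOrder
  tail h := Γ.tail h.1
  tail_inv h := Γ.tail_inv h.1

theorem component_isConnected (Γ : OGraph O) (c : Γ.Comp) : (Γ.component c).IsConnected := by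
  have key : ∀ v w : Γ.V, Relation.EqvGen Γ.Joined v w → ∀ (hv : Quot.mk Γ.Joined v = c)
      (hw : Quot.mk Γ.Joined w = c), (Quot.mk (Γ.component c).Joined (⟨v, hv⟩ : {v : Γ.V // Quot.mk Γ.Joined v = c})) =
        Quot.mk (Γ.component c).Joined (⟨w, hw⟩ : {v : Γ.V // Quot.mk Γ.Joined v = c}) := by
    intro v w h
    induction h with
    | rel v w h =>
      obtain ⟨h, rfl, rfl⟩ := h
      intro hv hw
      exact Quot.sound ⟨(⟨h, hv⟩ : {h : Γ.H // Quot.mk _ (Γ.vert h) = c}), rfl, rfl⟩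
    | refl v => exact fun _ _ => rfl
    | symm v w h ih => intro hv hw; exact (ih hw hv).symm
    | trans u v w h₁ h₂ ih₁ ih₂ =>
      intro hu hw
      have hv : Quot.mk Γ.Joined v = c := (Quot.eqvGen_sound h₁).symm.trans hu
      exact (ih₁ hu hv).trans (ih₂ hv hw)
  obtain ⟨v, rfl⟩ := Quot.exists_rep c
  refine Nat.card_eq_one_iff_exists.2 ⟨Quot.mk _ (⟨v, rfl⟩ : {w : Γ.V // Quot.mk Γ.Joined w = Quot.mk _ v}), ?_⟩
  rintro ⟨w⟩
  obtain ⟨w, hw⟩ : {w : Γ.V // Quot.mk Γ.Joined w = Quot.mk _ v} := w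
  exact key w v (Quot.eqvGen_exact hw) hw rfl

/-- The directed edges `e 0, …, e (i-1)` lie on pairwise different edges. -/
def IsSeparate (Γ : OGraph O) {i : ℕ} (e : Fin i → Γ.H) : Prop :=
  ∀ a b, a ≠ b → e a ≠ e b ∧ e a ≠ Γ.inv (e b)

theorem IsSeparate.injective {Γ : OGraph O} {i : ℕ} {e : Fin i → Γ.H} (he : Γ.IsSeparate e) :
    Function.Injective e := fun a b h => by
  by_contra hab
  exact (he a b hab).1 h

open Classical in
/-- The permutation of half-edges that sends the tail of `e a` to the tail of `e (a + 1)`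
(cyclically) and fixes all other half-edges. -/
noncomputable def turn (Γ : OGraph O) {i : ℕ} (e : Fin i → Γ.H) (he : Γ.IsSeparate e) :
    Equiv.Perm Γ.H :=
  (finRotate i).viaFintypeEmbedding ⟨e, he.injective⟩


theorem turn_of_notMem (Γ : OGraph O) {i : ℕ} (e : Fin i → Γ.H) (he : Γ.IsSeparate e) {h : Γ.H}
    (hh : h ∉ Set.range e) : Γ.turn e he h = h := by
  classical
  exact Equiv.Perm.viaFintypeEmbedding_apply_notMem_range _ _ hh

theorem turn_apply (Γ : OGraph O) {i : ℕ} (e : Fin i → Γ.H) (he : Γ.IsSeparate e) (a : Fin i) :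
    Γ.turn e he (e a) = e (finRotate i a) := by
  classical
  exact Equiv.Perm.viaFintypeEmbedding_apply_image _ ⟨e, he.injective⟩ a

/-- The directions of edges, changed where necessary so that they agree with those of the
`e a`. -/
def alignedTail (Γ : OGraph O) {i : ℕ} (e : Fin i → Γ.H) (h : Γ.H) : Prop :=
  h ∈ Set.range e ∨ (Γ.inv h ∉ Set.range e ∧ Γ.tail h)

theorem alignedTail_inv (Γ : OGraph O) {i : ℕ} (e : Fin i → Γ.H) (he : Γ.IsSeparate e) (h : Γ.H) :
    Γ.alignedTail e (Γ.inv h) ↔ ¬ Γ.alignedTail e h := by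
  have key : h ∈ Set.range e → Γ.inv h ∉ Set.range e := by
    rintro ⟨a, rfl⟩ ⟨b, hb⟩
    by_cases hab : b = a
    · exact Γ.inv_ne (e a) (by rw [← hb, hab])
    · exact (he b a hab).2 hb
  have := Γ.tail_inv h
  simp only [alignedTail, Γ.inv_inv]
  tauto

theorem alignedTail_turn (Γ : OGraph O) {i : ℕ} (e : Fin i → Γ.H) (he : Γ.IsSeparate e) (h : Γ.H) :
    Γ.alignedTail e (Γ.turn e he h) ↔ Γ.alignedTail e h := by
  by_cases hh : h ∈ Set.range e
  · obtain ⟨a, rfl⟩ := hh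
    rw [turn_apply]
    exact iff_of_true (Or.inl ⟨_, rfl⟩) (Or.inl ⟨_, rfl⟩)
  · rw [turn_of_notMem Γ e he hh]

/-- Attach a `2i`-gon: its sides `1, …, i` are glued to the directed edges `e 0, …, e (i-1)`, which
are then deleted. The remaining sides are the `i` new edges; with the direction opposite to the one
along the polygon, the `a`-th of them starts at the tail of `e (a + 1)` and ends at the head of `e a`.
The half-edges are kept, only their pairing changes. The directions of the old edges are first made
to agree with the `e a`, which costs the sign `attachSign`. -/
noncomputable def attach (Γ : OGraph O) {i : ℕ} (e : Fin i → Γ.H) (he : Γ.IsSeparate e) :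
    OGraph O :=
  { Γ with
    inv := fun h => Γ.turn e he (Γ.inv ((Γ.turn e he).symm h))
    inv_inv := fun h => by simp [Γ.inv_inv]
    inv_ne := fun h hh => Γ.inv_ne ((Γ.turn e he).symm h) (by
      rwa [Equiv.eq_symm_apply])
    tail := Γ.alignedTail e
    tail_inv := fun h => by
      rw [alignedTail_turn, alignedTail_inv Γ e he, ← alignedTail_turn Γ e he]
      simp }

/-- The sign for changing the directions of edges so that they agree with those of the `e a`. -/
noncomputable def attachSign (k : Type u) [Field k] {O : CyclicOperad.{u, w} k} (Γ : OGraph O)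
    {i : ℕ} (e : Fin i → Γ.H) : k :=
  (-1) ^ Nat.card {a : Fin i // ¬ Γ.tail (e a)}

section Contract
variable (Γ : OGraph O) (t : Γ.H)

/-- The vertices after contraction of the directed edge `t`: the two endpoints become one vertex,
which is represented by the initial one. -/
abbrev ContractV : Type := {v : Γ.V // v ≠ Γ.vert (Γ.inv t)}
/-- The half-edges after contraction of `t`. -/
abbrev ContractH : Type := {h : Γ.H // h ≠ t ∧ h ≠ Γ.inv t}

open Classical in
/-- The vertex of a half-edge after the contraction. -/
noncomputable def contractVert (ht : Γ.vert t ≠ Γ.vert (Γ.inv t)) (h : Γ.ContractH t) :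
    Γ.ContractV t :=
  if hh : Γ.vert h.1 = Γ.vert (Γ.inv t) then ⟨Γ.vert t, ht⟩ else ⟨Γ.vert h.1, hh⟩

variable {t} (ht : Γ.vert t ≠ Γ.vert (Γ.inv t))

open Classical in
/-- The half-edges at the merged vertex. -/
noncomputable def starMerged (v : Γ.ContractV t) (hv : v.1 = Γ.vert t) :
    {s : {h // Γ.vert h = Γ.vert t} // s ≠ ⟨t, rfl⟩} ⊕
      {s : {h // Γ.vert h = Γ.vert (Γ.inv t)} // s ≠ ⟨Γ.inv t, rfl⟩} ≃
      {h : Γ.ContractH t // Γ.contractVert t ht h = v} where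
  toFun := Sum.elim
    (fun s => ⟨⟨s.1.1, fun h => s.2 (Subtype.ext h), fun h => ht (by rw [← s.1.2, h])⟩, by
      rw [contractVert, dif_neg (by rw [s.1.2]; exact ht)]
      exact Subtype.ext (s.1.2.trans hv.symm)⟩)
    (fun s => ⟨⟨s.1.1, fun h => ht (by rw [← s.1.2, h]), fun h => s.2 (Subtype.ext h)⟩, by
      rw [contractVert, dif_pos s.1.2]
      exact Subtype.ext hv.symm⟩)
  invFun h :=
    if hh : Γ.vert h.1.1 = Γ.vert (Γ.inv t) then
      Sum.inr ⟨⟨h.1.1, hh⟩, fun e => h.1.2.2 (congrArg Subtype.val e)⟩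
    else Sum.inl ⟨⟨h.1.1, by
      have := h.2
      rw [contractVert, dif_neg hh] at this
      exact (congrArg Subtype.val this).trans hv⟩, fun e => h.1.2.1 (congrArg Subtype.val e)⟩
  left_inv := by
    rintro (⟨⟨s, hs⟩, hs'⟩ | ⟨⟨s, hs⟩, hs'⟩)
    · exact dif_neg (by rw [← hs] at ht; exact ht)
    · exact dif_pos hs
  right_inv h := by
    dsimp only
    split_ifs <;> rfl

/-- The half-edges at the other vertices do not change. -/
noncomputable def starOther (v : Γ.ContractV t) (hv : v.1 ≠ Γ.vert t) :
    {h // Γ.vert h = v.1} ≃ {h : Γ.ContractH t // Γ.contractVert t ht h = v} where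
  toFun s := ⟨⟨s.1, fun h => hv (by rw [← s.2, h]), fun h => v.2 (by rw [← s.2, h])⟩, by
    rw [contractVert, dif_neg (by rw [s.2]; exact v.2)]
    exact Subtype.ext s.2⟩
  invFun h := ⟨h.1.1, by
    have := h.2
    rw [contractVert] at this
    split_ifs at this with hh
    · exact absurd (congrArg Subtype.val this).symm hv
    · exact congrArg Subtype.val this⟩
  left_inv _ := rfl
  right_inv _ := rfl

theorem valence_merged : 4 ≤ Nat.card
    ({s : {h // Γ.vert h = Γ.vert t} // s ≠ ⟨t, rfl⟩} ⊕
      {s : {h // Γ.vert h = Γ.vert (Γ.inv t)} // s ≠ ⟨Γ.inv t, rfl⟩}) := by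
  classical
  have aux : ∀ (X : Type) [Finite X] (x : X), 3 ≤ Nat.card X → 2 ≤ Nat.card {s : X // s ≠ x} := by
    intro X _ x hX
    have := Fintype.ofFinite X
    rw [Nat.card_eq_fintype_card] at hX ⊢
    rw [Fintype.card_subtype_compl, Fintype.card_subtype_eq]
    omega
  rw [Nat.card_sum]
  have h₁ := aux _ ⟨t, rfl⟩ (Γ.valence (Γ.vert t))
  have h₂ := aux _ ⟨Γ.inv t, rfl⟩ (Γ.valence (Γ.vert (Γ.inv t)))
  omega

open Classical in
/-- Contraction of the directed edge `t`, which is not a loop: the labels of its endpoints are composed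
along `t`. The merged vertex takes the place of the initial endpoint of `t` in the ordering. -/
noncomputable def contract : OGraph O where
  V := Γ.ContractV t
  H := Γ.ContractH t
  vert := Γ.contractVert t ht
  inv h := ⟨Γ.inv h.1, fun e => h.2.2 ((Γ.inv_inv h.1).symm.trans (congrArg _ e)), fun e => h.2.1 (by
    exact (Γ.inv_inv h.1).symm.trans ((congrArg _ e).trans (Γ.inv_inv t)))⟩
  inv_inv h := Subtype.ext (Γ.inv_inv h.1)
  inv_ne h e := Γ.inv_ne h.1 (congrArg Subtype.val e)
  valence v := by
    by_cases hv : v.1 = Γ.vert t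
    · rw [← Nat.card_congr (Γ.starMerged ht v hv)]
      exact (Nat.le_succ 3).trans Γ.valence_merged
    · rw [← Nat.card_congr (Γ.starOther ht v hv)]
      exact Γ.valence v.1
  deco v :=
    if hv : v.1 = Γ.vert t then
      Labels.map O (Γ.starMerged ht v hv)
        (Labels.comp O ⟨t, rfl⟩ ⟨Γ.inv t, rfl⟩ (Γ.deco (Γ.vert t)) (Γ.deco (Γ.vert (Γ.inv t))))
    else Labels.map O (Γ.starOther ht v hv) (Γ.deco v.1)
  lt v w := Γ.lt v.1 w.1
  order := (RelEmbedding.preimage (Function.Embedding.subtype _) Γ.lt).isStrictTotalOrder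
  tail h := Γ.tail h.1
  tail_inv h := Γ.tail_inv h.1

end Contract

open Classical in
/-- The sign of the contraction. The induced orientation is fixed by the rule that, if `t` goes from
the first to the second vertex, then the merged vertex becomes the first one, followed by the other
vertices in their old order, with sign `+1`. In general let the initial and the final vertex of `t` be
preceded by `p` and `q` vertices. Moving them to the first two places costs `(-1) ^ (p + q)`, with one
more sign if the initial vertex comes first; moving the merged vertex back to the place of the initial
one costs `(-1) ^ p`, with one more sign if the final vertex came first. The product is
`(-1) ^ (q + 1)`. -/
noncomputable def contractSign (k : Type u) [Field k] {O : CyclicOperad.{u, w} k} (Γ : OGraph O)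
    (t : Γ.H) : k :=
  (if Γ.tail t then 1 else -1) *
    (-1) ^ (Nat.card {v : Γ.V // Γ.lt v (Γ.vert (Γ.inv t))} + 1)

open Classical in
/-- The graph obtained by contraction of `t`, with its sign; it is `0` if `t` is a loop. -/
noncomputable def contractTerm (Γ : OGraph O) (t : Γ.H) : OGraph O →₀ k :=
  if ht : Γ.vert t ≠ Γ.vert (Γ.inv t) then
    Finsupp.single (Γ.contract ht) (contractSign k Γ t) else 0

/-- `∂ᵢ` of a graph: the sum over all ways of attaching a `2i`-gon to `i` directed edges, followed by
contraction of the new edge between the first and the second side, which starts at the tail of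
`e 1` (of `e 0` if `i = 1`) and ends at the head of `e 0`. -/
noncomputable def polygonSum (i : ℕ) [NeZero i] (Γ : OGraph O) : OGraph O →₀ k :=
  ∑ᶠ e : {e : Fin i → Γ.H // Γ.IsSeparate e},
    attachSign k Γ e.1 • (Γ.attach e.1 e.2).contractTerm (e.1 1)

end OGraph

section Spaces

/-- The relations in the graph complex: multilinearity of the labels, `(G, or) = -(G, -or)` (and
independence of the representative of an orientation), and identification of isomorphic graphs. -/
inductive IsRelation : (OGraph O →₀ k) → Prop
  | deco_add (Γ : OGraph O) (v : Γ.V) (x y : Labels O {h // Γ.vert h = v}) :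
    IsRelation (Finsupp.single (Γ.setDeco v (x + y)) 1 -
      (Finsupp.single (Γ.setDeco v x) 1 + Finsupp.single (Γ.setDeco v y) 1))
  | deco_smul (Γ : OGraph O) (v : Γ.V) (c : k) (x : Labels O {h // Γ.vert h = v}) :
    IsRelation (Finsupp.single (Γ.setDeco v (c • x)) 1 - Finsupp.single (Γ.setDeco v x) c)
  | orientation (Γ : OGraph O) (lt' : Γ.V → Γ.V → Prop) [IsStrictTotalOrder Γ.V lt']
    (tail' : Γ.H → Prop) (h : ∀ h, tail' (Γ.inv h) ↔ ¬ tail' h) :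
    IsRelation (Finsupp.single (Γ.reorient lt' tail' h) 1 -
      Finsupp.single Γ ((-1) ^ Γ.changes lt' tail'))
  | iso (Γ Δ : OGraph O) (φ : Γ.Iso Δ) : IsRelation (Finsupp.single Δ 1 - Finsupp.single Γ 1)

/-- The graph complex `G^O`. -/
abbrev GraphSpace : Type (max 1 u w) :=
  (OGraph O →₀ k) ⧸ Submodule.span k {z | IsRelation O z}

variable {O} in
/-- The class of a graph in `G^O`. -/
noncomputable def OGraph.cls (Γ : OGraph O) : GraphSpace O :=
  Submodule.Quotient.mk (Finsupp.single Γ 1)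

/-- `P G^O`, the subspace of `G^O` generated by the connected graphs. -/
noncomputable def primitive : Submodule k (GraphSpace O) :=
  Submodule.span k {z | ∃ Γ : OGraph O, Γ.IsConnected ∧ Γ.cls = z}

variable {O} in
/-- The class of a connected graph in `P G^O`. -/
noncomputable def OGraph.pcls (Γ : OGraph O) (h : Γ.IsConnected) : primitive O :=
  ⟨Γ.cls, Submodule.subset_span ⟨Γ, h, rfl⟩⟩

/-- The grading of `P G^O` by the number of vertices. -/
noncomputable def grading (n : ℕ) : Submodule k (primitive O) :=
  Submodule.span k {z | ∃ (Γ : OGraph O) (h : Γ.IsConnected), Nat.card Γ.V = n ∧ Γ.pcls h = z}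

end Spaces

section GradedSymmetric
variable {W : Type*} [AddCommGroup W] [Module k W] (gr : ℕ → Submodule k W)

/-- The relation `x ⊙ y = (-1) ^ (|x| |y|) y ⊙ x` for homogeneous `x` and `y`. -/
inductive SymRel : TensorAlgebra k W → TensorAlgebra k W → Prop
  | comm {m n : ℕ} {x y : W} (hx : x ∈ gr m) (hy : y ∈ gr n) :
    SymRel (TensorAlgebra.ι k x * TensorAlgebra.ι k y)
      ((-1 : k) ^ (m * n) • (TensorAlgebra.ι k y * TensorAlgebra.ι k x))

/-- The free graded commutative algebra `S(W)` on a graded vector space `W`; `gr n` is the part of `W`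
of degree `n`. -/
abbrev GradedSym : Type _ := RingQuot (SymRel gr)

namespace GradedSym

/-- The inclusion of `W` in `S(W)`. -/
noncomputable def gen : W →ₗ[k] GradedSym gr :=
  (RingQuot.mkAlgHom k (SymRel gr)).toLinearMap ∘ₗ TensorAlgebra.ι k

theorem gen_mul_gen {m n : ℕ} {x y : W} (hx : x ∈ gr m) (hy : y ∈ gr n) :
    gen gr x * gen gr y = (-1 : k) ^ (m * n) • (gen gr y * gen gr x) := by
  have := RingQuot.mkAlgHom_rel k (SymRel.comm (gr := gr) hx hy)
  simpa [gen] using this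

open Polynomial in
/-- The homomorphism `x₁ ⊙ ⋯ ⊙ xᵣ ↦ (x₁ ⊙ ⋯ ⊙ xᵣ) Xʳ`. -/
noncomputable def wordLength : GradedSym gr →ₐ[k] Polynomial (GradedSym gr) :=
  RingQuot.liftAlgHom k ⟨TensorAlgebra.lift k
      ((LinearMap.mulRight k (X : Polynomial (GradedSym gr))) ∘ₗ
        (CAlgHom : GradedSym gr →ₐ[k] Polynomial (GradedSym gr)).toLinearMap ∘ₗ gen gr), by
    rintro _ _ ⟨hx, hy⟩
    rename_i m n x y
    have h := congrArg (fun z => (CAlgHom (R := k) z : Polynomial (GradedSym gr)))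
      (gen_mul_gen gr hx hy)
    simp only [map_mul, map_smul] at h
    simp only [map_mul, map_smul, TensorAlgebra.lift_ι_apply, LinearMap.comp_apply,
      LinearMap.mulRight_apply, AlgHom.toLinearMap_apply]
    have e : ∀ a b : Polynomial (GradedSym gr), a * X * (b * X) = a * b * (X * X) := fun a b => by
      rw [mul_assoc a, ← mul_assoc X, (commute_X b).eq, mul_assoc b, ← mul_assoc a]
    rw [e, e, h, smul_mul_assoc]⟩

/-- The projection `πᵢ` of `S(W)` onto `Sⁱ(W)`: the products of `i` elements of `W` are kept. -/
noncomputable def proj (i : ℕ) : GradedSym gr →ₗ[k] GradedSym gr :=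
  (Polynomial.lcoeff (GradedSym gr) i).restrictScalars k ∘ₗ (wordLength gr).toLinearMap

/-- The part of `S(W)` of degree `n`, where `|x₁ ⊙ ⋯ ⊙ xᵣ| = |x₁| + ⋯ + |xᵣ|`. -/
def homogeneous (n : ℕ) : Submodule k (GradedSym gr) :=
  Submodule.span k {s | ∃ l : List (Σ d : ℕ, gr d),
    (l.map Sigma.fst).sum = n ∧ (l.map fun x => gen gr (x.2 : W)).prod = s}

/-- `D` is a graded derivation of odd degree: `D(x ⊙ y) = D(x) ⊙ y + (-1)^|x| x ⊙ D(y)`. -/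
def IsOddDerivation (D : GradedSym gr →ₗ[k] GradedSym gr) : Prop :=
  ∀ (n : ℕ), ∀ x ∈ homogeneous gr n, ∀ y, D (x * y) = D x * y + (-1 : k) ^ n • (x * D y)

end GradedSym
end GradedSymmetric

/-- The graded symmetric algebra `S(P G^O)`. -/
abbrev SymP : Type _ := GradedSym (grading O)

section Fission
variable {O}

/-- The image of a graph under the isomorphism `S : G^O ≅ S(P G^O)`: the product of its connected
components, taken in some order, with the sign of the permutation which puts the vertices in the
order of the components. -/
noncomputable def OGraph.splitProduct (Γ : OGraph O) : SymP O :=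
  (-1 : k) ^ Nat.card {p : Γ.V × Γ.V // Γ.lt p.1 p.2 ∧
      Finite.equivFin Γ.Comp (Quot.mk _ p.2) < Finite.equivFin Γ.Comp (Quot.mk _ p.1)} •
    (List.ofFn fun a => GradedSym.gen (grading O)
      ((Γ.component ((Finite.equivFin Γ.Comp).symm a)).pcls
        (Γ.component_isConnected _))).prod

variable (O) in
/-- The map `S`, on linear combinations of graphs. -/
noncomputable def split : (OGraph O →₀ k) →ₗ[k] SymP O :=
  Finsupp.linearCombination k OGraph.splitProduct

/-- `θ` is the fission operation `θᵢ`: the extension as an odd derivation to `S(P G^O)` of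
`½ πᵢ ∘ S ∘ ∂ᵢ` on `P G^O`. -/
def IsFission (i : ℕ) [NeZero i] (θ : SymP O →ₗ[k] SymP O) : Prop :=
  GradedSym.IsOddDerivation (grading O) θ ∧
    ∀ (Γ : OGraph O) (h : Γ.IsConnected), θ (GradedSym.gen (grading O) (Γ.pcls h)) =
      (1 / 2 : k) • GradedSym.proj (grading O) i (split O (Γ.polygonSum i))

end Fission
end GraphComplex

/-! Attaching a polygon to `i ≥ 1` edges raises the number of connected components by at most `i -
1`, and contracting an edge that is not a loop does not change it. Hence on a connected graph `πᵢ ∘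
S ∘ ∂ᵢ` keeps exactly the terms where the number of components grows by `i - 1`. This condition
(`Splits`) makes sense for every graph, connected or not, and defines an operation `fission O i` on
the whole graph complex. The map `splitMap O` onto the symmetric algebra is surjective and turns
disjoint unions into products, and `fission O i` satisfies the Leibniz rule for disjoint unions.
Therefore `splitMap O` carries half of `fission O i` to `θᵢ` (`IsFission.comp_splitMap`), and it is
enough that the operations `fission O i` anticommute (`fission_comp_add_comp`).

A composite of two of them is a sum over pairs of lists `l`, `l'` of directed edges: attach a
polygon along `l`, contract its first new edge, attach a polygon along `l'` away from that edge,
contract again. Attaching commutes with contracting an edge that the polygon does not use, so both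
contractions can be done at the end, where they anticommute (`contractCls₂_swap`; the labels agree
by the associativity and the symmetry of the cyclic operad). If the two lists have no edge in
common, the attachments commute, and the term cancels against that of `(l', l)` in the other
composite.

The remaining terms cancel inside each composite. Maximal growth puts all edges of `l'` into one
component of the intermediate graph and the new edges of the first polygon into different ones, so
the second polygon uses only one of those new edges. After reversing the second polygon if necessary
(`fissionTerm₂_flip`), the lists share a half-edge `y`. The product of two cycles with a single
common element is one cycle (`cyc_mul_cyc`), so the two polygons are equivalent to a single polygon
in which two new edges are contracted (`pairTerm_merge`). These two edges cut the cyclic list into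
two pieces. Exchanging the pieces gives a minus sign, while the set of possible positions of `y` is
symmetric under this exchange, so the sum equals its own negative (`sum_cutSum`).

An odd derivation with given values on generators exists because it can be read off from an algebra
homomorphism to upper triangular matrices (`exists_isOddDerivation`); it is unique because the
connected graphs generate. -/

namespace GraphComplex
variable {k : Type u} [Field k] (O : CyclicOperad.{u, w} k)

/-! ### Naturality, symmetry and associativity of the composition of labels. -/

namespace Labels

theorem induction_on {H : Type} {P : Labels O H → Prop} (a : Labels O H) (zero : P 0)
    (mk : ∀ (n : ℕ) (L : H ≃ Fin (n + 1)) (o : O.obj n), P (mk O L o))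
    (add : ∀ a b, P a → P b → P (a + b)) : P a := by
  classical
  obtain ⟨z, rfl⟩ := Submodule.Quotient.mk_surjective _ a
  induction z using DirectSum.induction_on with
  | zero => exact zero
  | of L o => exact mk L.1 L.2 o
  | add x y hx hy => exact add _ _ hx hy

theorem map_mk {H H' : Type} (e : H ≃ H') {n : ℕ} (L : H ≃ Fin (n + 1)) (o : O.obj n) :
    map O e (mk O L o) = mk O (e.symm.trans L) o :=
  lift_mk O _ _ L o

theorem mk_congr {H : Type} {n : ℕ} {L L' : H ≃ Fin (n + 1)} (h : ∀ x, (L x : ℕ) = L' x)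
    (o : O.obj n) : mk O L o = mk O L' o := by
  rw [show L = L' from Equiv.ext fun x => Fin.ext (h x)]

theorem map_map {H H' H'' : Type} (e : H ≃ H') (e' : H' ≃ H'') (a : Labels O H) :
    map O e' (map O e a) = map O (e.trans e') a := by
  induction a using induction_on with
  | zero => simp
  | mk n L o => simp only [map_mk]; rfl
  | add a b ha hb => simp [ha, hb]

theorem map_congr {H H' : Type} {e e' : H ≃ H'} (h : ∀ x, e x = e' x) (a : Labels O H) :
    map O e a = map O e' a := by
  rw [Equiv.ext h]

theorem map_of_forall_eq {H : Type} {e : H ≃ H} (h : ∀ x, e x = x) (a : Labels O H) :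
    map O e a = a := by
  obtain rfl : e = Equiv.refl H := Equiv.ext h
  induction a using induction_on with
  | zero => simp
  | mk n L o => simp only [map_mk]; rfl
  | add a b ha hb => simp [ha, hb]

theorem glue_inl {H H' : Type} {x : H} {y : H'} {m n p : ℕ} (h : p + 1 = m + n) (i : Fin m)
    (L : H ≃ Fin (m + 1)) (L' : H' ≃ Fin (n + 1)) (hx : L x = i.succ) (hy : L' y = 0)
    (s : {s // s ≠ x}) : (glue h i L L' hx hy (Sum.inl s) : ℕ) =
      if (L s.1 : ℕ) ≤ i then (L s.1 : ℕ) else L s.1 + n - 1 := rfl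

theorem glue_inr {H H' : Type} {x : H} {y : H'} {m n p : ℕ} (h : p + 1 = m + n) (i : Fin m)
    (L : H ≃ Fin (m + 1)) (L' : H' ≃ Fin (n + 1)) (hx : L x = i.succ) (hy : L' y = 0)
    (t : {t // t ≠ y}) : (glue h i L L' hx hy (Sum.inr t) : ℕ) = i + L' t.1 := rfl

theorem exists_mk {H : Type} {n : ℕ} (L : H ≃ Fin (n + 1)) (o : O.obj n) (x : H)
    (j : Fin (n + 1)) : ∃ (L' : H ≃ Fin (n + 1)) (o' : O.obj n), L' x = j ∧
      mk O L o = mk O L' o' :=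
  ⟨L.trans (Equiv.swap (L x) j), O.act n (Equiv.swap (L x) j) o, by simp, (mk_act O L _ o).symm⟩

/-- Two transpositions suffice: the one that brings `y` to `j` moves only `j` and the current label
of `y`, both different from `i`. -/
theorem exists_mk₂ {H : Type} {n : ℕ} (L : H ≃ Fin (n + 1)) (o : O.obj n) {x y : H} (hxy : x ≠ y)
    {i j : Fin (n + 1)} (hij : i ≠ j) : ∃ (L' : H ≃ Fin (n + 1)) (o' : O.obj n), L' x = i ∧
      L' y = j ∧ mk O L o = mk O L' o' := by
  obtain ⟨L₁, o₁, h₁, e₁⟩ := exists_mk O L o x i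
  refine ⟨L₁.trans (Equiv.swap (L₁ y) j), O.act n (Equiv.swap (L₁ y) j) o₁, ?_, by simp,
    e₁.trans (mk_act O L₁ _ o₁).symm⟩
  rw [Equiv.trans_apply, Equiv.swap_apply_of_ne_of_ne _ (h₁ ▸ hij), h₁]
  exact fun h => hxy (L₁.injective h)

/-- This is the default value of `compAux`. With it, naturality of the composition needs no
assumption on the number of half-edges. -/
theorem comp_mk_of_eq_zero {H H' : Type} (x : H) (y : H') (L : H ≃ Fin 1) (a : O.obj 0)
    (b : Labels O H') : comp O x y (mk O L a) b = 0 := by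
  induction b using induction_on with
  | zero => simp
  | mk n L' o =>
    rw [comp, lift_mk, compRight, LinearMap.flip_apply, lift_mk, LinearMap.flip_apply]
    simp [compAux]
  | add a b ha hb => simp [ha, hb]

/-- Naturality of the composition. -/
theorem map_comp_map {H H' K K' M : Type} {x : H} {y : H'} {x' : K} {y' : K'} (e : H ≃ K)
    (e' : H' ≃ K') (hx : e x = x') (hy : e' y = y')
    (F : {s // s ≠ x'} ⊕ {t // t ≠ y'} ≃ M) (G : {s // s ≠ x} ⊕ {t // t ≠ y} ≃ M)
    (h₁ : ∀ s hs hs', F (Sum.inl ⟨e s, hs⟩) = G (Sum.inl ⟨s, hs'⟩))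
    (h₂ : ∀ t ht ht', F (Sum.inr ⟨e' t, ht⟩) = G (Sum.inr ⟨t, ht'⟩))
    (a : Labels O H) (b : Labels O H') :
    map O F (comp O x' y' (map O e a) (map O e' b)) = map O G (comp O x y a b) := by
  subst hx hy
  induction a using induction_on with
  | zero => simp
  | add a b ha hb => simp [ha, hb]
  | mk m L a =>
  induction b using induction_on with
  | zero => simp
  | add a b ha hb => simp [ha, hb]
  | mk n L' b =>
  cases m with
  | zero => rw [map_mk, comp_mk_of_eq_zero, comp_mk_of_eq_zero]; simp
  | succ m =>
  -- In the coinvariants `x` may be given the label 1 and `y` the label 0; then `comp_mk` applies at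
  -- the first leaf.
  obtain ⟨L, a, hL, e₁⟩ := exists_mk O L a x (Fin.succ 0)
  obtain ⟨L', b, hL', e₂⟩ := exists_mk O L' b y 0
  rw [e₁, e₂, map_mk, map_mk, comp_mk O (Nat.add_right_comm m n 1) 0 _ _ (by simpa) (by simpa),
    comp_mk O (Nat.add_right_comm m n 1) 0 _ _ hL hL', map_mk, map_mk]
  apply mk_congr
  intro z
  obtain ⟨z, rfl⟩ := G.surjective z
  rcases z with ⟨s, hs⟩ | ⟨t, ht⟩
  · simp only [Equiv.trans_apply, Equiv.symm_apply_apply]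
    rw [← h₁ s (fun h => hs (e.injective h)) hs, F.symm_apply_apply]
    simp [glue_inl]
  · simp only [Equiv.trans_apply, Equiv.symm_apply_apply]
    rw [← h₂ t (fun h => ht (e'.injective h)) ht, F.symm_apply_apply]
    simp [glue_inr]

/-- The composition is symmetric in its two arguments. -/
theorem map_comp_swap {H H' M : Type} (x : H) (y : H') (hH : 2 ≤ Nat.card H)
    (hH' : 2 ≤ Nat.card H') (F : {t // t ≠ y} ⊕ {s // s ≠ x} ≃ M)
    (G : {s // s ≠ x} ⊕ {t // t ≠ y} ≃ M) (h₁ : ∀ s, F (Sum.inr s) = G (Sum.inl s))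
    (h₂ : ∀ t, F (Sum.inl t) = G (Sum.inr t)) (a : Labels O H) (b : Labels O H') :
    map O F (comp O y x b a) = map O G (comp O x y a b) := by
  induction a using induction_on with
  | zero => simp
  | add a b ha hb => simp [ha, hb]
  | mk m L a =>
  induction b using induction_on with
  | zero => simp
  | add a b ha hb => simp [ha, hb]
  | mk n L' b =>
  have hm := Nat.card_congr L
  have hn := Nat.card_congr L'
  simp only [Nat.card_eq_fintype_card, Fintype.card_fin] at hm hn
  -- Each factor needs a leaf besides the root, since each of them is the outer one on one side of
  -- the equation; otherwise that side would take the default value 0.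
  obtain ⟨m, rfl⟩ : ∃ m', m = m' + 1 := ⟨m - 1, by omega⟩
  obtain ⟨n, rfl⟩ : ∃ n', n = n' + 1 := ⟨n - 1, by omega⟩
  obtain ⟨L, a, hL, e₁⟩ := exists_mk O L a x (Fin.succ 0)
  obtain ⟨L', b, hL', e₂⟩ := exists_mk O L' b y 0
  have hp : m + n + 1 + 1 = (m + 1) + (n + 1) := by omega
  have hp' : m + n + 1 + 1 = (n + 1) + (m + 1) := by omega
  -- Both permutations exchange the labels 0 and 1: the glued leaf of `a` becomes its root and the
  -- root of `b` becomes a leaf, as `act_comp_swap` requires. The permutation `ρ` of the remaining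
  -- labels is then forced.
  set σ : Equiv.Perm (Fin (m + 1 + 1)) := Equiv.swap (Fin.succ 0) 0 with hσ
  set τ : Equiv.Perm (Fin (n + 1 + 1)) := Equiv.swap 0 (Fin.succ 0) with hτ
  have hLσ : (L.trans σ) x = 0 := by simp [hL, hσ]
  have hLτ : (L'.trans τ) y = Fin.succ 0 := by simp [hL', hτ]
  rw [e₁, e₂, comp_mk O hp 0 L L' hL hL', ← mk_act O L σ, ← mk_act O L' τ,
    comp_mk O hp' 0 _ _ hLτ hLσ, map_mk, map_mk]
  set g := glue hp 0 L L' hL hL' with hg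
  set g' := glue hp' 0 _ _ hLτ hLσ with hg'
  set ρ : Equiv.Perm (Fin (m + n + 1 + 1)) := g.symm.trans (G.trans (F.symm.trans g')) with hρ
  have key₁ : ∀ s : {s // s ≠ x}, ρ (g (Sum.inl s)) = g' (Sum.inr s) := fun s => by
    simp [hρ, ← h₁]
  have key₂ : ∀ s : {s // s ≠ y}, ρ (g (Sum.inr s)) = g' (Sum.inl s) := fun s => by
    simp [hρ, ← h₂]
  rw [← O.act_comp_swap hp hp' 0 0 σ τ ρ (by simp [hσ]) (by simp [hτ]), ← mk_act O (G.symm.trans g) ρ]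
  · apply mk_congr
    intro z
    simp [hρ]
  · intro s hs
    have := key₁ ⟨L.symm s, by rw [ne_eq, Equiv.symm_apply_eq, hL]; exact hs⟩
    simpa [hg, hg', glue] using this
  · intro t ht
    have := key₂ ⟨L'.symm t, by rw [ne_eq, Equiv.symm_apply_eq, hL']; exact ht⟩
    simpa [hg, hg', glue] using this

/-- Naturality and symmetry of the composition. -/
theorem map_comp_map_swap {H H' K K' M : Type} {x : H} {y : H'} {x' : K} {y' : K'} (e : H ≃ K)
    (e' : H' ≃ K') (hx : e x = x') (hy : e' y = y') (hH : 2 ≤ Nat.card H) (hH' : 2 ≤ Nat.card H')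
    (F : {t // t ≠ y'} ⊕ {s // s ≠ x'} ≃ M) (G : {s // s ≠ x} ⊕ {t // t ≠ y} ≃ M)
    (h₁ : ∀ s hs hs', F (Sum.inr ⟨e s, hs⟩) = G (Sum.inl ⟨s, hs'⟩))
    (h₂ : ∀ t ht ht', F (Sum.inl ⟨e' t, ht⟩) = G (Sum.inr ⟨t, ht'⟩))
    (a : Labels O H) (b : Labels O H') :
    map O F (comp O y' x' (map O e' b) (map O e a)) = map O G (comp O x y a b) := by
  rw [← map_comp_swap O x y hH hH' ((Equiv.sumComm _ _).trans G) G (fun _ => rfl) (fun _ => rfl)]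
  exact map_comp_map O e' e hy hx F _ h₂ h₁ b a

/-- Compositions along two half-edges of the same set commute. -/
theorem map_comp_comp {H₁ H₂ H₃ M : Type} {x x' : H₁} (hne : x' ≠ x) (y : H₂) (w : H₃)
    (hcard : 3 ≤ Nat.card H₁)
    (F : {s : {s // s ≠ x} ⊕ {t // t ≠ y} // s ≠ Sum.inl ⟨x', hne⟩} ⊕ {r // r ≠ w} ≃ M)
    (G : {s : {s // s ≠ x'} ⊕ {t // t ≠ w} // s ≠ Sum.inl ⟨x, hne.symm⟩} ⊕ {r // r ≠ y} ≃ M)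
    (h₁ : ∀ s hs hs' h h', F (Sum.inl ⟨Sum.inl ⟨s, hs⟩, h⟩) = G (Sum.inl ⟨Sum.inl ⟨s, hs'⟩, h'⟩))
    (h₂ : ∀ t h, F (Sum.inl ⟨Sum.inr t, h⟩) = G (Sum.inr t))
    (h₃ : ∀ r h, F (Sum.inr r) = G (Sum.inl ⟨Sum.inr r, h⟩))
    (a : Labels O H₁) (b : Labels O H₂) (c : Labels O H₃) :
    map O F (comp O (Sum.inl ⟨x', hne⟩) w (comp O x y a b) c) =
      map O G (comp O (Sum.inl ⟨x, hne.symm⟩) y (comp O x' w a c) b) := by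
  induction a using induction_on with
  | zero => simp
  | add a b ha hb => simp [ha, hb]
  | mk l La a =>
  induction b using induction_on with
  | zero => simp
  | add a b ha hb => simp [ha, hb]
  | mk m Lb b =>
  induction c using induction_on with
  | zero => simp
  | add a b ha hb => simp [ha, hb]
  | mk n Lc c =>
  have hl := Nat.card_congr La
  simp only [Nat.card_eq_fintype_card, Fintype.card_fin] at hl
  obtain ⟨l, rfl⟩ : ∃ l', l = l' + 2 := ⟨l - 2, by omega⟩
  obtain ⟨La, a, hx, hx', e₁⟩ := exists_mk₂ O La a hne.symm
    (show (⟨0, by omega⟩ : Fin (l + 2)).succ ≠ (⟨1, by omega⟩ : Fin (l + 2)).succ from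
      fun h => absurd (congrArg Fin.val h) (by simp only [Fin.val_succ]; omega))
  obtain ⟨Lb, b, hy, e₂⟩ := exists_mk O Lb b y 0
  obtain ⟨Lc, c, hw, e₃⟩ := exists_mk O Lc c w 0
  have vx : (La x : ℕ) = 1 := by rw [hx]; rfl
  have vx' : (La x' : ℕ) = 2 := by rw [hx']; rfl
  have vy : (Lb y : ℕ) = 0 := by rw [hy]; rfl
  have vw : (Lc w : ℕ) = 0 := by rw [hw]; rfl
  have hp : l + m + 1 + 1 = (l + 2) + m := by omega
  have hr : l + n + 1 + 1 = (l + 2) + n := by omega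
  have hq : l + m + n + 1 = (l + m + 1) + n := by omega
  have hq' : l + m + n + 1 = (l + n + 1) + m := by omega
  -- Gluing `b`, which has `m` labels besides the root, at the label 1 of `x` moves the label 2 of
  -- `x'` to `m + 1`. Gluing `c` at the label 2 leaves the label of `x` alone. These are the leaf
  -- indices `m` and `0` in `comp_assoc_par`.
  have k₁ : glue hp ⟨0, by omega⟩ La Lb hx hy (Sum.inl ⟨x', hne⟩) =
      (⟨m, by omega⟩ : Fin (l + m + 1)).succ := by
    rw [Fin.ext_iff, glue_inl, Fin.val_succ]
    dsimp only
    rw [vx', if_neg (by omega)]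
    omega
  have k₂ : glue hr ⟨1, by omega⟩ La Lc hx' hw (Sum.inl ⟨x, hne.symm⟩) =
      (⟨0, by omega⟩ : Fin (l + n + 1)).succ := by
    rw [Fin.ext_iff, glue_inl, Fin.val_succ]
    dsimp only
    rw [vx, if_pos (by omega)]
  rw [e₁, e₂, e₃, comp_mk O hp ⟨0, by omega⟩ La Lb hx hy, comp_mk O hr ⟨1, by omega⟩ La Lc hx' hw,
    comp_mk O hq ⟨m, by omega⟩ _ _ k₁ hw, comp_mk O hq' ⟨0, by omega⟩ _ _ k₂ hy, map_mk, map_mk,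
    O.comp_assoc_par hp hq hr hq' ⟨0, by omega⟩ ⟨1, by omega⟩ ⟨m, by omega⟩ ⟨0, by omega⟩
      (by simp) (by simp; omega) rfl]
  apply mk_congr
  intro z
  obtain ⟨z, rfl⟩ := F.surjective z
  simp only [Equiv.trans_apply, Equiv.symm_apply_apply]
  rcases z with ⟨⟨s, hs⟩ | t, h⟩ | r
  · have hs' : s ≠ x' := fun e => h (by simp [e])
    have h0 : (La s : ℕ) ≠ 1 := fun e => hs (La.injective (Fin.ext (e.trans vx.symm)))
    have h1 : (La s : ℕ) ≠ 2 := fun e => hs' (La.injective (Fin.ext (e.trans vx'.symm)))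
    rw [h₁ s hs hs' h (by simpa using hs), Equiv.symm_apply_apply]
    simp only [glue_inl]
    split_ifs <;> omega
  · rw [h₂ t h, Equiv.symm_apply_apply]
    have h0 : (Lb t.1 : ℕ) ≠ 0 := fun e => t.2 (Lb.injective (Fin.ext (e.trans vy.symm)))
    have := (Lb t.1).2
    simp only [glue_inl, glue_inr]
    exact if_pos (by omega)
  · rw [h₃ r (by simp), Equiv.symm_apply_apply]
    have h0 : (Lc r.1 : ℕ) ≠ 0 := fun e => r.2 (Lc.injective (Fin.ext (e.trans vw.symm)))
    simp only [glue_inl, glue_inr]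
    refine Eq.trans ?_ (if_neg (by omega)).symm
    omega

end Labels
end GraphComplex
namespace GraphComplex

/-! ### Signs as products over finite types. -/

section Signs
variable (k : Type u) [Field k]

open Classical in
/-- The sign of a proposition: `-1` if it is true. -/
noncomputable def sg (p : Prop) : k := if p then -1 else 1

variable {k}

@[simp] theorem sg_true : sg k True = -1 := if_pos trivial

@[simp] theorem sg_false : sg k False = 1 := if_neg id

theorem sg_of {p : Prop} (h : p) : sg k p = -1 := if_pos h

theorem sg_of_not {p : Prop} (h : ¬ p) : sg k p = 1 := if_neg h

theorem sg_not (p : Prop) : sg k (¬ p) = - sg k p := by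
  by_cases h : p <;> simp [h]

@[simp] theorem sg_mul_self (p : Prop) : sg k p * sg k p = 1 := by
  by_cases h : p <;> simp [h]

theorem neg_one_pow_card {α : Type*} [Fintype α] (p : α → Prop) :
    (-1 : k) ^ Nat.card {x // p x} = ∏ x, sg k (p x) := by
  classical
  rw [Nat.card_eq_fintype_card, Fintype.card_subtype]
  simp only [sg, Finset.prod_ite, Finset.prod_const, one_pow, mul_one]

theorem neg_one_pow_mul_self (n : ℕ) : (-1 : k) ^ n * (-1) ^ n = 1 := by
  rw [← mul_pow]; simp

theorem prod_subtype_ne_mul {α : Type*} [Fintype α] (a : α) [Fintype {x // x ≠ a}] (f : α → k) :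
    (∏ x : {x // x ≠ a}, f x.1) * f a = ∏ x, f x := by
  classical
  rw [← Finset.prod_erase_mul _ _ (Finset.mem_univ a)]
  congr 1
  exact (Finset.prod_subtype _ (by simp) _).symm

theorem prod_subtype_ne_ne_mul {α : Type*} [Fintype α] {a b : α} (hab : a ≠ b)
    [Fintype {x // x ≠ a ∧ x ≠ b}] (f : α → k) :
    (∏ x : {x // x ≠ a ∧ x ≠ b}, f x.1) * (f a * f b) = ∏ x, f x := by
  classical
  rw [← Finset.prod_erase_mul _ _ (Finset.mem_univ b),
    ← Finset.prod_erase_mul _ _ (show a ∈ Finset.univ.erase b by simp [hab]), mul_assoc]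
  congr 1
  exact (Finset.prod_subtype _ (by simp) _).symm

end Signs

variable {k : Type u} [Field k] {O : CyclicOperad.{u, w} k}

namespace OGraph

theorem lt_asymm' (Γ : OGraph O) {v w : Γ.V} (h : Γ.lt v w) : ¬ Γ.lt w v :=
  fun h' => irrefl_of Γ.lt v (trans_of Γ.lt h h')

theorem not_lt_iff (lt : α → α → Prop) [IsStrictTotalOrder α lt] {v w : α} (h : v ≠ w) :
    ¬ lt v w ↔ lt w v := by
  constructor
  · intro h'
    rcases trichotomous_of lt v w with h₁ | h₁ | h₁
    · exact absurd h₁ h'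
    · exact absurd h₁ h
    · exact h₁
  · exact fun h₁ h₂ => irrefl_of lt v (trans_of lt h₂ h₁)

/-! ### Classes of graphs and linear maps out of the graph complex. -/

section Relations

theorem cls_iso {Γ Δ : OGraph O} (φ : Γ.Iso Δ) : Δ.cls = Γ.cls :=
  (Submodule.Quotient.eq _).2 (Submodule.subset_span (IsRelation.iso Γ Δ φ))

theorem cls_eq_mk (Γ : OGraph O) (c : k) :
    c • Γ.cls = (Submodule.Quotient.mk (Finsupp.single Γ c) : GraphSpace O) := by
  rw [cls, ← Submodule.Quotient.mk_smul]; simp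

theorem cls_reorient (Γ : OGraph O) (lt' : Γ.V → Γ.V → Prop) [IsStrictTotalOrder Γ.V lt']
    (tail' : Γ.H → Prop) (h : ∀ h, tail' (Γ.inv h) ↔ ¬ tail' h) :
    (Γ.reorient lt' tail' h).cls = (-1 : k) ^ Γ.changes lt' tail' • Γ.cls := by
  rw [cls_eq_mk]
  exact (Submodule.Quotient.eq _).2 (Submodule.subset_span (IsRelation.orientation Γ lt' tail' h))

/-- The class of a graph as a linear function of the label of `v`. -/
noncomputable def clsAt (Γ : OGraph O) (v : Γ.V) :
    Labels O {h // Γ.vert h = v} →ₗ[k] GraphSpace O where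
  toFun z := (Γ.setDeco v z).cls
  map_add' x y := by
    refine ((Submodule.Quotient.eq _).2 (Submodule.subset_span (IsRelation.deco_add Γ v x y))).trans ?_
    rfl
  map_smul' c x := by
    rw [RingHom.id_apply, cls_eq_mk]
    exact (Submodule.Quotient.eq _).2 (Submodule.subset_span (IsRelation.deco_smul Γ v c x))

/-- A function of graphs that respects the relations of the graph complex. -/
structure IsInvariant {M : Type*} [AddCommGroup M] [Module k M] (g : OGraph O → M) : Prop where
  iso : ∀ {Γ Δ : OGraph O}, Γ.Iso Δ → g Δ = g Γ
  reorient : ∀ (Γ : OGraph O) (lt' : Γ.V → Γ.V → Prop) [IsStrictTotalOrder Γ.V lt']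
    (tail' : Γ.H → Prop) (h : ∀ h, tail' (Γ.inv h) ↔ ¬ tail' h),
    g (Γ.reorient lt' tail' h) = (-1 : k) ^ Γ.changes lt' tail' • g Γ
  deco : ∀ (Γ : OGraph O) (v : Γ.V), ∃ Λ : Labels O {h // Γ.vert h = v} →ₗ[k] M,
    ∀ z, g (Γ.setDeco v z) = Λ z

/-- The linear map on the graph complex with the given values on graphs. -/
noncomputable def IsInvariant.lift {M : Type*} [AddCommGroup M] [Module k M] {g : OGraph O → M}
    (hg : IsInvariant g) : GraphSpace O →ₗ[k] M :=
  (Submodule.span k {z | IsRelation O z}).liftQ (Finsupp.linearCombination k g) <| by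
    rw [Submodule.span_le]
    rintro z hz
    rcases hz with ⟨Γ, v, x, y⟩ | ⟨Γ, v, c, x⟩ | ⟨Γ, lt', tail', h⟩ | ⟨Γ, Δ, φ⟩
    · obtain ⟨Λ, hΛ⟩ := hg.deco Γ v
      simp [hΛ]
    · obtain ⟨Λ, hΛ⟩ := hg.deco Γ v
      simp [hΛ]
    · simp [hg.reorient]
    · simp [hg.iso φ]

theorem IsInvariant.lift_cls {M : Type*} [AddCommGroup M] [Module k M] {g : OGraph O → M}
    (hg : IsInvariant g) (Γ : OGraph O) : hg.lift Γ.cls = g Γ := by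
  simp [lift, cls]

theorem graphSpace_hom_ext {M : Type*} [AddCommGroup M] [Module k M] {f g : GraphSpace O →ₗ[k] M}
    (h : ∀ Γ : OGraph O, f Γ.cls = g Γ.cls) : f = g := by
  apply Submodule.linearMap_qext
  ext Γ
  exact h Γ

end Relations

/-! ### Transport of labels, and contraction along isomorphisms. -/

section Deco

/-- Labels at equal vertices live in different types; the equality is turned into a relabelling that
fixes all half-edges. -/
theorem deco_of_eq (Γ : OGraph O) {v w : Γ.V} (h : v = w) :
    Γ.deco w = Labels.map O (Equiv.subtypeEquivRight fun x => by rw [h]) (Γ.deco v) := by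
  subst h
  exact (Labels.map_of_forall_eq O (fun _ => rfl) _).symm

/-- An isomorphism that need not respect the pairing of the half-edges and the orientation. -/
structure PreIso (Γ Δ : OGraph O) where
  onV : Γ.V ≃ Δ.V
  onH : Γ.H ≃ Δ.H
  vert_eq : ∀ h, Δ.vert (onH h) = onV (Γ.vert h)
  deco_eq : ∀ v, Δ.deco (onV v) = Labels.map O (onH.subtypeEquiv fun h => by
    rw [vert_eq, onV.apply_eq_iff_eq]) (Γ.deco v)

theorem PreIso.deco_of_eq {Γ Δ : OGraph O} (φ : PreIso Γ Δ) {v : Γ.V} {w : Δ.V}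
    (h : φ.onV v = w) : Δ.deco w = Labels.map O (φ.onH.subtypeEquiv fun h' => by
      rw [← h, φ.vert_eq, φ.onV.apply_eq_iff_eq]) (Γ.deco v) := by
  subst h
  exact φ.deco_eq v

/-- Forget that an isomorphism respects the pairing and the orientation. -/
def Iso.toPreIso {Γ Δ : OGraph O} (φ : Γ.Iso Δ) : PreIso Γ Δ := ⟨φ.onV, φ.onH, φ.vert_eq, φ.deco_eq⟩

theorem contractVert_val (Γ : OGraph O) {t : Γ.H} (ht : Γ.vert t ≠ Γ.vert (Γ.inv t))
    (h : Γ.ContractH t) [Decidable (Γ.vert h.1 = Γ.vert (Γ.inv t))] :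
    (Γ.contractVert t ht h).1 =
      if Γ.vert h.1 = Γ.vert (Γ.inv t) then Γ.vert t else Γ.vert h.1 := by
  rw [contractVert]
  split_ifs <;> rfl

theorem contract_vert_val (Γ : OGraph O) {t : Γ.H} (ht : Γ.vert t ≠ Γ.vert (Γ.inv t))
    (h : Γ.ContractH t) [Decidable (Γ.vert h.1 = Γ.vert (Γ.inv t))] :
    ((Γ.contract ht).vert h).1 =
      if Γ.vert h.1 = Γ.vert (Γ.inv t) then Γ.vert t else Γ.vert h.1 :=
  contractVert_val Γ ht h

theorem contract_deco_merged (Γ : OGraph O) {t : Γ.H} (ht : Γ.vert t ≠ Γ.vert (Γ.inv t))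
    (v : Γ.ContractV t) (hv : v.1 = Γ.vert t) :
    (Γ.contract ht).deco v = Labels.map O (Γ.starMerged ht v hv)
      (Labels.comp O ⟨t, rfl⟩ ⟨Γ.inv t, rfl⟩ (Γ.deco (Γ.vert t)) (Γ.deco (Γ.vert (Γ.inv t)))) :=
  dif_pos hv

theorem contract_deco_other (Γ : OGraph O) {t : Γ.H} (ht : Γ.vert t ≠ Γ.vert (Γ.inv t))
    (v : Γ.ContractV t) (hv : v.1 ≠ Γ.vert t) :
    (Γ.contract ht).deco v = Labels.map O (Γ.starOther ht v hv) (Γ.deco v.1) :=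
  dif_neg hv

/-- Contractions of corresponding edges. -/
noncomputable def PreIso.contract {Γ Δ : OGraph O} (φ : PreIso Γ Δ) {t : Γ.H} {s : Δ.H}
    (hs : φ.onH t = s) (hs' : φ.onH (Γ.inv t) = Δ.inv s) (ht : Γ.vert t ≠ Γ.vert (Γ.inv t))
    (ht' : Δ.vert s ≠ Δ.vert (Δ.inv s)) : PreIso (Γ.contract ht) (Δ.contract ht') where
  onV := φ.onV.subtypeEquiv fun v => by
    rw [← hs', φ.vert_eq, ne_eq, ne_eq, φ.onV.apply_eq_iff_eq]
  onH := φ.onH.subtypeEquiv fun h => by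
    rw [← hs', ← hs, ne_eq, ne_eq, ne_eq, ne_eq, φ.onH.apply_eq_iff_eq, φ.onH.apply_eq_iff_eq]
  vert_eq h := by
    classical
    refine Subtype.ext ?_
    refine (contract_vert_val Δ ht' _).trans ?_
    refine Eq.trans ?_ (congrArg φ.onV (contract_vert_val Γ ht h)).symm
    change (if Δ.vert (φ.onH h.1) = _ then _ else Δ.vert (φ.onH h.1)) = _
    rw [φ.vert_eq, ← hs', φ.vert_eq, ← hs, φ.vert_eq]
    simp only [φ.onV.apply_eq_iff_eq]
    split_ifs <;> rfl
  deco_eq v := by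
    have e₁ : φ.onV (Γ.vert t) = Δ.vert s := by rw [← hs, φ.vert_eq]
    have e₂ : φ.onV (Γ.vert (Γ.inv t)) = Δ.vert (Δ.inv s) := by rw [← hs', φ.vert_eq]
    by_cases hv : v.1 = Γ.vert t
    · have hv' : φ.onV v.1 = Δ.vert s := by rw [hv, e₁]
      rw [contract_deco_merged Γ ht v hv]
      refine Eq.trans ?_ (Labels.map_map O _ _ _).symm
      refine (contract_deco_merged Δ ht' _ hv').trans ?_
      rw [φ.deco_of_eq e₁, φ.deco_of_eq e₂]
      exact Labels.map_comp_map O _ _ (Subtype.ext hs) (Subtype.ext hs') _ _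
        (fun _ _ _ => Subtype.ext (Subtype.ext rfl)) (fun _ _ _ => Subtype.ext (Subtype.ext rfl)) _ _
    · have hv' : φ.onV v.1 ≠ Δ.vert s := by rwa [← e₁, ne_eq, φ.onV.apply_eq_iff_eq]
      rw [contract_deco_other Γ ht v hv]
      refine Eq.trans ?_ (Labels.map_map O _ _ _).symm
      refine (contract_deco_other Δ ht' _ hv').trans ?_
      refine (congrArg _ (φ.deco_eq v.1)).trans ?_
      refine (Labels.map_map O _ _ _).trans ?_
      exact Labels.map_congr O (fun _ => Subtype.ext (Subtype.ext rfl)) _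

/-- Contractions of corresponding edges of isomorphic graphs are isomorphic. -/
noncomputable def Iso.contract {Γ Δ : OGraph O} (φ : Γ.Iso Δ) {t : Γ.H}
    (ht : Γ.vert t ≠ Γ.vert (Γ.inv t))
    (ht' : Δ.vert (φ.onH t) ≠ Δ.vert (Δ.inv (φ.onH t))) :
    (Γ.contract ht).Iso (Δ.contract ht') :=
  { φ.toPreIso.contract rfl (φ.inv_eq t).symm ht ht' with
    inv_eq := fun h => Subtype.ext (φ.inv_eq h.1)
    lt_iff := fun v w => φ.lt_iff v.1 w.1
    tail_iff := fun h => φ.tail_iff h.1 }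

end Deco
end OGraph
end GraphComplex
namespace GraphComplex
variable {k : Type u} [Field k] {O : CyclicOperad.{u, w} k}
namespace OGraph

/-! ### Contraction and changes of the orientation. -/

section Reorient

theorem changes_sign (Γ : OGraph O) [Fintype Γ.V] [Fintype Γ.H] (lt' : Γ.V → Γ.V → Prop)
    (tail' : Γ.H → Prop) : (-1 : k) ^ Γ.changes lt' tail' =
      (∏ v, ∏ w, sg k (Γ.lt v w ∧ lt' w v)) * ∏ h, sg k (Γ.tail h ∧ ¬ tail' h) := by
  rw [changes, pow_add, neg_one_pow_card (fun p : Γ.V × Γ.V => Γ.lt p.1 p.2 ∧ lt' p.2 p.1),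
    neg_one_pow_card, Fintype.prod_prod_type]

theorem contractSign_eq (Γ : OGraph O) [Fintype Γ.V] (t : Γ.H) :
    contractSign k Γ t =
      sg k (¬ Γ.tail t) * - ∏ v, sg k (Γ.lt v (Γ.vert (Γ.inv t))) := by
  rw [contractSign, pow_succ, neg_one_pow_card, mul_neg_one]
  congr 1
  by_cases h : Γ.tail t <;> simp [h]

/-- A point `x ≠ a` forms an inversion with `a` exactly when `lt x a` and `lt' x a` disagree, so it
contributes the product of their signs. -/
theorem prod_sg_inversions {α : Type} [Fintype α] (lt lt' : α → α → Prop)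
    [IsStrictTotalOrder α lt] [IsStrictTotalOrder α lt'] (a : α) [Fintype {x // x ≠ a}] :
    (∏ x : {x // x ≠ a}, ∏ y : {x // x ≠ a}, sg k (lt x.1 y.1 ∧ lt' y.1 x.1)) *
      ((∏ x, sg k (lt x a)) * ∏ x, sg k (lt' x a)) = ∏ x, ∏ y, sg k (lt x y ∧ lt' y x) := by
  rw [← prod_subtype_ne_mul a (fun x => ∏ y, sg k (lt x y ∧ lt' y x))]
  simp_rw [← prod_subtype_ne_mul a (fun y => sg k (lt _ y ∧ lt' y _))]
  rw [Finset.prod_mul_distrib, mul_assoc]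
  congr 1
  have e : sg k (lt a a ∧ lt' a a) = 1 := sg_of_not fun h => irrefl_of lt a h.1
  rw [e, mul_one, ← prod_subtype_ne_mul a (fun x => sg k (lt x a)),
    ← prod_subtype_ne_mul a (fun x => sg k (lt' x a)), sg_of_not (irrefl_of lt a),
    sg_of_not (irrefl_of lt' a), mul_one, mul_one, ← Finset.prod_mul_distrib,
    ← Finset.prod_mul_distrib]
  refine Finset.prod_congr rfl fun x _ => ?_
  have h₁ := not_lt_iff lt x.2.symm
  have h₂ := not_lt_iff lt' x.2.symm
  rw [← h₁, ← not_lt_iff lt' x.2.symm]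
  by_cases h : lt a x.1 <;> by_cases h' : lt' a x.1 <;> simp [h, h']

end Reorient

section ContractCls

open Classical in
/-- The class of the graph obtained by contraction of `t`, with its sign. -/
noncomputable def contractCls (Γ : OGraph O) (t : Γ.H) : GraphSpace O :=
  if ht : Γ.vert t ≠ Γ.vert (Γ.inv t) then contractSign k Γ t • (Γ.contract ht).cls else 0

theorem contractCls_of_ne (Γ : OGraph O) {t : Γ.H} (ht : Γ.vert t ≠ Γ.vert (Γ.inv t)) :
    Γ.contractCls t = contractSign k Γ t • (Γ.contract ht).cls := dif_pos ht

theorem contractCls_of_eq (Γ : OGraph O) {t : Γ.H} (ht : Γ.vert t = Γ.vert (Γ.inv t)) :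
    Γ.contractCls t = 0 := dif_neg (not_not.2 ht)

theorem Iso.contractSign_eq {Γ Δ : OGraph O} (φ : Γ.Iso Δ) (t : Γ.H) :
    contractSign k Δ (φ.onH t) = contractSign k Γ t := by
  simp only [contractSign, φ.inv_eq, φ.vert_eq]
  have e : Nat.card {v // Δ.lt v (φ.onV (Γ.vert (Γ.inv t)))} =
      Nat.card {v // Γ.lt v (Γ.vert (Γ.inv t))} :=
    (Nat.card_congr (φ.onV.subtypeEquiv fun v => (φ.lt_iff v (Γ.vert (Γ.inv t))).symm)).symm
  rw [e]
  by_cases h : Γ.tail t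
  · simp [h, (φ.tail_iff t).2 h]
  · simp [h, mt (φ.tail_iff t).1 h]

theorem contractCls_iso {Γ Δ : OGraph O} (φ : Γ.Iso Δ) (t : Γ.H) :
    Δ.contractCls (φ.onH t) = Γ.contractCls t := by
  have e : Δ.vert (φ.onH t) = Δ.vert (Δ.inv (φ.onH t)) ↔ Γ.vert t = Γ.vert (Γ.inv t) := by
    rw [φ.inv_eq, φ.vert_eq, φ.vert_eq, φ.onV.apply_eq_iff_eq]
  by_cases ht : Γ.vert t = Γ.vert (Γ.inv t)
  · rw [contractCls_of_eq _ ht, contractCls_of_eq _ (e.2 ht)]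
  · rw [contractCls_of_ne _ ht, contractCls_of_ne Δ (t := φ.onH t) (fun h => ht (e.1 h)),
      φ.contractSign_eq, cls_iso (φ.contract ht _)]

/-- The sign of a contraction counts the vertices before the final vertex of `t`, and this is the
vertex that disappears. So the inversions in which it takes part, together with a possible reversal
of `t`, account exactly for the change of `contractSign`. -/
theorem contractSign_reorient (Γ : OGraph O) (lt' : Γ.V → Γ.V → Prop)
    [IsStrictTotalOrder Γ.V lt'] (tail' : Γ.H → Prop) (h : ∀ h, tail' (Γ.inv h) ↔ ¬ tail' h)
    {t : Γ.H} (ht : Γ.vert t ≠ Γ.vert (Γ.inv t)) :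
    contractSign k (Γ.reorient lt' tail' h) t *
        (-1) ^ (Γ.contract ht).changes (fun v w => lt' v.1 w.1) (fun h => tail' h.1) =
      (-1) ^ Γ.changes lt' tail' * contractSign k Γ t := by
  classical
  have iV : Fintype Γ.V := Fintype.ofFinite Γ.V
  have iH : Fintype Γ.H := Fintype.ofFinite Γ.H
  let i₂ : Fintype (Γ.contract ht).V := (inferInstance : Fintype {v // v ≠ Γ.vert (Γ.inv t)})
  let i₃ : Fintype (Γ.contract ht).H := (inferInstance : Fintype {h // h ≠ t ∧ h ≠ Γ.inv t})
  have hcs : contractSign k (Γ.reorient lt' tail' h) t =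
      sg k (¬ tail' t) * - ∏ v, sg k (lt' v (Γ.vert (Γ.inv t))) :=
    @contractSign_eq k _ O (Γ.reorient lt' tail' h) iV t
  rw [changes_sign, changes_sign, contractSign_eq, hcs,
    ← prod_sg_inversions Γ.lt lt' (Γ.vert (Γ.inv t)),
    ← prod_subtype_ne_ne_mul (Γ.inv_ne t).symm (fun h => sg k (Γ.tail h ∧ ¬ tail' h))]
  -- In either orientation exactly one of `t` and `inv t` is a tail, so the edge is counted once,
  -- and only if its two directions differ.
  have e : sg k (Γ.tail t ∧ ¬ tail' t) * sg k (Γ.tail (Γ.inv t) ∧ ¬ tail' (Γ.inv t)) =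
      sg k (¬ Γ.tail t) * sg k (¬ tail' t) := by
    rw [Γ.tail_inv, h]
    by_cases h₁ : Γ.tail t <;> by_cases h₂ : tail' t <;> simp [h₁, h₂]
  have e' : (∏ x, sg k (Γ.lt x (Γ.vert (Γ.inv t)))) * (∏ x, sg k (Γ.lt x (Γ.vert (Γ.inv t)))) = 1 := by
    rw [← Finset.prod_mul_distrib]; simp
  rw [e]
  change (sg k (¬ tail' t) * - ∏ v, sg k (lt' v (Γ.vert (Γ.inv t)))) *
    ((∏ x : {x // x ≠ Γ.vert (Γ.inv t)}, ∏ y : {x // x ≠ Γ.vert (Γ.inv t)},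
      sg k (Γ.lt x.1 y.1 ∧ lt' y.1 x.1)) *
      ∏ x : {h // h ≠ t ∧ h ≠ Γ.inv t}, sg k (Γ.tail x.1 ∧ ¬ tail' x.1)) = _
  generalize (∏ x : {x // x ≠ Γ.vert (Γ.inv t)}, ∏ y : {x // x ≠ Γ.vert (Γ.inv t)},
      sg k (Γ.lt x.1 y.1 ∧ lt' y.1 x.1)) = A
  generalize ∏ x : {h // h ≠ t ∧ h ≠ Γ.inv t}, sg k (Γ.tail x.1 ∧ ¬ tail' x.1) = B
  generalize (∏ x, sg k (Γ.lt x (Γ.vert (Γ.inv t)))) = C at *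
  generalize (∏ x, sg k (lt' x (Γ.vert (Γ.inv t)))) = D
  have e₂ := sg_mul_self (k := k) (¬ Γ.tail t)
  generalize sg k (¬ Γ.tail t) = E at *
  generalize sg k (¬ tail' t) = F
  linear_combination (F * D * A * B * C * C) * e₂ + F * D * A * B * e'

theorem contractCls_reorient (Γ : OGraph O) (lt' : Γ.V → Γ.V → Prop)
    [IsStrictTotalOrder Γ.V lt'] (tail' : Γ.H → Prop) (h : ∀ h, tail' (Γ.inv h) ↔ ¬ tail' h)
    (t : Γ.H) :
    (Γ.reorient lt' tail' h).contractCls t = (-1 : k) ^ Γ.changes lt' tail' • Γ.contractCls t := by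
  by_cases ht : Γ.vert t = Γ.vert (Γ.inv t)
  · rw [contractCls_of_eq _ ht, smul_zero]
    exact contractCls_of_eq (Γ.reorient lt' tail' h) ht
  · rw [contractCls_of_ne _ ht, smul_smul, ← contractSign_reorient Γ lt' tail' h ht, mul_smul]
    rw [contractCls_of_ne (Γ.reorient lt' tail' h) ht]
    congr 1
    have : IsStrictTotalOrder (Γ.contract ht).V (fun v w => lt' v.1 w.1) :=
      (RelEmbedding.preimage (Function.Embedding.subtype _) lt').isStrictTotalOrder
    exact cls_reorient (Γ.contract ht) (fun v w => lt' v.1 w.1) (fun h => tail' h.1)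
      (fun h' => h h'.1)

/-- Replace all labels. -/
def withDeco (Γ : OGraph O) (d : ∀ v, Labels O {h // Γ.vert h = v}) : OGraph O :=
  { Γ with deco := d }

theorem setDeco_deco_self (Γ : OGraph O) (v : Γ.V) (z : Labels O {h // Γ.vert h = v}) :
    (Γ.setDeco v z).deco v = z := by
  classical
  change Function.update Γ.deco v z v = _
  exact Function.update_self _ _ _

theorem setDeco_deco_of_ne (Γ : OGraph O) {v w : Γ.V} (h : w ≠ v)
    (z : Labels O {h // Γ.vert h = v}) : (Γ.setDeco v z).deco w = Γ.deco w := by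
  classical
  change Function.update Γ.deco v z w = _
  exact Function.update_of_ne h _ _

theorem contract_setDeco_other (Γ : OGraph O) {t : Γ.H} (ht : Γ.vert t ≠ Γ.vert (Γ.inv t)) {v : Γ.V}
    (h₁ : v ≠ Γ.vert t) (h₂ : v ≠ Γ.vert (Γ.inv t)) (z : Labels O {h // Γ.vert h = v}) :
    (Γ.setDeco v z).contract ht = (Γ.contract ht).setDeco (⟨v, h₂⟩ : Γ.ContractV t)
      (Labels.map O (Γ.starOther ht ⟨v, h₂⟩ h₁) z) := by
  change withDeco (Γ.contract ht) _ = withDeco (Γ.contract ht) _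
  refine congrArg _ (funext fun (x : Γ.ContractV t) => ?_)
  by_cases hx : x.1 = Γ.vert t
  · have hne : x ≠ ⟨v, h₂⟩ := fun e => h₁ (by rw [← hx, e])
    refine Eq.trans ?_ (setDeco_deco_of_ne (Γ.contract ht) hne _).symm
    refine (contract_deco_merged (Γ.setDeco v z) ht x hx).trans
      (Eq.trans ?_ (contract_deco_merged Γ ht x hx).symm)
    have e₁ := setDeco_deco_of_ne Γ h₁.symm z
    have e₂ := setDeco_deco_of_ne Γ h₂.symm z
    change Labels.map O (Γ.starMerged ht x hx) (Labels.comp O _ _ ((Γ.setDeco v z).deco (Γ.vert t))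
      ((Γ.setDeco v z).deco (Γ.vert (Γ.inv t)))) = _
    rw [e₁, e₂]
    rfl
  · refine (contract_deco_other (Γ.setDeco v z) ht x hx).trans ?_
    by_cases hxv : x = ⟨v, h₂⟩
    · subst hxv
      refine Eq.trans ?_ (setDeco_deco_self (Γ.contract ht) _ _).symm
      exact congrArg _ (setDeco_deco_self Γ v z)
    · refine Eq.trans ?_ (setDeco_deco_of_ne (Γ.contract ht) hxv _).symm
      refine Eq.trans ?_ (contract_deco_other Γ ht x hx).symm
      exact congrArg _ (setDeco_deco_of_ne Γ (fun e => hxv (Subtype.ext e)) z)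

theorem contract_setDeco_tail (Γ : OGraph O) {t : Γ.H} (ht : Γ.vert t ≠ Γ.vert (Γ.inv t))
    (z : Labels O {h // Γ.vert h = Γ.vert t}) :
    (Γ.setDeco (Γ.vert t) z).contract ht = (Γ.contract ht).setDeco (⟨Γ.vert t, ht⟩ : Γ.ContractV t)
      (Labels.map O (Γ.starMerged ht ⟨Γ.vert t, ht⟩ rfl)
        (Labels.comp O ⟨t, rfl⟩ ⟨Γ.inv t, rfl⟩ z (Γ.deco (Γ.vert (Γ.inv t))))) := by
  change withDeco (Γ.contract ht) _ = withDeco (Γ.contract ht) _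
  refine congrArg _ (funext fun (x : Γ.ContractV t) => ?_)
  by_cases hx : x.1 = Γ.vert t
  · obtain rfl : x = ⟨Γ.vert t, ht⟩ := Subtype.ext hx
    refine Eq.trans ?_ (setDeco_deco_self (Γ.contract ht) _ _).symm
    refine (contract_deco_merged (Γ.setDeco (Γ.vert t) z) ht _ rfl).trans ?_
    have e₁ := setDeco_deco_self Γ _ z
    have e₂ := setDeco_deco_of_ne Γ ht.symm z
    change Labels.map O (Γ.starMerged ht _ hx) (Labels.comp O _ _
      ((Γ.setDeco (Γ.vert t) z).deco (Γ.vert t))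
      ((Γ.setDeco (Γ.vert t) z).deco (Γ.vert (Γ.inv t)))) = _
    rw [e₁, e₂]
    rfl
  · refine Eq.trans ?_ (setDeco_deco_of_ne (Γ.contract ht)
      (fun e => hx (congrArg Subtype.val e)) _).symm
    refine (contract_deco_other (Γ.setDeco (Γ.vert t) z) ht x hx).trans ?_
    refine Eq.trans ?_ (contract_deco_other Γ ht x hx).symm
    exact congrArg _ (setDeco_deco_of_ne Γ hx z)

theorem contract_setDeco_head (Γ : OGraph O) {t : Γ.H} (ht : Γ.vert t ≠ Γ.vert (Γ.inv t))
    (z : Labels O {h // Γ.vert h = Γ.vert (Γ.inv t)}) :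
    (Γ.setDeco (Γ.vert (Γ.inv t)) z).contract ht = (Γ.contract ht).setDeco (⟨Γ.vert t, ht⟩ : Γ.ContractV t)
      (Labels.map O (Γ.starMerged ht ⟨Γ.vert t, ht⟩ rfl)
        (Labels.comp O ⟨t, rfl⟩ ⟨Γ.inv t, rfl⟩ (Γ.deco (Γ.vert t)) z)) := by
  change withDeco (Γ.contract ht) _ = withDeco (Γ.contract ht) _
  refine congrArg _ (funext fun (x : Γ.ContractV t) => ?_)
  by_cases hx : x.1 = Γ.vert t
  · obtain rfl : x = ⟨Γ.vert t, ht⟩ := Subtype.ext hx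
    refine Eq.trans ?_ (setDeco_deco_self (Γ.contract ht) _ _).symm
    refine (contract_deco_merged (Γ.setDeco (Γ.vert (Γ.inv t)) z) ht _ rfl).trans ?_
    have e₁ := setDeco_deco_of_ne Γ ht z
    have e₂ := setDeco_deco_self Γ _ z
    change Labels.map O (Γ.starMerged ht _ hx) (Labels.comp O _ _
      ((Γ.setDeco (Γ.vert (Γ.inv t)) z).deco (Γ.vert t))
      ((Γ.setDeco (Γ.vert (Γ.inv t)) z).deco (Γ.vert (Γ.inv t)))) = _
    rw [e₁, e₂]
    rfl
  · refine Eq.trans ?_ (setDeco_deco_of_ne (Γ.contract ht)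
      (fun e => hx (congrArg Subtype.val e)) _).symm
    refine (contract_deco_other (Γ.setDeco (Γ.vert (Γ.inv t)) z) ht x hx).trans ?_
    refine Eq.trans ?_ (contract_deco_other Γ ht x hx).symm
    exact congrArg _ (setDeco_deco_of_ne Γ x.2 z)

/-- The label at `v` enters one label of the contraction only: through one argument of the bilinear
composition if `v` is an endpoint of `t`, through a relabelling otherwise. -/
theorem contractCls_setDeco (Γ : OGraph O) (t : Γ.H) (v : Γ.V) :
    ∃ Λ : Labels O {h // Γ.vert h = v} →ₗ[k] GraphSpace O,
      ∀ z, (Γ.setDeco v z).contractCls t = Λ z := by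
  by_cases ht : Γ.vert t = Γ.vert (Γ.inv t)
  · exact ⟨0, fun z => contractCls_of_eq (Γ.setDeco v z) ht⟩
  have key : ∀ z, (Γ.setDeco v z).contractCls t =
      contractSign k Γ t • ((Γ.setDeco v z).contract ht).cls := fun z =>
    contractCls_of_ne (Γ.setDeco v z) ht
  by_cases h₁ : v = Γ.vert t
  · subst h₁
    refine ⟨contractSign k Γ t • (clsAt (Γ.contract ht) (⟨Γ.vert t, ht⟩ : Γ.ContractV t) ∘ₗ
      Labels.map O (Γ.starMerged ht ⟨Γ.vert t, ht⟩ rfl) ∘ₗ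
      (Labels.comp O (⟨t, rfl⟩ : {h // Γ.vert h = Γ.vert t})
        (⟨Γ.inv t, rfl⟩ : {h // Γ.vert h = Γ.vert (Γ.inv t)})).flip (Γ.deco (Γ.vert (Γ.inv t)))), fun z => ?_⟩
    rw [key, contract_setDeco_tail]
    rfl
  by_cases h₂ : v = Γ.vert (Γ.inv t)
  · subst h₂
    refine ⟨contractSign k Γ t • (clsAt (Γ.contract ht) (⟨Γ.vert t, ht⟩ : Γ.ContractV t) ∘ₗ
      Labels.map O (Γ.starMerged ht ⟨Γ.vert t, ht⟩ rfl) ∘ₗ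
      (Labels.comp O (⟨t, rfl⟩ : {h // Γ.vert h = Γ.vert t})
        (⟨Γ.inv t, rfl⟩ : {h // Γ.vert h = Γ.vert (Γ.inv t)})) (Γ.deco (Γ.vert t))), fun z => ?_⟩
    rw [key, contract_setDeco_head]
    rfl
  · refine ⟨contractSign k Γ t • (clsAt (Γ.contract ht) (⟨v, h₂⟩ : Γ.ContractV t) ∘ₗ
      Labels.map O (Γ.starOther ht ⟨v, h₂⟩ h₁)), fun z => ?_⟩
    rw [key, contract_setDeco_other Γ ht h₁ h₂]
    rfl

end ContractCls

end OGraph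
end GraphComplex
namespace GraphComplex
variable {k : Type u} [Field k] {O : CyclicOperad.{u, w} k}
namespace OGraph

/-! ### Independence of the direction of the contracted edge. -/

section Reversal

theorem deco_eq_map_refl (Γ : OGraph O) (v : Γ.V) :
    Γ.deco v = Labels.map O (Equiv.refl _) (Γ.deco v) :=
  (Labels.map_of_forall_eq O (fun _ => rfl) _).symm

theorem two_le_card_star (Γ : OGraph O) (v : Γ.V) : 2 ≤ Nat.card {h // Γ.vert h = v} :=
  (Nat.le_succ 2).trans (Γ.valence v)

theorem inv_injective (Γ : OGraph O) : Function.Injective Γ.inv :=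
  Function.LeftInverse.injective Γ.inv_inv

open Classical in
/-- If the endpoints of `t` are adjacent in the ordering, then contraction of `t` and of the reversed
edge give isomorphic graphs. -/
noncomputable def contractInvIso (Γ : OGraph O) {t : Γ.H} (ht : Γ.vert t ≠ Γ.vert (Γ.inv t))
    (ht' : Γ.vert (Γ.inv t) ≠ Γ.vert (Γ.inv (Γ.inv t)))
    (hadj : ∀ x, x ≠ Γ.vert t → x ≠ Γ.vert (Γ.inv t) →
      (Γ.lt x (Γ.vert t) ↔ Γ.lt x (Γ.vert (Γ.inv t)))) :
    (Γ.contract ht).Iso (Γ.contract ht') where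
  -- The merged vertex is represented by `vert t` in one contraction and by `vert (inv t)` in the
  -- other.
  onV := (Equiv.swap (Γ.vert t) (Γ.vert (Γ.inv t))).subtypeEquiv fun v => by
    rw [Γ.inv_inv, ne_eq, ne_eq, Equiv.swap_apply_eq_iff, Equiv.swap_apply_left]
  onH := Equiv.subtypeEquivRight fun h => by rw [Γ.inv_inv, and_comm]
  vert_eq h := by
    refine Subtype.ext ?_
    refine (contract_vert_val Γ ht' _).trans ?_
    refine Eq.trans ?_ (congrArg (Equiv.swap (Γ.vert t) (Γ.vert (Γ.inv t)))
      (contract_vert_val Γ ht h)).symm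
    change (if Γ.vert h.1 = _ then _ else Γ.vert h.1) = _
    rw [Γ.inv_inv]
    by_cases h₁ : Γ.vert h.1 = Γ.vert t
    · rw [if_pos h₁, if_neg (fun e => ht (h₁.symm.trans e)), h₁, Equiv.swap_apply_left]
    · by_cases h₂ : Γ.vert h.1 = Γ.vert (Γ.inv t)
      · rw [if_neg h₁, if_pos h₂, h₂, Equiv.swap_apply_left]
      · rw [if_neg h₁, if_neg h₂, Equiv.swap_apply_of_ne_of_ne h₁ h₂]
  deco_eq v := by
    by_cases hv : v.1 = Γ.vert t
    · have hv' : Equiv.swap (Γ.vert t) (Γ.vert (Γ.inv t)) v.1 = Γ.vert (Γ.inv t) := by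
        rw [hv, Equiv.swap_apply_left]
      rw [contract_deco_merged Γ ht v hv]
      refine Eq.trans ?_ (Labels.map_map O _ _ _).symm
      refine (contract_deco_merged Γ ht' _ hv').trans ?_
      refine (congrArg₂ (fun a b => Labels.map O _ (Labels.comp O _ _ a b)) (Γ.deco_eq_map_refl _)
        (Γ.deco_of_eq (congrArg Γ.vert (Γ.inv_inv t).symm))).trans ?_
      exact Labels.map_comp_map_swap O _ (Equiv.refl _) (Subtype.ext (Γ.inv_inv t).symm) rfl
        (Γ.two_le_card_star _) (Γ.two_le_card_star _) _ _
        (fun _ _ _ => Subtype.ext (Subtype.ext rfl)) (fun _ _ _ => Subtype.ext (Subtype.ext rfl)) _ _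
    · have hv' : Equiv.swap (Γ.vert t) (Γ.vert (Γ.inv t)) v.1 = v.1 :=
        Equiv.swap_apply_of_ne_of_ne hv v.2
      rw [contract_deco_other Γ ht v hv]
      refine Eq.trans ?_ (Labels.map_map O _ _ _).symm
      refine (contract_deco_other Γ ht' _ (fun e => v.2 (hv'.symm.trans e))).trans ?_
      refine (congrArg _ (Γ.deco_of_eq hv'.symm)).trans ?_
      refine (Labels.map_map O _ _ _).trans ?_
      exact Labels.map_congr O (fun _ => Subtype.ext (Subtype.ext rfl)) _
  inv_eq h := rfl
  -- No vertex lies between the two endpoints, so replacing one by the other respects the ordering.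
  lt_iff v w := by
    change Γ.lt (Equiv.swap _ _ v.1) (Equiv.swap _ _ w.1) ↔ Γ.lt v.1 w.1
    by_cases h₁ : v.1 = Γ.vert t <;> by_cases h₂ : w.1 = Γ.vert t
    · rw [h₁, h₂, Equiv.swap_apply_left]
      exact iff_of_false (irrefl_of _ _) (irrefl_of _ _)
    · rw [h₁, Equiv.swap_apply_left, Equiv.swap_apply_of_ne_of_ne h₂ w.2,
        ← not_lt_iff Γ.lt h₂, ← not_lt_iff Γ.lt w.2, hadj _ h₂ w.2]
    · rw [h₂, Equiv.swap_apply_left, Equiv.swap_apply_of_ne_of_ne h₁ v.2, hadj _ h₁ v.2]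
    · rw [Equiv.swap_apply_of_ne_of_ne h₁ v.2, Equiv.swap_apply_of_ne_of_ne h₂ w.2]
  tail_iff h := Iff.rfl

/-- Two changes of sign cancel: the direction relative to the orientation is reversed, and the
number of vertices before the final endpoint changes by one since the endpoints are adjacent. -/
theorem contractSign_inv (Γ : OGraph O) {t : Γ.H} (ht : Γ.vert t ≠ Γ.vert (Γ.inv t))
    (hadj : ∀ x, x ≠ Γ.vert t → x ≠ Γ.vert (Γ.inv t) →
      (Γ.lt x (Γ.vert t) ↔ Γ.lt x (Γ.vert (Γ.inv t)))) :
    contractSign k Γ (Γ.inv t) = contractSign k Γ t := by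
  classical
  have iV : Fintype Γ.V := Fintype.ofFinite Γ.V
  rw [contractSign_eq, contractSign_eq, Γ.inv_inv, Γ.tail_inv, sg_not (¬ Γ.tail t), neg_mul_neg,
    ← prod_subtype_ne_ne_mul ht, ← prod_subtype_ne_ne_mul ht (fun v => sg k (Γ.lt v _)),
    sg_of_not (irrefl_of Γ.lt (Γ.vert t)), sg_of_not (irrefl_of Γ.lt (Γ.vert (Γ.inv t))),
    ← not_lt_iff Γ.lt ht, sg_not (Γ.lt _ _),
    Finset.prod_congr rfl fun x _ => congrArg (sg k) (propext (hadj x.1 x.2.1 x.2.2))]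
  ring

theorem exists_order_adjacent {α : Type} (lt : α → α → Prop) [IsStrictTotalOrder α lt] (a b : α) :
    ∃ lt' : α → α → Prop, IsStrictTotalOrder α lt' ∧ ∀ x, x ≠ a → x ≠ b → (lt' x a ↔ lt' x b) := by
  classical
  -- The points `a` and `b` are moved to the front: compare by the rank `r` and then by the old
  -- order.
  set r : α → ℕ := fun x => if x = a then 0 else if x = b then 0 else 1 with hr
  refine ⟨fun x y => r x < r y ∨ (r x = r y ∧ lt x y), ?_, ?_⟩
  · refine { trichotomous := ?_, irrefl := ?_, trans := ?_ }
    · intro x y h₁ h₂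
      by_contra hne
      push Not at h₁ h₂
      have e : r x = r y := le_antisymm h₂.1 h₁.1
      exact h₂.2 e.symm ((not_lt_iff lt hne).1 (h₁.2 e))
    · rintro x (h | h)
      · exact lt_irrefl _ h
      · exact irrefl_of lt x h.2
    · rintro x y z (h | h) (h' | h')
      · exact Or.inl (h.trans h')
      · exact Or.inl (h'.1 ▸ h)
      · exact Or.inl (h.1 ▸ h')
      · exact Or.inr ⟨h.1.trans h'.1, trans_of lt h.2 h'.2⟩
  · intro x hxa hxb
    have h₁ : r x = 1 := by simp [hr, hxa, hxb]
    have h₂ : r a = 0 := by simp [hr]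
    have h₃ : r b = 0 := by simp [hr]
    simp [h₁, h₂, h₃]

theorem contractCls_inv_of_adjacent (Γ : OGraph O) {t : Γ.H} (ht : Γ.vert t ≠ Γ.vert (Γ.inv t))
    (hadj : ∀ x, x ≠ Γ.vert t → x ≠ Γ.vert (Γ.inv t) →
      (Γ.lt x (Γ.vert t) ↔ Γ.lt x (Γ.vert (Γ.inv t)))) :
    Γ.contractCls (Γ.inv t) = Γ.contractCls t := by
  have ht' : Γ.vert (Γ.inv t) ≠ Γ.vert (Γ.inv (Γ.inv t)) := by
    rw [Γ.inv_inv]; exact Ne.symm ht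
  rw [contractCls_of_ne Γ ht', contractCls_of_ne Γ ht, cls_iso (contractInvIso Γ ht ht' hadj),
    contractSign_inv Γ ht hadj]

/-- Both sides change by the same sign under a change of the vertex ordering, so the endpoints may
be assumed adjacent. -/
theorem contractCls_inv (Γ : OGraph O) (t : Γ.H) : Γ.contractCls (Γ.inv t) = Γ.contractCls t := by
  by_cases ht : Γ.vert t = Γ.vert (Γ.inv t)
  · rw [contractCls_of_eq _ ht, contractCls_of_eq]
    rw [Γ.inv_inv, ht]
  obtain ⟨lt', h, hadj⟩ := exists_order_adjacent Γ.lt (Γ.vert t) (Γ.vert (Γ.inv t))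
  have e := contractCls_inv_of_adjacent (Γ.reorient lt' Γ.tail Γ.tail_inv) ht hadj
  have e₁ := contractCls_reorient Γ lt' Γ.tail Γ.tail_inv t
  have e₂ := contractCls_reorient Γ lt' Γ.tail Γ.tail_inv (Γ.inv t)
  have := congrArg (fun z => (-1 : k) ^ Γ.changes lt' Γ.tail • z) (e₂.symm.trans (e.trans e₁))
  simpa only [smul_smul, neg_one_pow_mul_self, one_smul] using this

end Reversal

/-! ### Contracting two edges, one after the other. -/

section Double

open Classical in
/-- Contraction of `t` and then of `t'`, with the sign. -/
noncomputable def contractCls₂ (Γ : OGraph O) (t t' : Γ.H) : GraphSpace O :=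
  if h : Γ.vert t ≠ Γ.vert (Γ.inv t) ∧ t' ≠ t ∧ t' ≠ Γ.inv t then
    contractSign k Γ t • (Γ.contract h.1).contractCls ⟨t', h.2⟩ else 0

theorem contractCls₂_of (Γ : OGraph O) {t t' : Γ.H} (ht : Γ.vert t ≠ Γ.vert (Γ.inv t))
    (h : t' ≠ t ∧ t' ≠ Γ.inv t) :
    Γ.contractCls₂ t t' = contractSign k Γ t • (Γ.contract ht).contractCls ⟨t', h⟩ :=
  dif_pos ⟨ht, h⟩

theorem contractCls₂_of_eq (Γ : OGraph O) {t : Γ.H} (ht : Γ.vert t = Γ.vert (Γ.inv t)) (t' : Γ.H) :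
    Γ.contractCls₂ t t' = 0 := dif_neg fun h => h.1 ht

theorem contractCls₂_reorient (Γ : OGraph O) (lt' : Γ.V → Γ.V → Prop)
    [IsStrictTotalOrder Γ.V lt'] (tail' : Γ.H → Prop) (h : ∀ h, tail' (Γ.inv h) ↔ ¬ tail' h)
    (t t' : Γ.H) : (Γ.reorient lt' tail' h).contractCls₂ t t' =
      (-1 : k) ^ Γ.changes lt' tail' • Γ.contractCls₂ t t' := by
  by_cases hc : Γ.vert t ≠ Γ.vert (Γ.inv t) ∧ t' ≠ t ∧ t' ≠ Γ.inv t
  · rw [contractCls₂_of Γ hc.1 hc.2, smul_smul, ← contractSign_reorient Γ lt' tail' h hc.1, mul_smul]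
    refine (contractCls₂_of (Γ.reorient lt' tail' h) hc.1 hc.2).trans (congrArg _ ?_)
    have : IsStrictTotalOrder (Γ.contract hc.1).V (fun v w => lt' v.1 w.1) :=
      (RelEmbedding.preimage (Function.Embedding.subtype _) lt').isStrictTotalOrder
    exact contractCls_reorient (Γ.contract hc.1) (fun v w => lt' v.1 w.1) (fun h => tail' h.1)
      (fun h' => h h'.1) _
  · rw [contractCls₂, dif_neg hc, smul_zero]
    exact dif_neg hc

theorem contractCls₂_inv_left_of_adjacent (Γ : OGraph O) {t t' : Γ.H}
    (ht : Γ.vert t ≠ Γ.vert (Γ.inv t)) (hne : t' ≠ t ∧ t' ≠ Γ.inv t)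
    (hadj : ∀ x, x ≠ Γ.vert t → x ≠ Γ.vert (Γ.inv t) →
      (Γ.lt x (Γ.vert t) ↔ Γ.lt x (Γ.vert (Γ.inv t)))) :
    Γ.contractCls₂ (Γ.inv t) t' = Γ.contractCls₂ t t' := by
  have ht' : Γ.vert (Γ.inv t) ≠ Γ.vert (Γ.inv (Γ.inv t)) := by
    rw [Γ.inv_inv]; exact ht.symm
  have hn : t' ≠ Γ.inv t ∧ t' ≠ Γ.inv (Γ.inv t) := by rw [Γ.inv_inv]; exact hne.symm
  rw [contractCls₂_of Γ ht' hn, contractCls₂_of Γ ht hne, contractSign_inv Γ ht hadj]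
  exact congrArg _ (contractCls_iso (contractInvIso Γ ht ht' hadj) ⟨t', hne⟩)

theorem contractCls₂_inv_left (Γ : OGraph O) (t t' : Γ.H) :
    Γ.contractCls₂ (Γ.inv t) t' = Γ.contractCls₂ t t' := by
  by_cases hc : Γ.vert t ≠ Γ.vert (Γ.inv t) ∧ t' ≠ t ∧ t' ≠ Γ.inv t
  · obtain ⟨lt', h, hadj⟩ := exists_order_adjacent Γ.lt (Γ.vert t) (Γ.vert (Γ.inv t))
    have e := contractCls₂_inv_left_of_adjacent (Γ.reorient lt' Γ.tail Γ.tail_inv) hc.1 hc.2 hadj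
    have e₁ := contractCls₂_reorient Γ lt' Γ.tail Γ.tail_inv t t'
    have e₂ := contractCls₂_reorient Γ lt' Γ.tail Γ.tail_inv (Γ.inv t) t'
    have := congrArg (fun z => (-1 : k) ^ Γ.changes lt' Γ.tail • z) (e₂.symm.trans (e.trans e₁))
    simpa only [smul_smul, neg_one_pow_mul_self, one_smul] using this
  · rw [contractCls₂, contractCls₂, dif_neg hc, dif_neg]
    rwa [Γ.inv_inv, and_comm (a := t' ≠ _), ne_comm (a := Γ.vert _)]

theorem contractCls₂_inv_right (Γ : OGraph O) (t t' : Γ.H) :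
    Γ.contractCls₂ t (Γ.inv t') = Γ.contractCls₂ t t' := by
  by_cases hc : Γ.vert t ≠ Γ.vert (Γ.inv t) ∧ t' ≠ t ∧ t' ≠ Γ.inv t
  · have hc' : Γ.inv t' ≠ t ∧ Γ.inv t' ≠ Γ.inv t :=
      ⟨fun e => hc.2.2 (by rw [← e, Γ.inv_inv]), fun e => hc.2.1 (Γ.inv_injective e)⟩
    rw [contractCls₂_of Γ hc.1 hc.2, contractCls₂_of Γ hc.1 hc']
    exact congrArg _ (contractCls_inv (Γ.contract hc.1) ⟨t', hc.2⟩)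
  · rw [contractCls₂, contractCls₂, dif_neg hc, dif_neg]
    rintro ⟨h₁, h₂, h₃⟩
    exact hc ⟨h₁, fun e => h₃ (congrArg _ e), fun e => h₂ (by rw [e, Γ.inv_inv])⟩

end Double
end OGraph
end GraphComplex
namespace GraphComplex
variable {k : Type u} [Field k] {O : CyclicOperad.{u, w} k}
namespace OGraph

/-! ### Labels after two contractions. -/

section TwoContractions

/-- The restriction of an equivalence to the complements of corresponding points. -/
def neEquiv {X Y : Type} (e : X ≃ Y) {x : X} {y : Y} (h : e x = y) : {s // s ≠ x} ≃ {s // s ≠ y} :=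
  e.subtypeEquiv fun s => by rw [← h, ne_eq, ne_eq, e.apply_eq_iff_eq]

/-- The endpoints get free names `a` and `b`, and only the underlying half-edges of `E` are
recorded. This avoids transports between propositionally equal vertices when contractions are
iterated. -/
theorem contract_deco_merged_exists (Γ : OGraph O) {t : Γ.H} (ht : Γ.vert t ≠ Γ.vert (Γ.inv t))
    (y : Γ.ContractV t) {a b : Γ.V} (ha : Γ.vert t = a) (hb : Γ.vert (Γ.inv t) = b)
    (hy : y.1 = a) :
    ∃ E : {s : {h // Γ.vert h = a} // s ≠ ⟨t, ha⟩} ⊕ {s : {h // Γ.vert h = b} // s ≠ ⟨Γ.inv t, hb⟩} ≃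
        {h : Γ.ContractH t // Γ.contractVert t ht h = y},
      (∀ s, (E (Sum.inl s)).1.1 = s.1.1) ∧ (∀ s, (E (Sum.inr s)).1.1 = s.1.1) ∧
      (Γ.contract ht).deco y = Labels.map O E
        (Labels.comp O ⟨t, ha⟩ ⟨Γ.inv t, hb⟩ (Γ.deco a) (Γ.deco b)) := by
  subst ha hb
  exact ⟨Γ.starMerged ht y hy, fun _ => rfl, fun _ => rfl, contract_deco_merged Γ ht y hy⟩

theorem contract_deco_other_exists (Γ : OGraph O) {t : Γ.H} (ht : Γ.vert t ≠ Γ.vert (Γ.inv t))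
    (y : Γ.ContractV t) {a : Γ.V} (hy : y.1 = a) (ha : a ≠ Γ.vert t) :
    ∃ E : {h // Γ.vert h = a} ≃ {h : Γ.ContractH t // Γ.contractVert t ht h = y},
      (∀ s, (E s).1.1 = s.1) ∧ (Γ.contract ht).deco y = Labels.map O E (Γ.deco a) := by
  subst hy
  exact ⟨Γ.starOther ht y ha, fun _ => rfl, contract_deco_other Γ ht y ha⟩

variable (Γ : OGraph O) {t t' : Γ.H} (ht : Γ.vert t ≠ Γ.vert (Γ.inv t))
  (ht' : Γ.vert t' ≠ Γ.vert (Γ.inv t')) (hne : t' ≠ t ∧ t' ≠ Γ.inv t) (hne' : t ≠ t' ∧ t ≠ Γ.inv t')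
  (H₁ : (Γ.contract ht).vert ⟨t', hne⟩ ≠ (Γ.contract ht).vert ((Γ.contract ht).inv ⟨t', hne⟩))
  (H₂ : (Γ.contract ht').vert ⟨t, hne'⟩ ≠ (Γ.contract ht').vert ((Γ.contract ht').inv ⟨t, hne'⟩))

theorem contract_vert_val_of_ne {s : Γ.ContractH t} {a : Γ.V} (hs : Γ.vert s.1 = a)
    (h : a ≠ Γ.vert (Γ.inv t)) : ((Γ.contract ht).vert s).1 = a := by
  classical
  exact (contract_vert_val Γ ht s).trans ((if_neg (by rwa [hs])).trans hs)

theorem inv_ne_of_ne (hne : t' ≠ t ∧ t' ≠ Γ.inv t) : Γ.inv t' ≠ t ∧ Γ.inv t' ≠ Γ.inv t :=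
  ⟨fun e => hne.2 (by rw [← e, Γ.inv_inv]), fun e => hne.1 (Γ.inv_injective e)⟩

/-- The label at the initial vertex of `t` after two contractions of edges without common vertex. -/
theorem deco_contract_contract_of_ne (h₁ : Γ.vert t ≠ Γ.vert t')
    (h₂ : Γ.vert t ≠ Γ.vert (Γ.inv t')) (h₃ : Γ.vert (Γ.inv t) ≠ Γ.vert t')
    (h₄ : Γ.vert (Γ.inv t) ≠ Γ.vert (Γ.inv t'))
    (x : ((Γ.contract ht).contract H₁).V) (y : ((Γ.contract ht').contract H₂).V)
    (hx : x.1.1 = Γ.vert t) (hy : y.1.1 = Γ.vert t)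
    (e : {h // ((Γ.contract ht).contract H₁).vert h = x} ≃
      {h // ((Γ.contract ht').contract H₂).vert h = y})
    (he : ∀ s, (e s).1.1.1 = s.1.1.1) :
    ((Γ.contract ht').contract H₂).deco y =
      Labels.map O e (((Γ.contract ht).contract H₁).deco x) := by
  have hv₁ : ((Γ.contract ht).vert ⟨t', hne⟩).1 = Γ.vert t' :=
    contract_vert_val_of_ne Γ ht rfl h₃.symm
  have hv₂ : ((Γ.contract ht').vert ⟨t, hne'⟩).1 = Γ.vert t :=
    contract_vert_val_of_ne Γ ht' rfl h₂
  have hv₃ : ((Γ.contract ht').vert ((Γ.contract ht').inv ⟨t, hne'⟩)).1 = Γ.vert (Γ.inv t) :=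
    contract_vert_val_of_ne Γ ht' rfl h₄
  obtain ⟨E₁, hE₁, e₁⟩ := contract_deco_other_exists (Γ.contract ht) H₁ x (a := x.1) rfl
    (fun h => h₁ (by rw [← hx, h, hv₁]))
  obtain ⟨E₂, hE₂, hE₂', e₂⟩ := contract_deco_merged_exists Γ ht x.1 rfl rfl hx
  obtain ⟨E₃, hE₃, hE₃', e₃⟩ := contract_deco_merged_exists (Γ.contract ht') H₂ y rfl rfl
    (Subtype.ext (hy.trans hv₂.symm))
  obtain ⟨E₄, hE₄, e₄⟩ := contract_deco_other_exists Γ ht'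
    ((Γ.contract ht').vert ⟨t, hne'⟩) hv₂ h₁
  obtain ⟨E₅, hE₅, e₅⟩ := contract_deco_other_exists Γ ht'
    ((Γ.contract ht').vert ((Γ.contract ht').inv ⟨t, hne'⟩)) hv₃ h₃
  refine e₃.trans ?_
  refine (congrArg₂ (fun a b => Labels.map O E₃ (Labels.comp O _ _ a b)) e₄ e₅).trans ?_
  refine Eq.trans ?_ (congrArg (Labels.map O e) (e₁.trans (congrArg _ e₂))).symm
  refine Eq.trans ?_ (congrArg (Labels.map O e) (Labels.map_map O _ _ _)).symm
  refine Eq.trans ?_ (Labels.map_map O _ _ _).symm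
  refine Labels.map_comp_map O E₄ E₅ (Subtype.ext (Subtype.ext (hE₄ _)))
    (Subtype.ext (Subtype.ext (hE₅ _))) _ _ (fun s hs hs' => ?_) (fun s hs hs' => ?_) _ _
  · refine Subtype.ext (Subtype.ext (Subtype.ext ?_))
    refine (congrArg Subtype.val (hE₃ _)).trans ((hE₄ s).trans ?_)
    refine Eq.trans ?_ (he _).symm
    refine Eq.trans ?_ (congrArg Subtype.val (hE₁ _)).symm
    exact (hE₂ ⟨s, hs'⟩).symm
  · refine Subtype.ext (Subtype.ext (Subtype.ext ?_))
    refine (congrArg Subtype.val (hE₃' _)).trans ((hE₅ s).trans ?_)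
    refine Eq.trans ?_ (he _).symm
    refine Eq.trans ?_ (congrArg Subtype.val (hE₁ _)).symm
    exact (hE₂' ⟨s, hs'⟩).symm

/-- The label at the common initial vertex of `t` and `t'` after both contractions. -/
theorem deco_contract_contract_of_eq (h₁ : Γ.vert t' = Γ.vert t)
    (h₄ : Γ.vert (Γ.inv t) ≠ Γ.vert (Γ.inv t'))
    (x : ((Γ.contract ht).contract H₁).V) (y : ((Γ.contract ht').contract H₂).V)
    (hx : x.1.1 = Γ.vert t) (hy : y.1.1 = Γ.vert t)
    (e : {h // ((Γ.contract ht).contract H₁).vert h = x} ≃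
      {h // ((Γ.contract ht').contract H₂).vert h = y})
    (he : ∀ s, (e s).1.1.1 = s.1.1.1) :
    ((Γ.contract ht').contract H₂).deco y =
      Labels.map O e (((Γ.contract ht).contract H₁).deco x) := by
  have hv₁ : ((Γ.contract ht).vert ⟨t', hne⟩).1 = Γ.vert t :=
    contract_vert_val_of_ne Γ ht h₁ ht
  have hv₁' : ((Γ.contract ht).vert ((Γ.contract ht).inv ⟨t', hne⟩)).1 = Γ.vert (Γ.inv t') :=
    contract_vert_val_of_ne Γ ht rfl h₄.symm
  have hv₂ : ((Γ.contract ht').vert ⟨t, hne'⟩).1 = Γ.vert t :=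
    contract_vert_val_of_ne Γ ht' rfl (by rw [← h₁]; exact ht')
  have hv₂' : ((Γ.contract ht').vert ((Γ.contract ht').inv ⟨t, hne'⟩)).1 = Γ.vert (Γ.inv t) :=
    contract_vert_val_of_ne Γ ht' rfl h₄
  obtain ⟨E₁, hE₁, hE₁', e₁⟩ := contract_deco_merged_exists (Γ.contract ht) H₁ x rfl rfl
    (Subtype.ext (hx.trans hv₁.symm))
  obtain ⟨E₂, hE₂, hE₂', e₂⟩ := contract_deco_merged_exists (Γ.contract ht') H₂ y rfl rfl
    (Subtype.ext (hy.trans hv₂.symm))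
  obtain ⟨A₁, hA₁, hA₁', a₁⟩ := contract_deco_merged_exists Γ ht
    ((Γ.contract ht).vert ⟨t', hne⟩) rfl rfl hv₁
  obtain ⟨A₂, hA₂, hA₂', a₂⟩ := contract_deco_merged_exists Γ ht'
    ((Γ.contract ht').vert ⟨t, hne'⟩) h₁ rfl hv₂
  obtain ⟨B₁, hB₁, b₁⟩ := contract_deco_other_exists Γ ht
    ((Γ.contract ht).vert ((Γ.contract ht).inv ⟨t', hne⟩)) hv₁' (by rw [← h₁]; exact ht'.symm)
  obtain ⟨B₂, hB₂, b₂⟩ := contract_deco_other_exists Γ ht'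
    ((Γ.contract ht').vert ((Γ.contract ht').inv ⟨t, hne'⟩)) hv₂' (by rw [h₁]; exact ht.symm)
  have n₁ : (⟨t', h₁⟩ : {h // Γ.vert h = Γ.vert t}) ≠ ⟨t, rfl⟩ := fun h =>
    hne.1 (congrArg Subtype.val h)
  have k₁ : A₁ (Sum.inl ⟨⟨t', h₁⟩, n₁⟩) = ⟨⟨t', hne⟩, rfl⟩ := Subtype.ext (Subtype.ext (hA₁ _))
  have k₂ : A₂ (Sum.inl ⟨⟨t, rfl⟩, n₁.symm⟩) = ⟨⟨t, hne'⟩, rfl⟩ :=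
    Subtype.ext (Subtype.ext (hA₂ _))
  have l₁ : B₁ ⟨Γ.inv t', rfl⟩ = ⟨(Γ.contract ht).inv ⟨t', hne⟩, rfl⟩ :=
    Subtype.ext (Subtype.ext (hB₁ _))
  have l₂ : B₂ ⟨Γ.inv t, rfl⟩ = ⟨(Γ.contract ht').inv ⟨t, hne'⟩, rfl⟩ :=
    Subtype.ext (Subtype.ext (hB₂ _))
  let S₁ := Equiv.sumCongr (neEquiv A₁ k₁) (neEquiv B₁ l₁)
  let S₂ := Equiv.sumCongr (neEquiv A₂ k₂) (neEquiv B₂ l₂)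
  have m₁ : ((Γ.contract ht).contract H₁).deco x = Labels.map O (S₁.trans E₁)
      (Labels.comp O (Sum.inl ⟨⟨t', h₁⟩, n₁⟩) ⟨Γ.inv t', rfl⟩
        (Labels.comp O ⟨t, rfl⟩ ⟨Γ.inv t, rfl⟩ (Γ.deco (Γ.vert t)) (Γ.deco (Γ.vert (Γ.inv t))))
        (Γ.deco (Γ.vert (Γ.inv t')))) := by
    refine e₁.trans ?_
    refine (congrArg₂ (fun a b => Labels.map O E₁ (Labels.comp O _ _ a b)) a₁ b₁).trans ?_
    exact Labels.map_comp_map O A₁ B₁ k₁ l₁ _ _ (fun _ _ _ => rfl) (fun _ _ _ => rfl) _ _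
  have m₂ : ((Γ.contract ht').contract H₂).deco y = Labels.map O (S₂.trans E₂)
      (Labels.comp O (Sum.inl ⟨⟨t, rfl⟩, n₁.symm⟩) ⟨Γ.inv t, rfl⟩
        (Labels.comp O ⟨t', h₁⟩ ⟨Γ.inv t', rfl⟩ (Γ.deco (Γ.vert t)) (Γ.deco (Γ.vert (Γ.inv t'))))
        (Γ.deco (Γ.vert (Γ.inv t)))) := by
    refine e₂.trans ?_
    refine (congrArg₂ (fun a b => Labels.map O E₂ (Labels.comp O _ _ a b)) a₂ b₂).trans ?_
    exact Labels.map_comp_map O A₂ B₂ k₂ l₂ _ _ (fun _ _ _ => rfl) (fun _ _ _ => rfl) _ _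
  refine m₂.trans (Eq.trans ?_ (congrArg (Labels.map O e) m₁).symm)
  refine Eq.trans ?_ (Labels.map_map O _ _ _).symm
  -- Both labels are composites of the label at the common vertex with those at the two final
  -- vertices, in different orders; this is parallel associativity, and the valence bound supplies
  -- its hypothesis.
  refine (Labels.map_comp_comp O n₁ _ _ (Γ.valence _) _ _ (fun s hs hs' h h' => ?_)
    (fun s h => ?_) (fun s h => ?_) _ _ _).symm
  · refine Subtype.ext (Subtype.ext (Subtype.ext ?_))
    refine (he _).trans ((congrArg Subtype.val (hE₁ _)).trans ((hA₁ _).trans ?_))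
    exact ((congrArg Subtype.val (hE₂ _)).trans (hA₂ _)).symm
  · refine Subtype.ext (Subtype.ext (Subtype.ext ?_))
    refine (he _).trans ((congrArg Subtype.val (hE₁ _)).trans ((hA₁' _).trans ?_))
    exact ((congrArg Subtype.val (hE₂' _)).trans (hB₂ _)).symm
  · refine Subtype.ext (Subtype.ext (Subtype.ext ?_))
    refine (he _).trans ((congrArg Subtype.val (hE₁' _)).trans ((hB₁ _).trans ?_))
    exact ((congrArg Subtype.val (hE₂ _)).trans (hA₂' _)).symm

end TwoContractions
end OGraph
end GraphComplex
namespace GraphComplex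
variable {k : Type u} [Field k] {O : CyclicOperad.{u, w} k}
namespace OGraph

/-! ### Contractions of two edges anticommute. -/

section TwoContractions

/-- Two descriptions of the same iterated subtype. -/
def nestedSubtypeEquiv {X : Type} {p p' : X → Prop} {q : {x // p x} → Prop} {q' : {x // p' x} → Prop}
    (h : ∀ x, (∃ hx : p x, q ⟨x, hx⟩) ↔ ∃ hx : p' x, q' ⟨x, hx⟩) : {y // q y} ≃ {y // q' y} where
  toFun y := ⟨⟨y.1.1, ((h y.1.1).1 ⟨y.1.2, y.2⟩).1⟩, ((h y.1.1).1 ⟨y.1.2, y.2⟩).2⟩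
  invFun y := ⟨⟨y.1.1, ((h y.1.1).2 ⟨y.1.2, y.2⟩).1⟩, ((h y.1.1).2 ⟨y.1.2, y.2⟩).2⟩
  left_inv _ := rfl
  right_inv _ := rfl

variable (Γ : OGraph O) {t t' : Γ.H} (ht : Γ.vert t ≠ Γ.vert (Γ.inv t))
  (ht' : Γ.vert t' ≠ Γ.vert (Γ.inv t')) (hne : t' ≠ t ∧ t' ≠ Γ.inv t) (hne' : t ≠ t' ∧ t ≠ Γ.inv t')
  (H₁ : (Γ.contract ht).vert ⟨t', hne⟩ ≠ (Γ.contract ht).vert ((Γ.contract ht).inv ⟨t', hne⟩))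
  (H₂ : (Γ.contract ht').vert ⟨t, hne'⟩ ≠ (Γ.contract ht').vert ((Γ.contract ht').inv ⟨t, hne'⟩))

open Classical in
theorem contract_contract_vert_val (h₂ : Γ.vert t ≠ Γ.vert (Γ.inv t'))
    (h₃ : Γ.vert (Γ.inv t) ≠ Γ.vert t') (h₄ : Γ.vert (Γ.inv t) ≠ Γ.vert (Γ.inv t'))
    (h : ((Γ.contract ht).contract H₁).H) :
    (((Γ.contract ht).contract H₁).vert h).1.1 =
      if Γ.vert h.1.1 = Γ.vert (Γ.inv t') then Γ.vert t'
      else if Γ.vert h.1.1 = Γ.vert (Γ.inv t) then Γ.vert t else Γ.vert h.1.1 := by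
  have hv : ((Γ.contract ht).vert ⟨t', hne⟩).1 = Γ.vert t' :=
    contract_vert_val_of_ne Γ ht rfl h₃.symm
  have hv' : ((Γ.contract ht).vert ((Γ.contract ht).inv ⟨t', hne⟩)).1 = Γ.vert (Γ.inv t') :=
    contract_vert_val_of_ne Γ ht rfl h₄.symm
  refine (congrArg Subtype.val (contract_vert_val (Γ.contract ht) H₁ h)).trans ?_
  have e := contract_vert_val Γ ht h.1
  by_cases h₁ : Γ.vert h.1.1 = Γ.vert (Γ.inv t')
  · rw [if_pos h₁, if_pos, hv]
    refine Subtype.ext (e.trans ?_)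
    rw [if_neg (by rw [h₁]; exact h₄.symm), h₁, hv']
  · rw [if_neg h₁, if_neg, e]
    intro e'
    have := e.symm.trans ((congrArg Subtype.val e').trans hv')
    split_ifs at this with h₅
    · exact h₂ this
    · exact h₁ this

/-- Under these hypotheses the edges can only share their initial vertices. Since a contraction
deletes the final vertex, both orders delete the same two vertices and the same four half-edges. The
labels are compared at the initial vertex of `t`, at that of `t'`, and elsewhere. -/
theorem contract_contract_iso (h₂ : Γ.vert t ≠ Γ.vert (Γ.inv t'))
    (h₃ : Γ.vert (Γ.inv t) ≠ Γ.vert t') (h₄ : Γ.vert (Γ.inv t) ≠ Γ.vert (Γ.inv t')) :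
    Nonempty (((Γ.contract ht).contract H₁).Iso ((Γ.contract ht').contract H₂)) := by
  classical
  have hv₁ : ((Γ.contract ht).vert ⟨t', hne⟩).1 = Γ.vert t' :=
    contract_vert_val_of_ne Γ ht rfl h₃.symm
  have hv₁' : ((Γ.contract ht).vert ((Γ.contract ht).inv ⟨t', hne⟩)).1 = Γ.vert (Γ.inv t') :=
    contract_vert_val_of_ne Γ ht rfl h₄.symm
  have hv₂ : ((Γ.contract ht').vert ⟨t, hne'⟩).1 = Γ.vert t :=
    contract_vert_val_of_ne Γ ht' rfl h₂
  have hv₂' : ((Γ.contract ht').vert ((Γ.contract ht').inv ⟨t, hne'⟩)).1 = Γ.vert (Γ.inv t) :=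
    contract_vert_val_of_ne Γ ht' rfl h₄
  let onV : ((Γ.contract ht).contract H₁).V ≃ ((Γ.contract ht').contract H₂).V :=
    nestedSubtypeEquiv (p := fun x => x ≠ Γ.vert (Γ.inv t)) (p' := fun x => x ≠ Γ.vert (Γ.inv t'))
      (q := fun y => y ≠ (Γ.contract ht).vert ((Γ.contract ht).inv ⟨t', hne⟩))
      (q' := fun y => y ≠ (Γ.contract ht').vert ((Γ.contract ht').inv ⟨t, hne'⟩)) fun x => by
        have e₁ : ∀ hx, (⟨x, hx⟩ : Γ.ContractV t) =
            (Γ.contract ht).vert ((Γ.contract ht).inv ⟨t', hne⟩) ↔ x = Γ.vert (Γ.inv t') :=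
          fun hx => ⟨fun e => (congrArg Subtype.val e).trans hv₁',
            fun e => Subtype.ext (e.trans hv₁'.symm)⟩
        have e₂ : ∀ hx, (⟨x, hx⟩ : Γ.ContractV t') =
            (Γ.contract ht').vert ((Γ.contract ht').inv ⟨t, hne'⟩) ↔ x = Γ.vert (Γ.inv t) :=
          fun hx => ⟨fun e => (congrArg Subtype.val e).trans hv₂',
            fun e => Subtype.ext (e.trans hv₂'.symm)⟩
        constructor
        · rintro ⟨a, b⟩
          exact ⟨fun e => b ((e₁ a).2 e), fun e => a ((e₂ _).1 e)⟩
        · rintro ⟨a, b⟩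
          exact ⟨fun e => b ((e₂ a).2 e), fun e => a ((e₁ _).1 e)⟩
  let onH : ((Γ.contract ht).contract H₁).H ≃ ((Γ.contract ht').contract H₂).H :=
    nestedSubtypeEquiv (p := fun x => x ≠ t ∧ x ≠ Γ.inv t) (p' := fun x => x ≠ t' ∧ x ≠ Γ.inv t')
      (q := fun y => y ≠ ⟨t', hne⟩ ∧ y ≠ (Γ.contract ht).inv ⟨t', hne⟩)
      (q' := fun y => y ≠ ⟨t, hne'⟩ ∧ y ≠ (Γ.contract ht').inv ⟨t, hne'⟩) fun x => by
        constructor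
        · rintro ⟨a, b, c⟩
          exact ⟨⟨fun e => b (Subtype.ext e), fun e => c (Subtype.ext e)⟩,
            fun e => a.1 (congrArg Subtype.val e), fun e => a.2 (congrArg Subtype.val e)⟩
        · rintro ⟨a, b, c⟩
          exact ⟨⟨fun e => b (Subtype.ext e), fun e => c (Subtype.ext e)⟩,
            fun e => a.1 (congrArg Subtype.val e), fun e => a.2 (congrArg Subtype.val e)⟩
  have hvert : ∀ h, ((Γ.contract ht').contract H₂).vert (onH h) =
      onV (((Γ.contract ht).contract H₁).vert h) := by
    intro h
    refine Subtype.ext (Subtype.ext ?_)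
    refine (contract_contract_vert_val Γ ht' hne' H₂ h₃.symm h₂.symm h₄.symm (onH h)).trans ?_
    refine Eq.trans ?_ (contract_contract_vert_val Γ ht hne H₁ h₂ h₃ h₄ h).symm
    change (if Γ.vert h.1.1 = _ then _ else if Γ.vert h.1.1 = _ then _ else Γ.vert h.1.1) = _
    by_cases a : Γ.vert h.1.1 = Γ.vert (Γ.inv t')
    · rw [if_pos a, if_pos a, if_neg]
      rw [a]; exact h₄.symm
    · rw [if_neg a, if_neg a]
  refine ⟨{ onV := onV, onH := onH, vert_eq := hvert, deco_eq := fun x => ?_,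
            inv_eq := fun _ => rfl, lt_iff := fun _ _ => Iff.rfl, tail_iff := fun _ => Iff.rfl }⟩
  by_cases a : x.1.1 = Γ.vert t
  · by_cases b : Γ.vert t' = Γ.vert t
    · exact deco_contract_contract_of_eq Γ ht ht' hne hne' H₁ H₂ b h₄ x (onV x) a a _ fun _ => rfl
    · exact deco_contract_contract_of_ne Γ ht ht' hne hne' H₁ H₂ (Ne.symm b) h₂ h₃ h₄ x (onV x) a a _
        fun _ => rfl
  · by_cases b : x.1.1 = Γ.vert t'
    · have hn : Γ.vert t' ≠ Γ.vert t := fun e => a (b.trans e)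
      have := deco_contract_contract_of_ne Γ ht' ht hne' hne H₂ H₁ hn h₃.symm h₂.symm h₄.symm
        (onV x) x b b (onH.subtypeEquiv (fun h => by rw [hvert, onV.apply_eq_iff_eq])).symm
        fun _ => rfl
      refine Eq.trans ?_ (congrArg (Labels.map O _) this).symm
      refine Eq.trans ?_ (Labels.map_map O _ _ _).symm
      exact (Labels.map_of_forall_eq O (fun _ => rfl) _).symm
    · have a₁ : x.1 ≠ (Γ.contract ht).vert ⟨t', hne⟩ := fun e => b ((congrArg Subtype.val e).trans hv₁)
      have a₂ : (onV x).1 ≠ (Γ.contract ht').vert ⟨t, hne'⟩ :=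
        fun e => a ((congrArg Subtype.val e).trans hv₂)
      refine (contract_deco_other (Γ.contract ht') H₂ (onV x) a₂).trans ?_
      refine (congrArg (Labels.map O _) (contract_deco_other Γ ht' (onV x).1 b)).trans ?_
      refine Eq.trans ?_ (congrArg (Labels.map O _)
        (contract_deco_other (Γ.contract ht) H₁ x a₁)).symm
      refine Eq.trans ?_ (congrArg (fun z => Labels.map O _ (Labels.map O _ z))
        (contract_deco_other Γ ht x.1 a)).symm
      refine (Labels.map_map O _ _ _).trans (Eq.trans ?_ (Labels.map_map O _ _ _).symm)
      refine Eq.trans ?_ (Labels.map_map O _ _ _).symm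
      exact Labels.map_congr O (fun _ => rfl) _

/-- This is the source of the antisymmetry. Deleting the final vertex of `t` lowers the number of
vertices before that of `t'` by one precisely when it comes first, so exactly one of the two orders
of contraction acquires an extra sign. -/
theorem contractSign_contract (h₄ : Γ.vert (Γ.inv t) ≠ Γ.vert (Γ.inv t')) :
    contractSign k (Γ.contract ht) ⟨t', hne⟩ =
      contractSign k Γ t' * sg k (Γ.lt (Γ.vert (Γ.inv t)) (Γ.vert (Γ.inv t'))) := by
  classical
  have iV : Fintype Γ.V := Fintype.ofFinite Γ.V
  let i₂ : Fintype (Γ.contract ht).V := (inferInstance : Fintype {v // v ≠ Γ.vert (Γ.inv t)})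
  have hv : ((Γ.contract ht).vert ((Γ.contract ht).inv ⟨t', hne⟩)).1 = Γ.vert (Γ.inv t') :=
    contract_vert_val_of_ne Γ ht rfl h₄.symm
  have e : contractSign k (Γ.contract ht) ⟨t', hne⟩ = sg k (¬ Γ.tail t') *
      - ∏ x : {v // v ≠ Γ.vert (Γ.inv t)},
        sg k (Γ.lt x.1 ((Γ.contract ht).vert ((Γ.contract ht).inv ⟨t', hne⟩)).1) :=
    contractSign_eq (Γ.contract ht) ⟨t', hne⟩
  rw [e, contractSign_eq, hv, ← prod_subtype_ne_mul (Γ.vert (Γ.inv t))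
    (fun x => sg k (Γ.lt x (Γ.vert (Γ.inv t'))))]
  have := sg_mul_self (k := k) (Γ.lt (Γ.vert (Γ.inv t)) (Γ.vert (Γ.inv t')))
  linear_combination (sg k (¬ Γ.tail t') * ∏ x : {v // v ≠ Γ.vert (Γ.inv t)},
    sg k (Γ.lt x.1 (Γ.vert (Γ.inv t')))) * this

theorem contractCls₂_swap_aux (Γ : OGraph O) {t t' : Γ.H} (ht : Γ.vert t ≠ Γ.vert (Γ.inv t))
    (ht' : Γ.vert t' ≠ Γ.vert (Γ.inv t')) (hne : t' ≠ t ∧ t' ≠ Γ.inv t)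
    (hne' : t ≠ t' ∧ t ≠ Γ.inv t') (h₂ : Γ.vert t ≠ Γ.vert (Γ.inv t'))
    (h₃ : Γ.vert (Γ.inv t) ≠ Γ.vert t') (h₄ : Γ.vert (Γ.inv t) ≠ Γ.vert (Γ.inv t')) :
    Γ.contractCls₂ t t' = - Γ.contractCls₂ t' t := by
  have hv₁ : ((Γ.contract ht).vert ⟨t', hne⟩).1 = Γ.vert t' :=
    contract_vert_val_of_ne Γ ht rfl h₃.symm
  have hv₁' : ((Γ.contract ht).vert ((Γ.contract ht).inv ⟨t', hne⟩)).1 = Γ.vert (Γ.inv t') :=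
    contract_vert_val_of_ne Γ ht rfl h₄.symm
  have hv₂ : ((Γ.contract ht').vert ⟨t, hne'⟩).1 = Γ.vert t :=
    contract_vert_val_of_ne Γ ht' rfl h₂
  have hv₂' : ((Γ.contract ht').vert ((Γ.contract ht').inv ⟨t, hne'⟩)).1 = Γ.vert (Γ.inv t) :=
    contract_vert_val_of_ne Γ ht' rfl h₄
  have H₁ : (Γ.contract ht).vert ⟨t', hne⟩ ≠ (Γ.contract ht).vert ((Γ.contract ht).inv ⟨t', hne⟩) :=
    fun e => ht' (hv₁.symm.trans ((congrArg Subtype.val e).trans hv₁'))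
  have H₂ : (Γ.contract ht').vert ⟨t, hne'⟩ ≠
      (Γ.contract ht').vert ((Γ.contract ht').inv ⟨t, hne'⟩) :=
    fun e => ht (hv₂.symm.trans ((congrArg Subtype.val e).trans hv₂'))
  obtain ⟨φ⟩ := contract_contract_iso Γ ht ht' hne hne' H₁ H₂ h₂ h₃ h₄
  rw [contractCls₂_of Γ ht hne, contractCls₂_of Γ ht' hne', contractCls_of_ne _ H₁,
    contractCls_of_ne _ H₂, cls_iso φ, smul_smul, smul_smul, ← neg_smul,
    contractSign_contract Γ ht hne h₄, contractSign_contract Γ ht' hne' h₄.symm,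
    ← not_lt_iff Γ.lt h₄, sg_not]
  congr 1
  ring

end TwoContractions

/-- If one edge is a loop or the edges are parallel, both sides vanish. Otherwise the edges have at
most one common vertex, and since contraction does not depend on directions, the edges may be
reversed so that it is the initial vertex of both; then `contractCls₂_swap_aux` applies. -/
theorem contractCls₂_swap (Γ : OGraph O) (t t' : Γ.H) :
    Γ.contractCls₂ t t' = - Γ.contractCls₂ t' t := by
  by_cases hne : t' ≠ t ∧ t' ≠ Γ.inv t
  swap
  · have hne' : ¬ (t ≠ t' ∧ t ≠ Γ.inv t') := fun h =>
      hne ⟨h.1.symm, fun e => h.2 (by rw [e, Γ.inv_inv])⟩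
    rw [contractCls₂, contractCls₂, dif_neg fun h => hne h.2, dif_neg fun h => hne' h.2, neg_zero]
  have hne' : t ≠ t' ∧ t ≠ Γ.inv t' := ⟨hne.1.symm, fun e => hne.2 (by rw [e, Γ.inv_inv])⟩
  -- an edge whose endpoints coincide, possibly after the other contraction
  have loop : ∀ s s' : Γ.H, s' ≠ s ∧ s' ≠ Γ.inv s →
      (Γ.vert s' = Γ.vert (Γ.inv s') ∨
        (Γ.vert s' = Γ.vert s ∧ Γ.vert (Γ.inv s') = Γ.vert (Γ.inv s))) →
      Γ.contractCls₂ s s' = 0 := by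
    classical
    intro s s' hs hl
    by_cases hs' : Γ.vert s = Γ.vert (Γ.inv s)
    · exact contractCls₂_of_eq Γ hs' s'
    rw [contractCls₂_of Γ hs' hs]
    refine (congrArg _ (contractCls_of_eq (Γ.contract hs') ?_)).trans (smul_zero _)
    refine Subtype.ext ?_
    refine (contract_vert_val Γ hs' _).trans (Eq.trans ?_ (contract_vert_val Γ hs' _).symm)
    change (if Γ.vert s' = _ then _ else Γ.vert s') =
      (if Γ.vert (Γ.inv s') = _ then _ else Γ.vert (Γ.inv s'))
    rcases hl with h | ⟨h, h'⟩
    · rw [h]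
    · rw [h, h', if_neg hs', if_pos rfl]
  by_cases ht : Γ.vert t = Γ.vert (Γ.inv t)
  · rw [contractCls₂_of_eq Γ ht, loop t' t hne' (Or.inl ht), neg_zero]
  by_cases ht' : Γ.vert t' = Γ.vert (Γ.inv t')
  · rw [contractCls₂_of_eq Γ ht', loop t t' hne (Or.inl ht'), neg_zero]
  -- The case where neither edge starts at the end of the other. A common final vertex becomes a
  -- common initial vertex when both edges are reversed.
  have par : ∀ s s' : Γ.H, s' ≠ s ∧ s' ≠ Γ.inv s → s ≠ s' ∧ s ≠ Γ.inv s' →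
      Γ.vert s ≠ Γ.vert (Γ.inv s) → Γ.vert s' ≠ Γ.vert (Γ.inv s') →
      Γ.vert (Γ.inv s) ≠ Γ.vert s' → Γ.vert s ≠ Γ.vert (Γ.inv s') →
      Γ.contractCls₂ s s' = - Γ.contractCls₂ s' s := by
    intro s s' hs hs' a b h₃ h₂
    by_cases h₄ : Γ.vert (Γ.inv s) = Γ.vert (Γ.inv s')
    · by_cases h₁ : Γ.vert s = Γ.vert s'
      · rw [loop s s' hs (Or.inr ⟨h₁.symm, h₄.symm⟩), loop s' s hs' (Or.inr ⟨h₁, h₄⟩), neg_zero]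
      · rw [← contractCls₂_inv_left, ← contractCls₂_inv_right, ← contractCls₂_inv_left Γ s',
          ← contractCls₂_inv_right Γ _ s]
        have i₁ := inv_ne_of_ne Γ hs
        have i₂ := inv_ne_of_ne Γ hs'
        have e := Γ.inv_inv s
        have e' := Γ.inv_inv s'
        exact contractCls₂_swap_aux Γ (by rw [e]; exact a.symm) (by rw [e']; exact b.symm)
          (by rw [e]; exact i₁.symm) (by rw [e']; exact i₂.symm) (by rw [e']; exact h₃)
          (by rw [e]; exact h₂) (by rw [e, e']; exact h₁)
    · exact contractCls₂_swap_aux Γ a b hs hs' h₂ h₃ h₄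
  by_cases h₃ : Γ.vert (Γ.inv t) = Γ.vert t'
  · by_cases h₂ : Γ.vert t = Γ.vert (Γ.inv t')
    · rw [← contractCls₂_inv_right, ← contractCls₂_inv_left Γ t',
        loop t (Γ.inv t') (inv_ne_of_ne Γ hne) (Or.inr ⟨h₂.symm, by rw [Γ.inv_inv, h₃]⟩),
        loop (Γ.inv t') t ⟨hne'.2, by rw [Γ.inv_inv]; exact hne'.1⟩
          (Or.inr ⟨h₂, by rw [Γ.inv_inv, h₃]⟩), neg_zero]
    · -- reverse the first edge
      rw [← contractCls₂_inv_left, ← contractCls₂_inv_right Γ t']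
      refine par _ _ ⟨hne.2, by rw [Γ.inv_inv]; exact hne.1⟩ (inv_ne_of_ne Γ hne')
        (by rw [Γ.inv_inv]; exact Ne.symm ht) ht' ?_ ?_
      · rw [Γ.inv_inv, ← h₃]; exact ht
      · rw [h₃]; exact ht'
  · by_cases h₂ : Γ.vert t = Γ.vert (Γ.inv t')
    · rw [← contractCls₂_inv_right, ← contractCls₂_inv_left Γ t']
      refine par _ _ (inv_ne_of_ne Γ hne) ⟨hne'.2, by rw [Γ.inv_inv]; exact hne'.1⟩ ht
        (by rw [Γ.inv_inv]; exact Ne.symm ht') ?_ ?_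
      · rw [← h₂]; exact Ne.symm ht
      · rw [Γ.inv_inv, h₂]; exact Ne.symm ht'
    · exact par t t' hne hne' ht ht' h₃ h₂

end OGraph
end GraphComplex
namespace GraphComplex
variable {k : Type u} [Field k] {O : CyclicOperad.{u, w} k}

/-! ### Cyclic permutations given by lists. -/

section Cyc
variable {α β : Type}

open Classical in
/-- The cyclic permutation of the elements of a list. -/
noncomputable def cyc (l : List α) : Equiv.Perm α := l.formPerm

theorem cyc_mem_iff {l : List α} {x : α} : cyc l x ∈ l ↔ x ∈ l := by
  classical
  exact List.formPerm_mem_iff_mem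

theorem cyc_of_notMem {l : List α} {x : α} (h : x ∉ l) : cyc l x = x := by
  classical
  exact List.formPerm_apply_of_notMem h

theorem cyc_symm_of_notMem {l : List α} {x : α} (h : x ∉ l) : (cyc l).symm x = x := by
  rw [Equiv.symm_apply_eq, cyc_of_notMem h]

theorem cyc_symm_mem_iff {l : List α} {x : α} : (cyc l).symm x ∈ l ↔ x ∈ l := by
  rw [← cyc_mem_iff, Equiv.apply_symm_apply]

theorem cyc_map {f : α → β} (hf : Function.Injective f) (l : List α) (x : α) :
    cyc (l.map f) (f x) = f (cyc l x) := by
  classical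
  unfold cyc
  induction l with
  | nil => simp
  | cons a l ih =>
    cases l with
    | nil => simp
    | cons b l =>
      simp only [List.map_cons, List.formPerm_cons_cons, Equiv.Perm.mul_apply] at ih ⊢
      rw [ih, hf.swap_apply]

theorem cyc_map_symm {f : α → β} (hf : Function.Injective f) (l : List α) (x : α) :
    (cyc (l.map f)).symm (f x) = f ((cyc l).symm x) := by
  rw [Equiv.symm_apply_eq, cyc_map hf, Equiv.apply_symm_apply]

theorem cyc_reverse (l : List α) : cyc l.reverse = (cyc l)⁻¹ := by
  classical
  exact List.formPerm_reverse l

theorem cyc_of_isRotated {l l' : List α} (hd : l.Nodup) (h : l ~r l') : cyc l = cyc l' := by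
  classical
  exact List.formPerm_eq_of_isRotated hd h

/-- `List.formPerm` is a product of transpositions of consecutive elements, and such a product can
be cut at `y`. -/
theorem cyc_append (l : List α) (y : α) (l' : List α) :
    cyc (l ++ y :: l') = cyc (l ++ [y]) * cyc (y :: l') := by
  classical
  unfold cyc
  induction l with
  | nil => simp
  | cons a l ih =>
    cases l with
    | nil => simp [List.formPerm_cons_cons]
    | cons b l =>
      simp only [List.cons_append, List.formPerm_cons_cons] at ih ⊢
      rw [ih, mul_assoc]

end Cyc

namespace OGraph

/-! ### Attaching a polygon along a list of directed edges. -/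

section Attach

/-- Change the pairing of the half-edges by a permutation, and the directions of the edges. -/
def twist (Γ : OGraph O) (σ : Equiv.Perm Γ.H) (T : Γ.H → Prop) (h₁ : ∀ h, T (σ h) ↔ T h)
    (h₂ : ∀ h, T (Γ.inv h) ↔ ¬ T h) : OGraph O :=
  { Γ with
    inv := fun h => σ (Γ.inv (σ.symm h))
    inv_inv := fun h => by simp [Γ.inv_inv]
    inv_ne := fun h hh => Γ.inv_ne (σ.symm h) (by rwa [Equiv.eq_symm_apply])
    tail := T
    tail_inv := fun h => by rw [h₁, h₂, ← h₁]; simp }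

/-- The directed edges in the list lie on pairwise different edges. -/
def IsSep (Γ : OGraph O) (l : List Γ.H) : Prop := l.Nodup ∧ ∀ h ∈ l, Γ.inv h ∉ l

theorem IsSep.inv_mem {Γ : OGraph O} {l : List Γ.H} (hl : Γ.IsSep l) {h : Γ.H} (h' : Γ.inv h ∈ l) :
    h ∉ l := fun h'' => hl.2 h h'' h'

/-- The directions of edges, changed where necessary to agree with those in the list. -/
def aligned (Γ : OGraph O) (l : List Γ.H) (h : Γ.H) : Prop := h ∈ l ∨ (Γ.inv h ∉ l ∧ Γ.tail h)

theorem aligned_cyc (Γ : OGraph O) (l : List Γ.H) (h : Γ.H) :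
    Γ.aligned l (cyc l h) ↔ Γ.aligned l h := by
  by_cases hh : h ∈ l
  · exact iff_of_true (Or.inl (cyc_mem_iff.2 hh)) (Or.inl hh)
  · rw [cyc_of_notMem hh]

theorem aligned_inv (Γ : OGraph O) {l : List Γ.H} (hl : Γ.IsSep l) (h : Γ.H) :
    Γ.aligned l (Γ.inv h) ↔ ¬ Γ.aligned l h := by
  have h₁ := hl.2 h
  have h₂ := Γ.tail_inv h
  simp only [aligned, Γ.inv_inv]
  tauto

/-- Attach a polygon to the directed edges in the list. -/
noncomputable def attachList (Γ : OGraph O) (l : List Γ.H) (hl : Γ.IsSep l) : OGraph O :=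
  Γ.twist (cyc l) (Γ.aligned l) (Γ.aligned_cyc l) (Γ.aligned_inv hl)

variable (k) in
/-- The sign of `attachList`. -/
noncomputable def attachSgn {O : CyclicOperad.{u, w} k} (Γ : OGraph O) (l : List Γ.H) : k :=
  (l.map fun h => sg k (¬ Γ.tail h)).prod

/-- The number of connected components. -/
noncomputable def numComp (Γ : OGraph O) : ℕ := Nat.card Γ.Comp

/-- Attaching a polygon produces the largest possible number of components. -/
def Splits (Γ : OGraph O) (l : List Γ.H) : Prop :=
  ∃ hl : Γ.IsSep l, (Γ.attachList l hl).numComp + 1 = Γ.numComp + l.length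

open Classical in
/-- Attach a polygon, then contract the edge that starts with `t`. -/
noncomputable def attachTerm (Γ : OGraph O) (l : List Γ.H) (t : Γ.H) : GraphSpace O :=
  if hl : Γ.IsSep l then attachSgn k Γ l • (Γ.attachList l hl).contractCls t else 0

theorem attachTerm_of (Γ : OGraph O) {l : List Γ.H} (hl : Γ.IsSep l) (t : Γ.H) :
    Γ.attachTerm l t = attachSgn k Γ l • (Γ.attachList l hl).contractCls t := dif_pos hl

/-- Attach a polygon, then contract the new edge which starts with the first half-edge of the list. -/
noncomputable def headTerm (Γ : OGraph O) : List Γ.H → GraphSpace O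
  | [] => 0
  | t :: l => Γ.attachTerm (t :: l) t

open Classical in
/-- The contribution of a list to the fission operation. -/
noncomputable def fissionTerm (Γ : OGraph O) (l : List Γ.H) : GraphSpace O :=
  if Γ.Splits l then Γ.headTerm l else 0

theorem fissionTerm_of (Γ : OGraph O) {l : List Γ.H} (h : Γ.Splits l) :
    Γ.fissionTerm l = Γ.headTerm l := if_pos h

theorem fissionTerm_of_not (Γ : OGraph O) {l : List Γ.H} (h : ¬ Γ.Splits l) :
    Γ.fissionTerm l = 0 := if_neg h

/-- The lists of `i` directed edges that lie on different edges. -/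
noncomputable def words (Γ : OGraph O) (i : ℕ) : Finset (List Γ.H) :=
  ((List.finite_length_eq Γ.H i).subset (fun _ h => h.1) :
    {l : List Γ.H | l.length = i ∧ Γ.IsSep l}.Finite).toFinset

theorem mem_words {Γ : OGraph O} {i : ℕ} {l : List Γ.H} :
    l ∈ Γ.words i ↔ l.length = i ∧ Γ.IsSep l := by
  simp [words]

/-- The part of `∂ᵢ` where the number of components grows by `i - 1`. -/
noncomputable def fissionSum (i : ℕ) (Γ : OGraph O) : GraphSpace O :=
  ∑ l ∈ Γ.words i, Γ.fissionTerm l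

end Attach

/-! ### The fission operation is well defined on the graph complex. -/

section Invariance

theorem Iso.numComp_eq {Γ Δ : OGraph O} (φ : Γ.Iso Δ) : Δ.numComp = Γ.numComp := by
  refine (Nat.card_congr (Quot.congr φ.onV fun v w => ?_)).symm
  constructor
  · rintro ⟨h, rfl, rfl⟩
    exact ⟨φ.onH h, φ.vert_eq h, by rw [φ.inv_eq, φ.vert_eq]⟩
  · rintro ⟨h, h₁, h₂⟩
    obtain ⟨h, rfl⟩ := φ.onH.surjective h
    rw [φ.vert_eq, φ.onV.apply_eq_iff_eq] at h₁
    rw [φ.inv_eq, φ.vert_eq, φ.onV.apply_eq_iff_eq] at h₂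
    exact ⟨h, h₁, h₂⟩

variable {Γ Δ : OGraph O}

theorem Iso.isSep_map (φ : Γ.Iso Δ) {l : List Γ.H} : Δ.IsSep (l.map φ.onH) ↔ Γ.IsSep l := by
  refine and_congr (List.nodup_map_iff φ.onH.injective) ?_
  simp only [List.forall_mem_map, φ.inv_eq, List.mem_map_of_injective φ.onH.injective]

/-- Attaching polygons to corresponding edges of isomorphic graphs. -/
noncomputable def Iso.attachList (φ : Γ.Iso Δ) {l : List Γ.H} (hl : Γ.IsSep l)
    (hl' : Δ.IsSep (l.map φ.onH)) :
    (Γ.attachList l hl).Iso (Δ.attachList (l.map φ.onH) hl') where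
  onV := φ.onV
  onH := φ.onH
  vert_eq := φ.vert_eq
  inv_eq := by
    have key : ∀ h : Γ.H, cyc (l.map φ.onH) (Δ.inv ((cyc (l.map φ.onH)).symm (φ.onH h))) =
        φ.onH (cyc l (Γ.inv ((cyc l).symm h))) := fun h => by
      rw [cyc_map_symm φ.onH.injective, φ.inv_eq, cyc_map φ.onH.injective]
    exact key
  deco_eq := φ.deco_eq
  lt_iff := φ.lt_iff
  tail_iff := by
    have key : ∀ h : Γ.H, Δ.aligned (l.map φ.onH) (φ.onH h) ↔ Γ.aligned l h := fun h => by
      simp only [aligned, φ.inv_eq, List.mem_map_of_injective φ.onH.injective, φ.tail_iff]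
    exact key

theorem Iso.attachSgn_map (φ : Γ.Iso Δ) (l : List Γ.H) :
    attachSgn k Δ (l.map φ.onH) = attachSgn k Γ l := by
  simp only [attachSgn, List.map_map, Function.comp_def, φ.tail_iff]

theorem Iso.splits_map (φ : Γ.Iso Δ) (l : List Γ.H) : Δ.Splits (l.map φ.onH) ↔ Γ.Splits l := by
  constructor
  · rintro ⟨hl', h⟩
    have hl := φ.isSep_map.1 hl'
    refine ⟨hl, ?_⟩
    rwa [(φ.attachList hl hl').numComp_eq, φ.numComp_eq, List.length_map] at h
  · rintro ⟨hl, h⟩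
    have hl' := φ.isSep_map.2 hl
    refine ⟨hl', ?_⟩
    rwa [(φ.attachList hl hl').numComp_eq, φ.numComp_eq, List.length_map]

theorem Iso.fissionTerm_map (φ : Γ.Iso Δ) (l : List Γ.H) :
    Δ.fissionTerm (l.map φ.onH) = Γ.fissionTerm l := by
  by_cases h : Γ.Splits l
  · rw [fissionTerm_of _ h, fissionTerm_of _ ((φ.splits_map l).2 h)]
    cases l with
    | nil => rfl
    | cons t l =>
      obtain ⟨hl, -⟩ := h
      have hl' := φ.isSep_map.2 hl
      change Δ.attachTerm ((t :: l).map φ.onH) (φ.onH t) = Γ.attachTerm (t :: l) t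
      rw [attachTerm_of _ hl, attachTerm_of _ hl', φ.attachSgn_map]
      exact congrArg _ (contractCls_iso (φ.attachList hl hl') t)
  · rw [fissionTerm_of_not _ h, fissionTerm_of_not _ (mt (φ.splits_map l).1 h)]

theorem Iso.fissionSum_eq (φ : Γ.Iso Δ) (i : ℕ) : Δ.fissionSum i = Γ.fissionSum i := by
  refine (Finset.sum_bij (fun l _ => l.map φ.onH) (fun l hl => ?_) (fun l _ l' _ h => ?_)
    (fun l hl => ?_) (fun l _ => (φ.fissionTerm_map l).symm)).symm
  · rw [mem_words] at hl ⊢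
    exact ⟨(List.length_map _).trans hl.1, φ.isSep_map.2 hl.2⟩
  · exact List.map_injective_iff.2 φ.onH.injective h
  · rw [mem_words] at hl
    have e : (l.map φ.onH.symm).map φ.onH = l := by simp
    refine ⟨l.map φ.onH.symm, ?_, e⟩
    rw [mem_words, ← φ.isSep_map, e]
    exact ⟨(List.length_map _).trans hl.1, hl.2⟩

/-- The reversals are counted edge by edge: `f` counts those away from `l`, and an edge of `l` is
reversed exactly when `T` and `T'` differ at its half-edge in `l`. -/
theorem prod_sg_aligned (Γ : OGraph O) [Fintype Γ.H] {l : List Γ.H} (hl : Γ.IsSep l)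
    (T T' : Γ.H → Prop) (hT : ∀ h, T (Γ.inv h) ↔ ¬ T h) (hT' : ∀ h, T' (Γ.inv h) ↔ ¬ T' h)
    (f : Γ.H → k) (hf : ∀ h, h ∉ l → Γ.inv h ∉ l → f h = sg k (T h ∧ ¬ T' h))
    (hf₁ : ∀ h, h ∈ l → f h = 1) (hf₂ : ∀ h, Γ.inv h ∈ l → f h = 1) :
    ∏ h, sg k (T h ∧ ¬ T' h) =
      (∏ h, f h) * ((l.map fun h => sg k (¬ T h)).prod * (l.map fun h => sg k (¬ T' h)).prod) := by
  classical
  have e : ∀ h, sg k (T h ∧ ¬ T' h) = f h *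
      ((if h ∈ l then sg k (T h ∧ ¬ T' h) else 1) *
        if Γ.inv h ∈ l then sg k (T h ∧ ¬ T' h) else 1) := by
    intro h
    by_cases h₁ : h ∈ l
    · rw [if_pos h₁, if_neg (hl.2 h h₁), hf₁ h h₁]; ring
    · by_cases h₂ : Γ.inv h ∈ l
      · rw [if_neg h₁, if_pos h₂, hf₂ h h₂]; ring
      · rw [if_neg h₁, if_neg h₂, hf h h₁ h₂]; ring
  rw [Finset.prod_congr rfl fun h _ => e h, Finset.prod_mul_distrib, Finset.prod_mul_distrib]
  congr 1
  let ι : Equiv.Perm Γ.H := ⟨Γ.inv, Γ.inv, Γ.inv_inv, Γ.inv_inv⟩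
  -- Substituting `inv h` for `h` in the last product brings the two halves of each edge of `l`
  -- together in one factor.
  rw [← Equiv.prod_comp ι (fun h => if Γ.inv h ∈ l then sg k (T h ∧ ¬ T' h) else 1),
    ← Finset.prod_mul_distrib]
  have e₂ : ∀ h, ((if h ∈ l then sg k (T h ∧ ¬ T' h) else 1) *
      if Γ.inv (ι h) ∈ l then sg k (T (ι h) ∧ ¬ T' (ι h)) else 1) =
      if h ∈ l.toFinset then sg k (¬ T h) * sg k (¬ T' h) else 1 := by
    intro h
    change _ * (if Γ.inv (Γ.inv h) ∈ l then sg k (T (Γ.inv h) ∧ ¬ T' (Γ.inv h)) else 1) = _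
    rw [Γ.inv_inv, hT, hT']
    by_cases hh : h ∈ l
    · rw [if_pos hh, if_pos hh, if_pos (List.mem_toFinset.2 hh)]
      by_cases h₁ : T h <;> by_cases h₂ : T' h <;> simp [h₁, h₂, sg]
    · rw [if_neg hh, if_neg hh, if_neg (mt List.mem_toFinset.1 hh), mul_one]
  rw [Finset.prod_congr rfl fun h _ => e₂ h, Finset.prod_ite_mem, Finset.univ_inter,
    List.prod_toFinset _ hl.1, List.prod_map_mul]

/-- After alignment the directions of the edges of the polygon are the same for both orientations.
The part of the reorientation sign that they carried has moved into `attachSgn`. -/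
theorem attachSgn_reorient (Γ : OGraph O) (lt' : Γ.V → Γ.V → Prop)
    [IsStrictTotalOrder Γ.V lt'] (tail' : Γ.H → Prop) (h : ∀ h, tail' (Γ.inv h) ↔ ¬ tail' h)
    {l : List Γ.H} (hl : Γ.IsSep l) :
    attachSgn k (Γ.reorient lt' tail' h) l *
        (-1) ^ (Γ.attachList l hl).changes lt' ((Γ.reorient lt' tail' h).aligned l) =
      (-1) ^ Γ.changes lt' tail' * attachSgn k Γ l := by
  have iV : Fintype Γ.V := Fintype.ofFinite Γ.V
  have iH : Fintype Γ.H := Fintype.ofFinite Γ.H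
  have e : (-1 : k) ^ (Γ.attachList l hl).changes lt' ((Γ.reorient lt' tail' h).aligned l) =
      (∏ v, ∏ w, sg k (Γ.lt v w ∧ lt' w v)) *
        ∏ x, sg k (Γ.aligned l x ∧ ¬ (Γ.reorient lt' tail' h).aligned l x) :=
    @changes_sign k _ O (Γ.attachList l hl) iV iH _ _
  have e₂ := prod_sg_aligned Γ hl Γ.tail tail' Γ.tail_inv h
    (fun x => sg k (Γ.aligned l x ∧ ¬ (Γ.reorient lt' tail' h).aligned l x))
    (fun x h₁ h₂ => by
      congr 1
      have a : Γ.aligned l x ↔ Γ.tail x := by simp [aligned, h₁, h₂]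
      have b : (Γ.reorient lt' tail' h).aligned l x ↔ tail' x := by
        change (x ∈ l ∨ Γ.inv x ∉ l ∧ tail' x) ↔ _
        simp [h₁, h₂]
      rw [a, b])
    (fun x h₁ => sg_of_not fun h₂ => h₂.2 (Or.inl h₁))
    (fun x h₁ => sg_of_not fun h₂ => by
      rcases h₂.1 with h₃ | h₃
      · exact hl.2 x h₃ h₁
      · exact h₃.1 h₁)
  rw [e, changes_sign, e₂]
  change (l.map fun h => sg k (¬ tail' h)).prod * _ = _ * (l.map fun h => sg k (¬ Γ.tail h)).prod
  have e₃ : (l.map fun h => sg k (¬ Γ.tail h)).prod * (l.map fun h => sg k (¬ Γ.tail h)).prod = 1 := by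
    rw [← List.prod_map_mul]; simp
  linear_combination (-(∏ v, ∏ w, sg k (Γ.lt v w ∧ lt' w v)) *
    (∏ x, sg k (Γ.aligned l x ∧ ¬ (Γ.reorient lt' tail' h).aligned l x)) *
    (l.map fun h => sg k (¬ tail' h)).prod) * e₃

theorem fissionTerm_reorient (Γ : OGraph O) (lt' : Γ.V → Γ.V → Prop)
    [IsStrictTotalOrder Γ.V lt'] (tail' : Γ.H → Prop) (h : ∀ h, tail' (Γ.inv h) ↔ ¬ tail' h)
    (l : List Γ.H) : (Γ.reorient lt' tail' h).fissionTerm l =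
      (-1 : k) ^ Γ.changes lt' tail' • Γ.fissionTerm l := by
  by_cases hs : Γ.Splits l
  · rw [fissionTerm_of Γ hs]
    refine (fissionTerm_of (Γ.reorient lt' tail' h) hs).trans ?_
    cases l with
    | nil => exact (smul_zero _).symm
    | cons t l =>
      obtain ⟨hl, -⟩ := hs
      change _ = _ • Γ.attachTerm (t :: l) t
      rw [attachTerm_of Γ hl, smul_smul, ← attachSgn_reorient Γ lt' tail' h hl, mul_smul]
      refine (attachTerm_of (Γ.reorient lt' tail' h) (l := t :: l) hl t).trans (congrArg _ ?_)
      have : IsStrictTotalOrder (Γ.attachList (t :: l) hl).V lt' := ‹IsStrictTotalOrder Γ.V lt'›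
      exact contractCls_reorient (Γ.attachList (t :: l) hl) lt'
        ((Γ.reorient lt' tail' h).aligned (t :: l)) _ t
  · rw [fissionTerm_of_not Γ hs, smul_zero]
    exact fissionTerm_of_not (Γ.reorient lt' tail' h) hs

theorem fissionTerm_setDeco (Γ : OGraph O) (l : List Γ.H) (v : Γ.V) :
    ∃ Λ : Labels O {h // Γ.vert h = v} →ₗ[k] GraphSpace O,
      ∀ z, (Γ.setDeco v z).fissionTerm l = Λ z := by
  by_cases hs : Γ.Splits l
  · cases l with
    | nil => exact ⟨0, fun z => fissionTerm_of (Γ.setDeco v z) hs⟩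
    | cons t l =>
      obtain ⟨hl, -⟩ := id hs
      obtain ⟨Λ, hΛ⟩ := contractCls_setDeco (Γ.attachList (t :: l) hl) t v
      refine ⟨attachSgn k Γ (t :: l) • Λ, fun z => ?_⟩
      refine (fissionTerm_of (Γ.setDeco v z) hs).trans ?_
      refine (attachTerm_of (Γ.setDeco v z) (l := t :: l) hl t).trans ?_
      exact congrArg (attachSgn k Γ (t :: l) • ·) (hΛ z)
  · exact ⟨0, fun z => fissionTerm_of_not (Γ.setDeco v z) hs⟩

theorem isInvariant_fissionSum (i : ℕ) :
    IsInvariant (fissionSum i : OGraph O → GraphSpace O) where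
  iso φ := φ.fissionSum_eq i
  reorient Γ lt' _ tail' h := by
    rw [fissionSum, fissionSum, Finset.smul_sum]
    exact Finset.sum_congr rfl fun l _ => fissionTerm_reorient Γ lt' tail' h l
  deco Γ v := by
    choose Λ hΛ using fun l => fissionTerm_setDeco Γ l v
    refine ⟨∑ l ∈ Γ.words i, Λ l, fun z => ?_⟩
    rw [LinearMap.sum_apply]
    exact Finset.sum_congr rfl fun l _ => hΛ l z

variable (O) in
/-- The fission operation on the graph complex, without the factor `1/2`. -/
noncomputable def fission (i : ℕ) : GraphSpace O →ₗ[k] GraphSpace O := (isInvariant_fissionSum i).lift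

theorem fission_cls (i : ℕ) (Γ : OGraph O) : fission O i Γ.cls = Γ.fissionSum i :=
  (isInvariant_fissionSum i).lift_cls Γ

end Invariance

end OGraph
end GraphComplex
namespace GraphComplex
variable {k : Type u} [Field k] {O : CyclicOperad.{u, w} k}
namespace OGraph

/-! ### The growth of the number of components, by linear algebra. -/

section Counting

/-- The functions on the vertices that are constant on components. -/
def locConst (Γ : OGraph O) : Submodule ℚ (Γ.V → ℚ) where
  carrier := {f | ∀ h, f (Γ.vert h) = f (Γ.vert (Γ.inv h))}
  add_mem' hf hg h := congrArg₂ (· + ·) (hf h) (hg h)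
  zero_mem' _ := rfl
  smul_mem' c _ hf h := congrArg (c * ·) (hf h)

theorem eq_of_mk_eq {Γ : OGraph O} {f : Γ.V → ℚ} (hf : f ∈ Γ.locConst) {v w : Γ.V}
    (h : Quot.mk Γ.Joined v = Quot.mk Γ.Joined w) : f v = f w := by
  have e : ∀ v w, Γ.Joined v w → f v = f w := by
    rintro _ _ ⟨h, rfl, rfl⟩
    exact hf h
  exact congrArg (Quot.lift f e) h

theorem mk_vert_inv (Γ : OGraph O) (h : Γ.H) :
    Quot.mk Γ.Joined (Γ.vert (Γ.inv h)) = Quot.mk Γ.Joined (Γ.vert h) :=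
  (Quot.sound ⟨h, rfl, rfl⟩).symm

/-- With the number of components written as a dimension, its growth can be estimated by rank and
nullity. -/
theorem finrank_locConst (Γ : OGraph O) : Module.finrank ℚ Γ.locConst = Γ.numComp := by
  have iC : Fintype Γ.Comp := Fintype.ofFinite _
  let e : (Γ.Comp → ℚ) ≃ₗ[ℚ] Γ.locConst :=
    { toFun c := ⟨fun v => c (Quot.mk _ v), fun h => congrArg c (Γ.mk_vert_inv h).symm⟩
      map_add' _ _ := rfl
      map_smul' _ _ := rfl
      invFun f := Quot.lift f.1 fun v w h => eq_of_mk_eq f.2 (Quot.sound h)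
      left_inv c := funext fun x => Quot.inductionOn x fun _ => rfl
      right_inv f := rfl }
  rw [← e.finrank_eq, Module.finrank_fintype_fun_eq_card, numComp, Nat.card_eq_fintype_card]

variable (Γ : OGraph O)

theorem attachList_inv_of_mem {l : List Γ.H} (hl : Γ.IsSep l) {h : Γ.H} (hh : h ∈ l) :
    (Γ.attachList l hl).inv h = Γ.inv ((cyc l).symm h) :=
  cyc_of_notMem (hl.2 _ (cyc_symm_mem_iff.2 hh))

theorem attachList_inv_of_inv_mem {l : List Γ.H} (hl : Γ.IsSep l) {h : Γ.H} (hh : Γ.inv h ∈ l) :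
    (Γ.attachList l hl).inv h = cyc l (Γ.inv h) :=
  congrArg (fun x => cyc l (Γ.inv x)) (cyc_symm_of_notMem (hl.inv_mem hh))

theorem attachList_inv_of_notMem {l : List Γ.H} (hl : Γ.IsSep l) {h : Γ.H} (hh : h ∉ l)
    (hh' : Γ.inv h ∉ l) : (Γ.attachList l hl).inv h = Γ.inv h :=
  (congrArg (fun x => cyc l (Γ.inv x)) (cyc_symm_of_notMem hh)).trans (cyc_of_notMem hh')

/-- Every new edge joins the tail of one edge of `l` to the head of the preceding one. So if `f` is
constant on the new components and equals `c` at all tails, it equals `c` at all heads as well, and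
the old edges join equal values. -/
theorem mem_locConst_of_attachList {l : List Γ.H} (hl : Γ.IsSep l) {f : Γ.V → ℚ}
    (hf : f ∈ (Γ.attachList l hl).locConst) {c : ℚ} (hc : ∀ x ∈ l, f (Γ.vert x) = c) :
    f ∈ Γ.locConst := by
  have hf' : ∀ h : Γ.H, f (Γ.vert h) = f (Γ.vert ((Γ.attachList l hl).inv h)) := hf
  have key : ∀ h : Γ.H, h ∈ l → f (Γ.vert (Γ.inv h)) = c := fun h hh => by
    have h₁ := hf' (cyc l h)
    rwa [attachList_inv_of_mem Γ hl (cyc_mem_iff.2 hh), Equiv.symm_apply_apply,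
      hc _ (cyc_mem_iff.2 hh), eq_comm] at h₁
  intro h
  by_cases h₁ : h ∈ l
  · rw [key h h₁, hc h h₁]
  · by_cases h₂ : Γ.inv h ∈ l
    · have := key _ h₂
      rw [Γ.inv_inv] at this
      rw [this, hc _ h₂]
    · rw [hf' h, attachList_inv_of_notMem Γ hl h₁ h₂]

/-- The differences of the values at the polygon. -/
def valuesAt {t : Γ.H} {l : List Γ.H} (hl : Γ.IsSep (t :: l)) :
    (Γ.attachList (t :: l) hl).locConst →ₗ[ℚ] ({x // x ∈ l} → ℚ) where
  toFun f x := (f.1 : Γ.V → ℚ) (Γ.vert x.1) - (f.1 : Γ.V → ℚ) (Γ.vert t)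
  map_add' _ _ := funext fun _ => add_sub_add_comm _ _ _ _
  map_smul' _ _ := funext fun _ => (mul_sub _ _ _).symm

theorem mem_locConst_of_mem_ker {t : Γ.H} {l : List Γ.H} (hl : Γ.IsSep (t :: l))
    {f : (Γ.attachList (t :: l) hl).locConst} (hf : f ∈ LinearMap.ker (Γ.valuesAt hl)) :
    (f.1 : Γ.V → ℚ) ∈ Γ.locConst := by
  refine Γ.mem_locConst_of_attachList hl f.2 (c := (f.1 : Γ.V → ℚ) (Γ.vert t)) ?_
  intro x hx
  rcases List.mem_cons.1 hx with rfl | hx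
  · rfl
  · exact sub_eq_zero.1 (congrFun hf ⟨x, hx⟩)

/-- Functions that do not see the polygon. -/
def kerToLocConst {t : Γ.H} {l : List Γ.H} (hl : Γ.IsSep (t :: l)) :
    LinearMap.ker (Γ.valuesAt hl) →ₗ[ℚ] Γ.locConst where
  toFun f := ⟨f.1.1, Γ.mem_locConst_of_mem_ker hl f.2⟩
  map_add' _ _ := rfl
  map_smul' _ _ := rfl

theorem kerToLocConst_injective {t : Γ.H} {l : List Γ.H} (hl : Γ.IsSep (t :: l)) :
    Function.Injective (Γ.kerToLocConst hl) := fun _ _ h =>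
  Subtype.ext (Subtype.ext (congrArg (fun z : Γ.locConst => z.1) h))

theorem finrank_values {l : List Γ.H} (hl : l.Nodup) :
    Module.finrank ℚ ({x // x ∈ l} → ℚ) = l.length := by
  classical
  have : Fintype {x // x ∈ l} := Fintype.ofFinite _
  rw [Module.finrank_fintype_fun_eq_card, ← List.toFinset_card_of_nodup hl]
  exact Fintype.card_of_subtype _ fun x => List.mem_toFinset

/-- Compare the values of a locally constant function on the new graph at the tails with its value
at the tail of `t`. There are `l.length` differences, and the functions for which all of them vanish
are locally constant on the old graph. -/
theorem numComp_attachList_le {t : Γ.H} {l : List Γ.H} (hl : Γ.IsSep (t :: l)) :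
    (Γ.attachList (t :: l) hl).numComp ≤ Γ.numComp + l.length := by
  have iV : FiniteDimensional ℚ (Γ.V → ℚ) := inferInstance
  have h₀ : FiniteDimensional ℚ (Γ.attachList (t :: l) hl).locConst := inferInstance
  have h₁ := LinearMap.finrank_range_add_finrank_ker (Γ.valuesAt hl)
  have h₂ := LinearMap.finrank_le_finrank_of_injective (Γ.kerToLocConst_injective hl)
  have h₃ := Submodule.finrank_le (LinearMap.range (Γ.valuesAt hl))
  rw [finrank_values Γ hl.1.of_cons] at h₃
  rw [finrank_locConst] at h₁ h₂
  omega

/-- If the number of components grows as much as possible, then the polygon was attached to edges of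
one component, and in the new graph they lie in different components. -/
theorem mk_eq_of_numComp_attachList {t : Γ.H} {l : List Γ.H} (hl : Γ.IsSep (t :: l))
    (h : (Γ.attachList (t :: l) hl).numComp = Γ.numComp + l.length) :
    (∀ x ∈ t :: l, Quot.mk Γ.Joined (Γ.vert x) = Quot.mk Γ.Joined (Γ.vert t)) ∧
      ∀ x ∈ t :: l, ∀ y ∈ t :: l, Quot.mk (Γ.attachList (t :: l) hl).Joined (Γ.vert x) =
        Quot.mk (Γ.attachList (t :: l) hl).Joined (Γ.vert y) → x = y := by
  classical
  have iV : FiniteDimensional ℚ (Γ.V → ℚ) := inferInstance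
  have h₀ : FiniteDimensional ℚ (Γ.attachList (t :: l) hl).locConst := inferInstance
  have h₁ := LinearMap.finrank_range_add_finrank_ker (Γ.valuesAt hl)
  have h₂ := LinearMap.finrank_le_finrank_of_injective (Γ.kerToLocConst_injective hl)
  have h₃ := Submodule.finrank_le (LinearMap.range (Γ.valuesAt hl))
  have h₄ := finrank_values Γ hl.1.of_cons
  have h₅ := Γ.finrank_locConst
  rw [finrank_locConst] at h₁
  -- Equality in the count forces equality in both estimates: every locally constant function on the
  -- old graph lies in the kernel, and the differences take arbitrary values.
  have hk : Module.finrank ℚ (LinearMap.ker (Γ.valuesAt hl)) = Module.finrank ℚ Γ.locConst := by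
    omega
  have hr : Module.finrank ℚ (LinearMap.range (Γ.valuesAt hl)) =
    Module.finrank ℚ ({x // x ∈ l} → ℚ) := by omega
  have h₆ : FiniteDimensional ℚ Γ.locConst := inferInstance
  have hs : Function.Surjective (Γ.kerToLocConst hl) := LinearMap.range_eq_top.1
    (Submodule.eq_top_of_finrank_eq
      ((LinearMap.finrank_range_of_inj (Γ.kerToLocConst_injective hl)).trans hk))
  have hv : Function.Surjective (Γ.valuesAt hl) :=
    LinearMap.range_eq_top.1 (Submodule.eq_top_of_finrank_eq hr)
  constructor
  · intro x hx
    rcases List.mem_cons.1 hx with rfl | hx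
    · rfl
    by_contra hne
    -- The indicator function of the old component of `t` lies in the kernel, so it takes the same
    -- value at all tails.
    obtain ⟨⟨⟨f, hf⟩, hf'⟩, e⟩ := hs ⟨fun v => if Quot.mk Γ.Joined v = Quot.mk Γ.Joined (Γ.vert t)
      then 1 else 0, fun h => by beta_reduce; rw [Γ.mk_vert_inv]⟩
    have e' : f = fun v => if Quot.mk Γ.Joined v = Quot.mk Γ.Joined (Γ.vert t) then (1 : ℚ) else 0 :=
      congrArg Subtype.val e
    have := sub_eq_zero.1 (congrFun hf' ⟨x, hx⟩)
    change f (Γ.vert x) = f (Γ.vert t) at this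
    rw [e'] at this
    exact zero_ne_one ((if_neg hne).symm.trans (this.trans (if_pos rfl)))
  · have key : ∀ x ∈ l, ∀ y ∈ t :: l, Quot.mk (Γ.attachList (t :: l) hl).Joined (Γ.vert x) =
        Quot.mk (Γ.attachList (t :: l) hl).Joined (Γ.vert y) → x = y := by
      intro x hx y hy hxy
      -- A locally constant function on the new graph whose value at the tail of `x` exceeds by one
      -- its common value at the other tails separates `x` from them.
      obtain ⟨f, hf⟩ := hv (Pi.single ⟨x, hx⟩ 1)
      have e : (f.1 : Γ.V → ℚ) (Γ.vert x) = (f.1 : Γ.V → ℚ) (Γ.vert y) := eq_of_mk_eq f.2 hxy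
      have h₁ : (f.1 : Γ.V → ℚ) (Γ.vert x) - (f.1 : Γ.V → ℚ) (Γ.vert t) = 1 :=
        (congrFun hf ⟨x, hx⟩).trans (by simp)
      rcases List.mem_cons.1 hy with rfl | hy
      · rw [e, sub_self] at h₁
        exact absurd h₁ zero_ne_one
      · by_contra hne
        have h₂ : (f.1 : Γ.V → ℚ) (Γ.vert y) - (f.1 : Γ.V → ℚ) (Γ.vert t) = 0 :=
          (congrFun hf ⟨y, hy⟩).trans (Pi.single_eq_of_ne (fun e => hne (congrArg Subtype.val e).symm) _)
        rw [e, h₂] at h₁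
        exact zero_ne_one h₁
    intro x hx y hy hxy
    rcases List.mem_cons.1 hx with rfl | hx'
    · rcases List.mem_cons.1 hy with rfl | hy'
      · rfl
      · exact (key y hy' x hx hxy.symm).symm
    · exact key x hx' y hy hxy

open Classical in
/-- Contraction of an edge does not change the set of components. -/
theorem numComp_contract {t : Γ.H} (ht : Γ.vert t ≠ Γ.vert (Γ.inv t)) :
    (Γ.contract ht).numComp = Γ.numComp := by
  let p : Γ.V → Γ.ContractV t := fun v => if hv : v = Γ.vert (Γ.inv t) then ⟨Γ.vert t, ht⟩ else ⟨v, hv⟩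
  have hp : ∀ h : Γ.ContractH t, (Γ.contract ht).vert h = p (Γ.vert h.1) := fun h => rfl
  have hp₁ : p (Γ.vert (Γ.inv t)) = ⟨Γ.vert t, ht⟩ := dif_pos rfl
  have hp₂ : p (Γ.vert t) = ⟨Γ.vert t, ht⟩ := dif_neg ht
  have hq : ∀ v, Quot.mk Γ.Joined (p v).1 = Quot.mk Γ.Joined v := by
    intro v
    by_cases hv : v = Γ.vert (Γ.inv t)
    · rw [hv, hp₁, Γ.mk_vert_inv]
    · exact congrArg (fun z : Γ.ContractV t => Quot.mk Γ.Joined z.1) (dif_neg hv)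
  refine Nat.card_congr
    { toFun := Quot.lift (fun v => Quot.mk Γ.Joined v.1) ?_
      invFun := Quot.lift (fun v => Quot.mk (Γ.contract ht).Joined (p v)) ?_
      left_inv := ?_
      right_inv := ?_ }
  · rintro _ _ ⟨h, rfl, rfl⟩
    exact (hq _).trans ((Γ.mk_vert_inv h.1).symm.trans (hq _).symm)
  · rintro _ _ ⟨h, rfl, rfl⟩
    by_cases h₁ : h = t
    · rw [h₁, hp₁, hp₂]
    by_cases h₂ : h = Γ.inv t
    · rw [h₂, Γ.inv_inv, hp₁, hp₂]
    · exact Quot.sound ⟨(⟨h, h₁, h₂⟩ : Γ.ContractH t), rfl, rfl⟩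
  · rintro ⟨v⟩
    exact congrArg (Quot.mk _) (dif_neg v.2)
  · rintro ⟨v⟩
    exact hq v

end Counting

end OGraph
end GraphComplex
namespace GraphComplex
variable {k : Type u} [Field k] {O : CyclicOperad.{u, w} k}
namespace OGraph

/-! ### Attaching a polygon commutes with contracting an edge that it does not use. -/

section Repair

/-- Replace the pairing of the half-edges and the directions of the edges. -/
def repair (Γ : OGraph O) (ι : Γ.H → Γ.H) (h₁ : ∀ h, ι (ι h) = h) (h₂ : ∀ h, ι h ≠ h)
    (T : Γ.H → Prop) (h₃ : ∀ h, T (ι h) ↔ ¬ T h) : OGraph O :=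
  { Γ with inv := ι, inv_inv := h₁, inv_ne := h₂, tail := T, tail_inv := h₃ }

/-- Attaching polygons to `Γ` alters only the pairing and the directions, so any iterated attachment
is definitionally a `repair` of `Γ`. Two of them can thus be compared pointwise, without
isomorphisms. -/
theorem contractCls₂_repair_congr (Γ : OGraph O) {ι ι' : Γ.H → Γ.H} {T T' : Γ.H → Prop}
    (h₁ h₂ h₃ h₁' h₂' h₃') (hι : ∀ h, ι h = ι' h) (hT : ∀ h, T h ↔ T' h) (t x : Γ.H) :
    (Γ.repair ι h₁ h₂ T h₃).contractCls₂ t x = (Γ.repair ι' h₁' h₂' T' h₃').contractCls₂ t x := by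
  obtain rfl : ι = ι' := funext hι
  obtain rfl : T = T' := funext fun h => propext (hT h)
  rfl

theorem numComp_repair_congr (Γ : OGraph O) {ι ι' : Γ.H → Γ.H} {T T' : Γ.H → Prop}
    (h₁ h₂ h₃ h₁' h₂' h₃') (hι : ∀ h, ι h = ι' h) :
    (Γ.repair ι h₁ h₂ T h₃).numComp = (Γ.repair ι' h₁' h₂' T' h₃').numComp := by
  obtain rfl : ι = ι' := funext hι
  rfl

end Repair

section Commute
variable (Γ : OGraph O)

theorem contractSign_attachList {l : List Γ.H} (hl : Γ.IsSep l) {t : Γ.H} (h₁ : t ∉ l)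
    (h₂ : Γ.inv t ∉ l) : contractSign k (Γ.attachList l hl) t = contractSign k Γ t := by
  classical
  have e₁ : cyc l (Γ.inv ((cyc l).symm t)) = Γ.inv t := attachList_inv_of_notMem Γ hl h₁ h₂
  have e₂ : Γ.aligned l t ↔ Γ.tail t := by simp [aligned, h₁, h₂]
  have key : (if Γ.aligned l t then (1 : k) else -1) *
      (-1) ^ (Nat.card {v : Γ.V // Γ.lt v (Γ.vert (cyc l (Γ.inv ((cyc l).symm t))))} + 1) =
      contractSign k Γ t := by
    rw [e₁, contractSign]
    simp only [e₂]
  exact key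

open Classical in
/-- Attach a polygon, then contract the edge that starts with `t`, then the one that starts
with `x`. -/
noncomputable def attachTerm₂ (t : Γ.H) (l : List Γ.H) (x : Γ.H) : GraphSpace O :=
  if hl : Γ.IsSep l then attachSgn k Γ l • (Γ.attachList l hl).contractCls₂ t x else 0

theorem attachTerm₂_of {l : List Γ.H} (hl : Γ.IsSep l) (t x : Γ.H) :
    Γ.attachTerm₂ t l x = attachSgn k Γ l • (Γ.attachList l hl).contractCls₂ t x := dif_pos hl

open Classical in
/-- The contribution of a list to the fission operation on the contraction of `t`. -/
noncomputable def fissionTerm₂ (t : Γ.H) (l : List Γ.H) : GraphSpace O :=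
  if Γ.Splits l ∧ t ∉ l ∧ Γ.inv t ∉ l then
    match l.head? with
    | none => 0
    | some x => Γ.attachTerm₂ t l x
  else 0

theorem fissionTerm₂_of {t : Γ.H} {l : List Γ.H} {x : Γ.H} (h : Γ.Splits l ∧ t ∉ l ∧ Γ.inv t ∉ l)
    (hx : l.head? = some x) : Γ.fissionTerm₂ t l = Γ.attachTerm₂ t l x := by
  rw [fissionTerm₂, if_pos h, hx]

theorem fissionTerm₂_of_not {t : Γ.H} {l : List Γ.H} (h : ¬ (Γ.Splits l ∧ t ∉ l ∧ Γ.inv t ∉ l)) :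
    Γ.fissionTerm₂ t l = 0 := if_neg h

variable {Γ} {t : Γ.H}

theorem isSep_contract (ht : Γ.vert t ≠ Γ.vert (Γ.inv t)) (l : List (Γ.ContractH t)) :
    (Γ.contract ht).IsSep l ↔ Γ.IsSep (l.map Subtype.val) := by
  refine and_congr (List.nodup_map_iff Subtype.val_injective).symm ?_
  rw [List.forall_mem_map]
  refine forall_congr' fun h => forall_congr' fun _ => not_congr ?_
  exact (List.mem_map_of_injective (f := Subtype.val) Subtype.val_injective
    (a := (Γ.contract ht).inv h)).symm

theorem attachSgn_contract (ht : Γ.vert t ≠ Γ.vert (Γ.inv t)) (l : List (Γ.ContractH t)) :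
    attachSgn k (Γ.contract ht) l = attachSgn k Γ (l.map Subtype.val) := by
  refine Eq.trans (b := (l.map fun h : Γ.ContractH t => sg k (¬ Γ.tail h.1)).prod) rfl ?_
  rw [attachSgn, List.map_map]
  rfl

theorem notMem_map_val (l : List (Γ.ContractH t)) :
    t ∉ l.map Subtype.val ∧ Γ.inv t ∉ l.map Subtype.val := by
  simp only [List.mem_map, not_exists, not_and]
  exact ⟨fun h _ e => h.2.1 e, fun h _ e => h.2.2 e⟩

theorem vert_ne_attachList (ht : Γ.vert t ≠ Γ.vert (Γ.inv t)) {l : List Γ.H} (hl : Γ.IsSep l) (h₁ : t ∉ l) (h₂ : Γ.inv t ∉ l) :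
    (Γ.attachList l hl).vert t ≠ (Γ.attachList l hl).vert ((Γ.attachList l hl).inv t) :=
  fun e => ht (e.trans (congrArg Γ.vert (attachList_inv_of_notMem Γ hl h₁ h₂)))

/-- Attaching a polygon away from `t` commutes with the contraction of `t`. -/
noncomputable def attachContractIso (ht : Γ.vert t ≠ Γ.vert (Γ.inv t)) {l : List (Γ.ContractH t)} (hl : (Γ.contract ht).IsSep l)
    (hl' : Γ.IsSep (l.map Subtype.val)) :
    ((Γ.contract ht).attachList l hl).Iso ((Γ.attachList (l.map Subtype.val) hl').contract
      (vert_ne_attachList ht hl' (notMem_map_val l).1 (notMem_map_val l).2)) :=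
  -- The polygon leaves vertices, half-edges and labels alone, so the identity is a `PreIso`. To
  -- pass to the contractions it is enough that the two halves of `t` are still paired.
  let φ : PreIso Γ (Γ.attachList (l.map Subtype.val) hl') :=
    ⟨Equiv.refl _, Equiv.refl _, fun _ => rfl, fun v => Γ.deco_eq_map_refl v⟩
  let ψ := φ.contract rfl
    (attachList_inv_of_notMem Γ hl' (notMem_map_val l).1 (notMem_map_val l).2).symm ht
      (vert_ne_attachList ht hl' (notMem_map_val l).1 (notMem_map_val l).2)
  { onV := ψ.onV
    onH := ψ.onH
    vert_eq := ψ.vert_eq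
    deco_eq := ψ.deco_eq
    inv_eq := by
      have key : ∀ h : Γ.ContractH t, cyc (l.map Subtype.val) (Γ.inv ((cyc (l.map Subtype.val)).symm h.1)) =
          (cyc l ((Γ.contract ht).inv ((cyc l).symm h))).1 := fun h => by
        rw [cyc_map_symm Subtype.val_injective]
        exact cyc_map Subtype.val_injective l ((Γ.contract ht).inv ((cyc l).symm h))
      exact fun h => Subtype.ext (key h)
    lt_iff := fun _ _ => Iff.rfl
    tail_iff := by
      have key : ∀ h : Γ.ContractH t, Γ.aligned (l.map Subtype.val) h.1 ↔ (Γ.contract ht).aligned l h :=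
        fun h => or_congr (List.mem_map_of_injective Subtype.val_injective)
          (and_congr (not_congr (List.mem_map_of_injective (f := Subtype.val) Subtype.val_injective
            (a := (Γ.contract ht).inv h))) Iff.rfl)
      exact fun h => key h }

theorem numComp_attachList_contract (ht : Γ.vert t ≠ Γ.vert (Γ.inv t)) {l : List (Γ.ContractH t)} (hl : (Γ.contract ht).IsSep l)
    (hl' : Γ.IsSep (l.map Subtype.val)) : ((Γ.contract ht).attachList l hl).numComp =
      (Γ.attachList (l.map Subtype.val) hl').numComp :=
  (attachContractIso ht hl hl').numComp_eq.symm.trans (numComp_contract _ _)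

theorem splits_contract (ht : Γ.vert t ≠ Γ.vert (Γ.inv t)) (l : List (Γ.ContractH t)) :
    (Γ.contract ht).Splits l ↔ Γ.Splits (l.map Subtype.val) := by
  constructor
  · rintro ⟨hl, h⟩
    have hl' := (isSep_contract ht l).1 hl
    refine ⟨hl', ?_⟩
    rw [numComp_attachList_contract ht hl hl', numComp_contract] at h
    exact h.trans (congrArg _ (List.length_map _).symm)
  · rintro ⟨hl', h⟩
    have hl := (isSep_contract ht l).2 hl'
    refine ⟨hl, ?_⟩
    rw [numComp_attachList_contract ht hl hl', numComp_contract]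
    exact h.trans (congrArg _ (List.length_map _))

theorem fissionTerm_contract (ht : Γ.vert t ≠ Γ.vert (Γ.inv t)) (l : List (Γ.ContractH t)) :
    contractSign k Γ t • (Γ.contract ht).fissionTerm l = Γ.fissionTerm₂ t (l.map Subtype.val) := by
  by_cases h : Γ.Splits (l.map Subtype.val)
  · have h' := (splits_contract ht l).2 h
    rw [fissionTerm_of _ h']
    cases l with
    | nil => rw [fissionTerm₂, if_pos ⟨h, by simp⟩]; exact smul_zero _
    | cons x l =>
      have hn := notMem_map_val (x :: l)
      rw [fissionTerm₂_of Γ ⟨h, hn⟩ (x := x.1) rfl]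
      obtain ⟨hl, -⟩ := id h
      obtain ⟨hl', -⟩ := id h'
      rw [attachTerm₂_of Γ hl, contractCls₂_of (Γ.attachList ((x :: l).map Subtype.val) hl)
        (t := t) (t' := x.1) (vert_ne_attachList ht hl hn.1 hn.2)
        ⟨x.2.1, fun e => x.2.2 (e.trans (attachList_inv_of_notMem Γ hl hn.1 hn.2))⟩,
        contractSign_attachList Γ hl hn.1 hn.2, smul_comm]
      refine congrArg _ ((attachTerm_of (Γ.contract ht) (l := x :: l) hl' x).trans ?_)
      exact congrArg₂ (· • ·) (attachSgn_contract ht (x :: l))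
        (contractCls_iso (attachContractIso ht hl' hl) x).symm
  · rw [fissionTerm₂_of_not Γ fun h' => h h'.1,
      fissionTerm_of_not _ (mt (splits_contract ht l).1 h), smul_zero]

-- The lists of half-edges of the contraction are the lists in `Γ` that avoid both halves of `t`.
-- The operation on the contraction thus becomes a sum over lists in `Γ`, with both contractions
-- done last; if `t` is a loop, both sides are zero.
variable (Γ) in
theorem fission_contractCls (j : ℕ) (t : Γ.H) :
    fission O j (Γ.contractCls t) = ∑ l ∈ Γ.words j, Γ.fissionTerm₂ t l := by
  classical
  by_cases ht : Γ.vert t = Γ.vert (Γ.inv t)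
  · rw [contractCls_of_eq _ ht, map_zero]
    refine (Finset.sum_eq_zero fun l _ => ?_).symm
    by_cases h : Γ.Splits l ∧ t ∉ l ∧ Γ.inv t ∉ l
    · cases l with
      | nil => rw [fissionTerm₂, if_pos h]; rfl
      | cons x l =>
        obtain ⟨hl, -⟩ := h.1
        rw [fissionTerm₂_of Γ h (x := x) rfl, attachTerm₂_of Γ hl]
        refine (congrArg _ (contractCls₂_of_eq (Γ.attachList (x :: l) hl) (t := t) ?_ x)).trans
          (smul_zero _)
        exact ht.trans (congrArg Γ.vert (attachList_inv_of_notMem Γ hl h.2.1 h.2.2).symm)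
    · exact fissionTerm₂_of_not Γ h
  · rw [contractCls_of_ne Γ ht, map_smul, fission_cls, fissionSum, Finset.smul_sum]
    refine Finset.sum_bij_ne_zero (fun l _ _ => l.map Subtype.val) (fun l hl _ => ?_)
      (fun l _ _ l' _ _ h => List.map_injective_iff.2 Subtype.val_injective h) (fun l hl h => ?_)
      (fun l _ _ => fissionTerm_contract ht l)
    · rw [mem_words] at hl ⊢
      exact ⟨(List.length_map _).trans hl.1, (isSep_contract ht l).1 hl.2⟩
    · have hl' : Γ.Splits l ∧ t ∉ l ∧ Γ.inv t ∉ l := by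
        by_contra hn
        exact h (fissionTerm₂_of_not Γ hn)
      have hm : ∀ x ∈ l, x ≠ t ∧ x ≠ Γ.inv t := fun x hx =>
        ⟨fun e => hl'.2.1 (e ▸ hx), fun e => hl'.2.2 (e ▸ hx)⟩
      have e : (l.attach.map fun x => (⟨x.1, hm x.1 x.2⟩ : Γ.ContractH t)).map Subtype.val = l := by
        rw [List.map_map]
        exact List.attach_map_subtype_val l
      rw [mem_words] at hl
      refine ⟨l.attach.map fun x => (⟨x.1, hm x.1 x.2⟩ : Γ.ContractH t), ?_, ?_, e⟩
      · rw [mem_words]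
        exact ⟨(List.length_map _).trans (List.length_attach.trans hl.1), (isSep_contract ht _).2 (e.symm ▸ hl.2)⟩
      · intro h₀
        apply h
        rw [← e]
        exact (fissionTerm_contract ht _).symm.trans h₀

end Commute

/-! ### Reversing a polygon. -/

section Reverse
variable (Γ : OGraph O)

/-- The list of the reversed directed edges, in the reversed order. -/
def flip (l : List Γ.H) : List Γ.H := (l.map Γ.inv).reverse

theorem mem_flip {l : List Γ.H} {h : Γ.H} : h ∈ Γ.flip l ↔ Γ.inv h ∈ l := by
  have := List.mem_map_of_injective Γ.inv_injective (a := Γ.inv h) (l := l)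
  rw [Γ.inv_inv] at this
  rw [flip, List.mem_reverse, this]

theorem length_flip (l : List Γ.H) : (Γ.flip l).length = l.length := by
  rw [flip, List.length_reverse, List.length_map]

theorem flip_flip (l : List Γ.H) : Γ.flip (Γ.flip l) = l := by
  simp [flip, List.map_reverse, Function.comp_def, Γ.inv_inv]

variable {Γ} in
theorem IsSep.flip {l : List Γ.H} (hl : Γ.IsSep l) : Γ.IsSep (Γ.flip l) :=
  ⟨List.nodup_reverse.2 ((List.nodup_map_iff Γ.inv_injective).2 hl.1), fun h hh => by
    rw [mem_flip] at hh ⊢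
    exact hl.2 _ hh⟩

theorem cyc_flip_inv (l : List Γ.H) (h : Γ.H) : cyc (Γ.flip l) (Γ.inv h) = Γ.inv ((cyc l).symm h) := by
  rw [flip, cyc_reverse]
  exact cyc_map_symm Γ.inv_injective l h

theorem cyc_flip_symm_inv (l : List Γ.H) (h : Γ.H) :
    (cyc (Γ.flip l)).symm (Γ.inv h) = Γ.inv (cyc l h) := by
  rw [Equiv.symm_apply_eq, cyc_flip_inv, Equiv.symm_apply_apply]

/-- Reversing all the edges and their cyclic order joins the same heads to the same tails; only the
directions of the new edges change. -/
theorem attachList_flip_inv {l : List Γ.H} (hl : Γ.IsSep l) (h : Γ.H) :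
    (Γ.attachList (Γ.flip l) hl.flip).inv h = (Γ.attachList l hl).inv h := by
  by_cases h₁ : h ∈ l
  · rw [attachList_inv_of_mem Γ hl h₁]
    refine (attachList_inv_of_inv_mem Γ hl.flip ?_).trans (Γ.cyc_flip_inv l h)
    rwa [mem_flip, Γ.inv_inv]
  by_cases h₂ : Γ.inv h ∈ l
  · rw [attachList_inv_of_inv_mem Γ hl h₂]
    refine (attachList_inv_of_mem Γ hl.flip ((Γ.mem_flip).2 h₂)).trans ?_
    have := Γ.cyc_flip_symm_inv l (Γ.inv h)
    rw [Γ.inv_inv] at this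
    rw [this, Γ.inv_inv]
  · rw [attachList_inv_of_notMem Γ hl h₁ h₂]
    refine attachList_inv_of_notMem Γ hl.flip (mt (Γ.mem_flip).1 h₂) ?_
    rwa [mem_flip, Γ.inv_inv]

/-- Each edge of `l` gives two signs that cancel: one for aligning it with the opposite direction,
one for the reversal of a new edge. -/
theorem attachSgn_flip {l : List Γ.H} (hl : Γ.IsSep l) :
    attachSgn k Γ (Γ.flip l) *
      (-1) ^ (Γ.attachList l hl).changes Γ.lt (Γ.aligned (Γ.flip l)) = attachSgn k Γ l := by
  classical
  have iV : Fintype Γ.V := Fintype.ofFinite Γ.V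
  have iH : Fintype Γ.H := Fintype.ofFinite Γ.H
  have e : (-1 : k) ^ (Γ.attachList l hl).changes Γ.lt (Γ.aligned (Γ.flip l)) =
      (∏ v, ∏ w, sg k (Γ.lt v w ∧ Γ.lt w v)) *
        ∏ x, sg k (Γ.aligned l x ∧ ¬ Γ.aligned (Γ.flip l) x) :=
    @changes_sign k _ O (Γ.attachList l hl) iV iH _ _
  have e₁ : (∏ v, ∏ w, sg k (Γ.lt v w ∧ Γ.lt w v)) = 1 :=
    Finset.prod_eq_one fun v _ => Finset.prod_eq_one fun w _ =>
      sg_of_not fun h => Γ.lt_asymm' h.1 h.2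
  have e₂ : ∀ x, sg k (Γ.aligned l x ∧ ¬ Γ.aligned (Γ.flip l) x) =
      if x ∈ l.toFinset then -1 else 1 := by
    intro x
    have h₀ := hl.2 x
    have h₁ : (Γ.aligned l x ∧ ¬ Γ.aligned (Γ.flip l) x) ↔ x ∈ l := by
      simp only [aligned, mem_flip, Γ.inv_inv]
      tauto
    by_cases hx : x ∈ l
    · rw [if_pos (List.mem_toFinset.2 hx), sg_of (h₁.2 hx)]
    · rw [if_neg (mt List.mem_toFinset.1 hx), sg_of_not (mt h₁.1 hx)]
  rw [e, e₁, one_mul, Finset.prod_congr rfl fun x _ => e₂ x, Finset.prod_ite_mem, Finset.univ_inter,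
    List.prod_toFinset _ hl.1, attachSgn, flip, List.map_reverse, List.prod_reverse, List.map_map,
    ← List.prod_map_mul, attachSgn]
  refine congrArg List.prod (List.map_congr_left fun x _ => ?_)
  change sg k (¬ Γ.tail (Γ.inv x)) * -1 = _
  rw [Γ.tail_inv, sg_not (¬ Γ.tail x), neg_mul_neg, mul_one]

theorem numComp_attachList_flip {l : List Γ.H} (hl : Γ.IsSep l) :
    (Γ.attachList (Γ.flip l) hl.flip).numComp = (Γ.attachList l hl).numComp :=
  numComp_repair_congr Γ _ _ _ _ _ _ (Γ.attachList_flip_inv hl)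

theorem splits_flip (l : List Γ.H) : Γ.Splits (Γ.flip l) ↔ Γ.Splits l := by
  constructor
  · rintro ⟨hl, h⟩
    have hl' : Γ.IsSep l := Γ.flip_flip l ▸ hl.flip
    exact ⟨hl', by rwa [numComp_attachList_flip Γ hl', length_flip] at h⟩
  · rintro ⟨hl, h⟩
    exact ⟨hl.flip, by rwa [numComp_attachList_flip Γ hl, length_flip]⟩

theorem attachTerm₂_flip {l : List Γ.H} (hl : Γ.IsSep l) (t x : Γ.H) :
    Γ.attachTerm₂ t (Γ.flip l) x = Γ.attachTerm₂ t l x := by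
  rw [attachTerm₂_of Γ hl, attachTerm₂_of Γ hl.flip]
  have hT : ∀ h, Γ.aligned (Γ.flip l) ((Γ.attachList l hl).inv h) ↔ ¬ Γ.aligned (Γ.flip l) h := fun h =>
    (iff_of_eq (congrArg (Γ.aligned (Γ.flip l)) (attachList_flip_inv Γ hl h).symm)).trans
      ((Γ.attachList (Γ.flip l) hl.flip).tail_inv h)
  have iS : IsStrictTotalOrder (Γ.attachList l hl).V Γ.lt := Γ.order
  have e₁ := contractCls₂_reorient (Γ.attachList l hl) Γ.lt (Γ.aligned (Γ.flip l)) hT t x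
  have e₂ : (Γ.attachList (Γ.flip l) hl.flip).contractCls₂ t x =
      ((Γ.attachList l hl).reorient Γ.lt (Γ.aligned (Γ.flip l)) hT).contractCls₂ t x :=
    contractCls₂_repair_congr Γ _ _ _ _ _ _ (Γ.attachList_flip_inv hl) (fun _ => Iff.rfl) t x
  rw [← attachSgn_flip Γ hl, mul_smul]
  exact congrArg _ (e₂.trans e₁)

theorem attachTerm₂_inv {l : List Γ.H} (hl : Γ.IsSep l) (t x : Γ.H) :
    Γ.attachTerm₂ t l ((Γ.attachList l hl).inv x) = Γ.attachTerm₂ t l x := by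
  refine (attachTerm₂_of Γ hl t _).trans (Eq.trans ?_ (attachTerm₂_of Γ hl t x).symm)
  exact congrArg _ (contractCls₂_inv_right (Γ.attachList l hl) t x)

/-- The contracted edge is the same as well: the head of `flip l` is the opposite of the last
element of `l`, which is the other half of the new edge that starts with the head of `l`. -/
theorem fissionTerm₂_flip (t : Γ.H) (l : List Γ.H) :
    Γ.fissionTerm₂ t (Γ.flip l) = Γ.fissionTerm₂ t l := by
  have hc : (Γ.Splits (Γ.flip l) ∧ t ∉ Γ.flip l ∧ Γ.inv t ∉ Γ.flip l) ↔
      Γ.Splits l ∧ t ∉ l ∧ Γ.inv t ∉ l := by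
    rw [splits_flip, mem_flip, mem_flip, Γ.inv_inv, and_comm (a := t ∉ l)]
  by_cases h : Γ.Splits l ∧ t ∉ l ∧ Γ.inv t ∉ l
  · obtain ⟨hl, -⟩ := h.1
    cases l with
    | nil => rfl
    | cons x l =>
      have hlast : (x :: l) ≠ [] := List.cons_ne_nil _ _
      have hh : (Γ.flip (x :: l)).head? = some (Γ.inv ((x :: l).getLast hlast)) := by
        rw [flip, List.head?_reverse, List.getLast?_map, List.getLast?_eq_some_getLast hlast]
        rfl
      have hcyc : cyc (x :: l) ((x :: l).getLast hlast) = x := by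
        classical
        exact List.formPerm_apply_getLast x l
      have hx : (Γ.attachList (x :: l) hl).inv x = Γ.inv ((x :: l).getLast hlast) :=
        (attachList_inv_of_mem Γ hl List.mem_cons_self).trans
          (congrArg Γ.inv ((Equiv.symm_apply_eq _).2 hcyc.symm))
      rw [fissionTerm₂_of Γ (hc.2 h) hh, fissionTerm₂_of Γ h (x := x) rfl, attachTerm₂_flip Γ hl,
        ← hx, attachTerm₂_inv]
  · rw [fissionTerm₂_of_not Γ h, fissionTerm₂_of_not Γ (mt hc.1 h)]

end Reverse

end OGraph
end GraphComplex
namespace GraphComplex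
variable {k : Type u} [Field k] {O : CyclicOperad.{u, w} k}

/-! ### Pairs of polygons and their common edges. -/

section Cyc
variable {α : Type}

theorem cyc_mul_comm {l l' : List α} (h : ∀ x ∈ l, x ∉ l') : cyc l * cyc l' = cyc l' * cyc l := by
  ext x
  simp only [Equiv.Perm.mul_apply]
  by_cases h₁ : x ∈ l
  · rw [cyc_of_notMem (h x h₁), cyc_of_notMem (h _ (cyc_mem_iff.2 h₁))]
  · by_cases h₂ : x ∈ l'
    · rw [cyc_of_notMem h₁, cyc_of_notMem fun h₃ => h _ h₃ (cyc_mem_iff.2 h₂)]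
    · rw [cyc_of_notMem h₁, cyc_of_notMem h₂, cyc_of_notMem h₁]

/-- Rotate one cycle so that `y` comes last and the other so that `y` comes first; then `cyc_append`
joins them at `y`. -/
theorem cyc_mul_cyc {A B C D : List α} {y : α} (h₁ : (A ++ y :: B).Nodup)
    (h₂ : (C ++ y :: D).Nodup) (h₃ : ((A ++ D) ++ (C ++ y :: B)).Nodup) :
    cyc (C ++ y :: D) * cyc (A ++ y :: B) = cyc ((A ++ D) ++ (C ++ y :: B)) := by
  have e₁ : cyc (A ++ y :: B) = cyc (y :: (B ++ A)) :=
    cyc_of_isRotated h₁ (List.isRotated_append (l := A) (l' := y :: B))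
  have e₂ : cyc (C ++ y :: D) = cyc ((D ++ C) ++ [y]) := by
    refine cyc_of_isRotated h₂ ?_
    have := List.isRotated_append (l := C ++ [y]) (l' := D)
    simpa using this
  have e₃ : cyc ((A ++ D) ++ (C ++ y :: B)) = cyc ((D ++ C) ++ y :: (B ++ A)) := by
    refine cyc_of_isRotated h₃ ?_
    have := List.isRotated_append (l := A) (l' := D ++ (C ++ y :: B))
    simpa using this
  rw [e₁, e₂, e₃, ← cyc_append]

end Cyc

namespace OGraph

section Pairs
variable (Γ : OGraph O)

open Classical in
/-- The contribution of a pair of lists to the composition of two fission operations. -/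
noncomputable def pairTerm (l l' : List Γ.H) : GraphSpace O :=
  if hl : Γ.IsSep l then
    if Γ.Splits l then
      match l.head? with
      | none => 0
      | some t => attachSgn k Γ l • (Γ.attachList l hl).fissionTerm₂ t l'
    else 0
  else 0

/-- The conditions under which a pair of lists contributes. -/
structure IsAdm (l l' : List Γ.H) (t x : Γ.H) : Prop where
  sep : Γ.IsSep l
  sep' : (Γ.attachList l sep).IsSep l'
  count : ((Γ.attachList l sep).attachList l' sep').numComp + 2 = Γ.numComp + l.length + l'.length
  head : l.head? = some t
  head' : l'.head? = some x
  notMem : t ∉ l'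
  inv_notMem : Γ.inv ((cyc l).symm t) ∉ l'

theorem numComp_attachList_succ_le {l : List Γ.H} (hl : Γ.IsSep l) {t : Γ.H} (h : l.head? = some t) :
    (Γ.attachList l hl).numComp + 1 ≤ Γ.numComp + l.length := by
  cases l with
  | nil => cases h
  | cons x l =>
    have := Γ.numComp_attachList_le hl
    rw [List.length_cons]
    omega

theorem fissionTerm₂_of_head?_eq_none {t : Γ.H} {l : List Γ.H} (h : l.head? = none) :
    Γ.fissionTerm₂ t l = 0 := by
  rw [fissionTerm₂, h]
  exact ite_self _

variable {Γ}

theorem Splits.mk_eq {l : List Γ.H} (h : Γ.Splits l) {x y : Γ.H} (hx : x ∈ l) (hy : y ∈ l) :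
    Quot.mk Γ.Joined (Γ.vert x) = Quot.mk Γ.Joined (Γ.vert y) := by
  cases l with
  | nil => cases hx
  | cons t l =>
    obtain ⟨hl, h⟩ := h
    have := (Γ.mk_eq_of_numComp_attachList hl (by rw [List.length_cons] at h; omega)).1
    exact (this x hx).trans (this y hy).symm

theorem Splits.eq_of_mk_eq {l : List Γ.H} (h : Γ.Splits l) (hl : Γ.IsSep l) {x y : Γ.H} (hx : x ∈ l)
    (hy : y ∈ l) (hxy : Quot.mk (Γ.attachList l hl).Joined (Γ.vert x) =
      Quot.mk (Γ.attachList l hl).Joined (Γ.vert y)) : x = y := by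
  cases l with
  | nil => cases hx
  | cons t l =>
    obtain ⟨_, h⟩ := h
    exact (Γ.mk_eq_of_numComp_attachList hl (by rw [List.length_cons] at h; omega)).2 x hx y hy hxy

theorem mem_of_head? {α : Type} {l : List α} {t : α} (h : l.head? = some t) : t ∈ l :=
  List.mem_of_mem_head? h

/-- Each attachment adds at most its length minus one to the number of components. If the total
growth is maximal, each of the two is maximal. -/
theorem IsAdm.splits {l l' : List Γ.H} {t x : Γ.H} (h : Γ.IsAdm l l' t x) : Γ.Splits l := by
  have h₁ := Γ.numComp_attachList_succ_le h.sep h.head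
  have h₂ : ((Γ.attachList l h.sep).attachList l' h.sep').numComp + 1 ≤
      (Γ.attachList l h.sep).numComp + @List.length Γ.H l' :=
    (Γ.attachList l h.sep).numComp_attachList_succ_le h.sep' h.head'
  have h₃ := h.count
  exact ⟨h.sep, by omega⟩

theorem IsAdm.splits' {l l' : List Γ.H} {t x : Γ.H} (h : Γ.IsAdm l l' t x) :
    (Γ.attachList l h.sep).Splits l' := by
  have h₁ := Γ.numComp_attachList_succ_le h.sep h.head
  have h₂ : ((Γ.attachList l h.sep).attachList l' h.sep').numComp + 1 ≤
      (Γ.attachList l h.sep).numComp + @List.length Γ.H l' :=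
    (Γ.attachList l h.sep).numComp_attachList_succ_le h.sep' h.head'
  have h₃ := h.count
  have h₄ : ((Γ.attachList l h.sep).attachList l' h.sep').numComp + 1 =
      (Γ.attachList l h.sep).numComp + @List.length Γ.H l' := by omega
  exact ⟨h.sep', h₄⟩

theorem pairTerm_eq {l l' : List Γ.H} {t x : Γ.H} (h : Γ.IsAdm l l' t x) :
    Γ.pairTerm l l' = attachSgn k Γ l • attachSgn k (Γ.attachList l h.sep) l' •
      ((Γ.attachList l h.sep).attachList l' h.sep').contractCls₂ t x := by
  rw [pairTerm, dif_pos h.sep, if_pos h.splits, h.head]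
  refine congrArg (attachSgn k Γ l • ·) ?_
  refine (fissionTerm₂_of (Γ.attachList l h.sep) (t := t) ⟨h.splits', h.notMem, ?_⟩ h.head').trans ?_
  · have := h.inv_notMem
    rwa [← attachList_inv_of_mem Γ h.sep (mem_of_head? h.head)] at this
  · exact attachTerm₂_of (Γ.attachList l h.sep) h.sep' t x

/-- Identities between terms need to be checked on admissible pairs only, as the other terms are
zero. The condition `count` in `IsAdm` involves just the final graph and the two lengths, which
makes it easy to transfer to other pairs. -/
theorem exists_isAdm {l l' : List Γ.H} (h : Γ.pairTerm l l' ≠ 0) : ∃ t x, Γ.IsAdm l l' t x := by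
  by_cases hl : Γ.IsSep l
  swap
  · exact absurd (dif_neg hl) h
  rw [pairTerm, dif_pos hl] at h
  by_cases hs : Γ.Splits l
  swap
  · exact absurd (if_neg hs) h
  rw [if_pos hs] at h
  cases ht : l.head? with
  | none => rw [ht] at h; exact absurd rfl h
  | some t =>
    rw [ht] at h
    have h₀ : (Γ.attachList l hl).fissionTerm₂ t l' ≠ 0 := fun e =>
      h ((congrArg (attachSgn k Γ l • ·) e).trans (smul_zero _))
    by_cases hc : (Γ.attachList l hl).Splits l' ∧ t ∉ l' ∧ (Γ.attachList l hl).inv t ∉ l'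
    swap
    · exact absurd (fissionTerm₂_of_not (Γ.attachList l hl) hc) h₀
    cases hx : l'.head? with
    | none => exact absurd (fissionTerm₂_of_head?_eq_none (Γ.attachList l hl) hx) h₀
    | some x =>
      obtain ⟨⟨hl', h₂⟩, h₃, h₄⟩ := hc
      obtain ⟨_, h₁⟩ := hs
      have h₂' : ((Γ.attachList l hl).attachList l' hl').numComp + 1 =
        (Γ.attachList l hl).numComp + @List.length Γ.H l' := h₂
      refine ⟨t, x, hl, hl', ?_, ht, hx, h₃, ?_⟩
      · omega
      · rwa [attachList_inv_of_mem Γ hl (mem_of_head? ht)] at h₄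

/-- The second polygon meets at most one edge of the first one. -/
theorem IsAdm.unique {l l' : List Γ.H} {t x : Γ.H} (h : Γ.IsAdm l l' t x) {y z : Γ.H}
    (hy : y ∈ l') (hz : z ∈ l') (hy' : y ∈ l ∨ Γ.inv y ∈ l) (hz' : z ∈ l ∨ Γ.inv z ∈ l) : y = z := by
  have key : Quot.mk (Γ.attachList l h.sep).Joined (Γ.vert y) =
      Quot.mk (Γ.attachList l h.sep).Joined (Γ.vert z) := h.splits'.mk_eq hy hz
  have key₂ : ∀ a ∈ l, ∀ b ∈ l, Quot.mk (Γ.attachList l h.sep).Joined (Γ.vert a) =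
      Quot.mk (Γ.attachList l h.sep).Joined (Γ.vert b) → a = b :=
    fun a ha b hb => h.splits.eq_of_mk_eq h.sep ha hb
  -- The half-edge `a` ends the new edge that starts with `cyc l (inv a)`, so the two lie in the
  -- same component.
  have key₃ : ∀ a, Γ.inv a ∈ l → Quot.mk (Γ.attachList l h.sep).Joined (Γ.vert (cyc l (Γ.inv a))) =
      Quot.mk (Γ.attachList l h.sep).Joined (Γ.vert a) := fun a ha => by
    have := (Γ.attachList l h.sep).mk_vert_inv a
    rwa [attachList_inv_of_inv_mem Γ h.sep ha] at this
  -- Since the new edges lie in different components, `a` and `b` would be the two halves of one new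
  -- edge, and `l'` cannot contain both.
  have key₄ : ∀ a ∈ l, ∀ b, Γ.inv b ∈ l → a ∈ l' → b ∈ l' →
      Quot.mk (Γ.attachList l h.sep).Joined (Γ.vert a) =
      Quot.mk (Γ.attachList l h.sep).Joined (Γ.vert b) → False := fun a ha b hb ha' hb' e => by
    have := key₂ a ha _ (cyc_mem_iff.2 hb) (e.trans (key₃ b hb).symm)
    have h₂ := h.sep'.2 b hb'
    rw [attachList_inv_of_inv_mem Γ h.sep hb, ← this] at h₂
    exact h₂ ha'
  rcases hy' with hy' | hy' <;> rcases hz' with hz' | hz'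
  · exact key₂ y hy' z hz' key
  · exact (key₄ y hy' z hz' hy hz key).elim
  · exact (key₄ z hz' y hy' hz hy key.symm).elim
  · have := key₂ _ (cyc_mem_iff.2 hy') _ (cyc_mem_iff.2 hz')
      ((key₃ y hy').trans (key.trans (key₃ z hz').symm))
    exact Γ.inv_injective ((cyc l).injective this)

variable (Γ) in
/-- No edge of one list is opposite to one of the other. -/
structure IsUnionSep (l l' : List Γ.H) : Prop where
  nodup : l.Nodup
  nodup' : l'.Nodup
  inv : ∀ h, h ∈ l ∨ h ∈ l' → ¬ (Γ.inv h ∈ l ∨ Γ.inv h ∈ l')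

theorem IsUnionSep.symm {l l' : List Γ.H} (h : Γ.IsUnionSep l l') : Γ.IsUnionSep l' l :=
  ⟨h.nodup', h.nodup, fun x hx hx' => h.inv x hx.symm hx'.symm⟩

theorem IsUnionSep.sep {l l' : List Γ.H} (h : Γ.IsUnionSep l l') : Γ.IsSep l :=
  ⟨h.nodup, fun x hx hx' => h.inv x (Or.inl hx) (Or.inl hx')⟩

theorem IsUnionSep.inv_notMem {l l' : List Γ.H} (h : Γ.IsUnionSep l l') {x : Γ.H} (hx : x ∈ l) :
    Γ.inv ((cyc l).symm x) ∉ l' :=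
  fun hx' => h.inv _ (Or.inl (cyc_symm_mem_iff.2 hx)) (Or.inr hx')

theorem IsUnionSep.sep' {l l' : List Γ.H} (h : Γ.IsUnionSep l l') :
    (Γ.attachList l h.sep).IsSep l' := by
  refine ⟨h.nodup', ?_⟩
  have key : ∀ x : Γ.H, x ∈ l' → cyc l (Γ.inv ((cyc l).symm x)) ∉ l' := fun x hx => by
    by_cases hx' : x ∈ l
    · rw [cyc_of_notMem fun h' => h.inv _ (Or.inl (cyc_symm_mem_iff.2 hx')) (Or.inl h')]
      exact h.inv_notMem hx'
    · rw [cyc_symm_of_notMem hx', cyc_of_notMem fun h' => h.inv x (Or.inr hx) (Or.inl h')]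
      exact fun h' => h.inv x (Or.inr hx) (Or.inr h')
  exact key

/-- The directions after both attachments depend only on the union of the two lists, not on their
order or on the multiplicity of a common element. -/
theorem IsUnionSep.aligned_iff {l l' : List Γ.H} (h : Γ.IsUnionSep l l') (x : Γ.H) :
    (Γ.attachList l h.sep).aligned l' x ↔
      (x ∈ l ∨ x ∈ l') ∨ (¬ (Γ.inv x ∈ l ∨ Γ.inv x ∈ l') ∧ Γ.tail x) := by
  have key : (x ∈ l' ∨ (cyc l (Γ.inv ((cyc l).symm x)) ∉ l' ∧ Γ.aligned l x)) ↔
      (x ∈ l ∨ x ∈ l') ∨ (¬ (Γ.inv x ∈ l ∨ Γ.inv x ∈ l') ∧ Γ.tail x) := by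
    rw [aligned]
    by_cases hx : x ∈ l
    · have h₁ : cyc l (Γ.inv ((cyc l).symm x)) ∉ l' := by
        rw [cyc_of_notMem fun h' => h.inv _ (Or.inl (cyc_symm_mem_iff.2 hx)) (Or.inl h')]
        exact h.inv_notMem hx
      tauto
    · by_cases hx' : Γ.inv x ∈ l
      · have h₁ := h.inv (Γ.inv x) (Or.inl hx')
        rw [Γ.inv_inv] at h₁
        tauto
      · rw [cyc_symm_of_notMem hx, cyc_of_notMem hx']
        tauto
  exact key

theorem IsAdm.isUnionSep {l l' : List Γ.H} {t x : Γ.H} (h : Γ.IsAdm l l' t x)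
    (h' : ∀ y ∈ l', Γ.inv y ∉ l) : Γ.IsUnionSep l l' := by
  refine ⟨h.sep.1, h.sep'.1, ?_⟩
  have key : ∀ y : Γ.H, y ∈ l' → y ∉ l → Γ.inv y ∉ l' := fun y hy hy' => by
    have := h.sep'.2 y hy
    rwa [attachList_inv_of_notMem Γ h.sep hy' (h' y hy)] at this
  have key₂ : ∀ y : Γ.H, y ∈ l → Γ.inv y ∉ l' := fun y hy hy' => by
    have := h' _ hy'
    rw [Γ.inv_inv] at this
    exact this hy
  rintro y (hy | hy) (hy' | hy')
  · exact h.sep.2 y hy hy'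
  · exact key₂ y hy hy'
  · exact h' y hy hy'
  · by_cases hyl : y ∈ l
    · exact key₂ y hyl hy'
    · exact key y hy hyl hy'

end Pairs
end OGraph
end GraphComplex
namespace GraphComplex
variable {k : Type u} [Field k] {O : CyclicOperad.{u, w} k}
namespace OGraph

/-! ### Polygons without a common edge. -/

section Disjoint
variable {Γ : OGraph O}

theorem IsUnionSep.attachSgn_of_disjoint {l l' : List Γ.H} (h : Γ.IsUnionSep l l')
    (hd : ∀ y ∈ l', y ∉ l) : attachSgn k (Γ.attachList l h.sep) l' = attachSgn k Γ l' := by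
  have key : ∀ x : Γ.H, x ∈ l' → (Γ.aligned l x ↔ Γ.tail x) := fun x hx => by
    have h₂ : Γ.inv x ∉ l := fun h' => h.inv x (Or.inr hx) (Or.inl h')
    simp [aligned, hd x hx, h₂]
  refine congrArg List.prod (List.map_congr_left fun x hx => ?_)
  exact congrArg (sg k) (propext (not_congr (key x hx)))

theorem IsUnionSep.attachList_comm_inv {l l' : List Γ.H} (h : Γ.IsUnionSep l l')
    (hd : ∀ y ∈ l', y ∉ l) (x : Γ.H) :
    ((Γ.attachList l h.sep).attachList l' h.sep').inv x =
      ((Γ.attachList l' h.symm.sep).attachList l h.symm.sep').inv x := by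
  have e := cyc_mul_comm hd
  have e₁ : ∀ z, cyc l' (cyc l z) = cyc l (cyc l' z) := fun z => congrArg (fun σ => σ z) e
  have e₂ : (cyc l).symm ((cyc l').symm x) = (cyc l').symm ((cyc l).symm x) := by
    rw [Equiv.symm_apply_eq, Equiv.symm_apply_eq, e₁, Equiv.apply_symm_apply, Equiv.apply_symm_apply]
  have key : cyc l' (cyc l (Γ.inv ((cyc l).symm ((cyc l').symm x)))) =
      cyc l (cyc l' (Γ.inv ((cyc l').symm ((cyc l).symm x)))) := by rw [e₁, e₂]
  exact key

theorem IsUnionSep.attachList_comm_tail {l l' : List Γ.H} (h : Γ.IsUnionSep l l') (x : Γ.H) :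
    ((Γ.attachList l h.sep).attachList l' h.sep').tail x ↔
      ((Γ.attachList l' h.symm.sep).attachList l h.symm.sep').tail x := by
  refine (h.aligned_iff x).trans (Iff.trans ?_ (h.symm.aligned_iff x).symm)
  rw [or_comm (a := x ∈ l), or_comm (a := Γ.inv x ∈ l)]

theorem IsUnionSep.isAdm_swap {l l' : List Γ.H} {t x : Γ.H} (h : Γ.IsUnionSep l l')
    (hd : ∀ y ∈ l', y ∉ l) (ha : Γ.IsAdm l l' t x) : Γ.IsAdm l' l x t where
  sep := h.symm.sep
  sep' := h.symm.sep'
  count := by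
    have e : ((Γ.attachList l h.sep).attachList l' h.sep').numComp =
        ((Γ.attachList l' h.symm.sep).attachList l h.symm.sep').numComp :=
      numComp_repair_congr Γ _ _ _ _ _ _ (h.attachList_comm_inv hd)
    have := ha.count
    omega
  head := ha.head'
  head' := ha.head
  notMem := hd x (mem_of_head? ha.head')
  inv_notMem := h.symm.inv_notMem (mem_of_head? ha.head')

/-- The attachments commute because the two cycles have disjoint supports, and the alignment signs
are independent. The minus sign comes from the two contractions. -/
theorem IsUnionSep.pairTerm_swap {l l' : List Γ.H} {t x : Γ.H} (h : Γ.IsUnionSep l l')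
    (hd : ∀ y ∈ l', y ∉ l) (ha : Γ.IsAdm l l' t x) : Γ.pairTerm l l' = - Γ.pairTerm l' l := by
  have hd' : ∀ y ∈ l, y ∉ l' := fun y hy hy' => hd y hy' hy
  rw [pairTerm_eq ha, pairTerm_eq (h.isAdm_swap hd ha), smul_smul, smul_smul, ← smul_neg]
  have e : ((Γ.attachList l h.sep).attachList l' h.sep').contractCls₂ t x =
      ((Γ.attachList l' h.symm.sep).attachList l h.symm.sep').contractCls₂ t x :=
    contractCls₂_repair_congr Γ _ _ _ _ _ _ (h.attachList_comm_inv hd) h.attachList_comm_tail t x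
  refine congrArg₂ (· • ·) ?_ (e.trans
    (contractCls₂_swap ((Γ.attachList l' h.symm.sep).attachList l h.symm.sep') t x))
  rw [h.attachSgn_of_disjoint hd, h.symm.attachSgn_of_disjoint hd', mul_comm]

theorem pairTerm_swap {l l' : List Γ.H} (hd : ∀ y ∈ l', y ∉ l ∧ Γ.inv y ∉ l) :
    Γ.pairTerm l l' = - Γ.pairTerm l' l := by
  have hd' : ∀ y ∈ l, y ∉ l' ∧ Γ.inv y ∉ l' := fun y hy =>
    ⟨fun hy' => (hd y hy').1 hy, fun hy' => (hd _ hy').2 (by rwa [Γ.inv_inv])⟩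
  by_cases h₁ : Γ.pairTerm l l' = 0
  · by_cases h₂ : Γ.pairTerm l' l = 0
    · rw [h₁, h₂, neg_zero]
    · obtain ⟨t, x, ha⟩ := exists_isAdm h₂
      rw [(ha.isUnionSep fun y hy => (hd' y hy).2).pairTerm_swap (fun y hy => (hd' y hy).1) ha, neg_neg]
  · obtain ⟨t, x, ha⟩ := exists_isAdm h₁
    exact (ha.isUnionSep fun y hy => (hd y hy).2).pairTerm_swap (fun y hy => (hd y hy).1) ha

end Disjoint

/-! ### Polygons with a common edge merge into one. -/

section Merge
variable (Γ : OGraph O)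

open Classical in
/-- Attach one polygon to the edges of both lists, then contract the new edges which start with the
heads of the two lists. -/
noncomputable def cutTerm (U Z : List Γ.H) : GraphSpace O :=
  if Γ.Splits (U ++ Z) then
    match U.head?, Z.head? with
    | some t, some x => Γ.attachTerm₂ t (U ++ Z) x
    | _, _ => 0
  else 0

theorem cutTerm_of {U Z : List Γ.H} (h : Γ.Splits (U ++ Z)) {t x : Γ.H} (hU : U.head? = some t)
    (hZ : Z.head? = some x) : Γ.cutTerm U Z = Γ.attachTerm₂ t (U ++ Z) x := by
  rw [cutTerm, if_pos h, hU, hZ]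

theorem exists_of_cutTerm_ne_zero {U Z : List Γ.H} (h : Γ.cutTerm U Z ≠ 0) :
    Γ.Splits (U ++ Z) ∧ ∃ t x, U.head? = some t ∧ Z.head? = some x := by
  rw [cutTerm] at h
  split_ifs at h with hs
  swap
  · exact absurd rfl h
  refine ⟨hs, ?_⟩
  cases hU : U.head? with
  | none => rw [hU] at h; exact absurd rfl h
  | some t =>
    cases hZ : Z.head? with
    | none => rw [hU, hZ] at h; exact absurd rfl h
    | some x => exact ⟨t, x, rfl, rfl⟩

variable {Γ}

theorem IsSep.isRotated {l l' : List Γ.H} (hl : Γ.IsSep l) (h : l ~r l') : Γ.IsSep l' :=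
  ⟨h.perm.nodup_iff.1 hl.1, fun x hx hx' => hl.2 x (h.perm.mem_iff.2 hx) (h.perm.mem_iff.2 hx')⟩

theorem IsSep.attachList_inv_of_isRotated {l l' : List Γ.H} (hl : Γ.IsSep l) (h : l ~r l') (x : Γ.H) :
    (Γ.attachList l hl).inv x = (Γ.attachList l' (hl.isRotated h)).inv x := by
  have key : cyc l (Γ.inv ((cyc l).symm x)) = cyc l' (Γ.inv ((cyc l').symm x)) := by
    rw [cyc_of_isRotated hl.1 h]
  exact key

theorem aligned_of_mem_iff {l l' : List Γ.H} (h : ∀ x, x ∈ l ↔ x ∈ l') (x : Γ.H) :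
    Γ.aligned l x ↔ Γ.aligned l' x := by
  rw [aligned, aligned, h, h]

theorem Splits.isRotated {l l' : List Γ.H} (hs : Γ.Splits l) (h : l ~r l') : Γ.Splits l' := by
  obtain ⟨hl, hc⟩ := hs
  refine ⟨hl.isRotated h, ?_⟩
  have e : (Γ.attachList l hl).numComp = (Γ.attachList l' (hl.isRotated h)).numComp :=
    numComp_repair_congr Γ _ _ _ _ _ _ (hl.attachList_inv_of_isRotated h)
  rw [← e, hc, h.perm.length_eq]

theorem attachTerm₂_of_isRotated {l l' : List Γ.H} (hl : Γ.IsSep l) (h : l ~r l') (t x : Γ.H) :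
    Γ.attachTerm₂ t l x = Γ.attachTerm₂ t l' x := by
  rw [attachTerm₂_of Γ hl, attachTerm₂_of Γ (hl.isRotated h)]
  exact congrArg₂ (· • ·) (h.perm.map _).prod_eq (contractCls₂_repair_congr Γ _ _ _ _ _ _
    (hl.attachList_inv_of_isRotated h) (aligned_of_mem_iff fun x => h.perm.mem_iff) t x)

theorem attachTerm₂_swap (t : Γ.H) (l : List Γ.H) (x : Γ.H) :
    Γ.attachTerm₂ t l x = - Γ.attachTerm₂ x l t := by
  by_cases hl : Γ.IsSep l
  · rw [attachTerm₂_of Γ hl, attachTerm₂_of Γ hl, ← smul_neg]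
    exact congrArg _ (contractCls₂_swap (Γ.attachList l hl) t x)
  · rw [attachTerm₂, attachTerm₂, dif_neg hl, dif_neg hl, neg_zero]

/-- A polygon depends only on the cyclic order of its edges, so `U ++ Z` and `Z ++ U` give the same
graph; only the order of the two contractions changes. -/
theorem cutTerm_swap_of {U Z : List Γ.H} (h : Γ.cutTerm U Z ≠ 0) :
    Γ.cutTerm U Z = - Γ.cutTerm Z U := by
  obtain ⟨hs, t, x, hU, hZ⟩ := exists_of_cutTerm_ne_zero Γ h
  have hr : (U ++ Z) ~r (Z ++ U) := List.isRotated_append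
  rw [cutTerm_of Γ hs hU hZ, cutTerm_of Γ (hs.isRotated hr) hZ hU, attachTerm₂_swap]
  obtain ⟨hl, -⟩ := hs
  rw [attachTerm₂_of_isRotated hl hr]

theorem cutTerm_swap (U Z : List Γ.H) : Γ.cutTerm U Z = - Γ.cutTerm Z U := by
  by_cases h : Γ.cutTerm U Z = 0
  · by_cases h' : Γ.cutTerm Z U = 0
    · rw [h, h', neg_zero]
    · rw [cutTerm_swap_of h', neg_neg]
  · exact cutTerm_swap_of h

variable {A B C D : List Γ.H} {y : Γ.H}

theorem perm_merge {α : Type} (A B C D : List α) (y : α) :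
    List.Perm ((A ++ D) ++ (C ++ y :: B)) ((A ++ y :: B) ++ (C ++ D)) := by
  classical
  rw [List.perm_iff_count]
  intro a
  simp only [List.count_append, List.count_cons]
  omega

theorem mem_merge_iff (x : Γ.H) : x ∈ (A ++ D) ++ (C ++ y :: B) ↔ x ∈ A ++ y :: B ∨ x ∈ C ++ y :: D := by
  simp only [List.mem_append, List.mem_cons]
  tauto

theorem IsAdm.isUnionSep_of_mem {l l' : List Γ.H} {t x : Γ.H} (h : Γ.IsAdm l l' t x) (hy : y ∈ l)
    (hy' : y ∈ l') : Γ.IsUnionSep l l' :=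
  h.isUnionSep fun z hz hz' => h.sep.2 y hy (by
    rwa [← h.unique hz hy' (Or.inr hz') (Or.inl hy)])

/-- By `IsAdm.unique` the half-edge `y` is the only one shared by the lists, and the merged list
contains it once. -/
theorem IsAdm.isSep_merge {t x : Γ.H} (h : Γ.IsAdm (A ++ y :: B) (C ++ y :: D) t x) :
    Γ.IsSep ((A ++ D) ++ (C ++ y :: B)) := by
  have hU : Γ.IsUnionSep (A ++ y :: B) (C ++ y :: D) := h.isUnionSep_of_mem (y := y) (by simp) (by simp)
  constructor
  · rw [(perm_merge A B C D y).nodup_iff, List.nodup_append']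
    have h' : (y :: (C ++ D)).Nodup := by
      have := hU.nodup'
      rwa [List.nodup_middle] at this
    refine ⟨hU.nodup, h'.of_cons, fun z hz hz' => ?_⟩
    have hz'' : z ∈ C ++ y :: D := by
      rw [List.mem_append] at hz' ⊢
      exact hz'.imp_right (List.mem_cons_of_mem _)
    have e : z = y := h.unique hz'' (by simp) (Or.inl hz) (Or.inl (by simp))
    exact (List.nodup_cons.1 h').1 (e ▸ hz')
  · intro z hz
    rw [mem_merge_iff] at hz ⊢
    exact hU.inv z hz

theorem IsSep.isUnionSep_of_merge (h : Γ.IsSep ((A ++ D) ++ (C ++ y :: B))) :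
    Γ.IsUnionSep (A ++ y :: B) (C ++ y :: D) := by
  have h₁ := h.1
  rw [(perm_merge A B C D y).nodup_iff] at h₁
  have h₂ : (y :: (C ++ D)).Nodup := by
    refine h₁.sublist ?_
    rw [List.append_assoc]
    refine List.Sublist.trans ?_ (List.sublist_append_right A _)
    exact List.Sublist.cons_cons y (List.sublist_append_right B _)
  refine ⟨(List.nodup_append'.1 h₁).1, List.nodup_middle.2 h₂, fun z hz hz' => ?_⟩
  rw [← mem_merge_iff] at hz hz'
  exact h.2 z hz hz'

/-- Two attachments conjugate the pairing by one cycle and then by the other, hence by their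
product, which `cyc_mul_cyc` identifies as a single cycle. -/
theorem attachList_merge_inv (hU : Γ.IsUnionSep (A ++ y :: B) (C ++ y :: D))
    (hW : Γ.IsSep ((A ++ D) ++ (C ++ y :: B))) (x : Γ.H) :
    ((Γ.attachList _ hU.sep).attachList _ hU.sep').inv x = (Γ.attachList _ hW).inv x := by
  have e := cyc_mul_cyc hU.nodup hU.nodup' hW.1
  have e₁ : ∀ z, cyc (C ++ y :: D) (cyc (A ++ y :: B) z) = cyc ((A ++ D) ++ (C ++ y :: B)) z :=
    fun z => congrArg (fun σ => σ z) e
  have e₂ : (cyc (A ++ y :: B)).symm ((cyc (C ++ y :: D)).symm x) =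
      (cyc ((A ++ D) ++ (C ++ y :: B))).symm x := by
    rw [Equiv.symm_apply_eq, Equiv.symm_apply_eq, e₁, Equiv.apply_symm_apply]
  have key : cyc (C ++ y :: D) (cyc (A ++ y :: B) (Γ.inv
      ((cyc (A ++ y :: B)).symm ((cyc (C ++ y :: D)).symm x)))) =
      cyc ((A ++ D) ++ (C ++ y :: B)) (Γ.inv ((cyc ((A ++ D) ++ (C ++ y :: B))).symm x)) := by
    rw [e₁, e₂]
  exact key

theorem attachList_merge_tail (hU : Γ.IsUnionSep (A ++ y :: B) (C ++ y :: D))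
    (hW : Γ.IsSep ((A ++ D) ++ (C ++ y :: B))) (x : Γ.H) :
    ((Γ.attachList _ hU.sep).attachList _ hU.sep').tail x ↔ (Γ.attachList _ hW).tail x := by
  refine (hU.aligned_iff x).trans ?_
  rw [← mem_merge_iff, ← mem_merge_iff]
  exact Iff.rfl

/-- The first polygon has already aligned `y`, so the second sign only sees `C` and `D`. Every edge
of the merged list is counted once. -/
theorem attachSgn_merge (hU : Γ.IsUnionSep (A ++ y :: B) (C ++ y :: D))
    (hW : Γ.IsSep ((A ++ D) ++ (C ++ y :: B))) :
    attachSgn k Γ (A ++ y :: B) * attachSgn k (Γ.attachList _ hU.sep) (C ++ y :: D) =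
      attachSgn k Γ ((A ++ D) ++ (C ++ y :: B)) := by
  have h₁ := hW.1
  rw [(perm_merge A B C D y).nodup_iff, List.nodup_append'] at h₁
  have e₁ : ∀ x ∈ C ++ D, sg k (¬ Γ.aligned (A ++ y :: B) x) = sg k (¬ Γ.tail x) := fun x hx => by
    have hx₁ : x ∉ A ++ y :: B := fun h => h₁.2.2 h hx
    have hx₂ : Γ.inv x ∉ A ++ y :: B := fun h => hU.inv x (Or.inr (by
      rw [List.mem_append] at hx ⊢
      exact hx.imp_right (List.mem_cons_of_mem _))) (Or.inl h)
    rw [aligned]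
    simp only [hx₁, hx₂, not_false_eq_true, true_and, false_or]
  have e₂ : attachSgn k (Γ.attachList _ hU.sep) (C ++ y :: D) =
      ((C ++ D).map fun x => sg k (¬ Γ.tail x)).prod := by
    refine Eq.trans (b := ((C ++ y :: D).map fun x => sg k (¬ Γ.aligned (A ++ y :: B) x)).prod) rfl ?_
    rw [(List.perm_middle.map _).prod_eq, List.map_cons, List.prod_cons, List.map_congr_left e₁,
      sg_of_not (fun h => h (Or.inl (by simp))), one_mul]
  rw [e₂, attachSgn, attachSgn, ((perm_merge A B C D y).map _).prod_eq, List.map_append (l₂ := C ++ D),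
    List.prod_append]

theorem pairTerm_merge_of_isAdm {t x : Γ.H} (h : Γ.IsAdm (A ++ y :: B) (C ++ y :: D) t x) :
    Γ.pairTerm (A ++ y :: B) (C ++ y :: D) = Γ.attachTerm₂ t ((A ++ D) ++ (C ++ y :: B)) x := by
  have hU : Γ.IsUnionSep (A ++ y :: B) (C ++ y :: D) := h.isUnionSep_of_mem (y := y) (by simp) (by simp)
  rw [pairTerm_eq h, attachTerm₂_of Γ h.isSep_merge, smul_smul, ← attachSgn_merge hU h.isSep_merge]
  exact congrArg _ (contractCls₂_repair_congr Γ _ _ _ _ _ _ (attachList_merge_inv hU h.isSep_merge)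
    (attachList_merge_tail hU h.isSep_merge) t x)

theorem numComp_merge (hU : Γ.IsUnionSep (A ++ y :: B) (C ++ y :: D))
    (hW : Γ.IsSep ((A ++ D) ++ (C ++ y :: B))) :
    ((Γ.attachList _ hU.sep).attachList _ hU.sep').numComp = (Γ.attachList _ hW).numComp :=
  numComp_repair_congr Γ _ _ _ _ _ _ (attachList_merge_inv hU hW)

/-- The contracted edges correspond: as `A` is nonempty, the head of the first piece is that of the
first list; the second piece starts as the second list does, with `y` if `C` is empty. -/
theorem head?_merge (hA : A ≠ []) : ((A ++ D).head? = (A ++ y :: B).head?) ∧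
    (C ++ y :: B).head? = (C ++ y :: D).head? := by
  cases A with
  | nil => exact absurd rfl hA
  | cons a A => cases C <;> simp

theorem IsAdm.splits_merge {t x : Γ.H} (h : Γ.IsAdm (A ++ y :: B) (C ++ y :: D) t x) :
    Γ.Splits ((A ++ D) ++ (C ++ y :: B)) := by
  have hU : Γ.IsUnionSep (A ++ y :: B) (C ++ y :: D) := h.isUnionSep_of_mem (y := y) (by simp) (by simp)
  have h₁ := numComp_merge hU h.isSep_merge
  have h₂ := h.count
  have h₃ := (perm_merge A B C D y).length_eq
  refine ⟨h.isSep_merge, ?_⟩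
  rw [← h₁]
  simp only [List.length_append, List.length_cons] at h₂ h₃ ⊢
  omega

/-- The converse direction: a polygon that splits maximally, cut in two pieces, always comes from an
admissible pair. The head `t` lies in `A`, so it cannot occur in the second list. -/
theorem isAdm_of_merge (hA : A ≠ []) (hs : Γ.Splits ((A ++ D) ++ (C ++ y :: B))) {t x : Γ.H}
    (ht : (A ++ D).head? = some t) (hx : (C ++ y :: B).head? = some x) :
    Γ.IsAdm (A ++ y :: B) (C ++ y :: D) t x := by
  obtain ⟨hW, hc⟩ := hs
  have hU := hW.isUnionSep_of_merge
  obtain ⟨h₁, h₂⟩ := head?_merge (B := B) (C := C) (D := D) (y := y) hA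
  have ht' := h₁.symm.trans ht
  refine ⟨hU.sep, hU.sep', ?_, ht', h₂.symm.trans hx, ?_, hU.inv_notMem (mem_of_head? ht')⟩
  · rw [numComp_merge hU hW]
    have h₃ := (perm_merge A B C D y).length_eq
    simp only [List.length_append, List.length_cons] at hc h₃ ⊢
    omega
  · have hA' : t ∈ A := by
      cases A with
      | nil => exact absurd rfl hA
      | cons a A =>
        obtain rfl : a = t := by simpa using ht
        exact List.mem_cons_self
    have h₁ := hW.1
    rw [(perm_merge A B C D y).nodup_iff, List.nodup_append'] at h₁
    intro ht
    rw [List.mem_append, List.mem_cons] at ht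
    have h₂ : t ∉ C ++ D := h₁.2.2 (List.mem_append_left _ hA')
    rw [List.mem_append] at h₂
    have h₃ : t ≠ y := fun e => (List.nodup_append'.1 h₁.1).2.2 hA' (e ▸ List.mem_cons_self)
    tauto

/-- If the lists meet, the two polygons can be replaced by a single one. -/
theorem pairTerm_merge (hA : A ≠ []) :
    Γ.pairTerm (A ++ y :: B) (C ++ y :: D) = Γ.cutTerm (A ++ D) (C ++ y :: B) := by
  have key : ∀ t x, Γ.IsAdm (A ++ y :: B) (C ++ y :: D) t x →
      Γ.pairTerm (A ++ y :: B) (C ++ y :: D) = Γ.cutTerm (A ++ D) (C ++ y :: B) := fun t x h => by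
    obtain ⟨h₁, h₂⟩ := head?_merge (B := B) (C := C) (D := D) (y := y) hA
    rw [pairTerm_merge_of_isAdm h, cutTerm_of Γ h.splits_merge (h₁.trans h.head) (h₂.trans h.head')]
  by_cases h₁ : Γ.pairTerm (A ++ y :: B) (C ++ y :: D) = 0
  · by_cases h₂ : Γ.cutTerm (A ++ D) (C ++ y :: B) = 0
    · rw [h₁, h₂]
    · obtain ⟨hs, t, x, ht, hx⟩ := exists_of_cutTerm_ne_zero Γ h₂
      exact key t x (isAdm_of_merge hA hs ht hx)
  · obtain ⟨t, x, h⟩ := exists_isAdm h₁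
    exact key t x h

end Merge
end OGraph
end GraphComplex
namespace GraphComplex
variable {k : Type u} [Field k] {O : CyclicOperad.{u, w} k}
namespace OGraph

/-! ### Cancellation in the sums over pairs of lists. -/

section Sums
variable (Γ : OGraph O)

/-- The lists of `n` directed edges. -/
noncomputable def lists (n : ℕ) : Finset (List Γ.H) := (List.finite_length_eq Γ.H n).toFinset

variable {Γ} in
theorem mem_lists {n : ℕ} {l : List Γ.H} : l ∈ Γ.lists n ↔ l.length = n := by
  simp [lists]

theorem words_subset_lists (n : ℕ) : Γ.words n ⊆ Γ.lists n := fun l hl => by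
  rw [mem_words] at hl
  exact mem_lists.2 hl.1

/-- The sum runs over all lists of length `j`, including those that are not separate and contribute
0, so that the index set does not depend on `l`. -/
theorem fission_fissionTerm (j : ℕ) (l : List Γ.H) :
    fission O j (Γ.fissionTerm l) = ∑ l' ∈ Γ.lists j, Γ.pairTerm l l' := by
  classical
  by_cases hs : Γ.Splits l
  swap
  · rw [fissionTerm_of_not _ hs, map_zero]
    refine (Finset.sum_eq_zero fun l' _ => ?_).symm
    rw [pairTerm]
    split_ifs <;> rfl
  obtain ⟨hl, -⟩ := id hs
  rw [fissionTerm_of Γ hs]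
  cases l with
  | nil =>
    rw [headTerm, map_zero]
    refine (Finset.sum_eq_zero fun l' _ => ?_).symm
    rw [pairTerm, dif_pos hl, if_pos hs]
    rfl
  | cons t l =>
    rw [headTerm, attachTerm_of Γ hl, map_smul]
    have e : ∀ l', Γ.pairTerm (t :: l) l' =
        attachSgn k Γ (t :: l) • (Γ.attachList (t :: l) hl).fissionTerm₂ t l' := fun l' => by
      rw [pairTerm, dif_pos hl, if_pos hs]
      rfl
    rw [Finset.sum_congr rfl fun l' _ => e l']
    refine Eq.trans ?_ (Finset.smul_sum (s := Γ.lists j)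
      (f := fun l' => (Γ.attachList (t :: l) hl).fissionTerm₂ t l'))
    refine congrArg _ ((fission_contractCls (Γ.attachList (t :: l) hl) j t).trans ?_)
    refine Finset.sum_subset (words_subset_lists (Γ.attachList (t :: l) hl) j) fun l' hl' hw => ?_
    refine fissionTerm₂_of_not (Γ.attachList (t :: l) hl) fun h => hw ?_
    obtain ⟨⟨h₁, -⟩, -⟩ := h
    exact mem_words.2 ⟨mem_lists.1 hl', h₁⟩

theorem fission_fission_cls (i j : ℕ) :
    fission O j (fission O i Γ.cls) = ∑ l ∈ Γ.lists i, ∑ l' ∈ Γ.lists j, Γ.pairTerm l l' := by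
  rw [fission_cls, fissionSum, map_sum, Finset.sum_congr rfl fun l _ => Γ.fission_fissionTerm j l]
  refine Finset.sum_subset (Γ.words_subset_lists i) fun l hl hw => ?_
  refine Finset.sum_eq_zero fun l' _ => dif_neg fun h => hw ?_
  exact mem_words.2 ⟨mem_lists.1 hl, h⟩

variable {Γ}

/-- The lists have an element in common. -/
def Meets (l l' : List Γ.H) : Prop := ∃ y ∈ l', y ∈ l

/-- An element of the second list is opposite to one of the first. -/
def MeetsInv (l l' : List Γ.H) : Prop := ∃ y ∈ l', Γ.inv y ∈ l

/-- The reversal takes place in the graph with the first polygon attached, where `y ∈ l` is paired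
with the opposite of its predecessor. It exchanges the two directions in which the second polygon
can run along a new edge of the first. -/
theorem meets_flip {l l' : List Γ.H} (hl : Γ.IsSep l) :
    Meets (Γ := Γ) l ((Γ.attachList l hl).flip l') ↔ MeetsInv l l' := by
  have key : ∀ y : Γ.H, y ∈ l → cyc l (Γ.inv ((cyc l).symm y)) = Γ.inv ((cyc l).symm y) :=
    fun y hy => attachList_inv_of_mem Γ hl hy
  constructor
  · rintro ⟨y, hy, hyl⟩
    have hy' : cyc l (Γ.inv ((cyc l).symm y)) ∈ l' := (mem_flip (Γ.attachList l hl)).1 hy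
    rw [key y hyl] at hy'
    refine ⟨_, hy', ?_⟩
    rw [Γ.inv_inv]
    exact cyc_symm_mem_iff.2 hyl
  · rintro ⟨y, hy, hyl⟩
    refine ⟨cyc l (Γ.inv y), (mem_flip (Γ.attachList l hl)).2 ?_, cyc_mem_iff.2 hyl⟩
    have e : cyc l (Γ.inv ((cyc l).symm (cyc l (Γ.inv y)))) = y := by
      rw [key _ (cyc_mem_iff.2 hyl), Equiv.symm_apply_apply, Γ.inv_inv]
    have hy' : cyc l (Γ.inv ((cyc l).symm (cyc l (Γ.inv y)))) ∈ l' := by rwa [e]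
    exact hy'

-- A contributing pair cannot meet in both ways: by `IsAdm.unique` one half-edge would be both in
-- `l` and opposite to an element of `l`.
open Classical in
theorem pairTerm_eq_add (l l' : List Γ.H) : Γ.pairTerm l l' =
    (if ¬ Meets (Γ := Γ) l l' ∧ ¬ MeetsInv l l' then Γ.pairTerm l l' else 0) +
      ((if Meets (Γ := Γ) l l' then Γ.pairTerm l l' else 0) +
        if MeetsInv l l' then Γ.pairTerm l l' else 0) := by
  by_cases h : Γ.pairTerm l l' = 0
  · simp [h]
  obtain ⟨t, x, ha⟩ := exists_isAdm h
  by_cases h₁ : Meets (Γ := Γ) l l'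
  · have h₂ : ¬ MeetsInv l l' := by
      obtain ⟨y, hy, hy'⟩ := h₁
      rintro ⟨z, hz, hz'⟩
      have := ha.unique hy hz (Or.inl hy') (Or.inr hz')
      exact ha.sep.2 y hy' (this ▸ hz')
    simp [h₁, h₂]
  · by_cases h₂ : MeetsInv l l' <;> simp [h₁, h₂]

theorem pairTerm_of_sep {l : List Γ.H} (hl : Γ.IsSep l) (hs : Γ.Splits l) (l' : List Γ.H) :
    Γ.pairTerm l l' = match l.head? with
      | none => 0
      | some t => attachSgn k Γ l • (Γ.attachList l hl).fissionTerm₂ t l' :=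
  (dif_pos hl).trans (if_pos hs)

theorem pairTerm_of_not_splits {l : List Γ.H} (hs : ¬ Γ.Splits l) (l' : List Γ.H) :
    Γ.pairTerm l l' = 0 := by
  by_contra h
  obtain ⟨t, x, ha⟩ := exists_isAdm h
  exact hs ha.splits

theorem pairTerm_flip {l : List Γ.H} (hl : Γ.IsSep l) (l' : List Γ.H) :
    Γ.pairTerm l ((Γ.attachList l hl).flip l') = Γ.pairTerm l l' := by
  by_cases hs : Γ.Splits l
  · refine (pairTerm_of_sep hl hs _).trans (Eq.trans ?_ (pairTerm_of_sep hl hs l').symm)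
    cases l.head? with
    | none => rfl
    | some t => exact congrArg (attachSgn k Γ l • ·) (fissionTerm₂_flip (Γ.attachList l hl) t l')
  · exact (pairTerm_of_not_splits hs _).trans (pairTerm_of_not_splits hs _).symm

-- Reversing the second polygon does not change the term, and by `meets_flip` it matches the two
-- index sets.
open Classical in
theorem sum_meetsInv (j : ℕ) (l : List Γ.H) :
    (∑ l' ∈ Γ.lists j, if MeetsInv l l' then Γ.pairTerm l l' else 0) =
      ∑ l' ∈ Γ.lists j, if Meets (Γ := Γ) l l' then Γ.pairTerm l l' else 0 := by
  by_cases hl : Γ.IsSep l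
  swap
  · have e : ∀ l', Γ.pairTerm l l' = 0 := fun l' => dif_neg hl
    simp [e]
  refine Finset.sum_nbij' (fun l' => (Γ.attachList l hl).flip l') (fun l' => (Γ.attachList l hl).flip l')
    (fun l' h => ?_) (fun l' h => ?_) (fun l' _ => flip_flip (Γ.attachList l hl) l')
    (fun l' _ => flip_flip (Γ.attachList l hl) l') (fun l' _ => ?_)
  · exact mem_lists.2 ((length_flip (Γ.attachList l hl) l').trans (mem_lists.1 h))
  · exact mem_lists.2 ((length_flip (Γ.attachList l hl) l').trans (mem_lists.1 h))
  · exact if_congr (meets_flip hl).symm (pairTerm_flip hl l').symm rfl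

-- The condition of having no common edge is symmetric in the two lists, so the sums can be matched
-- term by term.
open Classical in
theorem sum_disjoint (i j : ℕ) :
    (∑ l ∈ Γ.lists i, ∑ l' ∈ Γ.lists j,
        if ¬ Meets (Γ := Γ) l l' ∧ ¬ MeetsInv l l' then Γ.pairTerm l l' else 0) =
      - ∑ l ∈ Γ.lists j, ∑ l' ∈ Γ.lists i,
        if ¬ Meets (Γ := Γ) l l' ∧ ¬ MeetsInv l l' then Γ.pairTerm l l' else 0 := by
  rw [Finset.sum_comm, ← Finset.sum_neg_distrib]
  refine Finset.sum_congr rfl fun l' _ => ?_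
  rw [← Finset.sum_neg_distrib]
  refine Finset.sum_congr rfl fun l _ => ?_
  have hc : (¬ Meets (Γ := Γ) l l' ∧ ¬ MeetsInv l l') ↔ ¬ Meets (Γ := Γ) l' l ∧ ¬ MeetsInv l' l := by
    refine and_congr (not_congr ⟨?_, ?_⟩) (not_congr ⟨?_, ?_⟩)
    · rintro ⟨y, hy, hy'⟩; exact ⟨y, hy', hy⟩
    · rintro ⟨y, hy, hy'⟩; exact ⟨y, hy', hy⟩
    · rintro ⟨y, hy, hy'⟩; exact ⟨Γ.inv y, hy', by rwa [Γ.inv_inv]⟩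
    · rintro ⟨y, hy, hy'⟩; exact ⟨Γ.inv y, hy', by rwa [Γ.inv_inv]⟩
  by_cases h : ¬ Meets (Γ := Γ) l l' ∧ ¬ MeetsInv l l'
  · rw [if_pos h, if_pos (hc.1 h)]
    exact pairTerm_swap fun y hy => ⟨fun hy' => h.1 ⟨y, hy, hy'⟩, fun hy' => h.2 ⟨y, hy, hy'⟩⟩
  · rw [if_neg h, if_neg (mt hc.2 h), neg_zero]

variable (Γ) in
/-- The sum of the contributions of a single polygon, cut into two pieces. -/
noncomputable def cutSum (N n : ℕ) : GraphSpace O :=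
  ∑ W ∈ Γ.lists N, Γ.cutTerm (W.take n) (W.drop n)

/-- Rotating `W` by `m` places exchanges its two pieces. -/
theorem cutSum_swap (m n : ℕ) : Γ.cutSum (m + n) m = - Γ.cutSum (m + n) n := by
  rw [cutSum, cutSum, ← Finset.sum_neg_distrib]
  refine Finset.sum_nbij' (fun W => W.drop m ++ W.take m) (fun W => W.drop n ++ W.take n)
    (fun W h => ?_) (fun W h => ?_) (fun W h => ?_) (fun W h => ?_) (fun W h => ?_) <;>
    rw [mem_lists] at *
  · simp; omega
  · simp; omega
  · rw [List.drop_left' (by simp; omega), List.take_left' (by simp; omega), List.take_append_drop]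
  · rw [List.drop_left' (by simp; omega), List.take_left' (by simp; omega), List.take_append_drop]
  · rw [List.drop_left' (by simp; omega), List.take_left' (by simp; omega), cutTerm_swap]

theorem exists_eq_append_cons {l : List Γ.H} {n : ℕ} {y : Γ.H} (h : l[n]? = some y) :
    ∃ A B, l = A ++ y :: B ∧ A.length = n := by
  obtain ⟨hn, rfl⟩ := List.getElem?_eq_some_iff.1 h
  exact ⟨l.take n, l.drop (n + 1), by simp, by simp; omega⟩

/-- The list obtained by merging two lists with a common element at the given positions. -/
def merge (a c : ℕ) (l l' : List Γ.H) : List Γ.H :=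
  (l.take a ++ l'.drop (c + 1)) ++ (l'.take c ++ l.drop a)

/-- The inverse operation. -/
def unmerge (a c d : ℕ) (W : List Γ.H) : List Γ.H × List Γ.H :=
  (W.take a ++ W.drop (a + d + c), (W.drop (a + d)).take (c + 1) ++ (W.drop a).take d)

theorem merge_append {a c : ℕ} {A B C D : List Γ.H} {y : Γ.H} (hA : A.length = a) (hC : C.length = c) :
    merge a c (A ++ y :: B) (C ++ y :: D) = (A ++ D) ++ (C ++ y :: B) := by
  rw [merge, List.take_left' hA, List.take_left' hC, List.drop_left' hA,
    List.append_cons C y D, List.drop_left' (by simp [hC])]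

theorem unmerge_append {a c d : ℕ} {A B C D : List Γ.H} {y : Γ.H} (hA : A.length = a)
    (hC : C.length = c) (hD : D.length = d) :
    unmerge a c d ((A ++ D) ++ (C ++ y :: B)) = (A ++ y :: B, C ++ y :: D) := by
  have h₁ : ((A ++ D) ++ (C ++ y :: B)).take a = A := by
    rw [List.append_assoc, List.take_left' hA]
  have h₂ : ((A ++ D) ++ (C ++ y :: B)).drop a = D ++ (C ++ y :: B) := by
    rw [List.append_assoc, List.drop_left' hA]
  have h₃ : ((A ++ D) ++ (C ++ y :: B)).drop (a + d) = C ++ y :: B :=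
    List.drop_left' (by simp [hA, hD])
  have h₄ : ((A ++ D) ++ (C ++ y :: B)).drop (a + d + c) = y :: B := by
    rw [← List.drop_drop, h₃, List.drop_left' hC]
  have h₅ : (C ++ y :: B).take (c + 1) = C ++ [y] := by
    rw [List.append_cons, List.take_left' (by simp [hC])]
  rw [unmerge, h₁, h₄, h₃, h₂, h₅, List.take_left' hD, List.append_assoc]
  rfl

theorem exists_eq_merge {a b c d : ℕ} {W : List Γ.H} (h : W.length = a + d + (c + 1 + b)) :
    ∃ A B C D y, W = (A ++ D) ++ (C ++ y :: B) ∧ A.length = a ∧ B.length = b ∧ C.length = c ∧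
      D.length = d := by
  obtain ⟨y, hy⟩ : ∃ y, W[a + d + c]? = some y := ⟨_, List.getElem?_eq_getElem (by omega)⟩
  obtain ⟨P, B, e, hP⟩ := exists_eq_append_cons hy
  refine ⟨P.take a, B, P.drop (a + d), (P.drop a).take d, y, e.trans ?_, ?_, ?_, ?_, ?_⟩
  · rw [← List.append_assoc, List.append_assoc (P.take a), ← List.drop_drop,
      List.take_append_drop, List.take_append_drop]
  · simp; omega
  · have := congrArg List.length e
    simp at this
    omega
  · simp; omega
  · simp; omega

-- The common element `y` is preceded by `a + 1` and followed by `b` elements in the first list,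
-- preceded by `c` and followed by `d` in the second. For fixed positions `merge` is a bijection
-- onto all lists of the total length minus one, and the first piece `A ++ D` has length `a + 1 +
-- d`.
open Classical in
theorem sum_meetsAt (a b c d : ℕ) :
    (∑ p ∈ Γ.lists (a + 1 + 1 + b) ×ˢ Γ.lists (c + 1 + d),
      if ∃ y, p.1[a + 1]? = some y ∧ p.2[c]? = some y then Γ.pairTerm p.1 p.2 else 0) =
      Γ.cutSum (a + 1 + d + (c + 1 + b)) (a + 1 + d) := by
  rw [← Finset.sum_filter, cutSum]
  have key : ∀ p ∈ (Γ.lists (a + 1 + 1 + b) ×ˢ Γ.lists (c + 1 + d)).filter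
      (fun p => ∃ y, p.1[a + 1]? = some y ∧ p.2[c]? = some y),
      ∃ A B C D y, p = (A ++ y :: B, C ++ y :: D) ∧ A.length = a + 1 ∧ B.length = b ∧ C.length = c ∧
        D.length = d := by
    rintro ⟨l, l'⟩ h
    simp only [Finset.mem_filter, Finset.mem_product, mem_lists] at h
    obtain ⟨⟨h₁, h₂⟩, y, h₃, h₄⟩ := h
    obtain ⟨A, B, rfl, hA⟩ := exists_eq_append_cons h₃
    obtain ⟨C, D, rfl, hC⟩ := exists_eq_append_cons h₄
    simp only [List.length_append, List.length_cons] at h₁ h₂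
    exact ⟨A, B, C, D, y, rfl, hA, by omega, hC, by omega⟩
  refine Finset.sum_bij' (fun p _ => merge (a + 1) c p.1 p.2) (fun W _ => unmerge (a + 1) c d W)
    ?_ ?_ ?_ ?_ ?_
  · intro p h
    obtain ⟨A, B, C, D, y, rfl, hA, hB, hC, hD⟩ := key p h
    rw [merge_append hA hC, mem_lists]
    simp only [List.length_append, List.length_cons]
    omega
  · intro W h
    obtain ⟨A, B, C, D, y, rfl, hA, hB, hC, hD⟩ := exists_eq_merge (mem_lists.1 h)
    rw [unmerge_append hA hC hD]
    simp only [Finset.mem_filter, Finset.mem_product, mem_lists, List.length_append, List.length_cons]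
    refine ⟨⟨by omega, by omega⟩, y, ?_, ?_⟩
    · rw [← hA, List.getElem?_append_right le_rfl, Nat.sub_self]; rfl
    · rw [← hC, List.getElem?_append_right le_rfl, Nat.sub_self]; rfl
  · intro p h
    obtain ⟨A, B, C, D, y, rfl, hA, hB, hC, hD⟩ := key p h
    rw [merge_append hA hC, unmerge_append hA hC hD]
  · intro W h
    obtain ⟨A, B, C, D, y, rfl, hA, hB, hC, hD⟩ := exists_eq_merge (mem_lists.1 h)
    rw [unmerge_append hA hC hD, merge_append hA hC]
  · intro p h
    obtain ⟨A, B, C, D, y, rfl, hA, hB, hC, hD⟩ := key p h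
    rw [merge_append hA hC, List.take_left' (by simp; omega), List.drop_left' (by simp; omega)]
    exact pairTerm_merge (by rintro rfl; simp at hA)

open Classical in
/-- A pair of lists that meet and contribute do so in exactly one place, which is not the head of the
first list. -/
theorem pairTerm_eq_sum (i j : ℕ) {l l' : List Γ.H} (hl : l.length = i + 1) (hl' : l'.length = j) :
    (if Meets (Γ := Γ) l l' then Γ.pairTerm l l' else 0) = ∑ q ∈ Finset.range i ×ˢ Finset.range j,
      if ∃ y, l[q.1 + 1]? = some y ∧ l'[q.2]? = some y then Γ.pairTerm l l' else 0 := by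
  by_cases h : Γ.pairTerm l l' = 0
  · simp [h]
  obtain ⟨t, x, ha⟩ := exists_isAdm h
  by_cases hm : Meets (Γ := Γ) l l'
  swap
  · rw [if_neg hm]
    refine (Finset.sum_eq_zero fun q _ => if_neg ?_).symm
    rintro ⟨y, h₁, h₂⟩
    exact hm ⟨y, List.mem_of_getElem? h₂, List.mem_of_getElem? h₁⟩
  rw [if_pos hm]
  obtain ⟨y, hy', hy⟩ := hm
  obtain ⟨n, hn⟩ := List.mem_iff_getElem?.1 hy
  obtain ⟨m, hm⟩ := List.mem_iff_getElem?.1 hy'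
  have hn₁ := (List.getElem?_eq_some_iff.1 hn).1
  have hm₁ := (List.getElem?_eq_some_iff.1 hm).1
  obtain ⟨n, rfl⟩ : ∃ n', n = n' + 1 := by
    cases n with
    | zero =>
      have ht := ha.head
      rw [List.head?_eq_getElem?, hn, Option.some.injEq] at ht
      exact absurd (ht ▸ hy') ha.notMem
    | succ n => exact ⟨n, rfl⟩
  rw [Finset.sum_eq_single (n, m)]
  · rw [if_pos ⟨y, hn, hm⟩]
  · rintro ⟨n', m'⟩ _ hne
    refine if_neg ?_
    rintro ⟨z, h₁, h₂⟩
    obtain rfl : y = z := ha.unique hy' (List.mem_of_getElem? h₂) (Or.inl hy)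
      (Or.inl (List.mem_of_getElem? h₁))
    have e₁ := (List.getElem?_inj hn₁ ha.sep.1).1 (hn.trans h₁.symm)
    have e₂ := (List.getElem?_inj hm₁ ha.sep'.1).1 (hm.trans h₂.symm)
    apply hne
    rw [Prod.mk.injEq]
    exact ⟨by simpa using e₁.symm, e₂.symm⟩
  · intro hq
    exfalso
    apply hq
    rw [Finset.mem_product, Finset.mem_range, Finset.mem_range]
    constructor
    · change n < i; omega
    · change m < j; omega

-- The common element is not the head of the first list, because the second polygon has to avoid the
-- edge that is contracted there. This leaves `i` positions in a list of length `i + 1`, and `j` in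
-- the other one.
open Classical in
theorem sum_meets_eq (i j : ℕ) :
    (∑ l ∈ Γ.lists (i + 1), ∑ l' ∈ Γ.lists j, if Meets (Γ := Γ) l l' then Γ.pairTerm l l' else 0) =
      ∑ q ∈ Finset.range i ×ˢ Finset.range j, Γ.cutSum (i + j) (q.1 + 1 + (j - 1 - q.2)) := by
  rw [← Finset.sum_product', Finset.sum_congr rfl fun p hp => pairTerm_eq_sum i j
    (mem_lists.1 (Finset.mem_product.1 hp).1) (mem_lists.1 (Finset.mem_product.1 hp).2),
    Finset.sum_comm]
  refine Finset.sum_congr rfl fun q hq => ?_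
  rw [Finset.mem_product, Finset.mem_range, Finset.mem_range] at hq
  obtain ⟨b, hb⟩ : ∃ b, i = q.1 + 1 + b := ⟨i - (q.1 + 1), by omega⟩
  obtain ⟨d, hd⟩ : ∃ d, j = q.2 + 1 + d := ⟨j - (q.2 + 1), by omega⟩
  have := sum_meetsAt (Γ := Γ) q.1 b q.2 d
  have e₁ : i + 1 = q.1 + 1 + 1 + b := by omega
  have e₂ : i + j = q.1 + 1 + d + (q.2 + 1 + b) := by omega
  have e₃ : q.1 + 1 + (j - 1 - q.2) = q.1 + 1 + d := by omega
  rw [e₁, e₂, e₃, hd]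
  exact this

/-- Reading both positions backwards replaces a cut after `n` of the `i + j` entries by a cut after
`i + j - n`. By `cutSum_swap` the sum is its own negative, hence zero since 2 is invertible. -/
theorem sum_cutSum [CharZero k] (i j : ℕ) :
    ∑ q ∈ Finset.range i ×ˢ Finset.range j, Γ.cutSum (i + j) (q.1 + 1 + (j - 1 - q.2)) = 0 := by
  have e : ∑ q ∈ Finset.range i ×ˢ Finset.range j, Γ.cutSum (i + j) (q.1 + 1 + (j - 1 - q.2)) =
      - ∑ q ∈ Finset.range i ×ˢ Finset.range j, Γ.cutSum (i + j) (q.1 + 1 + (j - 1 - q.2)) := by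
    rw [← Finset.sum_neg_distrib]
    refine Finset.sum_nbij' (fun q => (i - 1 - q.1, j - 1 - q.2)) (fun q => (i - 1 - q.1, j - 1 - q.2))
      ?_ ?_ ?_ ?_ ?_ <;> rintro ⟨a, b⟩ h <;>
      simp only [Finset.mem_product, Finset.mem_range, Prod.mk.injEq] at h ⊢
    · omega
    · omega
    · omega
    · omega
    · have e₁ : i + j = (a + 1 + (j - 1 - b)) + (i - 1 - a + 1 + (j - 1 - (j - 1 - b))) := by omega
      rw [e₁]
      convert cutSum_swap (Γ := Γ) (a + 1 + (j - 1 - b)) (i - 1 - a + 1 + (j - 1 - (j - 1 - b))) using 3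
  have h₂ : (2 : k) • ∑ q ∈ Finset.range i ×ˢ Finset.range j,
      Γ.cutSum (i + j) (q.1 + 1 + (j - 1 - q.2)) = 0 := by
    rw [two_smul]
    nth_rewrite 1 [e]
    exact neg_add_cancel _
  exact (smul_eq_zero.1 h₂).resolve_left two_ne_zero

/-- The terms with a common edge vanish in total within a single composite, for either direction of
the meeting. Only pairs without common edge remain, and these are antisymmetric. -/
theorem fission_fission_cls_eq [CharZero k] (i j : ℕ) :
    fission O j (fission O i Γ.cls) = ∑ l ∈ Γ.lists i, ∑ l' ∈ Γ.lists j,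
      open Classical in
      if ¬ Meets (Γ := Γ) l l' ∧ ¬ MeetsInv l l' then Γ.pairTerm l l' else 0 := by
  classical
  rw [fission_fission_cls]
  have e : (∑ l ∈ Γ.lists i, ∑ l' ∈ Γ.lists j,
      if Meets (Γ := Γ) l l' then Γ.pairTerm l l' else 0) = 0 := by
    cases i with
    | zero =>
      refine Finset.sum_eq_zero fun l hl => Finset.sum_eq_zero fun l' _ => ?_
      rw [mem_lists, List.length_eq_zero_iff] at hl
      subst hl
      refine if_neg ?_
      rintro ⟨y, _, hy⟩
      cases hy
    | succ i => rw [sum_meets_eq, sum_cutSum]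
  rw [Finset.sum_congr rfl fun l _ => Finset.sum_congr rfl fun l' _ => pairTerm_eq_add l l']
  simp only [Finset.sum_add_distrib, sum_meetsInv, e, add_zero]

theorem fission_comp_add_comp [CharZero k] (i j : ℕ) :
    fission O j ∘ₗ fission O i + fission O i ∘ₗ fission O j = 0 := by
  refine graphSpace_hom_ext fun Γ => ?_
  rw [LinearMap.add_apply, LinearMap.comp_apply, LinearMap.comp_apply, fission_fission_cls_eq,
    fission_fission_cls_eq, LinearMap.zero_apply, sum_disjoint]
  exact neg_add_cancel _

end Sums
end OGraph
end GraphComplex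
namespace GraphComplex
variable {k : Type u} [Field k] {O : CyclicOperad.{u, w} k}

/-! ### Products of components, with signs. -/

section PairSign
variable {α : Type}

/-- The product of `s a b` over the pairs of elements of a list, `a` before `b`. -/
def pairSign (s : α → α → k) : List α → k
  | [] => 1
  | a :: L => (L.map (s a)).prod * pairSign s L

theorem pairSign_append (s : α → α → k) (L L' : List α) :
    pairSign s (L ++ L') =
      pairSign s L * pairSign s L' * (L.map fun a => (L'.map (s a)).prod).prod := by
  induction L with
  | nil => simp [pairSign]
  | cons a L ih =>
    simp only [List.cons_append, pairSign, ih, List.map_append, List.prod_append, List.map_cons,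
      List.prod_cons]
    ring

theorem pairSign_map {β : Type} (s : α → α → k) (f : β → α) (L : List β) :
    pairSign s (L.map f) = pairSign (fun a b => s (f a) (f b)) L := by
  induction L with
  | nil => rfl
  | cons a L ih =>
    rw [List.map_cons, pairSign, pairSign, ih, List.map_map]
    rfl

theorem pairSign_ofFn (s : α → α → k) {n : ℕ} (f : Fin n → α) :
    pairSign s (List.ofFn f) = ∏ a, ∏ b, if a < b then s (f a) (f b) else 1 := by
  induction n with
  | zero => simp [pairSign]
  | succ n ih =>
    rw [List.ofFn_succ, pairSign, ih, List.map_ofFn, List.prod_ofFn, Fin.prod_univ_succ]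
    congr 1
    · rw [Fin.prod_univ_succ]
      simp
    · refine Finset.prod_congr rfl fun a _ => ?_
      rw [Fin.prod_univ_succ]
      simp

end PairSign

namespace OGraph

section CompProd
variable (Γ : OGraph O)

variable (k) in
/-- The sign of the inversions between two components, the first one being placed before the second
one. -/
noncomputable def compSign {O : CyclicOperad.{u, w} k} (Γ : OGraph O) (c d : Γ.Comp) : k :=
  (-1) ^ Nat.card {p : Γ.V × Γ.V // Γ.lt p.1 p.2 ∧ Quot.mk Γ.Joined p.1 = d ∧ Quot.mk Γ.Joined p.2 = c}

theorem compSign_eq [Fintype Γ.V] (c d : Γ.Comp) : compSign k Γ c d =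
    ∏ v, ∏ w, sg k (Γ.lt v w ∧ Quot.mk Γ.Joined v = d ∧ Quot.mk Γ.Joined w = c) := by
  rw [compSign, neg_one_pow_card, Fintype.prod_prod_type]

/-- Each vertex of `c` together with each vertex of `d` is an inversion for exactly one of the two
orders of the components. -/
theorem compSign_mul_swap {c d : Γ.Comp} (h : c ≠ d) : compSign k Γ c d * compSign k Γ d c =
    (-1) ^ (Nat.card (Γ.component c).V * Nat.card (Γ.component d).V) := by
  have iV : Fintype Γ.V := Fintype.ofFinite _
  have e : Nat.card (Γ.component c).V * Nat.card (Γ.component d).V =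
      Nat.card {p : Γ.V × Γ.V // Quot.mk Γ.Joined p.1 = c ∧ Quot.mk Γ.Joined p.2 = d} := by
    rw [← Nat.card_prod]
    exact Nat.card_congr (Equiv.subtypeProdEquivProd (p := fun v => Quot.mk Γ.Joined v = c)
      (q := fun v => Quot.mk Γ.Joined v = d)).symm
  rw [e, neg_one_pow_card (fun p : Γ.V × Γ.V => Quot.mk Γ.Joined p.1 = c ∧ Quot.mk Γ.Joined p.2 = d),
    compSign_eq, compSign_eq, Finset.prod_comm, Fintype.prod_prod_type, ← Finset.prod_mul_distrib]
  refine Finset.prod_congr rfl fun v _ => ?_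
  rw [← Finset.prod_mul_distrib]
  refine Finset.prod_congr rfl fun w _ => ?_
  by_cases hv : Quot.mk Γ.Joined v = c
  · by_cases hw : Quot.mk Γ.Joined w = d
    · have hvw : v ≠ w := fun e => h (hv.symm.trans ((congrArg _ e).trans hw))
      have := not_lt_iff Γ.lt hvw
      by_cases hl : Γ.lt v w
      · have h₂ : ¬ Γ.lt w v := Γ.lt_asymm' hl
        simp [hv, hw, hl, h₂]
      · simp [hv, hw, hl, this.1 hl]
    · simp [hw]
  · simp [hv]

/-- A connected component as an element of the symmetric algebra. -/
noncomputable def compGen (c : Γ.Comp) : SymP O :=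
  GradedSym.gen (grading O) ((Γ.component c).pcls (Γ.component_isConnected c))

/-- The product of some components, with sign. -/
noncomputable def compProd (L : List Γ.Comp) : SymP O :=
  pairSign (compSign k Γ) L • (L.map Γ.compGen).prod

theorem pcls_mem_grading {Γ : OGraph O} (h : Γ.IsConnected) : Γ.pcls h ∈ grading O (Nat.card Γ.V) :=
  Submodule.subset_span ⟨Γ, h, rfl, rfl⟩

theorem compGen_mul_compGen (c d : Γ.Comp) : Γ.compGen c * Γ.compGen d =
    (-1 : k) ^ (Nat.card (Γ.component c).V * Nat.card (Γ.component d).V) •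
      (Γ.compGen d * Γ.compGen c) :=
  GradedSym.gen_mul_gen _ (pcls_mem_grading _) (pcls_mem_grading _)

theorem compProd_cons (c : Γ.Comp) (L : List Γ.Comp) :
    Γ.compProd (c :: L) = (L.map (compSign k Γ c)).prod • (Γ.compGen c * Γ.compProd L) := by
  rw [compProd, compProd, pairSign, List.map_cons, List.prod_cons, mul_smul, mul_smul_comm]

/-- Exchanging two neighbours changes `pairSign` by the same Koszul sign that graded commutativity
produces in the product. -/
theorem compProd_perm {L L' : List Γ.Comp} (h : L.Perm L') (hL : L.Nodup) :
    Γ.compProd L = Γ.compProd L' := by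
  induction h with
  | nil => rfl
  | cons c h ih =>
    rw [compProd_cons, compProd_cons, ih hL.of_cons, (h.map _).prod_eq]
  | swap c d L =>
    have hne : d ≠ c := by
      rintro rfl
      exact (List.nodup_cons.1 hL).1 List.mem_cons_self
    simp only [compProd_cons, List.map_cons, List.prod_cons, mul_smul_comm, smul_smul,
      ← mul_assoc (Γ.compGen _), compGen_mul_compGen Γ d c, ← compSign_mul_swap Γ hne,
      smul_mul_assoc]
    congr 1
    have h₁ : compSign k Γ d c * compSign k Γ d c = 1 := neg_one_pow_mul_self _
    linear_combination (compSign k Γ c d * (L.map (compSign k Γ d)).prod *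
      (L.map (compSign k Γ c)).prod) * h₁
  | trans h₁ h₂ ih₁ ih₂ => rw [ih₁ hL, ih₂ (h₁.nodup_iff.1 hL)]

/-- The inversions are grouped by the components that contain their two vertices. -/
theorem sign_ofFn [Fintype Γ.V] :
    ∏ v, ∏ w, sg k (Γ.lt v w ∧ Finite.equivFin Γ.Comp (Quot.mk _ w) <
      Finite.equivFin Γ.Comp (Quot.mk _ v)) =
      pairSign (compSign k Γ) (List.ofFn (Finite.equivFin Γ.Comp).symm) := by
  classical
  have iC : Fintype Γ.Comp := Fintype.ofFinite _
  set e := Finite.equivFin Γ.Comp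
  rw [pairSign_ofFn, ← e.prod_comp]
  simp only [← e.prod_comp (fun b => if _ < b then _ else _), Equiv.symm_apply_apply]
  have key : ∀ v w, sg k (Γ.lt v w ∧ e (Quot.mk _ w) < e (Quot.mk _ v)) =
      ∏ c, ∏ d, if e c < e d then
        sg k (Γ.lt v w ∧ Quot.mk Γ.Joined v = d ∧ Quot.mk Γ.Joined w = c) else 1 := by
    intro v w
    rw [Finset.prod_eq_single (Quot.mk Γ.Joined w), Finset.prod_eq_single (Quot.mk Γ.Joined v)]
    · by_cases h : e (Quot.mk _ w) < e (Quot.mk _ v)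
      · simp [h]
      · simp [h]
    · intro d _ hd
      rw [sg_of_not fun h => hd h.2.1.symm, ite_self]
    · exact fun h => absurd (Finset.mem_univ _) h
    · intro c _ hc
      refine Finset.prod_eq_one fun d _ => ?_
      rw [sg_of_not fun h => hc h.2.2.symm, ite_self]
    · exact fun h => absurd (Finset.mem_univ _) h
  simp only [key]
  rw [Finset.prod_congr rfl fun v _ => Finset.prod_comm, Finset.prod_comm]
  refine Finset.prod_congr rfl fun c _ => ?_
  rw [Finset.prod_congr rfl fun v _ => Finset.prod_comm, Finset.prod_comm]
  refine Finset.prod_congr rfl fun d _ => ?_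
  by_cases h : e c < e d
  · simp [h, compSign_eq]
  · simp [h]

theorem splitProduct_eq_ofFn :
    Γ.splitProduct = Γ.compProd (List.ofFn (Finite.equivFin Γ.Comp).symm) := by
  have iV : Fintype Γ.V := Fintype.ofFinite _
  rw [splitProduct, compProd, ← sign_ofFn, List.map_ofFn, neg_one_pow_card, Fintype.prod_prod_type]
  rfl

/-- The product of the components does not depend on their order. -/
theorem splitProduct_eq {L : List Γ.Comp} (hL : L.Nodup) (h : ∀ c, c ∈ L) :
    Γ.splitProduct = Γ.compProd L := by
  rw [splitProduct_eq_ofFn]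
  have h₁ : (List.ofFn (Finite.equivFin Γ.Comp).symm).Nodup :=
    List.nodup_ofFn.2 (Finite.equivFin Γ.Comp).symm.injective
  refine Γ.compProd_perm ((List.perm_ext_iff_of_nodup h₁ hL).2 fun c => ?_) h₁
  exact iff_of_true ((List.mem_ofFn' _ _).2 ⟨Finite.equivFin Γ.Comp c, Equiv.symm_apply_apply _ _⟩) (h c)

theorem exists_full_list : ∃ L : List Γ.Comp, L.Nodup ∧ ∀ c, c ∈ L := by
  have iC : Fintype Γ.Comp := Fintype.ofFinite _
  exact ⟨Finset.univ.toList, Finset.nodup_toList _, fun c => Finset.mem_toList.2 (Finset.mem_univ c)⟩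

end CompProd
end OGraph
end GraphComplex
namespace GraphComplex
variable {k : Type u} [Field k] {O : CyclicOperad.{u, w} k}
namespace OGraph

/-! ### The product of components respects the relations of the graph complex. -/

section IsoInvariance
variable {Γ Δ : OGraph O}

/-- The components of isomorphic graphs. -/
def Iso.onComp (φ : Γ.Iso Δ) : Γ.Comp ≃ Δ.Comp :=
  Quot.congr φ.onV fun v w => by
    constructor
    · rintro ⟨h, rfl, rfl⟩
      exact ⟨φ.onH h, φ.vert_eq h, by rw [φ.inv_eq, φ.vert_eq]⟩
    · rintro ⟨h, h₁, h₂⟩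
      obtain ⟨h, rfl⟩ := φ.onH.surjective h
      rw [φ.vert_eq, φ.onV.apply_eq_iff_eq] at h₁
      rw [φ.inv_eq, φ.vert_eq, φ.onV.apply_eq_iff_eq] at h₂
      exact ⟨h, h₁, h₂⟩

theorem Iso.mk_onV (φ : Γ.Iso Δ) (v : Γ.V) (c : Γ.Comp) :
    Quot.mk Δ.Joined (φ.onV v) = φ.onComp c ↔ Quot.mk Γ.Joined v = c :=
  φ.onComp.apply_eq_iff_eq (x := Quot.mk Γ.Joined v)

/-- The half-edges at a vertex of a component. -/
def compStar (Γ : OGraph O) (c : Γ.Comp) (v : (Γ.component c).V) :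
    {h // Γ.vert h = v.1} ≃ {h // (Γ.component c).vert h = v} where
  toFun h := ⟨⟨h.1, (congrArg _ h.2).trans v.2⟩, Subtype.ext h.2⟩
  invFun h := ⟨h.1.1, congrArg Subtype.val h.2⟩
  left_inv _ := rfl
  right_inv _ := rfl

theorem component_deco (Γ : OGraph O) (c : Γ.Comp) (v : (Γ.component c).V) :
    (Γ.component c).deco v = Labels.map O (Γ.compStar c v) (Γ.deco v.1) := rfl

/-- Corresponding components of isomorphic graphs are isomorphic. -/
noncomputable def Iso.component (φ : Γ.Iso Δ) (c : Γ.Comp) {d : Δ.Comp} (hd : φ.onComp c = d) :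
    (Γ.component c).Iso (Δ.component d) where
  onV := φ.onV.subtypeEquiv fun v => by rw [← hd, φ.mk_onV]
  onH := φ.onH.subtypeEquiv fun h => by rw [← hd, φ.vert_eq, φ.mk_onV]
  vert_eq h := Subtype.ext (φ.vert_eq h.1)
  inv_eq h := Subtype.ext (φ.inv_eq h.1)
  deco_eq v := by
    rw [component_deco]
    refine Eq.trans ?_ (Labels.map_map O _ _ _).symm
    refine (component_deco Δ _ _).trans ?_
    refine (congrArg _ (φ.deco_eq v.1)).trans ?_
    refine (Labels.map_map O _ _ _).trans ?_
    exact Labels.map_congr O (fun _ => Subtype.ext (Subtype.ext rfl)) _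
  lt_iff v w := φ.lt_iff v.1 w.1
  tail_iff h := φ.tail_iff h.1

theorem pcls_eq {Γ Δ : OGraph O} (h : Γ.IsConnected) (h' : Δ.IsConnected) (e : Γ.cls = Δ.cls) :
    Γ.pcls h = Δ.pcls h' := Subtype.ext e

theorem Iso.compGen_eq (φ : Γ.Iso Δ) (c : Γ.Comp) : Δ.compGen (φ.onComp c) = Γ.compGen c :=
  congrArg _ (pcls_eq _ _ (cls_iso (φ.component c rfl)))

theorem Iso.compSign_eq (φ : Γ.Iso Δ) (c d : Γ.Comp) :
    compSign k Δ (φ.onComp c) (φ.onComp d) = compSign k Γ c d := by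
  refine congrArg _ (Nat.card_congr ?_).symm
  refine (φ.onV.prodCongr φ.onV).subtypeEquiv fun p => ?_
  change _ ↔ Δ.lt (φ.onV p.1) (φ.onV p.2) ∧ Quot.mk Δ.Joined (φ.onV p.1) = _ ∧
    Quot.mk Δ.Joined (φ.onV p.2) = _
  rw [φ.lt_iff, φ.mk_onV, φ.mk_onV]

theorem Iso.splitProduct_eq (φ : Γ.Iso Δ) : Δ.splitProduct = Γ.splitProduct := by
  obtain ⟨L, hL, h⟩ := Γ.exists_full_list
  rw [Γ.splitProduct_eq hL h, Δ.splitProduct_eq (L := L.map φ.onComp)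
    ((List.nodup_map_iff φ.onComp.injective).2 hL)
    (fun c => List.mem_map.2 ⟨φ.onComp.symm c, h _, Equiv.apply_symm_apply _ _⟩), compProd, compProd,
    pairSign_map, List.map_map]
  simp only [φ.compSign_eq, Function.comp_def, φ.compGen_eq]

end IsoInvariance

section Reorient

theorem prod_fiber {α β : Type} [Fintype α] (p : α → β) (b : β) [Fintype {a // p a = b}]
    [DecidableEq β] (f : α → k) :
    ∏ a : {a // p a = b}, f a.1 = ∏ a, if p a = b then f a else 1 := by
  rw [← Finset.prod_filter]
  exact (Finset.prod_subtype _ (by simp) _).symm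

theorem list_prod_smul {A : Type*} [Ring A] [Algebra k A] {ι : Type*} (L : List ι) (f : ι → k)
    (g : ι → A) : (L.map fun c => f c • g c).prod = (L.map f).prod • (L.map g).prod := by
  induction L with
  | nil => simp
  | cons c L ih => simp only [List.map_cons, List.prod_cons, ih, smul_mul_smul_comm]

variable (Γ : OGraph O) (lt' : Γ.V → Γ.V → Prop) (tail' : Γ.H → Prop)

/-- The number of changes of the orientation in a component. -/
noncomputable def changesIn (c : Γ.Comp) : ℕ :=
  (Γ.component c).changes (fun v w => lt' v.1 w.1) (fun h => tail' h.1)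

theorem compGen_reorient [IsStrictTotalOrder Γ.V lt']
    (h : ∀ h, tail' (Γ.inv h) ↔ ¬ tail' h) (c : Γ.Comp) : (Γ.reorient lt' tail' h).compGen c =
    (-1 : k) ^ Γ.changesIn lt' tail' c • Γ.compGen c := by
  have iS : IsStrictTotalOrder (Γ.component c).V (fun v w => lt' v.1 w.1) :=
    (RelEmbedding.preimage (Function.Embedding.subtype _) lt').isStrictTotalOrder
  have e := cls_reorient (Γ.component c) (fun v w => lt' v.1 w.1) (fun h => tail' h.1) (fun x => h x.1)
  rw [compGen, ← map_smul]
  exact congrArg _ (Subtype.ext e)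

/-- Every edge lies in one component, but of the inversions only those within a component are seen
here. The others are accounted for by `sign_reorient`. -/
theorem prod_changesIn [Fintype Γ.V] [Fintype Γ.H] [Fintype Γ.Comp] [DecidableEq Γ.Comp] :
    ∏ c, (-1 : k) ^ Γ.changesIn lt' tail' c =
      (∏ v, ∏ w, if Quot.mk Γ.Joined w = Quot.mk Γ.Joined v then sg k (Γ.lt v w ∧ lt' w v) else 1) *
        ∏ x, sg k (Γ.tail x ∧ ¬ tail' x) := by
  have e : ∀ c, (-1 : k) ^ Γ.changesIn lt' tail' c =
      (∏ v : {v // Quot.mk Γ.Joined v = c}, ∏ w, if Quot.mk Γ.Joined w = Quot.mk Γ.Joined v.1 then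
        sg k (Γ.lt v.1 w ∧ lt' w v.1) else 1) *
      ∏ x : {x // Quot.mk Γ.Joined (Γ.vert x) = c}, sg k (Γ.tail x.1 ∧ ¬ tail' x.1) := fun c => by
    refine (@changes_sign k _ O (Γ.component c) (inferInstanceAs (Fintype {v // Quot.mk Γ.Joined v = c}))
      (inferInstanceAs (Fintype {x // Quot.mk Γ.Joined (Γ.vert x) = c})) _ _).trans ?_
    refine congrArg (· * _) (Finset.prod_congr rfl fun v _ => ?_)
    refine (prod_fiber (fun w => Quot.mk Γ.Joined w) c (fun w => sg k (Γ.lt v.1 w ∧ lt' w v.1))).trans ?_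
    rw [v.2]
  rw [Finset.prod_congr rfl fun c _ => e c, Finset.prod_mul_distrib,
    Fintype.prod_fiberwise (fun v => Quot.mk Γ.Joined v) (fun v => ∏ w,
      if Quot.mk Γ.Joined w = Quot.mk Γ.Joined v then sg k (Γ.lt v w ∧ lt' w v) else 1),
    Fintype.prod_fiberwise (fun x => Quot.mk Γ.Joined (Γ.vert x)) (fun x => sg k (Γ.tail x ∧ ¬ tail' x))]

/-- Pairs within a fibre of `e` contribute equally to both sides. If `e w < e v`, the pair is an
inversion between the two orderings exactly when `lt v w` and `lt' v w` disagree, so its sign is the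
product of its two shuffle signs. -/
theorem sign_reorient [IsStrictTotalOrder Γ.V lt'] {γ : Type} [LinearOrder γ] [Fintype Γ.V] (e : Γ.V → γ) :
    (∏ v, ∏ w, sg k (lt' v w ∧ e w < e v)) *
        (∏ v, ∏ w, if e w = e v then sg k (Γ.lt v w ∧ lt' w v) else 1) =
      (∏ v, ∏ w, sg k (Γ.lt v w ∧ lt' w v)) * ∏ v, ∏ w, sg k (Γ.lt v w ∧ e w < e v) := by
  have e₁ : (∏ v, ∏ w, sg k (Γ.lt v w ∧ lt' w v)) =
      (∏ v, ∏ w, if e w = e v then sg k (Γ.lt v w ∧ lt' w v) else 1) *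
      ((∏ v, ∏ w, if e w < e v then sg k (Γ.lt v w ∧ lt' w v) else 1) *
        ∏ v, ∏ w, if e w < e v then sg k (Γ.lt w v ∧ lt' v w) else 1) := by
    rw [Finset.prod_comm (f := fun v w => if e w < e v then sg k (Γ.lt w v ∧ lt' v w) else 1),
      ← Finset.prod_mul_distrib, ← Finset.prod_mul_distrib]
    refine Finset.prod_congr rfl fun v _ => ?_
    rw [← Finset.prod_mul_distrib, ← Finset.prod_mul_distrib]
    refine Finset.prod_congr rfl fun w _ => ?_
    rcases lt_trichotomy (e w) (e v) with h | h | h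
    · simp [h, h.ne, h.not_gt]
    · simp [h]
    · simp [h, h.ne', h.not_gt]
  rw [e₁, mul_comm, mul_assoc]
  congr 1
  rw [← Finset.prod_mul_distrib, ← Finset.prod_mul_distrib]
  refine Finset.prod_congr rfl fun v _ => ?_
  rw [← Finset.prod_mul_distrib, ← Finset.prod_mul_distrib]
  refine Finset.prod_congr rfl fun w _ => ?_
  by_cases h : e w < e v
  · have hne : v ≠ w := fun e => by rw [e] at h; exact lt_irrefl _ h
    have h₁ := not_lt_iff Γ.lt hne
    have h₂ := not_lt_iff lt' hne
    rw [if_pos h, if_pos h, ← h₁, ← h₂]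
    by_cases a : Γ.lt v w <;> by_cases b : lt' v w <;> simp [a, b, h]
  · simp [h]

theorem splitProduct_reorient [IsStrictTotalOrder Γ.V lt']
    (h : ∀ h, tail' (Γ.inv h) ↔ ¬ tail' h) : (Γ.reorient lt' tail' h).splitProduct =
    (-1 : k) ^ Γ.changes lt' tail' • Γ.splitProduct := by
  classical
  have iV : Fintype Γ.V := Fintype.ofFinite _
  have iH : Fintype Γ.H := Fintype.ofFinite _
  have iC : Fintype Γ.Comp := Fintype.ofFinite _
  have e₁ := (Γ.reorient lt' tail' h).splitProduct_eq_ofFn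
  have e₂ : pairSign (compSign k (Γ.reorient lt' tail' h)) (List.ofFn (Finite.equivFin Γ.Comp).symm) =
      ∏ v, ∏ w, sg k (lt' v w ∧ Finite.equivFin Γ.Comp (Quot.mk _ w) <
        Finite.equivFin Γ.Comp (Quot.mk _ v)) :=
    (@sign_ofFn k _ O (Γ.reorient lt' tail' h) iV).symm
  refine e₁.trans ?_
  have e₅ : ((List.ofFn (Finite.equivFin Γ.Comp).symm).map
      fun c : Γ.Comp => (Γ.reorient lt' tail' h).compGen c) =
      (List.ofFn (Finite.equivFin Γ.Comp).symm).map
        fun c => (-1 : k) ^ Γ.changesIn lt' tail' c • Γ.compGen c :=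
    List.map_congr_left fun c _ => compGen_reorient Γ lt' tail' h c
  refine (congrArg₂ (· • ·) e₂ ((congrArg List.prod e₅).trans (list_prod_smul _ _ _))).trans ?_
  rw [splitProduct_eq_ofFn, compProd, ← sign_ofFn, smul_smul, smul_smul]
  congr 1
  rw [List.map_ofFn, List.prod_ofFn]
  have e₃ : ∏ i, ((fun c => (-1 : k) ^ Γ.changesIn lt' tail' c) ∘ (Finite.equivFin Γ.Comp).symm) i =
      ∏ c, (-1 : k) ^ Γ.changesIn lt' tail' c :=
    (Finite.equivFin Γ.Comp).symm.prod_comp fun c => (-1 : k) ^ Γ.changesIn lt' tail' c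
  have e₄ := sign_reorient Γ lt' (k := k) fun v => Finite.equivFin Γ.Comp (Quot.mk _ v)
  simp only [EmbeddingLike.apply_eq_iff_eq] at e₄
  rw [e₃, prod_changesIn, ← mul_assoc, e₄, changes_sign]
  ring

end Reorient

section Deco
variable (Γ : OGraph O)

theorem component_setDeco_of_ne {v : Γ.V} {c : Γ.Comp} (hc : Quot.mk Γ.Joined v ≠ c)
    (z : Labels O {h // Γ.vert h = v}) : (Γ.setDeco v z).component c = Γ.component c := by
  change withDeco (Γ.component c) _ = withDeco (Γ.component c) _
  refine congrArg _ (funext fun x => ?_)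
  refine congrArg (Labels.map O (Γ.compStar c x)) ?_
  exact setDeco_deco_of_ne Γ (fun e => hc ((congrArg _ e.symm).trans x.2)) z

theorem component_setDeco {v : Γ.V} (z : Labels O {h // Γ.vert h = v}) :
    (Γ.setDeco v z).component (Quot.mk Γ.Joined v) =
      (Γ.component (Quot.mk Γ.Joined v)).setDeco ⟨v, rfl⟩
        (Labels.map O (Γ.compStar (Quot.mk Γ.Joined v) ⟨v, rfl⟩) z) := by
  change withDeco (Γ.component (Quot.mk Γ.Joined v)) _ = withDeco (Γ.component (Quot.mk Γ.Joined v)) _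
  refine congrArg _ (funext fun x => ?_)
  by_cases hx : x = ⟨v, rfl⟩
  · subst hx
    refine Eq.trans ?_ (setDeco_deco_self (Γ.component (Quot.mk Γ.Joined v)) _ _).symm
    exact congrArg (Labels.map O _) (setDeco_deco_self Γ v z)
  · refine Eq.trans ?_ (setDeco_deco_of_ne (Γ.component (Quot.mk Γ.Joined v)) hx _).symm
    refine congrArg (Labels.map O (Γ.compStar _ x)) ?_
    exact setDeco_deco_of_ne Γ (fun e => hx (Subtype.ext e)) z

/-- The class of a connected graph as a function of a label. -/
noncomputable def pclsAt (h : Γ.IsConnected) (v : Γ.V) :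
    Labels O {h // Γ.vert h = v} →ₗ[k] primitive O :=
  (clsAt Γ v).codRestrict (primitive O) fun z => ((Γ.setDeco v z).pcls h).2

theorem compGen_setDeco (v : Γ.V) : ∃ Λ : Labels O {h // Γ.vert h = v} →ₗ[k] SymP O,
    ∀ z, (Γ.setDeco v z).compGen (Quot.mk Γ.Joined v) = Λ z := by
  refine ⟨GradedSym.gen (grading O) ∘ₗ (Γ.component (Quot.mk Γ.Joined v)).pclsAt
    (Γ.component_isConnected _) (⟨v, rfl⟩ : {w // Quot.mk Γ.Joined w = Quot.mk Γ.Joined v}) ∘ₗ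
    Labels.map O (Γ.compStar (Quot.mk Γ.Joined v) ⟨v, rfl⟩), fun z => ?_⟩
  refine congrArg _ (Subtype.ext ?_)
  exact congrArg cls (Γ.component_setDeco z)

theorem compGen_setDeco_of_ne {v : Γ.V} {c : Γ.Comp} (hc : Quot.mk Γ.Joined v ≠ c)
    (z : Labels O {h // Γ.vert h = v}) : (Γ.setDeco v z).compGen c = Γ.compGen c :=
  congrArg _ (Subtype.ext (congrArg cls (Γ.component_setDeco_of_ne hc z)))

/-- Only the factor of the component of `v` depends on the label at `v`, and the signs do not
involve labels. -/
theorem splitProduct_setDeco (v : Γ.V) : ∃ Λ : Labels O {h // Γ.vert h = v} →ₗ[k] SymP O,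
    ∀ z, (Γ.setDeco v z).splitProduct = Λ z := by
  obtain ⟨L, hL, hf⟩ := Γ.exists_full_list
  obtain ⟨A, B, rfl⟩ := List.append_of_mem (hf (Quot.mk Γ.Joined v))
  obtain ⟨Λ, hΛ⟩ := Γ.compGen_setDeco v
  have hL' := List.nodup_cons.1 (List.nodup_middle.1 hL)
  rw [List.mem_append, not_or] at hL'
  have h₁ : ∀ M : List Γ.Comp, Quot.mk Γ.Joined v ∉ M → ∀ z,
      M.map (Γ.setDeco v z).compGen = M.map Γ.compGen := fun M hM z =>
    List.map_congr_left fun c hc => Γ.compGen_setDeco_of_ne (fun e => hM (by rwa [e])) z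
  refine ⟨pairSign (compSign k Γ) (A ++ Quot.mk Γ.Joined v :: B) •
    (LinearMap.mulLeft k (A.map Γ.compGen).prod ∘ₗ LinearMap.mulRight k (B.map Γ.compGen).prod ∘ₗ Λ),
    fun z => ?_⟩
  refine ((Γ.setDeco v z).splitProduct_eq (L := A ++ Quot.mk Γ.Joined v :: B) hL hf).trans ?_
  refine congrArg (pairSign (compSign k Γ) (A ++ Quot.mk Γ.Joined v :: B) • ·) ?_
  have h₂ : ∀ f : Γ.Comp → SymP O, ((A ++ Quot.mk Γ.Joined v :: B).map f).prod =
      (A.map f).prod * (f (Quot.mk Γ.Joined v) * (B.map f).prod) := fun f => by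
    simp only [List.map_append, List.map_cons, List.prod_append, List.prod_cons]
  refine (h₂ _).trans ?_
  exact congrArg₂ (· * ·) (congrArg List.prod (h₁ A hL'.1.1 z))
    (congrArg₂ (· * ·) (hΛ z) (congrArg List.prod (h₁ B hL'.1.2 z)))

end Deco

theorem isInvariant_splitProduct : IsInvariant (splitProduct : OGraph O → SymP O) where
  iso φ := φ.splitProduct_eq
  reorient Γ lt' _ tail' h := Γ.splitProduct_reorient lt' tail' h
  deco Γ v := Γ.splitProduct_setDeco v

variable (O) in
/-- The map from the graph complex to the graded symmetric algebra which sends a graph to the product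
of its components. -/
noncomputable def splitMap : GraphSpace O →ₗ[k] SymP O := isInvariant_splitProduct.lift

theorem splitMap_cls (Γ : OGraph O) : splitMap O Γ.cls = Γ.splitProduct :=
  isInvariant_splitProduct.lift_cls Γ

end OGraph
end GraphComplex
namespace GraphComplex
variable {k : Type u} [Field k] {O : CyclicOperad.{u, w} k}

theorem Labels.map_map_eq {A B C D : Type} (e₁ : A ≃ B) (e₂ : B ≃ D) (e₃ : A ≃ C) (e₄ : C ≃ D)
    (h : ∀ x, e₂ (e₁ x) = e₄ (e₃ x)) (a : Labels O A) :
    Labels.map O e₂ (Labels.map O e₁ a) = Labels.map O e₄ (Labels.map O e₃ a) :=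
  (Labels.map_map O _ _ _).trans ((Labels.map_congr O h _).trans (Labels.map_map O _ _ _).symm)

namespace OGraph

/-! ### Disjoint unions. -/

section Union

theorem isStrictTotalOrder_sumLex {α β : Type} (r : α → α → Prop) (s : β → β → Prop)
    [IsStrictTotalOrder α r] [IsStrictTotalOrder β s] : IsStrictTotalOrder (α ⊕ β) (Sum.Lex r s) where
  trichotomous := by
    rintro (a | a) (b | b) h₁ h₂
    · rw [Sum.lex_inl_inl] at h₁ h₂
      by_contra hne
      exact h₂ ((not_lt_iff r fun e => hne (congrArg _ e)).1 h₁)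
    · exact absurd (Sum.Lex.sep _ _) h₁
    · exact absurd (Sum.Lex.sep _ _) h₂
    · rw [Sum.lex_inr_inr] at h₁ h₂
      by_contra hne
      exact h₂ ((not_lt_iff s fun e => hne (congrArg _ e)).1 h₁)
  irrefl := by
    rintro (a | a) h
    · exact irrefl_of r a (Sum.lex_inl_inl.1 h)
    · exact irrefl_of s a (Sum.lex_inr_inr.1 h)
  trans := by
    rintro _ _ _ (h | h | _) (h' | h' | _)
    · exact Sum.Lex.inl (trans_of r h h')
    · exact Sum.Lex.sep _ _
    · exact Sum.Lex.inr (trans_of s h h')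
    · exact Sum.Lex.sep _ _

/-- The half-edges at a vertex of the first graph of a disjoint union. -/
def starInl {V V' H H' : Type} (f : H → V) (g : H' → V') (v : V) :
    {h // f h = v} ≃ {h // Sum.map f g h = Sum.inl v} where
  toFun h := ⟨Sum.inl h.1, congrArg Sum.inl h.2⟩
  invFun h := match h with
    | ⟨Sum.inl h, e⟩ => ⟨h, Sum.inl.inj e⟩
    | ⟨Sum.inr _, e⟩ => nomatch e
  left_inv _ := rfl
  right_inv h := match h with
    | ⟨Sum.inl _, _⟩ => rfl
    | ⟨Sum.inr _, e⟩ => nomatch e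

/-- The half-edges at a vertex of the second graph of a disjoint union. -/
def starInr {V V' H H' : Type} (f : H → V) (g : H' → V') (v : V') :
    {h // g h = v} ≃ {h // Sum.map f g h = Sum.inr v} where
  toFun h := ⟨Sum.inr h.1, congrArg Sum.inr h.2⟩
  invFun h := match h with
    | ⟨Sum.inr h, e⟩ => ⟨h, Sum.inr.inj e⟩
    | ⟨Sum.inl _, e⟩ => nomatch e
  left_inv _ := rfl
  right_inv h := match h with
    | ⟨Sum.inr _, _⟩ => rfl
    | ⟨Sum.inl _, e⟩ => nomatch e

/-- The disjoint union; the vertices of the first graph precede those of the second one. -/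
noncomputable def union (Γ Δ : OGraph O) : OGraph O where
  V := Γ.V ⊕ Δ.V
  H := Γ.H ⊕ Δ.H
  vert := Sum.map Γ.vert Δ.vert
  inv := Sum.map Γ.inv Δ.inv
  inv_inv := by
    rintro (h | h)
    · exact congrArg Sum.inl (Γ.inv_inv h)
    · exact congrArg Sum.inr (Δ.inv_inv h)
  inv_ne := by
    rintro (h | h) e
    · exact Γ.inv_ne h (Sum.inl.inj e)
    · exact Δ.inv_ne h (Sum.inr.inj e)
  valence := by
    rintro (v | v)
    · exact (Γ.valence v).trans_eq (Nat.card_congr (starInl _ _ v))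
    · exact (Δ.valence v).trans_eq (Nat.card_congr (starInr _ _ v))
  deco v := match v with
    | Sum.inl v => Labels.map O (starInl _ _ v) (Γ.deco v)
    | Sum.inr v => Labels.map O (starInr _ _ v) (Δ.deco v)
  lt := Sum.Lex Γ.lt Δ.lt
  order := isStrictTotalOrder_sumLex _ _
  tail := Sum.elim Γ.tail Δ.tail
  tail_inv := by
    rintro (h | h)
    · exact Γ.tail_inv h
    · exact Δ.tail_inv h

variable (Γ Δ : OGraph O)

/-- The components of a disjoint union. -/
def compUnion : Γ.Comp ⊕ Δ.Comp ≃ (Γ.union Δ).Comp where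
  toFun := Sum.elim
    (Quot.lift (fun v => Quot.mk _ (Sum.inl v)) (by
      rintro _ _ ⟨h, rfl, rfl⟩
      exact Quot.sound ⟨Sum.inl h, rfl, rfl⟩))
    (Quot.lift (fun v => Quot.mk _ (Sum.inr v)) (by
      rintro _ _ ⟨h, rfl, rfl⟩
      exact Quot.sound ⟨Sum.inr h, rfl, rfl⟩))
  invFun := Quot.lift (fun v : Γ.V ⊕ Δ.V => Sum.map (Quot.mk Γ.Joined) (Quot.mk Δ.Joined) v) (by
    rintro _ _ ⟨h | h, rfl, rfl⟩
    · exact congrArg Sum.inl (Γ.mk_vert_inv h).symm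
    · exact congrArg Sum.inr (Δ.mk_vert_inv h).symm)
  left_inv := by rintro (c | c) <;> induction c using Quot.inductionOn <;> rfl
  right_inv := by rintro ⟨v | v⟩ <;> rfl

theorem numComp_union : (Γ.union Δ).numComp = Γ.numComp + Δ.numComp := by
  rw [numComp, ← Nat.card_congr (compUnion Γ Δ), Nat.card_sum]
  rfl

theorem mk_inl_eq_inl (v : Γ.V) (c : Γ.Comp) :
    Quot.mk (Γ.union Δ).Joined (Sum.inl v) = compUnion Γ Δ (Sum.inl c) ↔ Quot.mk Γ.Joined v = c :=
  ((compUnion Γ Δ).apply_eq_iff_eq (x := Sum.inl (Quot.mk Γ.Joined v))).trans Sum.inl_injective.eq_iff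

theorem mk_inr_eq_inr (v : Δ.V) (c : Δ.Comp) :
    Quot.mk (Γ.union Δ).Joined (Sum.inr v) = compUnion Γ Δ (Sum.inr c) ↔ Quot.mk Δ.Joined v = c :=
  ((compUnion Γ Δ).apply_eq_iff_eq (x := Sum.inr (Quot.mk Δ.Joined v))).trans Sum.inr_injective.eq_iff

theorem mk_inr_ne_inl (v : Δ.V) (c : Γ.Comp) :
    Quot.mk (Γ.union Δ).Joined (Sum.inr v) ≠ compUnion Γ Δ (Sum.inl c) := fun e =>
  nomatch ((compUnion Γ Δ).apply_eq_iff_eq (x := Sum.inr (Quot.mk Δ.Joined v))).1 e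

theorem mk_inl_ne_inr (v : Γ.V) (c : Δ.Comp) :
    Quot.mk (Γ.union Δ).Joined (Sum.inl v) ≠ compUnion Γ Δ (Sum.inr c) := fun e =>
  nomatch ((compUnion Γ Δ).apply_eq_iff_eq (x := Sum.inl (Quot.mk Γ.Joined v))).1 e

/-- The components of the first graph of a disjoint union. -/
noncomputable def componentInl (c : Γ.Comp) :
    (Γ.component c).Iso ((Γ.union Δ).component (compUnion Γ Δ (Sum.inl c))) where
  onV := Equiv.ofBijective (fun v : {v // Quot.mk Γ.Joined v = c} =>
      (⟨Sum.inl v.1, (mk_inl_eq_inl Γ Δ _ _).2 v.2⟩ :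
        {v // Quot.mk (Γ.union Δ).Joined v = compUnion Γ Δ (Sum.inl c)}))
    ⟨fun v w e => Subtype.ext (Sum.inl_injective (congrArg Subtype.val e)), by
      rintro ⟨v | v, e⟩
      · exact ⟨⟨v, (mk_inl_eq_inl Γ Δ _ _).1 e⟩, rfl⟩
      · exact absurd e (mk_inr_ne_inl Γ Δ v c)⟩
  onH := Equiv.ofBijective (fun h : {h // Quot.mk Γ.Joined (Γ.vert h) = c} =>
      (⟨Sum.inl h.1, (mk_inl_eq_inl Γ Δ _ _).2 h.2⟩ :
        {h // Quot.mk (Γ.union Δ).Joined ((Γ.union Δ).vert h) = compUnion Γ Δ (Sum.inl c)}))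
    ⟨fun v w e => Subtype.ext (Sum.inl_injective (congrArg Subtype.val e)), by
      rintro ⟨h | h, e⟩
      · exact ⟨⟨h, (mk_inl_eq_inl Γ Δ _ _).1 e⟩, rfl⟩
      · exact absurd e (mk_inr_ne_inl Γ Δ (Δ.vert h) c)⟩
  vert_eq _ := rfl
  inv_eq _ := rfl
  deco_eq v := by
    exact Labels.map_map_eq (starInl Γ.vert Δ.vert v.1)
      ((Γ.union Δ).compStar (compUnion Γ Δ (Sum.inl c)) ⟨Sum.inl v.1, (mk_inl_eq_inl Γ Δ _ _).2 v.2⟩)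
      (Γ.compStar c v) _ (fun _ => rfl) (Γ.deco v.1)
  lt_iff _ _ := Sum.lex_inl_inl (r := Γ.lt) (s := Δ.lt)
  tail_iff _ := Iff.rfl

/-- The components of the second graph of a disjoint union. -/
noncomputable def componentInr (c : Δ.Comp) :
    (Δ.component c).Iso ((Γ.union Δ).component (compUnion Γ Δ (Sum.inr c))) where
  onV := Equiv.ofBijective (fun v : {v // Quot.mk Δ.Joined v = c} =>
      (⟨Sum.inr v.1, (mk_inr_eq_inr Γ Δ _ _).2 v.2⟩ :
        {v // Quot.mk (Γ.union Δ).Joined v = compUnion Γ Δ (Sum.inr c)}))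
    ⟨fun v w e => Subtype.ext (Sum.inr_injective (congrArg Subtype.val e)), by
      rintro ⟨v | v, e⟩
      · exact absurd e (mk_inl_ne_inr Γ Δ v c)
      · exact ⟨⟨v, (mk_inr_eq_inr Γ Δ _ _).1 e⟩, rfl⟩⟩
  onH := Equiv.ofBijective (fun h : {h // Quot.mk Δ.Joined (Δ.vert h) = c} =>
      (⟨Sum.inr h.1, (mk_inr_eq_inr Γ Δ _ _).2 h.2⟩ :
        {h // Quot.mk (Γ.union Δ).Joined ((Γ.union Δ).vert h) = compUnion Γ Δ (Sum.inr c)}))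
    ⟨fun v w e => Subtype.ext (Sum.inr_injective (congrArg Subtype.val e)), by
      rintro ⟨h | h, e⟩
      · exact absurd e (mk_inl_ne_inr Γ Δ (Γ.vert h) c)
      · exact ⟨⟨h, (mk_inr_eq_inr Γ Δ _ _).1 e⟩, rfl⟩⟩
  vert_eq _ := rfl
  inv_eq _ := rfl
  deco_eq v := by
    exact Labels.map_map_eq (starInr Γ.vert Δ.vert v.1)
      ((Γ.union Δ).compStar (compUnion Γ Δ (Sum.inr c)) ⟨Sum.inr v.1, (mk_inr_eq_inr Γ Δ _ _).2 v.2⟩)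
      (Δ.compStar c v) _ (fun _ => rfl) (Δ.deco v.1)
  lt_iff _ _ := Sum.lex_inr_inr (r := Γ.lt) (s := Δ.lt)
  tail_iff _ := Iff.rfl

theorem compGen_inl (c : Γ.Comp) :
    (Γ.union Δ).compGen (compUnion Γ Δ (Sum.inl c)) = Γ.compGen c :=
  congrArg _ (pcls_eq _ _ (cls_iso (componentInl Γ Δ c)))

theorem compGen_inr (c : Δ.Comp) :
    (Γ.union Δ).compGen (compUnion Γ Δ (Sum.inr c)) = Δ.compGen c :=
  congrArg _ (pcls_eq _ _ (cls_iso (componentInr Γ Δ c)))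

theorem compSign_union (c d : (Γ.union Δ).Comp) [Fintype Γ.V] [Fintype Δ.V] :
    compSign k (Γ.union Δ) c d = (∏ v : Γ.V ⊕ Δ.V, ∏ w : Γ.V ⊕ Δ.V,
      sg k (Sum.Lex Γ.lt Δ.lt v w ∧ Quot.mk (Γ.union Δ).Joined v = d ∧
        Quot.mk (Γ.union Δ).Joined w = c)) :=
  @compSign_eq k _ O (Γ.union Δ) (inferInstanceAs (Fintype (Γ.V ⊕ Δ.V))) c d

theorem compSign_inl_inl (c d : Γ.Comp) :
    compSign k (Γ.union Δ) (compUnion Γ Δ (Sum.inl c)) (compUnion Γ Δ (Sum.inl d)) =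
      compSign k Γ c d := by
  have i₁ : Fintype Γ.V := Fintype.ofFinite _
  have i₂ : Fintype Δ.V := Fintype.ofFinite _
  rw [compSign_union, compSign_eq]
  simp only [Fintype.prod_sum_type, mk_inl_eq_inl, mk_inr_ne_inl, Sum.lex_inl_inl, false_and, and_false,
    sg_false, Finset.prod_const_one, mul_one]

theorem compSign_inr_inr (c d : Δ.Comp) :
    compSign k (Γ.union Δ) (compUnion Γ Δ (Sum.inr c)) (compUnion Γ Δ (Sum.inr d)) =
      compSign k Δ c d := by
  have i₁ : Fintype Γ.V := Fintype.ofFinite _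
  have i₂ : Fintype Δ.V := Fintype.ofFinite _
  rw [compSign_union, compSign_eq]
  simp only [Fintype.prod_sum_type, mk_inr_eq_inr, mk_inl_ne_inr, Sum.lex_inr_inr, false_and, and_false,
    sg_false, Finset.prod_const_one, one_mul]

theorem compSign_inl_inr (c : Γ.Comp) (d : Δ.Comp) :
    compSign k (Γ.union Δ) (compUnion Γ Δ (Sum.inl c)) (compUnion Γ Δ (Sum.inr d)) = 1 := by
  have i₁ : Fintype Γ.V := Fintype.ofFinite _
  have i₂ : Fintype Δ.V := Fintype.ofFinite _
  rw [compSign_union]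
  simp only [Fintype.prod_sum_type, mk_inl_ne_inr, mk_inr_ne_inl, Sum.lex_inr_inl, false_and, and_false,
    sg_false, Finset.prod_const_one, one_mul]

/-- List the components of `Γ` before those of `Δ`. The vertices of `Γ` already come first, so no
signs arise between the two groups. -/
theorem splitProduct_union : (Γ.union Δ).splitProduct = Γ.splitProduct * Δ.splitProduct := by
  obtain ⟨L, hL, h⟩ := Γ.exists_full_list
  obtain ⟨M, hM, h'⟩ := Δ.exists_full_list
  have hn : (L.map (fun c => compUnion Γ Δ (Sum.inl c)) ++
      M.map (fun c => compUnion Γ Δ (Sum.inr c))).Nodup := by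
    refine List.nodup_append'.2 ⟨?_, ?_, ?_⟩
    · exact (List.nodup_map_iff ((compUnion Γ Δ).injective.comp Sum.inl_injective)).2 hL
    · exact (List.nodup_map_iff ((compUnion Γ Δ).injective.comp Sum.inr_injective)).2 hM
    · intro x hx hx'
      obtain ⟨c, _, rfl⟩ := List.mem_map.1 hx
      obtain ⟨d, _, e⟩ := List.mem_map.1 hx'
      exact nomatch (compUnion Γ Δ).injective e
  have hf : ∀ c, c ∈ L.map (fun c => compUnion Γ Δ (Sum.inl c)) ++
      M.map (fun c => compUnion Γ Δ (Sum.inr c)) := by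
    intro c
    obtain ⟨c | c, rfl⟩ := (compUnion Γ Δ).surjective c
    · exact List.mem_append_left _ (List.mem_map.2 ⟨c, h c, rfl⟩)
    · exact List.mem_append_right _ (List.mem_map.2 ⟨c, h' c, rfl⟩)
  rw [Γ.splitProduct_eq hL h, Δ.splitProduct_eq hM h', (Γ.union Δ).splitProduct_eq hn hf, compProd,
    compProd, compProd, pairSign_append, pairSign_map, pairSign_map, List.map_append, List.prod_append,
    List.map_map, List.map_map, List.map_map]
  have e : ∀ c, ((M.map fun c => compUnion Γ Δ (Sum.inr c)).map
      (compSign k (Γ.union Δ) (compUnion Γ Δ (Sum.inl c)))).prod = 1 := fun c => by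
    rw [List.map_map]
    refine List.prod_eq_one fun x hx => ?_
    obtain ⟨d, _, rfl⟩ := List.mem_map.1 hx
    exact compSign_inl_inr Γ Δ c d
  simp only [Function.comp_def, compSign_inl_inl, compSign_inr_inr, compGen_inl, compGen_inr, e,
    List.map_const', List.prod_replicate, one_pow, mul_one, smul_mul_smul_comm]

end Union

/-! ### Splitting off one component. -/

section Complement
variable (Γ : OGraph O) (c : Γ.Comp)

/-- The union of all components but one. -/
noncomputable def complement : OGraph O where
  V := {v : Γ.V // Quot.mk Γ.Joined v ≠ c}
  H := {h : Γ.H // Quot.mk Γ.Joined (Γ.vert h) ≠ c}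
  vert h := ⟨Γ.vert h.1, h.2⟩
  inv h := ⟨Γ.inv h.1, (Γ.mk_vert_inv h.1).trans_ne h.2⟩
  inv_inv h := Subtype.ext (Γ.inv_inv h.1)
  inv_ne h e := Γ.inv_ne h.1 (congrArg Subtype.val e)
  valence v := (Γ.valence v.1).trans_eq (Nat.card_congr
    { toFun h := ⟨⟨h.1, (congrArg _ h.2).trans_ne v.2⟩, Subtype.ext h.2⟩
      invFun h := ⟨h.1.1, congrArg Subtype.val h.2⟩
      left_inv _ := rfl
      right_inv _ := rfl })
  deco v := Labels.map O
    { toFun h := ⟨⟨h.1, (congrArg _ h.2).trans_ne v.2⟩, Subtype.ext h.2⟩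
      invFun h := ⟨h.1.1, congrArg Subtype.val h.2⟩
      left_inv _ := rfl
      right_inv _ := rfl } (Γ.deco v.1)
  lt v w := Γ.lt v.1 w.1
  order := (RelEmbedding.preimage (Function.Embedding.subtype _) Γ.lt).isStrictTotalOrder
  tail h := Γ.tail h.1
  tail_inv h := Γ.tail_inv h.1

/-- The ordering of the vertices where those of one component come first. -/
def ltFirst (v w : Γ.V) : Prop :=
  (Quot.mk Γ.Joined v = c ∧ Quot.mk Γ.Joined w ≠ c) ∨
    ((Quot.mk Γ.Joined v = c ↔ Quot.mk Γ.Joined w = c) ∧ Γ.lt v w)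

theorem isStrictTotalOrder_ltFirst : IsStrictTotalOrder Γ.V (Γ.ltFirst c) where
  trichotomous v w h₁ h₂ := by
    by_contra hne
    have := not_lt_iff Γ.lt hne
    simp only [ltFirst] at h₁ h₂
    tauto
  irrefl v h := by
    have := irrefl_of Γ.lt v
    simp only [ltFirst] at h
    tauto
  trans u v w h₁ h₂ := by
    have : Γ.lt u v → Γ.lt v w → Γ.lt u w := trans_of Γ.lt
    simp only [ltFirst] at h₁ h₂ ⊢
    tauto

open Classical in
/-- A graph is the disjoint union of a component and of its complement. -/
noncomputable def unionIso : ((Γ.component c).union (Γ.complement c)).Iso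
    (@reorient k _ O Γ (Γ.ltFirst c) (Γ.isStrictTotalOrder_ltFirst c) Γ.tail Γ.tail_inv) where
  onV := Equiv.sumCompl fun v => Quot.mk Γ.Joined v = c
  onH := Equiv.sumCompl fun h => Quot.mk Γ.Joined (Γ.vert h) = c
  vert_eq := by rintro (h | h) <;> rfl
  inv_eq := by rintro (h | h) <;> rfl
  deco_eq := by
    rintro (v | v)
    · refine Eq.trans ?_ (Labels.map_map O _ _ _).symm
      refine Eq.trans ?_ (Labels.map_map O _ _ _).symm
      exact (Labels.map_of_forall_eq O (fun _ => rfl) _).symm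
    · refine Eq.trans ?_ (Labels.map_map O _ _ _).symm
      refine Eq.trans ?_ (Labels.map_map O _ _ _).symm
      exact (Labels.map_of_forall_eq O (fun _ => rfl) _).symm
  lt_iff := by
    have key : ∀ v w : {v : Γ.V // Quot.mk Γ.Joined v = c} ⊕ {v : Γ.V // Quot.mk Γ.Joined v ≠ c},
        Γ.ltFirst c (Sum.elim Subtype.val Subtype.val v) (Sum.elim Subtype.val Subtype.val w) ↔
          Sum.Lex (fun a b => Γ.lt a.1 b.1) (fun a b => Γ.lt a.1 b.1) v w := by
      rintro (v | v) (w | w) <;> simp [ltFirst, v.2, w.2]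
    exact key
  tail_iff := by rintro (h | h) <;> exact Iff.rfl

/-- The scalar is the sign of moving the vertices of `c` to the front. Its value is irrelevant when
identities between linear maps are reduced to disjoint unions. -/
theorem exists_cls_eq_union : ∃ ε : k,
    Γ.cls = ε • ((Γ.component c).union (Γ.complement c)).cls := by
  have iS := Γ.isStrictTotalOrder_ltFirst c
  have h₁ := cls_iso (Γ.unionIso c)
  rw [cls_reorient] at h₁
  refine ⟨(-1) ^ Γ.changes (Γ.ltFirst c) Γ.tail, ?_⟩
  rw [← h₁, smul_smul, neg_one_pow_mul_self, one_smul]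

theorem numComp_complement : (Γ.complement c).numComp + 1 = Γ.numComp := by
  have h₁ := (Γ.unionIso c).numComp_eq
  rw [numComp_union] at h₁
  have h₂ : (Γ.component c).numComp = 1 := Γ.component_isConnected c
  have h₃ : (@reorient k _ O Γ (Γ.ltFirst c) (Γ.isStrictTotalOrder_ltFirst c) Γ.tail Γ.tail_inv).numComp =
    Γ.numComp := rfl
  omega

end Complement

/-! ### Word length and the projections. -/

section Proj
open Polynomial
variable {W : Type*} [AddCommGroup W] [Module k W] (gr : ℕ → Submodule k W)

theorem wordLength_gen (x : W) :
    GradedSym.wordLength gr (GradedSym.gen gr x) = C (GradedSym.gen gr x) * X := by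
  simp [GradedSym.wordLength, GradedSym.gen]

theorem wordLength_prod (L : List W) : GradedSym.wordLength gr (L.map (GradedSym.gen gr)).prod =
    C (L.map (GradedSym.gen gr)).prod * X ^ L.length := by
  induction L with
  | nil => simp
  | cons x L ih =>
    rw [List.map_cons, List.prod_cons, map_mul, ih, wordLength_gen, map_mul, List.length_cons, pow_succ',
      mul_assoc, ← mul_assoc X, (commute_X _).eq]
    simp only [mul_assoc]

theorem proj_prod (i : ℕ) (L : List W) : GradedSym.proj gr i (L.map (GradedSym.gen gr)).prod =
    if L.length = i then (L.map (GradedSym.gen gr)).prod else 0 := by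
  rw [GradedSym.proj, LinearMap.comp_apply, AlgHom.toLinearMap_apply, wordLength_prod]
  simp [coeff_X_pow, eq_comm]

/-- The product of the components is, up to sign, a word whose length is the number of components.
-/
theorem proj_splitProduct (i : ℕ) (Γ : OGraph O) : GradedSym.proj (grading O) i Γ.splitProduct =
    if Γ.numComp = i then Γ.splitProduct else 0 := by
  obtain ⟨L, hL, h⟩ := Γ.exists_full_list
  have hl : L.length = Γ.numComp := by
    classical
    have iC : Fintype Γ.Comp := Fintype.ofFinite _
    rw [← List.toFinset_card_of_nodup hL, numComp, Nat.card_eq_fintype_card, ← Finset.card_univ]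
    congr 1
    ext c
    simp [h]
  have e : L.map Γ.compGen = (L.map fun c => (Γ.component c).pcls (Γ.component_isConnected c)).map
      (GradedSym.gen (grading O)) := by rw [List.map_map]; rfl
  rw [Γ.splitProduct_eq hL h, compProd, map_smul, e, proj_prod, List.length_map, hl]
  split_ifs
  · rfl
  · exact smul_zero _

theorem splitProduct_of_isConnected {Γ : OGraph O} (h : Γ.IsConnected) :
    Γ.splitProduct = GradedSym.gen (grading O) (Γ.pcls h) := by
  obtain ⟨c, hc⟩ := Nat.card_eq_one_iff_exists.1 h
  rw [Γ.splitProduct_eq (L := [c]) (List.nodup_singleton c) fun d => by rw [hc d]; exact List.mem_cons_self]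
  rw [compProd_cons]
  simp only [List.map_nil, List.prod_nil, one_smul]
  have e : Γ.compProd [] = 1 := by simp [compProd, pairSign]
  rw [e, mul_one]
  refine congrArg _ (pcls_eq _ _ ?_)
  have φ : (Γ.component c).Iso Γ :=
    { onV := Equiv.subtypeUnivEquiv fun v => hc _
      onH := Equiv.subtypeUnivEquiv fun v => hc _
      vert_eq := fun _ => rfl
      inv_eq := fun _ => rfl
      deco_eq := fun v => by
        rw [component_deco]
        refine Eq.trans ?_ (Labels.map_map O _ _ _).symm
        exact (Labels.map_of_forall_eq O (fun _ => rfl) _).symm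
      lt_iff := fun _ _ => Iff.rfl
      tail_iff := fun _ => Iff.rfl }
  exact (cls_iso φ).symm

end Proj
end OGraph
end GraphComplex
namespace GraphComplex
variable {k : Type u} [Field k] {O : CyclicOperad.{u, w} k}
namespace OGraph

/-! ### Fission in one part of a disjoint union. -/

section FissionUnion
variable (Γ Δ : OGraph O)

/-- The half-edges of the first graph of a disjoint union. -/
def inlH (h : Γ.H) : (Γ.union Δ).H := Sum.inl h

/-- The half-edges of the second graph of a disjoint union. -/
def inrH (h : Δ.H) : (Γ.union Δ).H := Sum.inr h

theorem inlH_injective : Function.Injective (inlH Γ Δ) := Sum.inl_injective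

theorem inrH_injective : Function.Injective (inrH Γ Δ) := Sum.inr_injective

theorem isSep_map_inl {l : List Γ.H} : (Γ.union Δ).IsSep (l.map (inlH Γ Δ)) ↔ Γ.IsSep l := by
  refine and_congr (List.nodup_map_iff (inlH_injective Γ Δ)) ?_
  refine List.forall_mem_map.trans (forall₂_congr fun h _ => not_congr ?_)
  exact List.mem_map_of_injective (inlH_injective Γ Δ)

theorem inr_notMem_map_inl {α β : Type} (l : List α) (b : β) :
    (Sum.inr b : α ⊕ β) ∉ l.map Sum.inl := by simp

/-- Attaching a polygon to edges of the first graph of a disjoint union. -/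
noncomputable def attachUnionIso {l : List Γ.H} (hl : Γ.IsSep l)
    (hl' : (Γ.union Δ).IsSep (l.map (inlH Γ Δ))) :
    ((Γ.attachList l hl).union Δ).Iso ((Γ.union Δ).attachList (l.map (inlH Γ Δ)) hl') where
  onV := Equiv.refl _
  onH := Equiv.refl _
  vert_eq _ := rfl
  inv_eq := by
    have key : ∀ h : Γ.H ⊕ Δ.H, cyc (l.map (Sum.inl : Γ.H → Γ.H ⊕ Δ.H)) (Sum.map Γ.inv Δ.inv
        ((cyc (l.map (Sum.inl : Γ.H → Γ.H ⊕ Δ.H))).symm h)) =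
          Sum.map (fun h => cyc l (Γ.inv ((cyc l).symm h))) Δ.inv h := by
      rintro (h | h)
      · rw [cyc_map_symm Sum.inl_injective]
        exact cyc_map Sum.inl_injective _ _
      · rw [cyc_symm_of_notMem (inr_notMem_map_inl l h)]
        exact cyc_of_notMem (inr_notMem_map_inl l (Δ.inv h))
    exact key
  deco_eq := by
    rintro (v | v)
    · exact (Labels.map_of_forall_eq O (fun _ => rfl) ((Γ.union Δ).deco (Sum.inl v))).symm
    · exact (Labels.map_of_forall_eq O (fun _ => rfl) ((Γ.union Δ).deco (Sum.inr v))).symm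
  lt_iff _ _ := Iff.rfl
  tail_iff := by
    have key : ∀ h : Γ.H ⊕ Δ.H, (Γ.union Δ).aligned (l.map Sum.inl) h ↔
        Sum.elim (Γ.aligned l) Δ.tail h := by
      rintro (h | h)
      · refine or_congr (List.mem_map_of_injective (f := (Sum.inl : Γ.H → Γ.H ⊕ Δ.H))
          Sum.inl_injective) (and_congr (not_congr ?_) Iff.rfl)
        exact List.mem_map_of_injective (f := (Sum.inl : Γ.H → Γ.H ⊕ Δ.H)) Sum.inl_injective
      · exact (or_iff_right (inr_notMem_map_inl l h)).trans
          (and_iff_right (inr_notMem_map_inl l (Δ.inv h)))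
    exact key

theorem attachSgn_map_inl (l : List Γ.H) :
    attachSgn k (Γ.union Δ) (l.map (inlH Γ Δ)) = attachSgn k Γ l := by
  unfold attachSgn
  rw [List.map_map]
  rfl

theorem splits_map_inl (l : List Γ.H) : (Γ.union Δ).Splits (l.map (inlH Γ Δ)) ↔ Γ.Splits l := by
  have key : ∀ hl : Γ.IsSep l, ∀ hl' : (Γ.union Δ).IsSep (l.map (inlH Γ Δ)),
      ((Γ.union Δ).attachList (l.map (inlH Γ Δ)) hl').numComp =
        (Γ.attachList l hl).numComp + Δ.numComp := fun hl hl' =>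
    (attachUnionIso Γ Δ hl hl').numComp_eq.trans (numComp_union _ _)
  have e : (l.map (inlH Γ Δ)).length = l.length := List.length_map _
  have e' := numComp_union Γ Δ
  constructor
  · rintro ⟨hl', h⟩
    have hl := (isSep_map_inl Γ Δ).1 hl'
    have := key hl hl'
    exact ⟨hl, by omega⟩
  · rintro ⟨hl, h⟩
    have hl' := (isSep_map_inl Γ Δ).2 hl
    have := key hl hl'
    exact ⟨hl', by omega⟩

/-- The vertices after contraction of an edge of the first graph of a disjoint union. -/
def contractUnionV (t : Γ.H) : Γ.ContractV t ⊕ Δ.V ≃ (Γ.union Δ).ContractV (inlH Γ Δ t) where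
  toFun := Sum.elim (fun v => (⟨Sum.inl v.1, fun e => v.2 (Sum.inl_injective e)⟩ :
    {v : Γ.V ⊕ Δ.V // v ≠ Sum.inl (Γ.vert (Γ.inv t))})) fun v => ⟨Sum.inr v, Sum.inr_ne_inl⟩
  invFun v := match v with
    | ⟨Sum.inl v, h⟩ => Sum.inl ⟨v, fun e => h (congrArg _ e)⟩
    | ⟨Sum.inr v, _⟩ => Sum.inr v
  left_inv := by rintro (v | v) <;> rfl
  right_inv := by rintro ⟨v | v, h⟩ <;> rfl

/-- The half-edges after contraction of an edge of the first graph of a disjoint union. -/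
def contractUnionH (t : Γ.H) : Γ.ContractH t ⊕ Δ.H ≃ (Γ.union Δ).ContractH (inlH Γ Δ t) where
  toFun := Sum.elim (fun h => (⟨Sum.inl h.1, fun e => h.2.1 (Sum.inl_injective e),
    fun e => h.2.2 (Sum.inl_injective e)⟩ :
      {h : Γ.H ⊕ Δ.H // h ≠ Sum.inl t ∧ h ≠ Sum.inl (Γ.inv t)}))
    fun v => ⟨Sum.inr v, Sum.inr_ne_inl, Sum.inr_ne_inl⟩
  invFun v := match v with
    | ⟨Sum.inl v, h⟩ => Sum.inl ⟨v, fun e => h.1 (congrArg _ e), fun e => h.2 (congrArg _ e)⟩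
    | ⟨Sum.inr v, _⟩ => Sum.inr v
  left_inv := by rintro (v | v) <;> rfl
  right_inv := by rintro ⟨v | v, h⟩ <;> rfl

theorem contractUnion_vert {t : Γ.H} (ht : Γ.vert t ≠ Γ.vert (Γ.inv t))
    (ht' : (Γ.union Δ).vert (inlH Γ Δ t) ≠ (Γ.union Δ).vert ((Γ.union Δ).inv (inlH Γ Δ t)))
    (h : Γ.ContractH t ⊕ Δ.H) : (Γ.union Δ).contractVert (inlH Γ Δ t) ht' (contractUnionH Γ Δ t h) =
      contractUnionV Γ Δ t (Sum.map (Γ.contractVert t ht) Δ.vert h) := by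
  classical
  rcases h with h | h
  · refine Subtype.ext ((contractVert_val (Γ.union Δ) ht' _).trans ?_)
    refine Eq.trans ?_ (congrArg Sum.inl (contractVert_val Γ ht h).symm)
    by_cases e : Γ.vert h.1 = Γ.vert (Γ.inv t)
    · exact (if_pos (congrArg Sum.inl e)).trans (congrArg Sum.inl (if_pos e).symm)
    · exact (if_neg fun e' => e (Sum.inl_injective e')).trans (congrArg Sum.inl (if_neg e).symm)
  · exact Subtype.ext ((contractVert_val (Γ.union Δ) ht' _).trans (if_neg Sum.inr_ne_inl))

/-- The half-edges at the initial vertex of an edge of the first graph of a disjoint union. -/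
def starAt (t : Γ.H) : {h // Γ.vert h = Γ.vert t} ≃
    {h // (Γ.union Δ).vert h = (Γ.union Δ).vert (inlH Γ Δ t)} := starInl Γ.vert Δ.vert (Γ.vert t)

/-- The half-edges at the final vertex of an edge of the first graph of a disjoint union. -/
def starAtInv (t : Γ.H) : {h // Γ.vert h = Γ.vert (Γ.inv t)} ≃
    {h // (Γ.union Δ).vert h = (Γ.union Δ).vert ((Γ.union Δ).inv (inlH Γ Δ t))} :=
  starInl Γ.vert Δ.vert (Γ.vert (Γ.inv t))

/-- The bijection `E` is arbitrary with prescribed underlying half-edges, so that the statement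
applies to the one built into an isomorphism of graphs. -/
theorem contractUnion_deco_inl {t : Γ.H} (ht : Γ.vert t ≠ Γ.vert (Γ.inv t))
    (ht' : (Γ.union Δ).vert (inlH Γ Δ t) ≠ (Γ.union Δ).vert ((Γ.union Δ).inv (inlH Γ Δ t)))
    (v : Γ.ContractV t)
    (E : {h // Γ.contractVert t ht h = v} ≃ {h : (Γ.union Δ).ContractH (inlH Γ Δ t) //
      (Γ.union Δ).contractVert (inlH Γ Δ t) ht' h = contractUnionV Γ Δ t (Sum.inl v)})
    (hE : ∀ h, (E h).1.1 = Sum.inl h.1.1) :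
    ((Γ.union Δ).contract ht').deco (contractUnionV Γ Δ t (Sum.inl v)) =
      Labels.map O E ((Γ.contract ht).deco v) := by
  by_cases hv : v.1 = Γ.vert t
  · rw [contract_deco_merged (Γ.union Δ) ht' _ (congrArg Sum.inl hv), contract_deco_merged Γ ht v hv]
    have a₁ : (Γ.union Δ).deco ((Γ.union Δ).vert (inlH Γ Δ t)) =
      Labels.map O (starAt Γ Δ t) (Γ.deco (Γ.vert t)) := rfl
    have a₂ : (Γ.union Δ).deco ((Γ.union Δ).vert ((Γ.union Δ).inv (inlH Γ Δ t))) =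
      Labels.map O (starAtInv Γ Δ t) (Γ.deco (Γ.vert (Γ.inv t))) := rfl
    rw [Labels.map_map, a₁, a₂]
    have h₁ : starAt Γ Δ t ⟨t, rfl⟩ = ⟨inlH Γ Δ t, rfl⟩ := rfl
    have h₂ : starAtInv Γ Δ t ⟨Γ.inv t, rfl⟩ = ⟨(Γ.union Δ).inv (inlH Γ Δ t), rfl⟩ := rfl
    have key := Labels.map_comp_map O (starAt Γ Δ t) (starAtInv Γ Δ t) h₁ h₂
      ((Γ.union Δ).starMerged ht' (contractUnionV Γ Δ t (Sum.inl v)) (congrArg Sum.inl hv))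
      ((Γ.starMerged ht v hv).trans E)
    refine key (fun s hs hs' => Subtype.ext (Subtype.ext ?_)) (fun s hs hs' => Subtype.ext (Subtype.ext ?_))
      (Γ.deco (Γ.vert t)) (Γ.deco (Γ.vert (Γ.inv t)))
    · exact (hE (Γ.starMerged ht v hv (Sum.inl ⟨s, hs'⟩))).symm
    · exact (hE (Γ.starMerged ht v hv (Sum.inr ⟨s, hs'⟩))).symm
  · rw [contract_deco_other (Γ.union Δ) ht' _ fun e => hv (Sum.inl_injective e),
      contract_deco_other Γ ht v hv]
    refine Eq.trans ?_ (Labels.map_map O _ _ _).symm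
    refine Eq.trans (Labels.map_map O (starInl Γ.vert Δ.vert v.1) _ _) ?_
    exact Labels.map_congr O (fun s => Subtype.ext (Subtype.ext (hE (Γ.starOther ht v hv s)).symm)) _

theorem contractUnion_deco_inr {t : Γ.H}
    (ht' : (Γ.union Δ).vert (inlH Γ Δ t) ≠ (Γ.union Δ).vert ((Γ.union Δ).inv (inlH Γ Δ t)))
    (v : Δ.V) (E : {h // Δ.vert h = v} ≃ {h : (Γ.union Δ).ContractH (inlH Γ Δ t) //
      (Γ.union Δ).contractVert (inlH Γ Δ t) ht' h = contractUnionV Γ Δ t (Sum.inr v)})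
    (hE : ∀ h, (E h).1.1 = Sum.inr h.1) :
    ((Γ.union Δ).contract ht').deco (contractUnionV Γ Δ t (Sum.inr v)) =
      Labels.map O E (Δ.deco v) := by
  rw [contract_deco_other (Γ.union Δ) ht' _ Sum.inr_ne_inl]
  refine Eq.trans (Labels.map_map O (starInr Γ.vert Δ.vert v) _ _) ?_
  exact Labels.map_congr O (fun s => Subtype.ext (Subtype.ext (hE _).symm)) _

/-- Contraction of an edge of the first graph of a disjoint union. -/
noncomputable def contractUnionIso {t : Γ.H} (ht : Γ.vert t ≠ Γ.vert (Γ.inv t))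
    (ht' : (Γ.union Δ).vert (inlH Γ Δ t) ≠ (Γ.union Δ).vert ((Γ.union Δ).inv (inlH Γ Δ t))) :
    ((Γ.contract ht).union Δ).Iso ((Γ.union Δ).contract ht') where
  onV := contractUnionV Γ Δ t
  onH := contractUnionH Γ Δ t
  vert_eq := by
    rintro (h | h)
    · exact contractUnion_vert Γ Δ ht ht' (Sum.inl h)
    · exact contractUnion_vert Γ Δ ht ht' (Sum.inr h)
  inv_eq := by rintro (h | h) <;> rfl
  deco_eq := by
    rintro (v | v)
    · refine Eq.trans ?_ (Labels.map_map O (starInl (Γ.contract ht).vert Δ.vert v) _ _).symm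
      exact contractUnion_deco_inl Γ Δ ht ht' v _ fun _ => rfl
    · refine Eq.trans ?_ (Labels.map_map O (starInr (Γ.contract ht).vert Δ.vert v) _ _).symm
      exact contractUnion_deco_inr Γ Δ ht' v _ fun _ => rfl
  lt_iff := by
    rintro (v | v) (w | w)
    · exact (Sum.lex_inl_inl (r := Γ.lt) (s := Δ.lt)).trans
        (Sum.lex_inl_inl (r := (Γ.contract ht).lt) (s := Δ.lt)).symm
    · exact iff_of_true (Sum.Lex.sep _ _) (Sum.Lex.sep _ _)
    · exact iff_of_false Sum.lex_inr_inl Sum.lex_inr_inl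
    · exact (Sum.lex_inr_inr (r := Γ.lt) (s := Δ.lt)).trans
        (Sum.lex_inr_inr (r := (Γ.contract ht).lt) (s := Δ.lt)).symm
  tail_iff := by rintro (h | h) <;> exact Iff.rfl

/-- The vertices of `Δ` come after all endpoints of `t`, so they do not enter the count. -/
theorem contractSign_inl (t : Γ.H) :
    contractSign k (Γ.union Δ) (inlH Γ Δ t) = contractSign k Γ t := by
  have i₁ : Fintype Γ.V := Fintype.ofFinite _
  have i₂ : Fintype Δ.V := Fintype.ofFinite _
  refine Eq.trans ?_ (contractSign_eq Γ t).symm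
  refine (@contractSign_eq k _ O (Γ.union Δ) (inferInstanceAs (Fintype (Γ.V ⊕ Δ.V))) _).trans ?_
  refine congrArg (sg k (¬ Γ.tail t) * ·) (congrArg Neg.neg ?_)
  change ∏ v : Γ.V ⊕ Δ.V, sg k (Sum.Lex Γ.lt Δ.lt v (Sum.inl (Γ.vert (Γ.inv t)))) = _
  rw [Fintype.prod_sum_type]
  simp only [Sum.lex_inl_inl, Sum.lex_inr_inl, sg_false, Finset.prod_const_one, mul_one]

theorem splitMap_contractCls_inl (t : Γ.H) : splitMap O ((Γ.union Δ).contractCls (inlH Γ Δ t)) =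
    splitMap O (Γ.contractCls t) * Δ.splitProduct := by
  by_cases ht : Γ.vert t = Γ.vert (Γ.inv t)
  · rw [contractCls_of_eq _ ht,
      contractCls_of_eq (Γ.union Δ) (t := inlH Γ Δ t) (congrArg Sum.inl ht), map_zero, zero_mul]
  · have ht' : (Γ.union Δ).vert (inlH Γ Δ t) ≠ (Γ.union Δ).vert ((Γ.union Δ).inv (inlH Γ Δ t)) :=
      fun e => ht (Sum.inl_injective e)
    rw [contractCls_of_ne _ ht, contractCls_of_ne _ ht', contractSign_inl,
      cls_iso (contractUnionIso Γ Δ ht ht'), map_smul, map_smul, splitMap_cls, splitMap_cls,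
      splitProduct_union, smul_mul_assoc]

theorem splitMap_fissionTerm_inl (l : List Γ.H) :
    splitMap O ((Γ.union Δ).fissionTerm (l.map (inlH Γ Δ))) =
      splitMap O (Γ.fissionTerm l) * Δ.splitProduct := by
  by_cases h : Γ.Splits l
  · rw [fissionTerm_of _ h, fissionTerm_of _ ((splits_map_inl Γ Δ l).2 h)]
    cases l with
    | nil => exact (map_zero _).trans ((congrArg (· * _) (map_zero (splitMap O))).trans (zero_mul _)).symm
    | cons t l =>
      obtain ⟨hl, -⟩ := h
      have hl' := (isSep_map_inl Γ Δ).2 hl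
      change splitMap O ((Γ.union Δ).attachTerm ((t :: l).map (inlH Γ Δ)) (inlH Γ Δ t)) =
        splitMap O (Γ.attachTerm (t :: l) t) * _
      rw [attachTerm_of _ hl, attachTerm_of _ hl', attachSgn_map_inl, map_smul, map_smul, smul_mul_assoc]
      refine congrArg _ (Eq.trans ?_ (splitMap_contractCls_inl (Γ.attachList (t :: l) hl) Δ t))
      exact congrArg _ (contractCls_iso (attachUnionIso Γ Δ hl hl') (Sum.inl t))
  · rw [fissionTerm_of_not _ h, fissionTerm_of_not _ (mt (splits_map_inl Γ Δ l).1 h), map_zero, zero_mul]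

/-- The ordering of the vertices of a disjoint union where those of the second graph come first. -/
def ltSwap (v w : (Γ.union Δ).V) : Prop := Sum.Lex Δ.lt Γ.lt (Sum.swap v) (Sum.swap w)

theorem isStrictTotalOrder_ltSwap : IsStrictTotalOrder (Γ.union Δ).V (Γ.ltSwap Δ) :=
  have := isStrictTotalOrder_sumLex Δ.lt Γ.lt
  (RelEmbedding.preimage (Equiv.sumComm Γ.V Δ.V).toEmbedding (Sum.Lex Δ.lt Γ.lt)).isStrictTotalOrder

/-- The exchange of the two graphs of a disjoint union. -/
def unionSwap : (Δ.union Γ).Iso (@reorient k _ O (Γ.union Δ) (Γ.ltSwap Δ)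
    (Γ.isStrictTotalOrder_ltSwap Δ) (Γ.union Δ).tail (Γ.union Δ).tail_inv) where
  onV := Equiv.sumComm _ _
  onH := Equiv.sumComm _ _
  vert_eq := by rintro (h | h) <;> rfl
  inv_eq := by rintro (h | h) <;> rfl
  deco_eq := by
    rintro (v | v)
    · refine Eq.trans ?_ (Labels.map_map O (starInl Δ.vert Γ.vert v) _ _).symm
      refine Labels.map_congr O (e := starInr Γ.vert Δ.vert v) (fun _ => ?_) (Δ.deco v)
      rfl
    · refine Eq.trans ?_ (Labels.map_map O (starInr Δ.vert Γ.vert v) _ _).symm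
      refine Labels.map_congr O (e := starInl Γ.vert Δ.vert v) (fun _ => ?_) (Γ.deco v)
      rfl
  lt_iff := by rintro (v | v) (w | w) <;> exact Iff.rfl
  tail_iff := by rintro (h | h) <;> exact Iff.rfl

theorem changes_ltSwap : (Γ.union Δ).changes (Γ.ltSwap Δ) (Γ.union Δ).tail =
    Nat.card Γ.V * Nat.card Δ.V := by
  have e : Nat.card {h // (Γ.union Δ).tail h ∧ ¬ (Γ.union Δ).tail h} = 0 := by simp
  unfold changes
  refine (congrArg (_ + ·) e).trans (Eq.trans ?_ (Nat.card_prod _ _))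
  symm
  refine Nat.card_congr (Equiv.ofBijective (fun p => (⟨(Sum.inl p.1, Sum.inr p.2), Sum.Lex.sep _ _,
    Sum.Lex.sep _ _⟩ : {p : (Γ.V ⊕ Δ.V) × (Γ.V ⊕ Δ.V) // Sum.Lex Γ.lt Δ.lt p.1 p.2 ∧
      Γ.ltSwap Δ p.2 p.1})) ⟨?_, ?_⟩)
  · rintro ⟨a, b⟩ ⟨a', b'⟩ e
    have e₁ := congrArg (fun p => p.1.1) e
    have e₂ := congrArg (fun p => p.1.2) e
    exact Prod.ext (Sum.inl_injective e₁) (Sum.inr_injective e₂)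
  · rintro ⟨⟨a | a, b | b⟩, h₁, h₂⟩
    · exact absurd (Sum.lex_inr_inr.1 h₂) (Γ.lt_asymm' (Sum.lex_inl_inl.1 h₁))
    · exact ⟨(a, b), rfl⟩
    · exact absurd h₁ Sum.lex_inr_inl
    · exact absurd (Sum.lex_inl_inl.1 h₂) (Δ.lt_asymm' (Sum.lex_inr_inr.1 h₁))

/-- Exchanging the two parts of the union reduces polygons in `Δ` to the case of the first part; the
sign is that of moving all vertices of `Δ` past those of `Γ`. -/
theorem fissionTerm_inr (l : List Δ.H) : (Γ.union Δ).fissionTerm (l.map (inrH Γ Δ)) =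
    (-1 : k) ^ (Nat.card Γ.V * Nat.card Δ.V) • (Δ.union Γ).fissionTerm (l.map (inlH Δ Γ)) := by
  have iS := Γ.isStrictTotalOrder_ltSwap Δ
  have h₁ := (unionSwap Γ Δ).fissionTerm_map (l.map (inlH Δ Γ))
  have e : (l.map (inlH Δ Γ)).map (unionSwap Γ Δ).onH = l.map (inrH Γ Δ) :=
    List.map_map.symm ▸ rfl
  have h₂ := fissionTerm_reorient (Γ.union Δ) (Γ.ltSwap Δ) (Γ.union Δ).tail
    (Γ.union Δ).tail_inv (l.map (inrH Γ Δ))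
  rw [← h₁, ← changes_ltSwap]
  refine Eq.trans ?_ (congrArg _ (h₂.symm.trans (congrArg _ e.symm)))
  rw [smul_smul, neg_one_pow_mul_self, one_smul]

end FissionUnion
end OGraph
end GraphComplex
namespace GraphComplex
variable {k : Type u} [Field k] {O : CyclicOperad.{u, w} k}

/-! ### Graded commutativity and odd derivations of the symmetric algebra. -/

namespace GradedSym
variable {W : Type*} [AddCommGroup W] [Module k W] (gr : ℕ → Submodule k W)

/-- The product of a list of homogeneous generators. -/
noncomputable def word (l : List (Σ d : ℕ, gr d)) : GradedSym gr :=
  (l.map fun x => gen gr (x.2 : W)).prod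

theorem word_cons (x : Σ d : ℕ, gr d) (l : List (Σ d : ℕ, gr d)) :
    word gr (x :: l) = gen gr (x.2 : W) * word gr l := List.prod_cons

theorem homogeneous_induction {n : ℕ} {P : GradedSym gr → Prop} {x : GradedSym gr}
    (hx : x ∈ homogeneous gr n) (word : ∀ l, (l.map Sigma.fst).sum = n → P (word gr l)) (zero : P 0)
    (add : ∀ x y, P x → P y → P (x + y)) (smul : ∀ (c : k) x, P x → P (c • x)) : P x := by
  refine Submodule.span_induction ?_ zero (fun x y _ _ => add x y) (fun c x _ => smul c x) hx
  rintro _ ⟨l, hl, rfl⟩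
  exact word l hl

theorem gen_mem_homogeneous {n : ℕ} {x : W} (hx : x ∈ gr n) : gen gr x ∈ homogeneous gr n :=
  Submodule.subset_span ⟨[⟨n, x, hx⟩], by simp, by simp⟩

theorem one_mem_homogeneous : (1 : GradedSym gr) ∈ homogeneous gr 0 :=
  Submodule.subset_span ⟨[], by simp, by simp⟩

theorem mul_mem_homogeneous {m n : ℕ} {x y : GradedSym gr} (hx : x ∈ homogeneous gr m)
    (hy : y ∈ homogeneous gr n) : x * y ∈ homogeneous gr (m + n) := by
  refine homogeneous_induction gr (P := fun x => x * y ∈ homogeneous gr (m + n)) hx (fun l hl => ?_) (by simp)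
    (fun x x' h h' => by rw [add_mul]; exact add_mem h h')
    (fun c x h => by rw [smul_mul_assoc]; exact Submodule.smul_mem _ _ h)
  refine homogeneous_induction gr (P := fun y => word gr l * y ∈ homogeneous gr (m + n)) hy (fun l' hl' => ?_) (by simp)
    (fun x x' h h' => by rw [mul_add]; exact add_mem h h')
    (fun c x h => by rw [mul_smul_comm]; exact Submodule.smul_mem _ _ h)
  refine Submodule.subset_span ⟨l ++ l', ?_, ?_⟩
  · rw [List.map_append, List.sum_append, hl, hl']
  · rw [List.map_append, List.prod_append]; rfl

theorem gen_mul_word {m : ℕ} {x : W} (hx : x ∈ gr m) (l : List (Σ d : ℕ, gr d)) :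
    gen gr x * word gr l = (-1 : k) ^ (m * (l.map Sigma.fst).sum) • (word gr l * gen gr x) := by
  induction l with
  | nil => simp [word]
  | cons y l ih =>
    rw [word_cons, ← mul_assoc, gen_mul_gen gr hx y.2.2, smul_mul_assoc, mul_assoc, ih, mul_smul_comm,
      smul_smul, mul_assoc, List.map_cons, List.sum_cons, mul_add, pow_add]

theorem word_mul_word (l l' : List (Σ d : ℕ, gr d)) : word gr l * word gr l' =
    (-1 : k) ^ ((l.map Sigma.fst).sum * (l'.map Sigma.fst).sum) • (word gr l' * word gr l) := by
  induction l with
  | nil => simp [word]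
  | cons x l ih =>
    rw [word_cons, mul_assoc, ih, mul_smul_comm, ← mul_assoc, gen_mul_word gr x.2.2, smul_mul_assoc,
      smul_smul, mul_assoc, List.map_cons, List.sum_cons, add_mul, pow_add, mul_comm ((-1 : k) ^ _)]

/-- Homogeneous elements commute up to the Koszul sign. -/
theorem mul_comm_of_mem {m n : ℕ} {x y : GradedSym gr} (hx : x ∈ homogeneous gr m)
    (hy : y ∈ homogeneous gr n) : x * y = (-1 : k) ^ (m * n) • (y * x) := by
  refine homogeneous_induction gr (P := fun x => x * y = (-1 : k) ^ (m * n) • (y * x)) hx (fun l hl => ?_) (by simp)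
    (fun x x' h h' => by rw [add_mul, mul_add, smul_add, h, h'])
    (fun c x h => by rw [smul_mul_assoc, mul_smul_comm, h, smul_comm])
  refine homogeneous_induction gr
    (P := fun y => word gr l * y = (-1 : k) ^ (m * n) • (y * word gr l)) hy (fun l' hl' => ?_) (by simp)
    (fun x x' h h' => by rw [add_mul, mul_add, smul_add, h, h'])
    (fun c x h => by rw [smul_mul_assoc, mul_smul_comm, h, smul_comm])
  rw [word_mul_word, hl, hl']

theorem induction_gen {P : GradedSym gr → Prop} (algebraMap : ∀ c : k, P (algebraMap k _ c))
    (gen : ∀ x, P (gen gr x)) (add : ∀ x y, P x → P y → P (x + y))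
    (mul : ∀ x y, P x → P y → P (x * y)) (x : GradedSym gr) : P x := by
  obtain ⟨x, rfl⟩ := RingQuot.mkAlgHom_surjective k (SymRel gr) x
  induction x using TensorAlgebra.induction with
  | algebraMap c => rw [AlgHom.commutes]; exact algebraMap c
  | ι x => exact gen x
  | mul x y hx hy => rw [map_mul]; exact mul _ _ hx hy
  | add x y hx hy => rw [map_add]; exact add _ _ hx hy

section Derivation
variable {gr} (ε : W →ₗ[k] W) (φ : W →ₗ[k] GradedSym gr)

/-- The matrices that describe the derivation extending `φ`, where `ε` is the parity involution. -/
noncomputable def derivMatrix : W →ₗ[k] Matrix (Fin 2) (Fin 2) (GradedSym gr) where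
  toFun x := !![gen gr (ε x), φ x; 0, gen gr x]
  map_add' x y := by ext i j; fin_cases i <;> fin_cases j <;> simp
  map_smul' c x := by ext i j; fin_cases i <;> fin_cases j <;> simp

/-- A map `D` satisfies the graded Leibniz rule when `x ↦ !![ε x, D x; 0, x]` is multiplicative, `ε`
being the parity. So the matrices of the generators have to satisfy the defining relations; `hφ`
says that `φ` changes the parity of the degree. -/
theorem derivMatrix_rel (hε : ∀ n, ∀ x ∈ gr n, ε x = (-1 : k) ^ n • x)
    (hφ : ∀ m n, ∀ x ∈ gr m, ∀ y ∈ gr n,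
      φ x * gen gr y = (-1 : k) ^ ((m + 1) * n) • (gen gr y * φ x)) ⦃a b : TensorAlgebra k W⦄
    (h : SymRel gr a b) :
    TensorAlgebra.lift k (derivMatrix ε φ) a = TensorAlgebra.lift k (derivMatrix ε φ) b := by
  obtain ⟨hx, hy⟩ := h
  rename_i m n x y
  have h₁ := gen_mul_gen gr hx hy
  have s : ∀ a b : ℕ, (-1 : k) ^ (a * b) * (-1) ^ (a * b) = 1 := fun a b => neg_one_pow_mul_self _
  have h₂ := hφ m n x hx y hy
  have h₃ := hφ n m y hy x hx
  simp only [map_mul, map_smul, TensorAlgebra.lift_ι_apply]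
  ext i j
  fin_cases i <;> fin_cases j <;>
    simp only [derivMatrix, LinearMap.coe_mk, AddHom.coe_mk, Matrix.mul_apply, Fin.sum_univ_two,
      Matrix.smul_apply, Matrix.of_apply, Matrix.cons_val', Matrix.cons_val_zero, Matrix.cons_val_one,
      Matrix.cons_val_fin_one, Fin.zero_eta, Fin.mk_one, Fin.isValue, mul_zero, zero_mul, add_zero,
      zero_add, smul_zero]
  · rw [hε m x hx, hε n y hy]
    simp only [map_smul, smul_mul_assoc, mul_smul_comm, h₁]
    rw [smul_comm ((-1 : k) ^ n), smul_comm ((-1 : k) ^ n) ((-1 : k) ^ (m * n)),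
      smul_comm ((-1 : k) ^ m) ((-1 : k) ^ (m * n))]
  · rw [hε m x hx, hε n y hy, h₂, h₃]
    simp only [map_smul, smul_mul_assoc, smul_add, smul_smul]
    rw [add_comm]
    congr 2
    · ring
    · rw [add_mul, one_mul, pow_add, mul_comm n m, ← mul_assoc, s, one_mul]
  · exact h₁

/-- The derivation of odd degree which extends `φ`. -/
theorem exists_isOddDerivation (hε : ∀ n, ∀ x ∈ gr n, ε x = (-1 : k) ^ n • x)
    (hφ : ∀ m n, ∀ x ∈ gr m, ∀ y ∈ gr n,
      φ x * gen gr y = (-1 : k) ^ ((m + 1) * n) • (gen gr y * φ x)) :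
    ∃ D : GradedSym gr →ₗ[k] GradedSym gr, IsOddDerivation gr D ∧ ∀ x, D (gen gr x) = φ x := by
  let F : GradedSym gr →ₐ[k] Matrix (Fin 2) (Fin 2) (GradedSym gr) :=
    RingQuot.liftAlgHom k ⟨TensorAlgebra.lift k (derivMatrix ε φ), derivMatrix_rel ε φ hε hφ⟩
  have hF : ∀ x, F (gen gr x) = derivMatrix ε φ x := fun x => by simp [F, gen]
  -- All matrices are upper triangular with `y` itself in the lower corner; this gives the factor
  -- `y` in `D x * y`.
  have h₁ : ∀ y, F y 1 0 = 0 ∧ F y 1 1 = y := by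
    refine induction_gen gr (fun c => ?_) (fun x => ?_) (fun x y hx hy => ?_) (fun x y hx hy => ?_)
    · rw [AlgHom.commutes]
      simp [Matrix.algebraMap_matrix_apply]
    · rw [hF]; simp [derivMatrix]
    · simp [hx, hy]
    · simp [Matrix.mul_apply, Fin.sum_univ_two, hx, hy]
  -- The upper left corner is the parity of `x`; it supplies the sign in front of `x * D y`.
  have h₂ : ∀ n, ∀ x ∈ homogeneous gr n, F x 0 0 = (-1 : k) ^ n • x := by
    intro n x hx
    refine homogeneous_induction gr (P := fun x => F x 0 0 = (-1 : k) ^ n • x) hx (fun l hl => ?_)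
      (by simp) (fun x y h h' => by simp [h, h']) (fun c x h => by
        rw [map_smul, Matrix.smul_apply, h, smul_comm])
    subst hl
    clear hx
    induction l with
    | nil => simp [word]
    | cons x l ih =>
      rw [word_cons, map_mul, Matrix.mul_apply, Fin.sum_univ_two, ih,
        (h₁ _).1, mul_zero, add_zero, hF]
      have e : derivMatrix ε φ (x.2 : W) 0 0 = gen gr (ε x.2) := by simp [derivMatrix]
      rw [e, hε x.1 x.2 x.2.2, map_smul, List.map_cons, List.sum_cons, pow_add, mul_smul,
        smul_mul_assoc, mul_smul_comm]
  refine ⟨{ toFun := fun x => F x 0 1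
            map_add' := fun x y => by simp
            map_smul' := fun c x => by simp }, fun n x hx y => ?_, fun x => ?_⟩
  · change F (x * y) 0 1 = F x 0 1 * y + _ • (x * F y 0 1)
    rw [map_mul, Matrix.mul_apply, Fin.sum_univ_two, h₂ n x hx, (h₁ y).2, smul_mul_assoc, add_comm]
  · change F (gen gr x) 0 1 = _
    rw [hF]; simp [derivMatrix]

end Derivation

theorem word_span (hgr : ⨆ n, gr n = ⊤) (x : GradedSym gr) :
    x ∈ Submodule.span k (Set.range (word gr)) := by
  refine induction_gen gr (fun c => ?_) (fun x => ?_) (fun x y hx hy => add_mem hx hy)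
    (fun x y hx hy => ?_) x
  · rw [Algebra.algebraMap_eq_smul_one]
    exact Submodule.smul_mem _ _ (Submodule.subset_span ⟨[], by simp [word]⟩)
  · have hx : x ∈ ⨆ n, gr n := hgr ▸ Submodule.mem_top
    induction hx using Submodule.iSup_induction' with
    | mem n x hx => exact Submodule.subset_span ⟨[⟨n, x, hx⟩], by simp [word]⟩
    | zero => simp
    | add x y _ _ hx hy => rw [map_add]; exact add_mem hx hy
  · refine Submodule.span_induction ?_ (by simp) (fun x x' _ _ h h' => by rw [add_mul]; exact add_mem h h')
      (fun c x _ h => by rw [smul_mul_assoc]; exact Submodule.smul_mem _ _ h) hx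
    rintro _ ⟨l, rfl⟩
    refine Submodule.span_induction ?_ (by simp) (fun x x' _ _ h h' => by rw [mul_add]; exact add_mem h h')
      (fun c x _ h => by rw [mul_smul_comm]; exact Submodule.smul_mem _ _ h) hy
    rintro _ ⟨l', rfl⟩
    exact Submodule.subset_span ⟨l ++ l', by simp [word]⟩

theorem IsOddDerivation.map_one {D : GradedSym gr →ₗ[k] GradedSym gr} (hD : IsOddDerivation gr D) :
    D 1 = 0 := by
  have h := hD 0 1 (one_mem_homogeneous gr) 1
  rw [mul_one, mul_one, pow_zero, one_smul, one_mul] at h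
  simpa using h

/-- An odd derivation is determined by its values on homogeneous generators. -/
theorem IsOddDerivation.ext (hgr : ⨆ n, gr n = ⊤) {D D' : GradedSym gr →ₗ[k] GradedSym gr}
    (hD : IsOddDerivation gr D) (hD' : IsOddDerivation gr D')
    (h : ∀ n, ∀ x ∈ gr n, D (gen gr x) = D' (gen gr x)) : D = D' := by
  refine LinearMap.ext fun x => ?_
  refine Submodule.span_induction ?_ (by simp) (fun x y _ _ h h' => by rw [map_add, map_add, h, h'])
    (fun c x _ h => by rw [map_smul, map_smul, h]) (word_span gr hgr x)
  rintro _ ⟨l, rfl⟩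
  induction l with
  | nil => exact (hD.map_one gr).trans (hD'.map_one gr).symm
  | cons x l ih =>
    have hx := gen_mem_homogeneous gr x.2.2
    rw [word_cons, hD _ _ hx, hD' _ _ hx, ih, h _ _ x.2.2]

end GradedSym
end GraphComplex
namespace GraphComplex
variable {k : Type u} [Field k] {O : CyclicOperad.{u, w} k}
namespace OGraph

/-! ### Degrees, and graded commutation of the fission terms. -/

section Degree

theorem card_union (Γ Δ : OGraph O) : Nat.card (Γ.union Δ).V = Nat.card Γ.V + Nat.card Δ.V :=
  Nat.card_sum

theorem card_complement (Γ : OGraph O) (c : Γ.Comp) :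
    Nat.card (Γ.component c).V + Nat.card (Γ.complement c).V = Nat.card Γ.V := by
  rw [← card_union]
  exact Nat.card_congr (Γ.unionIso c).onV

theorem isEmpty_of_numComp {Γ : OGraph O} (h : Γ.numComp = 0) : IsEmpty Γ.V := by
  have : IsEmpty Γ.Comp := (Finite.card_eq_zero_iff).1 h
  exact ⟨fun v => isEmptyElim (Quot.mk Γ.Joined v)⟩

theorem splitProduct_of_isEmpty (Γ : OGraph O) [IsEmpty Γ.V] : Γ.splitProduct = 1 := by
  rw [Γ.splitProduct_eq List.nodup_nil fun c => (Quot.exists_rep c).elim fun v _ => isEmptyElim v]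
  simp [compProd, pairSign]

theorem exists_splitProduct_eq_mul (Γ : OGraph O) (c : Γ.Comp) : ∃ ε : k, Γ.splitProduct =
    ε • ((Γ.component c).splitProduct * (Γ.complement c).splitProduct) := by
  obtain ⟨ε, h⟩ := Γ.exists_cls_eq_union c
  refine ⟨ε, ?_⟩
  rw [← splitMap_cls, h, map_smul, splitMap_cls, splitProduct_union]

/-- Induction on the number of components, splitting off one at a time. -/
theorem splitProduct_mem_homogeneous (Γ : OGraph O) :
    Γ.splitProduct ∈ GradedSym.homogeneous (grading O) (Nat.card Γ.V) := by
  induction hn : Γ.numComp generalizing Γ with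
  | zero =>
    have := isEmpty_of_numComp hn
    rw [splitProduct_of_isEmpty, Nat.card_of_isEmpty]
    exact GradedSym.one_mem_homogeneous _
  | succ n ih =>
    have : Nonempty Γ.Comp := (Nat.card_pos_iff.1 (hn.symm ▸ Nat.succ_pos n : 0 < Γ.numComp)).1
    obtain ⟨c⟩ := this
    obtain ⟨ε, h⟩ := Γ.exists_splitProduct_eq_mul c
    rw [h, ← Γ.card_complement c, splitProduct_of_isConnected (Γ.component_isConnected c)]
    refine Submodule.smul_mem _ _ (GradedSym.mul_mem_homogeneous _
      (GradedSym.gen_mem_homogeneous _ (pcls_mem_grading _)) (ih _ ?_))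
    have := Γ.numComp_complement c
    omega

variable {n : ℕ} {y : SymP O}

/-- A contraction removes one vertex. The degree is written as `Nat.card Γ.V + 1`, which has the
right parity and avoids truncated subtraction. -/
theorem splitMap_contractCls_mul (Γ : OGraph O) (hy : y ∈ GradedSym.homogeneous (grading O) n)
    (t : Γ.H) : splitMap O (Γ.contractCls t) * y =
      (-1 : k) ^ ((Nat.card Γ.V + 1) * n) • (y * splitMap O (Γ.contractCls t)) := by
  by_cases ht : Γ.vert t = Γ.vert (Γ.inv t)
  · rw [contractCls_of_eq _ ht, map_zero, zero_mul, mul_zero, smul_zero]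
  · rw [contractCls_of_ne _ ht, map_smul, splitMap_cls, smul_mul_assoc, mul_smul_comm,
      GradedSym.mul_comm_of_mem _ (splitProduct_mem_homogeneous _) hy, smul_comm]
    have e : Nat.card (Γ.contract ht).V + 1 = Nat.card Γ.V := by
      classical
      have iV : Fintype Γ.V := Fintype.ofFinite _
      have h₁ : Nat.card {v // v ≠ Γ.vert (Γ.inv t)} = Nat.card Γ.V - 1 := by
        rw [Nat.card_eq_fintype_card, Nat.card_eq_fintype_card]
        exact Set.card_ne_eq _
      have h₂ : 0 < Nat.card Γ.V := Nat.card_pos_iff.2 ⟨⟨Γ.vert t⟩, inferInstance⟩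
      exact (congrArg (· + 1) h₁).trans (by omega)
    rw [← e, add_assoc, add_mul _ (1 + 1), pow_add, (by ring : (1 + 1) * n = n + n), ← two_mul,
      pow_mul _ 2 n, neg_one_sq, one_pow, mul_one]

theorem splitMap_fissionTerm_mul (Γ : OGraph O) (hy : y ∈ GradedSym.homogeneous (grading O) n)
    (l : List Γ.H) : splitMap O (Γ.fissionTerm l) * y =
      (-1 : k) ^ ((Nat.card Γ.V + 1) * n) • (y * splitMap O (Γ.fissionTerm l)) := by
  by_cases h : Γ.Splits l
  · rw [fissionTerm_of _ h]
    cases l with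
    | nil =>
      have e : splitMap O (Γ.headTerm []) = 0 := map_zero _
      rw [e, zero_mul, mul_zero, smul_zero]
    | cons t l =>
      obtain ⟨hl, -⟩ := h
      have e : splitMap O (Γ.headTerm (t :: l)) =
          attachSgn k Γ (t :: l) • splitMap O ((Γ.attachList (t :: l) hl).contractCls t) :=
        (congrArg _ (attachTerm_of Γ hl t)).trans (map_smul _ _ _)
      rw [e, smul_mul_assoc, mul_smul_comm, smul_comm]
      exact congrArg _ (splitMap_contractCls_mul (Γ.attachList (t :: l) hl) hy t)
  · rw [fissionTerm_of_not _ h, map_zero, zero_mul, mul_zero, smul_zero]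

theorem splitMap_fission_mul (Γ : OGraph O) (hy : y ∈ GradedSym.homogeneous (grading O) n)
    (i : ℕ) : splitMap O (fission O i Γ.cls) * y =
      (-1 : k) ^ ((Nat.card Γ.V + 1) * n) • (y * splitMap O (fission O i Γ.cls)) := by
  rw [fission_cls, fissionSum, map_sum, Finset.sum_mul, Finset.mul_sum, Finset.smul_sum]
  exact Finset.sum_congr rfl fun l _ => splitMap_fissionTerm_mul Γ hy l

end Degree

/-! ### The derivation rule for fission. -/

section FissionOfUnion
variable (Γ Δ : OGraph O)

/-- With `p` and `q` the numbers of vertices of `Γ` and `Δ`, exchanging the parts costs `(-1) ^ (p *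
q)` and moving `Γ` back to the left costs `(-1) ^ ((q + 1) * p)`. Together this is the sign `(-1) ^
p` of an odd derivation. -/
theorem splitMap_fissionTerm_inr (l : List Δ.H) :
    splitMap O ((Γ.union Δ).fissionTerm (l.map (inrH Γ Δ))) =
      (-1 : k) ^ Nat.card Γ.V • (Γ.splitProduct * splitMap O (Δ.fissionTerm l)) := by
  rw [fissionTerm_inr, map_smul, splitMap_fissionTerm_inl,
    splitMap_fissionTerm_mul Δ Γ.splitProduct_mem_homogeneous, smul_smul, add_mul, one_mul, pow_add,
    ← mul_assoc, mul_comm (Nat.card Δ.V), neg_one_pow_mul_self, one_mul]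

theorem isSep_map_inr {l : List Δ.H} : (Γ.union Δ).IsSep (l.map (inrH Γ Δ)) ↔ Δ.IsSep l := by
  refine and_congr (List.nodup_map_iff (inrH_injective Γ Δ)) ?_
  refine List.forall_mem_map.trans (forall₂_congr fun h _ => not_congr ?_)
  exact List.mem_map_of_injective (inrH_injective Γ Δ)

/-- A polygon with maximal growth is attached within a single component, hence within one part of
the union. Without this condition there would be mixed terms and no derivation rule. -/
theorem exists_map_of_splits {l : List (Γ.union Δ).H} (h : (Γ.union Δ).Splits l) :
    (∃ l', List.map (inlH Γ Δ) l' = l) ∨ ∃ l', List.map (inrH Γ Δ) l' = l := by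
  have hr : ∀ {A : Type} (f : A → (Γ.union Δ).H), (∀ x ∈ l, x ∈ Set.range f) →
      ∃ l', List.map f l' = l := fun f hf => by
    have : l ∈ Set.range (List.map f) := by rw [Set.range_list_map]; exact hf
    exact this
  cases l with
  | nil => exact Or.inl ⟨[], rfl⟩
  | cons x l =>
    have key := fun y hy => h.mk_eq (List.mem_cons_self (a := x) (l := l)) (y := y) hy
    rcases x with t | t
    · refine Or.inl (hr _ fun y hy => ?_)
      rcases y with s | s
      · exact ⟨s, rfl⟩
      · exact absurd (key _ hy).symm (mk_inr_ne_inl Γ Δ (Δ.vert s) (Quot.mk _ (Γ.vert t)))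
    · refine Or.inr (hr _ fun y hy => ?_)
      rcases y with s | s
      · exact absurd (key _ hy) (mk_inr_ne_inl Γ Δ (Δ.vert t) (Quot.mk _ (Γ.vert s)))
      · exact ⟨s, rfl⟩

/-- For `i ≠ 0` no list comes from both parts, the empty list being excluded. -/
theorem fissionSum_union {i : ℕ} (hi : i ≠ 0) : (Γ.union Δ).fissionSum i =
    (∑ l ∈ Γ.words i, (Γ.union Δ).fissionTerm (l.map (inlH Γ Δ))) +
      ∑ l ∈ Δ.words i, (Γ.union Δ).fissionTerm (l.map (inrH Γ Δ)) := by
  classical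
  rw [← Finset.sum_image (f := (Γ.union Δ).fissionTerm) (g := List.map (inlH Γ Δ))
      (List.map_injective_iff.2 (inlH_injective Γ Δ)).injOn,
    ← Finset.sum_image (f := (Γ.union Δ).fissionTerm) (g := List.map (inrH Γ Δ))
      (List.map_injective_iff.2 (inrH_injective Γ Δ)).injOn, ← Finset.sum_union]
  · symm
    refine Finset.sum_subset (fun l hl => ?_) fun l hl hl' => fissionTerm_of_not _ fun h => hl' ?_
    · rw [Finset.mem_union, Finset.mem_image, Finset.mem_image] at hl
      rw [mem_words]
      rcases hl with ⟨l, hl, rfl⟩ | ⟨l, hl, rfl⟩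
      · rw [mem_words] at hl
        exact ⟨(List.length_map _).trans hl.1, (isSep_map_inl Γ Δ).2 hl.2⟩
      · rw [mem_words] at hl
        exact ⟨(List.length_map _).trans hl.1, (isSep_map_inr Γ Δ).2 hl.2⟩
    · rw [mem_words] at hl
      rw [Finset.mem_union, Finset.mem_image, Finset.mem_image]
      rcases exists_map_of_splits Γ Δ h with ⟨l, rfl⟩ | ⟨l, rfl⟩
      · exact Or.inl ⟨l, mem_words.2 ⟨(List.length_map _).symm.trans hl.1,
          (isSep_map_inl Γ Δ).1 hl.2⟩, rfl⟩
      · exact Or.inr ⟨l, mem_words.2 ⟨(List.length_map _).symm.trans hl.1,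
          (isSep_map_inr Γ Δ).1 hl.2⟩, rfl⟩
  · rw [Finset.disjoint_left]
    intro l h₁ h₂
    obtain ⟨l₁, h₃, rfl⟩ := Finset.mem_image.1 h₁
    obtain ⟨l₂, -, e⟩ := Finset.mem_image.1 h₂
    rw [mem_words] at h₃
    cases l₁ with
    | nil => exact hi h₃.1.symm
    | cons x l₁ =>
      cases l₂ with
      | nil => simp at e
      | cons y l₂ => exact Sum.inr_ne_inl (List.cons.inj e).1

/-- The fission operations are derivations with respect to disjoint union. -/
theorem splitMap_fission_union {i : ℕ} (hi : i ≠ 0) : splitMap O (fission O i (Γ.union Δ).cls) =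
    splitMap O (fission O i Γ.cls) * Δ.splitProduct +
      (-1 : k) ^ Nat.card Γ.V • (Γ.splitProduct * splitMap O (fission O i Δ.cls)) := by
  rw [fission_cls, fission_cls, fission_cls, fissionSum_union Γ Δ hi, map_add, map_sum, map_sum]
  simp only [fissionSum, map_sum, Finset.sum_mul, Finset.mul_sum, Finset.smul_sum,
    splitMap_fissionTerm_inl, splitMap_fissionTerm_inr]

end FissionOfUnion

/-! ### Products of graphs span the symmetric algebra. -/

section Generation

/-- The graph without vertices. -/
def emptyGraph (O : CyclicOperad.{u, w} k) : OGraph O where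
  V := Empty
  H := Empty
  vert := id
  inv := id
  inv_inv h := h.elim
  inv_ne h := h.elim
  valence v := v.elim
  deco v := v.elim
  lt _ _ := False
  order :=
    { trichotomous := fun a => a.elim
      irrefl := fun a => a.elim
      trans := fun a => a.elim }
  tail _ := False
  tail_inv h := h.elim

theorem primitive_induction {P : primitive O → Prop} (x : primitive O)
    (pcls : ∀ (Γ : OGraph O) (h : Γ.IsConnected), P (Γ.pcls h)) (zero : P 0)
    (add : ∀ x y, P x → P y → P (x + y)) (smul : ∀ (c : k) x, P x → P (c • x)) : P x := by
  obtain ⟨x, hx⟩ := x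
  refine Submodule.span_induction (p := fun x hx => P ⟨x, hx⟩) ?_ zero
    (fun x y _ _ => add _ _) (fun c x _ => smul c _) hx
  rintro _ ⟨Γ, h, rfl⟩
  exact pcls Γ h

theorem iSup_grading : ⨆ n, grading O n = ⊤ := by
  refine eq_top_iff.2 fun x _ => ?_
  exact primitive_induction x (fun Γ h => Submodule.mem_iSup_of_mem _ (pcls_mem_grading h))
    (zero_mem _) (fun x y => add_mem) (fun c x => Submodule.smul_mem _ c)

/-- The span is closed under products by disjoint union, contains 1 by the empty graph, and contains
the generators as connected graphs. -/
theorem mem_span_splitProduct (x : SymP O) :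
    x ∈ Submodule.span k (Set.range (splitProduct : OGraph O → SymP O)) := by
  refine GradedSym.induction_gen _ (fun c => ?_) (fun x => ?_) (fun x y hx hy => add_mem hx hy)
    (fun x y hx hy => ?_) x
  · rw [Algebra.algebraMap_eq_smul_one]
    have : IsEmpty (emptyGraph O).V := inferInstanceAs (IsEmpty Empty)
    exact Submodule.smul_mem _ _ (Submodule.subset_span ⟨emptyGraph O, splitProduct_of_isEmpty _⟩)
  · refine primitive_induction (P := fun x => GradedSym.gen (grading O) x ∈ _) x (fun Γ h => ?_) ?_
      (fun x y hx hy => ?_) (fun c x hx => ?_)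
    · exact Submodule.subset_span ⟨Γ, splitProduct_of_isConnected h⟩
    · rw [map_zero]; exact zero_mem _
    · rw [map_add]; exact add_mem hx hy
    · rw [map_smul]; exact Submodule.smul_mem _ _ hx
  · refine Submodule.span_induction ?_ (by simp) (fun x x' _ _ h h' => by rw [add_mul]; exact add_mem h h')
      (fun c x _ h => by rw [smul_mul_assoc]; exact Submodule.smul_mem _ _ h) hx
    rintro _ ⟨Γ, rfl⟩
    refine Submodule.span_induction ?_ (by simp) (fun x x' _ _ h h' => by rw [mul_add]; exact add_mem h h')
      (fun c x _ h => by rw [mul_smul_comm]; exact Submodule.smul_mem _ _ h) hy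
    rintro _ ⟨Δ, rfl⟩
    exact Submodule.subset_span ⟨Γ.union Δ, splitProduct_union Γ Δ⟩

theorem splitMap_surjective : Function.Surjective (splitMap O) := by
  intro x
  refine Submodule.span_induction ?_ ⟨0, map_zero _⟩ ?_ ?_ (mem_span_splitProduct x)
  · rintro _ ⟨Γ, rfl⟩
    exact ⟨Γ.cls, splitMap_cls Γ⟩
  · rintro _ _ _ _ ⟨a, rfl⟩ ⟨b, rfl⟩
    exact ⟨a + b, map_add _ _ _⟩
  · rintro c _ _ ⟨a, rfl⟩
    exact ⟨c • a, map_smul _ _ _⟩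

end Generation

/-! ### Existence of the derivations and their relation to the operations on graphs. -/

section Extension

/-- Defining the parity on graphs makes it a linear map without any appeal to the independence of
the subspaces `grading O n`. -/
theorem isInvariant_parity : IsInvariant (k := k) (O := O) fun Γ => (-1 : k) ^ Nat.card Γ.V • Γ.cls where
  iso φ := by rw [cls_iso φ, Nat.card_congr φ.onV]
  reorient Γ lt' _ tail' h := by
    rw [smul_comm, ← cls_reorient Γ lt' tail' h]; rfl
  deco Γ v := ⟨(-1 : k) ^ Nat.card Γ.V • clsAt Γ v, fun _ => rfl⟩

/-- The parity involution of the primitive part. -/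
noncomputable def parity : primitive O →ₗ[k] primitive O :=
  isInvariant_parity.lift.restrict fun x hx => by
    refine primitive_induction (P := fun x => isInvariant_parity.lift (x : GraphSpace O) ∈ primitive O)
      ⟨x, hx⟩ (fun Γ h => ?_) ?_ (fun x y hx hy => ?_) (fun c x hx => ?_)
    · change isInvariant_parity.lift Γ.cls ∈ _
      rw [IsInvariant.lift_cls]
      exact Submodule.smul_mem _ _ (Γ.pcls h).2
    · rw [Submodule.coe_zero, map_zero]; exact zero_mem _
    · rw [Submodule.coe_add, map_add]; exact add_mem hx hy
    · rw [Submodule.coe_smul, map_smul]; exact Submodule.smul_mem _ _ hx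

theorem parity_of_mem {n : ℕ} {x : primitive O} (hx : x ∈ grading O n) :
    parity x = (-1 : k) ^ n • x := by
  refine Submodule.span_induction (p := fun x _ => parity x = (-1 : k) ^ n • x) ?_ (by simp)
    (fun x y _ _ h h' => by rw [map_add, smul_add, h, h'])
    (fun c x _ h => by rw [map_smul, h, smul_comm]) hx
  rintro _ ⟨Γ, h, rfl, rfl⟩
  exact Subtype.ext (isInvariant_parity.lift_cls Γ)

/-- Half of a fission operation, on the primitive part. -/
noncomputable def halfFission (O : CyclicOperad.{u, w} k) (i : ℕ) : primitive O →ₗ[k] SymP O :=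
  (1 / 2 : k) • splitMap O ∘ₗ fission O i ∘ₗ (primitive O).subtype

theorem halfFission_pcls (i : ℕ) {Γ : OGraph O} (h : Γ.IsConnected) :
    halfFission O i (Γ.pcls h) = (1 / 2 : k) • splitMap O (fission O i Γ.cls) := rfl

/-- The commutation rule that `exists_isOddDerivation` asks of the values on generators. -/
theorem halfFission_mul_gen (i : ℕ) {m n : ℕ} {x y : primitive O} (hx : x ∈ grading O m)
    (hy : y ∈ grading O n) : halfFission O i x * GradedSym.gen (grading O) y =
      (-1 : k) ^ ((m + 1) * n) • (GradedSym.gen (grading O) y * halfFission O i x) := by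
  refine Submodule.span_induction (p := fun x _ => halfFission O i x * GradedSym.gen (grading O) y =
      (-1 : k) ^ ((m + 1) * n) • (GradedSym.gen (grading O) y * halfFission O i x)) ?_ (by simp)
    (fun x x' _ _ h h' => by rw [map_add, add_mul, mul_add, smul_add, h, h'])
    (fun c x _ h => by rw [map_smul, smul_mul_assoc, mul_smul_comm, h, smul_comm]) hx
  rintro _ ⟨Γ, h, rfl, rfl⟩
  rw [halfFission_pcls, smul_mul_assoc, mul_smul_comm,
    splitMap_fission_mul Γ (GradedSym.gen_mem_homogeneous _ hy), smul_comm]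

theorem exists_isOddDerivation_halfFission (O : CyclicOperad.{u, w} k) (i : ℕ) :
    ∃ D : SymP O →ₗ[k] SymP O, GradedSym.IsOddDerivation (grading O) D ∧
      ∀ x, D (GradedSym.gen (grading O) x) = halfFission O i x :=
  GradedSym.exists_isOddDerivation parity (halfFission O i) (fun _ _ => parity_of_mem)
    fun _ _ _ hx _ => halfFission_mul_gen i hx

theorem fissionSum_of_isEmpty {i : ℕ} (hi : i ≠ 0) (Γ : OGraph O) [IsEmpty Γ.V] :
    Γ.fissionSum i = 0 := by
  refine Finset.sum_eq_zero fun l hl => ?_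
  rw [mem_words] at hl
  cases l with
  | nil => exact absurd hl.1.symm hi
  | cons x l => exact isEmptyElim (Γ.vert x)

/-- The derivation extending half of a fission operation corresponds to the operation on graphs. -/
theorem derivation_splitMap {i : ℕ} (hi : i ≠ 0) {D : SymP O →ₗ[k] SymP O}
    (hD : GradedSym.IsOddDerivation (grading O) D)
    (h : ∀ (Γ : OGraph O) (h : Γ.IsConnected), D (GradedSym.gen (grading O) (Γ.pcls h)) =
      (1 / 2 : k) • splitMap O (fission O i Γ.cls)) :
    D ∘ₗ splitMap O = (1 / 2 : k) • splitMap O ∘ₗ fission O i := by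
  refine graphSpace_hom_ext fun Γ => ?_
  change D (splitMap O Γ.cls) = (1 / 2 : k) • splitMap O (fission O i Γ.cls)
  induction hn : Γ.numComp generalizing Γ with
  | zero =>
    have := isEmpty_of_numComp hn
    rw [splitMap_cls, splitProduct_of_isEmpty, hD.map_one, fission_cls, fissionSum_of_isEmpty hi,
      map_zero, smul_zero]
  | succ n ih =>
    have : Nonempty Γ.Comp := (Nat.card_pos_iff.1 (hn.symm ▸ Nat.succ_pos n : 0 < Γ.numComp)).1
    obtain ⟨c⟩ := this
    obtain ⟨ε, e⟩ := Γ.exists_cls_eq_union c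
    have hc := Γ.component_isConnected c
    have ih' := ih (Γ.complement c) (by have := Γ.numComp_complement c; omega)
    rw [splitMap_cls] at ih'
    -- One component is split off. Both operators satisfy the same Leibniz rule for the resulting
    -- union, agree on the connected part by `h`, and on the complement by induction.
    rw [e, map_smul, map_smul, map_smul, map_smul, splitMap_cls, splitProduct_union,
      splitMap_fission_union _ _ hi, hD _ _ (splitProduct_mem_homogeneous _), ih',
      splitProduct_of_isConnected hc, h, smul_comm]
    simp only [smul_add, smul_mul_assoc, mul_smul_comm]
    rw [smul_comm (1 / 2 : k) ((-1 : k) ^ _)]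

end Extension
end OGraph
end GraphComplex
namespace GraphComplex
variable {k : Type u} [Field k] {O : CyclicOperad.{u, w} k}
namespace OGraph

/-! ### Comparison with the sum over polygons in the definition of `∂ᵢ`. -/

section Polygon

/-- The list `f 1, f 2, …, f 0`. -/
def turnList {α : Type} {i : ℕ} (f : Fin i → α) : List α := List.ofFn fun a => f (finRotate i a)

theorem mem_turnList {α : Type} {i : ℕ} {f : Fin i → α} {x : α} :
    x ∈ turnList f ↔ x ∈ Set.range f := by
  rw [turnList, List.mem_ofFn]
  exact ((finRotate i).surjective.exists (p := fun a => f a = x)).symm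

theorem length_turnList {α : Type} {i : ℕ} (f : Fin i → α) : (turnList f).length = i :=
  List.length_ofFn

theorem turnList_injective {α : Type} (i : ℕ) :
    Function.Injective (turnList : (Fin i → α) → List α) := by
  intro f g h
  have h := List.ofFn_injective h
  funext a
  obtain ⟨a, rfl⟩ := (finRotate i).surjective a
  exact congrFun h a

theorem exists_turnList {α : Type} (l : List α) : ∃ f : Fin l.length → α, turnList f = l :=
  ⟨fun a => l.get ((finRotate _).symm a), by
    simp only [turnList, Equiv.symm_apply_apply]
    exact List.ofFn_get l⟩

/-- The shift by one puts `f 1` first and `f 0` last, so the new edge that starts with the head of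
the list ends at the head of `f 0`: the edge contracted in `polygonSum`. For `i = 1` both indices
are `0`. -/
theorem turnList_eq_cons {α : Type} {i : ℕ} [NeZero i] (f : Fin i → α) :
    ∃ l, turnList f = f 1 :: l := by
  obtain ⟨m, rfl⟩ := Nat.exists_eq_succ_of_ne_zero (NeZero.ne i)
  refine ⟨List.ofFn fun a : Fin m => f (finRotate (m + 1) a.succ), (List.ofFn_succ).trans ?_⟩
  rw [finRotate_apply_zero]

theorem cyc_turnList {α : Type} {i : ℕ} {f : Fin i → α} (hf : Function.Injective f) (a : Fin i) :
    cyc (turnList f) (f a) = f (finRotate i a) := by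
  classical
  cases i with
  | zero => exact a.elim0
  | succ m =>
    obtain ⟨b, rfl⟩ := (finRotate (m + 1)).surjective a
    have hd : (turnList f).Nodup := List.nodup_ofFn.2 (hf.comp (finRotate _).injective)
    have hb : (b : ℕ) < (turnList f).length := (length_turnList f).symm ▸ b.2
    have h := List.formPerm_apply_getElem (turnList f) hd b hb
    have e : ∀ (n : ℕ) (hn : n < (turnList f).length), (turnList f)[n] =
        f (finRotate (m + 1) ⟨n, length_turnList f ▸ hn⟩) := fun n hn => List.getElem_ofFn hn
    rw [e, e] at h
    refine h.trans (congrArg (fun b => f (finRotate (m + 1) b)) (Fin.ext ?_))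
    simp [length_turnList, Fin.val_add]

variable (Γ : OGraph O) {i : ℕ}

theorem isSep_turnList (e : Fin i → Γ.H) : Γ.IsSep (turnList e) ↔ Γ.IsSeparate e := by
  constructor
  · intro h a b hab
    have hi : Function.Injective e := by
      have h₁ := List.nodup_ofFn.1 h.1
      exact (Function.Injective.of_comp_iff' e (finRotate i).bijective).1 h₁
    refine ⟨fun e' => hab (hi e'), fun e' => ?_⟩
    exact h.2 (e b) (mem_turnList.2 ⟨b, rfl⟩) (e' ▸ mem_turnList.2 ⟨a, rfl⟩)
  · intro h
    refine ⟨List.nodup_ofFn.2 (h.injective.comp (finRotate i).injective), fun x hx hx' => ?_⟩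
    obtain ⟨a, rfl⟩ := mem_turnList.1 hx
    obtain ⟨b, hb⟩ := mem_turnList.1 hx'
    by_cases hab : b = a
    · exact Γ.inv_ne (e a) (by rw [← hb, hab])
    · exact (h b a hab).2 hb

theorem turn_eq_cyc {e : Fin i → Γ.H} (he : Γ.IsSeparate e) : Γ.turn e he = cyc (turnList e) := by
  ext h
  by_cases hh : h ∈ Set.range e
  · obtain ⟨a, rfl⟩ := hh
    rw [turn_apply, cyc_turnList he.injective]
  · rw [turn_of_notMem Γ e he hh, cyc_of_notMem (mt mem_turnList.1 hh)]

theorem attachSgn_turnList (e : Fin i → Γ.H) : attachSgn k Γ (turnList e) = attachSign k Γ e := by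
  rw [attachSgn, attachSign, turnList, List.map_ofFn, List.prod_ofFn, neg_one_pow_card]
  exact Equiv.prod_comp (finRotate i) fun a => sg k (¬ Γ.tail (e a))

/-- The two descriptions of the attachment of a polygon agree. -/
noncomputable def attachTurnIso {e : Fin i → Γ.H} (he : Γ.IsSeparate e)
    (hl : Γ.IsSep (turnList e)) : (Γ.attach e he).Iso (Γ.attachList (turnList e) hl) where
  onV := Equiv.refl _
  onH := Equiv.refl _
  vert_eq _ := rfl
  inv_eq := by
    have key : ∀ h : Γ.H, cyc (turnList e) (Γ.inv ((cyc (turnList e)).symm h)) =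
        Γ.turn e he (Γ.inv ((Γ.turn e he).symm h)) := fun h => by rw [turn_eq_cyc]
    exact key
  deco_eq v := (Labels.map_of_forall_eq O (fun _ => rfl) (Γ.deco v)).symm
  lt_iff _ _ := Iff.rfl
  tail_iff := by
    have key : ∀ h : Γ.H, Γ.aligned (turnList e) h ↔ Γ.alignedTail e h := fun h => by
      rw [aligned, alignedTail, mem_turnList, mem_turnList]
    exact key

theorem proj_split_contractTerm (t : Γ.H) (i : ℕ) :
    GradedSym.proj (grading O) i (split O (Γ.contractTerm t)) =
      if Γ.numComp = i then splitMap O (Γ.contractCls t) else 0 := by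
  by_cases ht : Γ.vert t = Γ.vert (Γ.inv t)
  · rw [contractCls_of_eq _ ht, contractTerm, dif_neg (not_not.2 ht), map_zero, map_zero, map_zero,
      ite_self]
  · rw [contractCls_of_ne _ ht, contractTerm, dif_pos ht, split, Finsupp.linearCombination_single,
      map_smul, map_smul, splitMap_cls, proj_splitProduct, numComp_contract, smul_ite, smul_zero]

/-- Contraction preserves the number of components, so the projection selects the terms where the
attached graph has `i` of them. For connected `Γ` this is the condition `Splits`. -/
theorem polygonTerm_eq [NeZero i] (hΓ : Γ.IsConnected) {e : Fin i → Γ.H} (he : Γ.IsSeparate e) :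
    GradedSym.proj (grading O) i (split O (attachSign k Γ e • (Γ.attach e he).contractTerm (e 1))) =
      splitMap O (Γ.fissionTerm (turnList e)) := by
  have hl := (Γ.isSep_turnList e).2 he
  have hn : Γ.numComp = 1 := hΓ
  obtain ⟨l, h⟩ := turnList_eq_cons e
  have ht : Γ.headTerm (turnList e) =
      attachSign k Γ e • (Γ.attachList (turnList e) hl).contractCls (e 1) := by
    rw [← attachSgn_turnList, ← attachTerm_of]
    revert hl
    rw [h]
    exact fun _ => rfl
  have e₁ : (Γ.attachList (turnList e) hl).numComp = (Γ.attach e he).numComp :=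
    (Γ.attachTurnIso he hl).numComp_eq
  have e₂ := contractCls_iso (Γ.attachTurnIso he hl) (e 1)
  have hs : (Γ.attach e he).numComp = i ↔ Γ.Splits (turnList e) := by
    have e₃ := length_turnList e
    constructor
    · exact fun h => ⟨hl, by omega⟩
    · rintro ⟨hl', h'⟩
      have e₄ : (Γ.attachList (turnList e) hl').numComp = (Γ.attach e he).numComp := e₁
      omega
  have hp := proj_split_contractTerm (Γ.attach e he) (e 1) i
  rw [map_smul, map_smul]
  refine (congrArg _ hp).trans ?_
  by_cases h : (Γ.attach e he).numComp = i
  · rw [if_pos h, fissionTerm_of _ (hs.1 h), ht, map_smul]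
    exact congrArg _ (congrArg _ e₂.symm)
  · rw [if_neg h, fissionTerm_of_not _ (mt hs.2 h), smul_zero, map_zero]

/-- On connected graphs the projection of `∂ᵢ` to products of `i` components is the part of `∂ᵢ` where
the number of components grows by `i - 1`. -/
theorem proj_split_polygonSum (i : ℕ) [NeZero i] (hΓ : Γ.IsConnected) :
    GradedSym.proj (grading O) i (split O (Γ.polygonSum i)) = splitMap O (fission O i Γ.cls) := by
  have iF : Fintype {e : Fin i → Γ.H // Γ.IsSeparate e} := Fintype.ofFinite _
  rw [polygonSum, finsum_eq_sum_of_fintype, map_sum, map_sum, fission_cls, fissionSum, map_sum]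
  refine Finset.sum_bij (fun e _ => turnList e.1) (fun e _ => ?_) (fun e _ e' _ h => ?_)
    (fun l hl => ?_) (fun e _ => polygonTerm_eq Γ hΓ e.2)
  · exact mem_words.2 ⟨length_turnList _, (Γ.isSep_turnList e.1).2 e.2⟩
  · exact Subtype.ext (turnList_injective i h)
  · obtain ⟨h, hs⟩ := mem_words.1 hl
    subst h
    obtain ⟨f, hf⟩ := exists_turnList l
    exact ⟨⟨f, (Γ.isSep_turnList f).1 (hf.symm ▸ hs)⟩, Finset.mem_univ _, hf⟩

end Polygon

end OGraph

theorem isFission_iff (i : ℕ) [NeZero i] (θ : SymP O →ₗ[k] SymP O) : IsFission i θ ↔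
    GradedSym.IsOddDerivation (grading O) θ ∧ ∀ (Γ : OGraph O) (h : Γ.IsConnected),
      θ (GradedSym.gen (grading O) (Γ.pcls h)) =
        (1 / 2 : k) • OGraph.splitMap O (OGraph.fission O i Γ.cls) :=
  and_congr_right fun _ => forall₂_congr fun Γ h => by rw [Γ.proj_split_polygonSum i h]

theorem exists_isFission (O : CyclicOperad.{u, w} k) (i : ℕ) [NeZero i] :
    ∃ θ : SymP O →ₗ[k] SymP O, IsFission i θ := by
  obtain ⟨D, hD, h⟩ := OGraph.exists_isOddDerivation_halfFission O i
  exact ⟨D, (isFission_iff i D).2 ⟨hD, fun Γ hΓ => h _⟩⟩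

theorem IsFission.unique {i : ℕ} [NeZero i] {θ θ' : SymP O →ₗ[k] SymP O} (h : IsFission i θ)
    (h' : IsFission i θ') : θ = θ' := by
  refine GradedSym.IsOddDerivation.ext _ OGraph.iSup_grading h.1 h'.1 fun n x _ => ?_
  refine OGraph.primitive_induction
    (P := fun x => θ (GradedSym.gen (grading O) x) = θ' (GradedSym.gen (grading O) x)) x
    (fun Γ hΓ => (h.2 Γ hΓ).trans (h'.2 Γ hΓ).symm) (by simp)
    (fun x y hx hy => by rw [map_add, map_add, map_add, hx, hy])
    (fun c x hx => by rw [map_smul, map_smul, map_smul, hx])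

theorem IsFission.comp_splitMap {i : ℕ} [NeZero i] {θ : SymP O →ₗ[k] SymP O} (h : IsFission i θ) :
    θ ∘ₗ OGraph.splitMap O = (1 / 2 : k) • OGraph.splitMap O ∘ₗ OGraph.fission O i :=
  OGraph.derivation_splitMap (NeZero.ne i) h.1 ((isFission_iff i θ).1 h).2

/-- The fission operations anticommute. -/
theorem IsFission.comp_add_comp [CharZero k] {i j : ℕ} [NeZero i] [NeZero j]
    {θ θ' : SymP O →ₗ[k] SymP O} (h : IsFission i θ) (h' : IsFission j θ') :
    θ ∘ₗ θ' + θ' ∘ₗ θ = 0 := by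
  have h₁ := LinearMap.ext_iff.1 h.comp_splitMap
  have h₂ := LinearMap.ext_iff.1 h'.comp_splitMap
  simp only [LinearMap.comp_apply, LinearMap.smul_apply] at h₁ h₂
  refine LinearMap.ext fun x => ?_
  obtain ⟨x, rfl⟩ := OGraph.splitMap_surjective x
  have h₃ := LinearMap.ext_iff.1 (OGraph.fission_comp_add_comp (O := O) i j) x
  simp only [LinearMap.add_apply, LinearMap.comp_apply, LinearMap.zero_apply] at h₃ ⊢
  rw [h₁, h₂, map_smul, map_smul, h₁, h₂, smul_smul, smul_smul, ← smul_add, ← map_add, add_comm, h₃,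
    map_zero, smul_zero]

end GraphComplex

theorem theorem2 {k : Type u} [Field k] [CharZero k] (O : GraphComplex.CyclicOperad.{u, w} k) :
    ∃ θ : ℕ+ → GraphComplex.SymP O →ₗ[k] GraphComplex.SymP O,
      (∀ i : ℕ+, GraphComplex.IsFission (i : ℕ) (θ i) ∧
        ∀ D, GraphComplex.IsFission (i : ℕ) D → D = θ i) ∧
      (∀ i j : ℕ+, i ≠ j → θ i ∘ₗ θ j + θ j ∘ₗ θ i = 0) ∧
      ∀ i : ℕ+, θ i ∘ₗ θ i = 0 := by
  choose θ hθ using fun i : ℕ+ => GraphComplex.exists_isFission O (i : ℕ)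
  refine ⟨θ, fun i => ⟨hθ i, fun D hD => hD.unique (hθ i)⟩, fun i j _ => (hθ i).comp_add_comp (hθ j),
    fun i => ?_⟩
  -- Anticommutation also holds for equal indices, where it says that twice the square is zero.
  have h := (hθ i).comp_add_comp (hθ i)
  rw [← two_smul k] at h
  exact (smul_eq_zero.1 h).resolve_left two_ne_zero
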